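/- Let $\Bbbk$ be an algebraically closed field of characteristic $0$, $H$ a cosemisimple Hopf algebra over $\Bbbk$ with bijective antipode, and $\theta\in\mathbb N$. Let $(g_i,\chi_i)_{1\le i\le\theta}$ be YD-pairs for $H$: $g_i\in H$ is group-like, $\chi_i:H\to\Bbbk$ is an algebra map and $\chi_i(h)\,g_i=\chi_i(h_{(2)})\,h_{(1)}g_i\mathcal S(h_{(3)})$ for all $h\in H$. Let $V$ be the Yetter–Drinfeld module with basis $x_1,\dots,x_\theta$, action $h\cdot x_i=\chi_i(h)x_i$ and coaction $x_i\mapsto g_i\otimes x_i$, and put $q_{ij}=\chi_j(g_i)$. Assume that $V$ is of type $A_\theta$ at $-1$: $q_{ii}=-1$ for all $i$, $q_{ij}q_{ji}=-1$ if $|i-j|=1$, and $q_{ij}q_{ji}=1$ if $|i-j|>1$. In the bosonization $T(V)\#H$ (generated by $H$ and $x_1,\dots,x_\theta$, with $hx_i=\chi_i(h_{(1)})x_ih_{(2)}$ and $\Delta(x_i)=x_i\otimes1+g_i\otimes x_i$) write $[u,v]_c=uv-q_{\alpha\beta}vu$ for $u,v\in T(V)$ of degrees $\alpha,\beta\in\mathbb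 N_0^\theta$, where $q_{\alpha\beta}=\prod_{i,j}q_{ij}^{\alpha_i\beta_j}$; $x_{ij}=[x_i,x_j]_c$; and $x_{(i-1\,i+1)}=[x_{i-1},[x_i,x_{i+1}]_c]_c$. We use the same notation when the generators are renamed $y_i$ or $a_i$. Let $\lambda_{ij}$ ($1\le i<j-1<\theta$), $\mu_k$ ($1\le k\le\theta$), $\nu_i$ ($1<i<\theta$) be scalars with $\lambda_{ij}=0$ if $\chi_i\chi_j\ne\varepsilon$, $\mu_k=0$ if $\chi_k^2\ne\varepsilon$, and $\nu_i=0$ if $\chi_i^2\chi_{i-1}\chi_{i+1}\neq\varepsilon$ (products of characters are convolution products). Consider the following quotient algebras of $T(V)\#H$: * $\widehat{\mathcal H}$, by the relations $x_{ij}=0$ ($i<j-1$), $x_k^2=0$ ($1\le k\le\theta$), $[x_{(i-1\,i+1)},x_i]_c=0$ ($1<i<\theta$); * $\widehat{\mathcal A}$, by the relations $y_{ij}=\lambda_{ij}$ ($i<j-1$), $y_k^2=\mu_k$ ($1\le k\le\theta$), $[y_{(i-1\,i+1)},y_i]_c=\nu_i$ ($1<i<\theta$); * $\widehat{\mathcal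 L}$, by the relations $$a_{ij}=\lambda_{ij}(1-g_ig_j)\ \ (i<j-1),\qquad a_k^2=\mu_k(1-g_k^2)\ \ (1\le k\le\theta),$$ $$[a_{(i-1\,i+1)},a_i]_c=\nu_i(1-g_i^2g_{i-1}g_{i+1})-4\chi_i(g_{i-1})\,\mu_i\,\lambda_{i-1\,i+1}\,g_{i-1}g_{i+1}(1-g_i^2)\ \ (1<i<\theta).$$ Then: 1. The ideals of $T(V)\#H$ defining $\widehat{\mathcal H}$ and $\widehat{\mathcal L}$ are Hopf ideals, so $\widehat{\mathcal H}$ and $\widehat{\mathcal L}$ are Hopf algebras. There is an algebra map $\rho:\widehat{\mathcal A}\to\widehat{\mathcal A}\otimes\widehat{\mathcal H}$ with $\rho(y_i)=y_i\otimes1+g_i\otimes x_i$ and $\rho(h)=h_{(1)}\otimes h_{(2)}$ for $h\in H$, and with it $\widehat{\mathcal A}$ is a cleft object of $\widehat{\mathcal H}$: a right comodule algebra with coinvariants $\Bbbk$ that has a convolution-invertible colinear map $\widehat{\mathcal H}\to\widehat{\mathcal A}$. 2. $\widehat{\mathcal L}$ is isomorphic, as a Hopf algebra, to $L(\widehat{\mathcal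 A},\widehat{\mathcal H})$. Here $L(A,K)$ denotes Schauenburg's Hopf algebra of a cleft object $A$ of $K$ with coaction $a\mapsto a_{(0)}\otimes a_{(1)}$: as an algebra it is $(A\otimes A^{\mathrm{op}})^{\mathrm{co}\,K}$ for the codiagonal coaction $x\otimes y\mapsto x_{(0)}\otimes y_{(0)}\otimes x_{(1)}y_{(1)}$; its comultiplication is $x\otimes y\mapsto x_{(0)}\otimes\tau'(x_{(1)})\otimes\tau''(x_{(1)})\otimes y$, where $\tau(h)=\tau'(h)\otimes\tau''(h)\in A\otimes A$ is the preimage of $1\otimes h$ under the (bijective) Galois map $x\otimes y\mapsto xy_{(0)}\otimes y_{(1)}$; and its counit is $x\otimes y\mapsto xy\in\Bbbk$. 3. $\widehat{\mathcal L}$ is a cocycle deformation of $\widehat{\mathcal H}$: it is isomorphic to $\widehat{\mathcal H}_\sigma$ for a (normalized, convolution-invertible) Hopf 2-cocycle $\sigma:\widehat{\mathcal H}\otimes\widehat{\mathcal H}\to\Bbbk$, where $\widehat{\mathcal H}_\sigma$ is the coalgebra $\widehat{\mathcal H}$ with the same unit and the product $x\cdot y=\sigma(x_{(1)},y_{(1)})\,x_{(2)}y_{(2)}\,\sigma^{-1}(x_{(3)},y_{(3)})$.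 4. Let $F_n\widehat{\mathcal L}$ be the image of $\bigoplus_{i\le n}T^i(V)\#H$ in $\widehat{\mathcal L}$ and $\widehat{\mathcal H}(n)$ the image of $T^n(V)\#H$ in $\widehat{\mathcal H}$. Then $(F_n\widehat{\mathcal L})_{n\ge0}$ is an exhaustive Hopf algebra filtration, $\widehat{\mathcal H}=\bigoplus_n\widehat{\mathcal H}(n)$ is a graded Hopf algebra, and $\operatorname{gr}_F\widehat{\mathcal L}\simeq\widehat{\mathcal H}$ as graded Hopf algebras. -/

import Mathlib

open scoped TensorProduct
open Coalgebra HopfAlgebra WithConv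

noncomputable section

namespace ALift

universe u v

section Generic

variable (k : Type u) [Field k] (H : Type v) [Ring H] [HopfAlgebra k H]

/-- A subcoalgebra: a subspace `C` with `Δ(C) ⊆ C ⊗ C`. -/
def IsSubcoalgebra (C : Submodule k H) : Prop :=
  ∀ c ∈ C, comul (R := k) c ∈ LinearMap.range (TensorProduct.map C.subtype C.subtype)

/-- A simple subcoalgebra: nonzero, with no proper nonzero subcoalgebra. -/
def IsSimpleSubcoalgebra (C : Submodule k H) : Prop :=
  IsSubcoalgebra k H C ∧ C ≠ ⊥ ∧
    ∀ D : Submodule k H, IsSubcoalgebra k H D → D ≠ ⊥ → D ≤ C → D = C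

/-- `H` is cosemisimple: it equals its coradical, the sum of its simple subcoalgebras. -/
def IsCosemisimple : Prop :=
  sSup {C : Submodule k H | IsSimpleSubcoalgebra k H C} = ⊤

/-- The linear map `h ↦ ε(h) g`. -/
def constMap {B : Type*} [Ring B] [Algebra k B] (b : B) : H →ₗ[k] B :=
  (LinearMap.toSpanSingleton k B b) ∘ₗ counit

/-- A YD-pair `(g, χ)`: `g` is group-like, `χ : H → k` is an algebra map and
`χ(h) g = χ(h₂) h₁ g S(h₃)` for all `h`. The last identity is an equality of linear
maps `H → H`, written with the convolution product of `h ↦ h`, `h ↦ χ(h) 1`,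
`h ↦ ε(h) g` and `S`. -/
structure IsYDPair (g : H) (χ : H →ₐ[k] k) : Prop where
  groupLike : IsGroupLikeElem k g
  compat : ∀ h : H,
    χ h • g = (toConv (LinearMap.id : H →ₗ[k] H) *
      toConv (Algebra.linearMap k H ∘ₗ χ.toLinearMap) *
      toConv (constMap k H g) * toConv (antipode k)).ofConv h

/-- A principal realization over `H` of a braided vector space of diagonal type with
basis `x_i`, `i ∈ Fin θ`: a family of YD-pairs `(g_i, χ_i)`. The braiding matrix is
`q_{ij} = χ_j(g_i)`. -/
structure PrincipalRealization (θ : ℕ) where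
  g : Fin θ → H
  χ : Fin θ → H →ₐ[k] k
  ydPair : ∀ i, IsYDPair k H (g i) (χ i)

end Generic

variable {k : Type u} [Field k] {H : Type v} [Ring H] [HopfAlgebra k H] {θ : ℕ}

section conv
variable {B : Type*} [Ring B] [Algebra k B]

lemma conv_mul_const (f : H →ₗ[k] B) (b : B) (h : H) :
    (toConv f * toConv (constMap k H b)).ofConv h = f h * b := by
  have e : TensorProduct.map f (constMap k H b) =
      TensorProduct.map f (LinearMap.toSpanSingleton k B b) ∘ₗ counit.lTensor H := by
    ext; simp [constMap]
  change LinearMap.mul' k B (TensorProduct.map f (constMap k H b) (comul h)) = _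
  rw [e, LinearMap.comp_apply, lTensor_counit_comul]; simp

lemma const_mul_conv (f : H →ₗ[k] B) (b : B) (h : H) :
    (toConv (constMap k H b) * toConv f).ofConv h = b * f h := by
  have e : TensorProduct.map (constMap k H b) f =
      TensorProduct.map (LinearMap.toSpanSingleton k B b) f ∘ₗ counit.rTensor H := by
    ext; simp [constMap]
  change LinearMap.mul' k B (TensorProduct.map (constMap k H b) f (comul h)) = _
  rw [e, LinearMap.comp_apply, rTensor_counit_comul]; simp

lemma const_mul_const (b c : B) :
    toConv (constMap k H b) * toConv (constMap k H c) = toConv (constMap k H (b * c)) := by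
  ext h
  rw [const_mul_conv]; simp [constMap]

lemma algHom_comp_conv {C : Type*} [Ring C] [Algebra k C] (F : B →ₐ[k] C) (a b : WithConv (H →ₗ[k] B)) :
    toConv (F.toLinearMap ∘ₗ (a * b).ofConv) =
      toConv (F.toLinearMap ∘ₗ a.ofConv) * toConv (F.toLinearMap ∘ₗ b.ofConv) :=
  WithConv.ext (LinearMap.algHom_comp_convMul_distrib F a b)

lemma conv_apply (f g : H →ₗ[k] B) (h : H) {ι : Type*} (R : Repr k h ι) :
    (toConv f * toConv g).ofConv h = ∑ i ∈ R.index, f (R.left i) * g (R.right i) :=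
  R.convMul_apply _ _

lemma conv_commute (P A C F : H →ₗ[k] B) (s : B)
    (e1 : ∀ h, P h = ∑ i ∈ (ℛ k h).index, A ((ℛ k h).left i) * C ((ℛ k h).right i))
    (e2 : ∀ h, C h * s = s * C h)
    (e3 : ∀ h, A h * s = ∑ i ∈ (ℛ k h).index, F ((ℛ k h).left i) * A ((ℛ k h).right i))
    (h : H) {ι : Type*} (R : Repr k h ι) :
    P h * s = ∑ i ∈ R.index, F (R.left i) * P (R.right i) := by
  have f1 : toConv P = toConv A * toConv C := by
    ext h; rw [conv_apply A C h (ℛ k h), ← e1]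
  have f2 : toConv C * toConv (constMap k H s) = toConv (constMap k H s) * toConv C := by
    ext h; rw [conv_mul_const, const_mul_conv, e2]
  have f3 : toConv A * toConv (constMap k H s) = toConv F * toConv A := by
    ext h; rw [conv_mul_const, conv_apply F A h (ℛ k h), e3]
  rw [← conv_apply F P h R, ← conv_mul_const, f1, mul_assoc, f2, ← mul_assoc, f3, mul_assoc]

end conv

namespace PrincipalRealization

variable (D : PrincipalRealization k H θ)

/-- The entries `q_{ij} = χ_j(g_i)` of the braiding matrix. -/
def q (i j : Fin θ) : k := D.χ j (D.g i)

/-- The action of `H` on `T(V)`, `V = ⨁ k x_i` with `h · x_i = χ_i(h) x_i`, as an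
algebra map from `T(V)` (the free algebra on the `x_i`) to the convolution algebra of linear
maps `H → T(V)`; that it is an algebra map is the rule `h · (r s) = (h₁ · r) (h₂ · s)`. -/
def actConv : FreeAlgebra k (Fin θ) →ₐ[k] WithConv (H →ₗ[k] FreeAlgebra k (Fin θ)) :=
  FreeAlgebra.lift k fun i =>
    toConv (LinearMap.toSpanSingleton k _ (FreeAlgebra.ι k i) ∘ₗ (D.χ i).toLinearMap)

/-- The action `h · r` of `H` on `T(V)`. -/
def act : H →ₗ[k] Module.End k (FreeAlgebra k (Fin θ)) where
  toFun h :=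
    { toFun := fun r => (D.actConv r).ofConv h
      map_add' := fun r s => by simp
      map_smul' := fun c r => by simp }
  map_add' h l := by ext; simp
  map_smul' c h := by ext; simp

lemma act_apply (h : H) (r : FreeAlgebra k (Fin θ)) : D.act h r = (D.actConv r).ofConv h := rfl

lemma act_ι (h : H) (i : Fin θ) : D.act h (FreeAlgebra.ι k i) = D.χ i h • FreeAlgebra.ι k i := by
  simp [act_apply, actConv]

lemma act_one (h : H) : D.act h 1 = algebraMap k _ (counit h) := by
  simp [act_apply]

lemma act_mul (h : H) (r s : FreeAlgebra k (Fin θ)) {ι : Type*} (R : Repr k h ι) :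
    D.act h (r * s) = ∑ i ∈ R.index, D.act (R.left i) r * D.act (R.right i) s := by
  simp only [act_apply, map_mul]
  exact R.convMul_apply _ _

lemma act_act (h l : H) (r : FreeAlgebra k (Fin θ)) : D.act (h * l) r = D.act h (D.act l r) := by
  induction r using FreeAlgebra.induction generalizing h l with
  | grade0 c => simp [Algebra.algebraMap_eq_smul_one, act_one, smul_smul, mul_comm, mul_left_comm]
  | grade1 i => simp [act_ι, mul_comm, smul_smul]
  | add r s hr hs => simp [hr, hs]
  | mul r s hr hs =>
    rw [D.act_mul _ r s ((ℛ k h).mul (ℛ k l)), D.act_mul l r s (ℛ k l), map_sum]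
    simp_rw [D.act_mul h _ _ (ℛ k h)]
    simp [Finset.sum_product_right, hr, hs]

lemma act_one_left (r : FreeAlgebra k (Fin θ)) : D.act 1 r = r := by
  induction r using FreeAlgebra.induction with
  | grade0 c => simp [Algebra.algebraMap_eq_smul_one, act_one]
  | grade1 i => simp [act_ι]
  | add r s hr hs => simp [hr, hs]
  | mul r s hr hs =>
    have h1 := congr(LinearMap.mul' k _ (TensorProduct.map (D.actConv r).ofConv (D.actConv s).ofConv
      $(Bialgebra.comul_one (R := k) (A := H))))
    simp only [act_apply] at hr hs ⊢
    rw [map_mul]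
    refine Eq.trans h1 ?_
    simp [Algebra.TensorProduct.one_def, hr, hs]

end PrincipalRealization

/-- The bosonization (smash product) `T(V) # H`: the vector space `T(V) ⊗ H` with
`(r # h)(s # l) = r (h₁ · s) # h₂ l`. -/
def Bosonization (_D : PrincipalRealization k H θ) : Type (max u v) :=
  FreeAlgebra k (Fin θ) ⊗[k] H

namespace Bosonization

variable (D : PrincipalRealization k H θ)

instance : AddCommGroup (Bosonization D) :=
  inferInstanceAs (AddCommGroup (FreeAlgebra k (Fin θ) ⊗[k] H))
instance : Module k (Bosonization D) :=
  inferInstanceAs (Module k (FreeAlgebra k (Fin θ) ⊗[k] H))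

/-- Left multiplication by `r ∈ T(V)` on `T(V) ⊗ H`. -/
def leftT : FreeAlgebra k (Fin θ) →ₗ[k] Module.End k (FreeAlgebra k (Fin θ) ⊗[k] H) :=
  LinearMap.rTensorHom H ∘ₗ LinearMap.mul k _

/-- The diagonal action `h ▹ (s ⊗ l) = (h₁ · s) ⊗ h₂ l` of `H` on `T(V) ⊗ H`. -/
def leftH : H →ₗ[k] Module.End k (FreeAlgebra k (Fin θ) ⊗[k] H) :=
  TensorProduct.homTensorHomMap (RingHom.id k) _ _ _ _ ∘ₗ
    TensorProduct.map D.act (LinearMap.mul k H) ∘ₗ comul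

/-- The multiplication, `(r # h) · t = r (h ▹ t)`. -/
def mulMap : FreeAlgebra k (Fin θ) ⊗[k] H →ₗ[k] Module.End k (FreeAlgebra k (Fin θ) ⊗[k] H) :=
  LinearMap.mul' k _ ∘ₗ TensorProduct.map leftT (leftH D)

lemma mulMap_tmul (r : FreeAlgebra k (Fin θ)) (h : H) :
    mulMap D (r ⊗ₜ h) = leftT r * leftH D h := by simp [mulMap]

lemma leftT_tmul (r s : FreeAlgebra k (Fin θ)) (l : H) :
    leftT (k := k) (H := H) r (s ⊗ₜ l) = (r * s) ⊗ₜ l := by simp [leftT]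

lemma leftH_tmul {ι : Type*} (h : H) (R : Repr k h ι) (s : FreeAlgebra k (Fin θ)) (l : H) :
    leftH D h (s ⊗ₜ l) = ∑ i ∈ R.index, (D.act (R.left i) s) ⊗ₜ (R.right i * l) := by
  simp [leftH, ← R.eq, LinearMap.sum_apply]

lemma leftT_mul (r s : FreeAlgebra k (Fin θ)) :
    leftT (k := k) (H := H) (r * s) = leftT r * leftT s := by
  ext; simp [leftT, mul_assoc]

lemma leftT_one : leftT (k := k) (H := H) (1 : FreeAlgebra k (Fin θ)) = 1 := by
  ext; simp [leftT]

lemma leftH_mul (h l : H) : leftH D (h * l) = leftH D h * leftH D l := by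
  refine TensorProduct.ext' fun s m => ?_
  rw [Module.End.mul_apply, leftH_tmul D _ ((ℛ k h).mul (ℛ k l)), leftH_tmul D l (ℛ k l), map_sum]
  simp_rw [leftH_tmul D h (ℛ k h)]
  simp [Finset.sum_product_right, D.act_act, mul_assoc]

lemma leftH_one : leftH D 1 = 1 := by
  refine TensorProduct.ext' fun s m => ?_
  simp [leftH, Algebra.TensorProduct.one_def, D.act_one_left]

lemma leftH_leftT (h : H) (s : FreeAlgebra k (Fin θ)) {ι : Type*} (R : Repr k h ι) :
    leftH D h * leftT s = ∑ i ∈ R.index, leftT (D.act (R.left i) s) * leftH D (R.right i) := by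
  refine conv_commute (leftH D) (LinearMap.rTensorHom H ∘ₗ D.act)
    (LinearMap.lTensorHom (FreeAlgebra k (Fin θ)) ∘ₗ LinearMap.mul k H)
    (leftT ∘ₗ D.act.flip s) (leftT s) (fun h => ?_) (fun h => ?_) (fun h => ?_) h R
  · refine TensorProduct.ext' fun t m => ?_
    simp [leftH_tmul D h (ℛ k h), LinearMap.sum_apply]
  · refine TensorProduct.ext' fun t m => ?_
    simp [leftT]
  · refine TensorProduct.ext' fun t m => ?_
    simp [leftT, D.act_mul h s t (ℛ k h), LinearMap.sum_apply, TensorProduct.sum_tmul]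

lemma mulMap_leftT (r : FreeAlgebra k (Fin θ)) (t : FreeAlgebra k (Fin θ) ⊗[k] H) :
    mulMap D (leftT r t) = leftT r * mulMap D t := by
  induction t with
  | zero => simp
  | add x y hx hy => simp [hx, hy, mul_add]
  | tmul s l => rw [leftT_tmul, mulMap_tmul, mulMap_tmul, leftT_mul, mul_assoc]

lemma mulMap_leftH (h : H) (t : FreeAlgebra k (Fin θ) ⊗[k] H) :
    mulMap D (leftH D h t) = leftH D h * mulMap D t := by
  induction t with
  | zero => simp
  | add x y hx hy => simp [hx, hy, mul_add]
  | tmul s l =>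
    rw [leftH_tmul D h (ℛ k h), mulMap_tmul, map_sum, ← mul_assoc, leftH_leftT D h s (ℛ k h),
      Finset.sum_mul]
    simp [mulMap_tmul, leftH_mul, mul_assoc]

lemma mulMap_mulMap (x y : FreeAlgebra k (Fin θ) ⊗[k] H) :
    mulMap D (mulMap D x y) = mulMap D x * mulMap D y := by
  induction x with
  | zero => simp
  | add x x' hx hy => simp [hx, hy, add_mul]
  | tmul s l => rw [mulMap_tmul, Module.End.mul_apply, mulMap_leftT, mulMap_leftH, mul_assoc]

lemma mulMap_one (t : FreeAlgebra k (Fin θ) ⊗[k] H) : mulMap D t (1 ⊗ₜ 1) = t := by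
  induction t with
  | zero => simp
  | add x y hx hy => rw [map_add, LinearMap.add_apply, hx, hy]
  | tmul r h =>
    rw [mulMap_tmul, Module.End.mul_apply, leftH_tmul D h (ℛ k h)]
    simp only [D.act_one, mul_one, Algebra.algebraMap_eq_smul_one, TensorProduct.smul_tmul]
    rw [← TensorProduct.tmul_sum, sum_counit_smul, leftT_tmul, mul_one]

lemma one_mulMap (t : FreeAlgebra k (Fin θ) ⊗[k] H) : mulMap D (1 ⊗ₜ 1) t = t := by
  rw [mulMap_tmul, leftT_one, leftH_one]; rfl

instance : Mul (Bosonization D) := ⟨fun x y => mulMap D x y⟩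
instance : One (Bosonization D) :=
  ⟨((1 : FreeAlgebra k (Fin θ)) ⊗ₜ[k] (1 : H) : FreeAlgebra k (Fin θ) ⊗[k] H)⟩

instance : Ring (Bosonization D) where
  __ := (inferInstance : AddCommGroup (Bosonization D))
  __ := (inferInstance : Mul (Bosonization D))
  __ := (inferInstance : One (Bosonization D))
  left_distrib x y z := map_add (mulMap D x) y z
  right_distrib x y z := congr($(map_add (mulMap D) x y) z)
  zero_mul x := congr($(map_zero (mulMap D)) x)
  mul_zero x := map_zero (mulMap D x)
  mul_assoc x y z := congr($(mulMap_mulMap D x y) z)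
  one_mul x := one_mulMap D x
  mul_one x := mulMap_one D x

instance : Algebra k (Bosonization D) :=
  Algebra.ofModule
    (fun c x y => congr($(map_smul (mulMap D) c x) y))
    (fun c x y => map_smul (mulMap D x) c y)

/-- The inclusion of `T(V)`, `r ↦ r # 1`. -/
def inT : FreeAlgebra k (Fin θ) →ₐ[k] Bosonization D :=
  AlgHom.ofLinearMap ((TensorProduct.mk k (FreeAlgebra k (Fin θ)) H).flip 1) rfl (fun r s => by
    change (r * s) ⊗ₜ[k] (1 : H) = mulMap D (r ⊗ₜ[k] 1) (s ⊗ₜ[k] 1)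
    rw [mulMap_tmul, leftH_one, Module.End.mul_apply, Module.End.one_apply, leftT_tmul])

/-- The inclusion of `H`, `h ↦ 1 # h`. -/
def inH : H →ₐ[k] Bosonization D :=
  AlgHom.ofLinearMap (TensorProduct.mk k (FreeAlgebra k (Fin θ)) H 1) rfl (fun h l => by
    change 1 ⊗ₜ[k] (h * l) = mulMap D (1 ⊗ₜ[k] h) (1 ⊗ₜ[k] l)
    rw [mulMap_tmul, leftT_one, Module.End.mul_apply, Module.End.one_apply,
      leftH_tmul D h (ℛ k h)]
    simp only [D.act_one, Algebra.algebraMap_eq_smul_one, TensorProduct.smul_tmul]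
    rw [← TensorProduct.tmul_sum]
    simp only [← smul_mul_assoc, ← Finset.sum_mul, sum_counit_smul])

/-- The generator `x_i # 1`. -/
def x (i : Fin θ) : Bosonization D := inT D (FreeAlgebra.ι k i)

lemma tmul_eq (r : FreeAlgebra k (Fin θ)) (h : H) :
    (r ⊗ₜ[k] h : FreeAlgebra k (Fin θ) ⊗[k] H) = (inT D r * inH D h : Bosonization D) := by
  change _ = mulMap D (r ⊗ₜ[k] 1) (1 ⊗ₜ[k] h)
  rw [mulMap_tmul, leftH_one, Module.End.mul_apply, Module.End.one_apply, leftT_tmul, mul_one]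

section lift
variable {B : Type*} [Ring B] [Algebra k B]

/-- Compatibility of `b_i ∈ B` and `f : H → B`: `f(h) b_i = χ_i(h₁) b_i f(h₂)`. -/
def Compat (b : Fin θ → B) (f : H →ₐ[k] B) : Prop :=
  ∀ i, toConv f.toLinearMap * toConv (constMap k H (b i)) =
    toConv (LinearMap.toSpanSingleton k B (b i) ∘ₗ (D.χ i).toLinearMap) * toConv f.toLinearMap

variable {D}

lemma Compat.free {b : Fin θ → B} {f : H →ₐ[k] B} (hc : Compat D b f)
    (s : FreeAlgebra k (Fin θ)) :
    toConv f.toLinearMap * toConv (constMap k H (FreeAlgebra.lift k b s)) =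
      toConv ((FreeAlgebra.lift k b).toLinearMap ∘ₗ (D.actConv s).ofConv) *
        toConv f.toLinearMap := by
  induction s using FreeAlgebra.induction with
  | grade0 c => 
    have e : toConv ((FreeAlgebra.lift k b).toLinearMap ∘ₗ (D.actConv (algebraMap k _ c)).ofConv) =
        toConv (constMap k H (algebraMap k B c)) := by
      ext h
      simp [constMap, Algebra.algebraMap_eq_smul_one, mul_comm, smul_smul]
    rw [e, AlgHom.commutes]
    ext h
    rw [conv_mul_const, const_mul_conv, Algebra.commutes]
  | grade1 i =>
    rw [FreeAlgebra.lift_ι_apply, hc i]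
    congr 2
    ext h
    simp [PrincipalRealization.actConv]
  | add r s hr hs =>
    have e : toConv (constMap k H (FreeAlgebra.lift k b (r + s))) =
        toConv (constMap k H (FreeAlgebra.lift k b r)) + toConv (constMap k H (FreeAlgebra.lift k b s)) := by
      ext h; simp [constMap]
    rw [e, mul_add, hr, hs, ← add_mul]
    congr 1
    ext h; simp
  | mul r s hr hs =>
    rw [map_mul, ← const_mul_const, ← mul_assoc, hr, mul_assoc, hs, ← mul_assoc, map_mul,
      algHom_comp_conv]

/-- The linear map `r # h ↦ F(r) f(h)`, `F` extending `b`. -/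
def liftLin (b : Fin θ → B) (f : H →ₐ[k] B) : FreeAlgebra k (Fin θ) ⊗[k] H →ₗ[k] B :=
  LinearMap.mul' k B ∘ₗ TensorProduct.map (FreeAlgebra.lift k b).toLinearMap f.toLinearMap

lemma liftLin_tmul (b : Fin θ → B) (f : H →ₐ[k] B) (r : FreeAlgebra k (Fin θ)) (h : H) :
    liftLin b f (r ⊗ₜ h) = FreeAlgebra.lift k b r * f h := by simp [liftLin]

lemma liftLin_mulMap (b : Fin θ → B) (f : H →ₐ[k] B) (hc : Compat D b f)
    (x y : FreeAlgebra k (Fin θ) ⊗[k] H) :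
    liftLin b f (mulMap D x y) = liftLin b f x * liftLin b f y := by
  induction x with
  | zero => simp
  | add x x' hx hy => rw [map_add, LinearMap.add_apply, map_add, hx, hy, map_add, add_mul]
  | tmul r h =>
  induction y with
  | zero => simp
  | add x x' hx hy => rw [map_add, map_add, hx, hy, map_add, mul_add]
  | tmul s l =>
    have key := congr($(hc.free s).ofConv h)
    rw [conv_mul_const, conv_apply _ _ h (ℛ k h)] at key
    simp only [AlgHom.toLinearMap_apply, LinearMap.comp_apply] at key
    have e : liftLin b f (r ⊗ₜ h) * liftLin b f (s ⊗ₜ l) =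
        FreeAlgebra.lift k b r * (f h * FreeAlgebra.lift k b s) * f l := by
      simp [liftLin_tmul, mul_assoc]
    rw [e, key, mulMap_tmul, Module.End.mul_apply, leftH_tmul D h (ℛ k h)]
    simp only [map_sum, leftT_tmul, Finset.mul_sum, Finset.sum_mul]
    refine Finset.sum_congr rfl fun i _ => ?_
    simp [liftLin_tmul, D.act_apply, mul_assoc]

/-- The universal property of `T(V) # H`. -/
def lift (b : Fin θ → B) (f : H →ₐ[k] B) (hc : Compat D b f) : Bosonization D →ₐ[k] B :=
  AlgHom.ofLinearMap (liftLin b f) ((liftLin_tmul b f 1 1).trans (by simp))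
    (liftLin_mulMap b f hc)

@[simp] lemma lift_x (b : Fin θ → B) (f : H →ₐ[k] B) (hc : Compat D b f) (i : Fin θ) :
    lift b f hc (x D i) = b i := by
  change LinearMap.mul' k B (TensorProduct.map _ _ ((FreeAlgebra.ι k i) ⊗ₜ[k] (1 : H))) = _
  simp

@[simp] lemma lift_inH (b : Fin θ → B) (f : H →ₐ[k] B) (hc : Compat D b f) (h : H) :
    lift b f hc (inH D h) = f h := by
  change LinearMap.mul' k B (TensorProduct.map _ _ (1 ⊗ₜ[k] h)) = _
  simp

lemma algHom_ext {F G : Bosonization D →ₐ[k] B} (h1 : ∀ i, F (x D i) = G (x D i))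
    (h2 : ∀ h, F (inH D h) = G (inH D h)) : F = G := by
  have e : F.comp (inT D) = G.comp (inT D) := FreeAlgebra.hom_ext (funext h1)
  refine AlgHom.ext fun t => ?_
  induction t using TensorProduct.induction_on with
  | zero => exact (map_zero F).trans (map_zero G).symm
  | add x y hx hy =>
    exact (map_add F x y).trans ((congrArg₂ (· + ·) hx hy).trans (map_add G x y).symm)
  | tmul r h =>
    rw [tmul_eq, map_mul, map_mul, h2]
    congr 1
    exact congr($e r)

end lift

lemma compat_in : Compat D (x D) (inH D) := by
  intro i
  ext h
  rw [conv_mul_const, show (toConv (LinearMap.toSpanSingleton k (Bosonization D) (x D i) ∘ₗ (D.χ i).toLinearMap) *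
    toConv (inH D).toLinearMap).ofConv h = _ from (ℛ k h).convMul_apply _ _]
  change mulMap D (1 ⊗ₜ[k] h) (FreeAlgebra.ι k i ⊗ₜ[k] 1) = _
  rw [mulMap_tmul, leftT_one, Module.End.mul_apply, Module.End.one_apply, leftH_tmul D h (ℛ k h)]
  refine Finset.sum_congr rfl fun j _ => ?_
  rw [mul_one, D.act_ι, tmul_eq, map_smul]
  rfl

end Bosonization

namespace PrincipalRealization
variable (D : PrincipalRealization k H θ)

lemma yd_comm (i : Fin θ) :
    toConv (LinearMap.id : H →ₗ[k] H) * toConv (Algebra.linearMap k H ∘ₗ (D.χ i).toLinearMap) *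
      toConv (constMap k H (D.g i)) =
    toConv (Algebra.linearMap k H ∘ₗ (D.χ i).toLinearMap) * toConv (constMap k H (D.g i)) *
      toConv (LinearMap.id : H →ₗ[k] H) := by
  have h1 : toConv (Algebra.linearMap k H ∘ₗ (D.χ i).toLinearMap) *
      toConv (constMap k H (D.g i)) = toConv (LinearMap.id : H →ₗ[k] H) *
      toConv (Algebra.linearMap k H ∘ₗ (D.χ i).toLinearMap) *
      toConv (constMap k H (D.g i)) * toConv (antipode k) := by
    ext h
    rw [conv_mul_const, ← (D.ydPair i).compat h]
    simp [Algebra.smul_def]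
  conv_rhs => rw [h1, mul_assoc _ (toConv (antipode k)), LinearMap.antipode_mul_id, mul_one]

lemma g_counit (i : Fin θ) : counit (R := k) (D.g i) = 1 := (D.ydPair i).groupLike.counit_eq_one
lemma g_comul (i : Fin θ) : comul (R := k) (D.g i) = D.g i ⊗ₜ D.g i :=
  (D.ydPair i).groupLike.comul_eq_tmul_self

end PrincipalRealization

section conv2
variable {B : Type*} [Ring B] [Algebra k B]

lemma scal_comm (χ : H →ₐ[k] k) (b : B) :
    toConv (Algebra.linearMap k B ∘ₗ χ.toLinearMap) * toConv (constMap k H b) =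
      toConv (constMap k H b) * toConv (Algebra.linearMap k B ∘ₗ χ.toLinearMap) := by
  ext h; rw [conv_mul_const, const_mul_conv]; exact Algebra.commutes _ _

lemma span_eq (χ : H →ₐ[k] k) (b : B) :
    toConv (LinearMap.toSpanSingleton k B b ∘ₗ χ.toLinearMap) =
      toConv (Algebra.linearMap k B ∘ₗ χ.toLinearMap) * toConv (constMap k H b) := by
  ext h; rw [conv_mul_const]; simp [Algebra.smul_def]

lemma scal_map {C : Type*} [Ring C] [Algebra k C] (F : B →ₐ[k] C) (χ : H →ₐ[k] k) :
    F.toLinearMap ∘ₗ (Algebra.linearMap k B ∘ₗ χ.toLinearMap) =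
      Algebra.linearMap k C ∘ₗ χ.toLinearMap := by
  ext h; simp

lemma const_map {C : Type*} [Ring C] [Algebra k C] (F : B →ₐ[k] C) (b : B) :
    F.toLinearMap ∘ₗ constMap k H b = constMap k H (F b) := by
  ext h; simp [constMap]

end conv2

section monoid
variable {M : Type*} [Monoid M]

lemma monoid_aux₁ {α β X c : M} (h1 : α * c = X * c * α) (h2 : β * c = c * β) :
    α * β * c = X * c * (α * β) := by
  rw [mul_assoc, h2, ← mul_assoc, h1, mul_assoc]

lemma monoid_aux₂ {α β X cg cx : M} (hyd : α * X * cg = X * cg * α) (hX : X * cg = cg * X)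
    (hβ : β * cx = X * cx * β) (hβg : β * cg = cg * β) (hα : α * cx = cx * α) :
    α * β * (cg * cx) = X * (cg * cx) * (α * β) := by
  calc α * β * (cg * cx) = α * (β * cg) * cx := by simp only [mul_assoc]
    _ = α * cg * (β * cx) := by rw [hβg]; simp only [mul_assoc]
    _ = α * (cg * X) * cx * β := by rw [hβ]; simp only [mul_assoc]
    _ = (α * X * cg) * cx * β := by rw [← hX]; simp only [mul_assoc]
    _ = X * cg * (α * cx) * β := by rw [hyd]; simp only [mul_assoc]
    _ = _ := by rw [hα]; simp only [mul_assoc]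

lemma monoid_aux₃ {E S X G Gi C : M} (hES : E * S = 1) (hSE : S * E = 1) (hG : G * Gi = 1)
    (hG' : Gi * G = 1) (hXi : X * Gi = Gi * X)
    (hC : E * C = X * C * E) (hyd : E * X * G = X * G * E) :
    Gi * C * S = X * S * (Gi * C) := by
  have a : C * S = S * X * C := by
    calc C * S = S * (E * C) * S := by rw [← mul_assoc S, hSE, one_mul]
      _ = S * X * C * (E * S) := by rw [hC]; simp only [mul_assoc]
      _ = _ := by rw [hES, mul_one]
  have b : X * G * S = S * X * G := by
    calc X * G * S = S * (E * X * G) * S := by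
          rw [mul_assoc E, ← mul_assoc S, hSE, one_mul]
      _ = S * X * G * (E * S) := by rw [hyd]; simp only [mul_assoc]
      _ = _ := by rw [hES, mul_one]
  have c : Gi * S * X = X * S * Gi := by
    calc Gi * S * X = Gi * (S * X * G) * Gi := by simp only [mul_assoc, hG, mul_one]
      _ = (Gi * X) * G * S * Gi := by rw [← b]; simp only [mul_assoc]
      _ = X * (Gi * G) * S * Gi := by rw [← hXi]; simp only [mul_assoc]
      _ = _ := by rw [hG', mul_one]
  rw [mul_assoc, a, ← mul_assoc, ← mul_assoc, c]; simp only [mul_assoc]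

end monoid

namespace Bosonization

variable (D : PrincipalRealization k H θ)

lemma E_mul_C (i : Fin θ) : toConv (inH D).toLinearMap * toConv (constMap k H (x D i)) =
    toConv (Algebra.linearMap k _ ∘ₗ (D.χ i).toLinearMap) * toConv (constMap k H (x D i)) *
      toConv (inH D).toLinearMap := by
  rw [← span_eq]; exact compat_in D i

section map
variable {B : Type*} [Ring B] [Algebra k B] (F : Bosonization D →ₐ[k] B)

lemma E_mul_C_map (i : Fin θ) :
    toConv (F.toLinearMap ∘ₗ (inH D).toLinearMap) * toConv (constMap k H (F (x D i))) =
    toConv (Algebra.linearMap k _ ∘ₗ (D.χ i).toLinearMap) * toConv (constMap k H (F (x D i))) *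
      toConv (F.toLinearMap ∘ₗ (inH D).toLinearMap) := by
  have := congr(toConv (F.toLinearMap ∘ₗ ($(E_mul_C D i)).ofConv))
  rw [algHom_comp_conv, algHom_comp_conv, algHom_comp_conv] at this
  dsimp only at this
  rwa [scal_map, const_map] at this

lemma E_yd_map (F : H →ₐ[k] B) (i : Fin θ) :
    toConv F.toLinearMap * toConv (Algebra.linearMap k _ ∘ₗ (D.χ i).toLinearMap) *
      toConv (constMap k H (F (D.g i))) =
    toConv (Algebra.linearMap k _ ∘ₗ (D.χ i).toLinearMap) *
      toConv (constMap k H (F (D.g i))) * toConv F.toLinearMap := by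
  have := congr(toConv (F.toLinearMap ∘ₗ ($(D.yd_comm i)).ofConv))
  rw [algHom_comp_conv, algHom_comp_conv, algHom_comp_conv, algHom_comp_conv] at this
  dsimp only at this
  rwa [scal_map, const_map, LinearMap.comp_id] at this

lemma compat_aux (i : Fin θ) (iL iR : Bosonization D →ₐ[k] B) (hLR : ∀ a b, iR a * iL b = iL b * iR a)
    (f : H →ₐ[k] B) (b : B) (hb : b = iL (x D i) + iL (inH D (D.g i)) * iR (x D i))
    (hf : ∀ h, f h = ∑ j ∈ (ℛ k h).index, iL (inH D ((ℛ k h).left j)) * iR (inH D ((ℛ k h).right j))) :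
    toConv f.toLinearMap * toConv (constMap k H b) =
    toConv (LinearMap.toSpanSingleton k B b ∘ₗ (D.χ i).toLinearMap) * toConv f.toLinearMap := by
  have hf : toConv f.toLinearMap =
      toConv (iL.toLinearMap ∘ₗ (inH D).toLinearMap) *
        toConv (iR.toLinearMap ∘ₗ (inH D).toLinearMap) := by
    ext h
    rw [conv_apply _ _ h (ℛ k h)]
    exact hf h
  have hc : toConv (constMap k H b) = toConv (constMap k H (iL (x D i))) +
      toConv (constMap k H (iL (inH D (D.g i)))) * toConv (constMap k H (iR (x D i))) := by
    rw [const_mul_const]; ext h; simp [constMap, hb]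
  have hcomm : ∀ b, toConv (iR.toLinearMap ∘ₗ (inH D).toLinearMap) * toConv (constMap k H (iL b)) =
      toConv (constMap k H (iL b)) * toConv (iR.toLinearMap ∘ₗ (inH D).toLinearMap) := by
    intro b; ext h; rw [conv_mul_const, const_mul_conv]; exact hLR _ _
  have hcomm' : ∀ b, toConv (iL.toLinearMap ∘ₗ (inH D).toLinearMap) * toConv (constMap k H (iR b)) =
      toConv (constMap k H (iR b)) * toConv (iL.toLinearMap ∘ₗ (inH D).toLinearMap) := by
    intro b; ext h; rw [conv_mul_const, const_mul_conv]; exact (hLR _ _).symm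
  rw [span_eq, hf, hc, mul_add, mul_add, add_mul,
    monoid_aux₁ (E_mul_C_map D iL i) (hcomm _)]
  congr 1
  exact monoid_aux₂ (E_yd_map D (iL.comp (inH D)) i) (scal_comm _ _) (E_mul_C_map D iR i)
    (hcomm _) (hcomm' _)

end map

/-- `Δ(h) = h₁ ⊗ h₂` in `(T(V) # H) ⊗ (T(V) # H)`. -/
def comulH : H →ₐ[k] Bosonization D ⊗[k] Bosonization D :=
  (Algebra.TensorProduct.map (inH D) (inH D)).comp (Bialgebra.comulAlgHom k H)

/-- `Δ(x_i) = x_i ⊗ 1 + g_i ⊗ x_i`. -/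
def comulX (i : Fin θ) : Bosonization D ⊗[k] Bosonization D :=
  x D i ⊗ₜ 1 + inH D (D.g i) ⊗ₜ x D i

lemma compat_comul : Compat D (comulX D) (comulH D) := by
  intro i
  refine compat_aux D i Algebra.TensorProduct.includeLeft Algebra.TensorProduct.includeRight
    (fun a b => by simp) _ _ (by simp [comulX]) (fun h => ?_)
  change Algebra.TensorProduct.map (inH D) (inH D) (comul h) = _
  conv_lhs => rw [← (ℛ k h).eq]
  simp

lemma compat_counit : Compat D (fun _ => (0 : k)) (Bialgebra.counitAlgHom k H) := by
  intro i
  have e : toConv (constMap k H (0 : k)) = 0 := by ext h; simp [constMap]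
  have e' : toConv (LinearMap.toSpanSingleton k k 0 ∘ₗ (D.χ i).toLinearMap) = 0 := by ext h; simp
  rw [e, e', mul_zero, zero_mul]

section
variable {B : Type*} [Ring B] [Algebra k B] (F : H →ₐ[k] B) (G : B →ₐ[k] B ⊗[k] B)

lemma coassoc_aux (hG : ∀ h, G (F h) = Algebra.TensorProduct.map F F (comul h))
    (h : H) :
    Algebra.TensorProduct.assoc k k k B B B (Algebra.TensorProduct.map G (.id k B) (G (F h))) =
      Algebra.TensorProduct.map (.id k B) G (G (F h)) := by
  have h1 : ∀ (z : H ⊗[k] H) (b : H), Algebra.TensorProduct.assoc k k k B B B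
      (Algebra.TensorProduct.map F F z ⊗ₜ F b) =
      Algebra.TensorProduct.map F (Algebra.TensorProduct.map F F)
        (TensorProduct.assoc k H H H (z ⊗ₜ b)) := by
    intro z b
    induction z with
    | zero => simp
    | add x y hx hy => simp only [map_add, TensorProduct.add_tmul, hx, hy]
    | tmul x y => simp
  have h2 : ∀ y : H ⊗[k] H, Algebra.TensorProduct.assoc k k k B B B
      (Algebra.TensorProduct.map G (.id k B) (Algebra.TensorProduct.map F F y)) =
      Algebra.TensorProduct.map F (Algebra.TensorProduct.map F F)
        (TensorProduct.assoc k H H H (comul.rTensor H y)) := by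
    intro y
    induction y with
    | zero => simp
    | add x y hx hy => simp only [map_add, hx, hy]
    | tmul x y => simp [hG, h1]
  have h3 : ∀ y : H ⊗[k] H,
      Algebra.TensorProduct.map (.id k B) G (Algebra.TensorProduct.map F F y) =
      Algebra.TensorProduct.map F (Algebra.TensorProduct.map F F) (comul.lTensor H y) := by
    intro y
    induction y with
    | zero => simp
    | add x y hx hy => simp only [map_add, hx, hy]
    | tmul x y => simp [hG]
  rw [hG, h2, h3, coassoc_apply]

lemma rTensor_aux (hG : ∀ h, G (F h) = Algebra.TensorProduct.map F F (comul h))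
    (E : B →ₐ[k] k) (hE : ∀ h, E (F h) = counit h) (h : H) :
    Algebra.TensorProduct.map E (.id k B) (G (F h)) = 1 ⊗ₜ F h := by
  have h3 : ∀ y : H ⊗[k] H,
      Algebra.TensorProduct.map E (.id k B) (Algebra.TensorProduct.map F F y) =
      TensorProduct.map LinearMap.id F.toLinearMap (counit.rTensor H y) := by
    intro y
    induction y with
    | zero => simp
    | add x y hx hy => simp only [map_add, hx, hy]
    | tmul x y => simp [hE]
  rw [hG, h3, rTensor_counit_comul]; simp

lemma lTensor_aux (hG : ∀ h, G (F h) = Algebra.TensorProduct.map F F (comul h))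
    (E : B →ₐ[k] k) (hE : ∀ h, E (F h) = counit h) (h : H) :
    Algebra.TensorProduct.map (.id k B) E (G (F h)) = F h ⊗ₜ 1 := by
  have h3 : ∀ y : H ⊗[k] H,
      Algebra.TensorProduct.map (.id k B) E (Algebra.TensorProduct.map F F y) =
      TensorProduct.map F.toLinearMap LinearMap.id (counit.lTensor H y) := by
    intro y
    induction y with
    | zero => simp
    | add x y hx hy => simp only [map_add, hx, hy]
    | tmul x y => simp [hE]
  rw [hG, h3, lTensor_counit_comul]; simp

end

/-- The bialgebra structure of `T(V) # H`: `H` is a subbialgebra and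
`Δ(x_i) = x_i ⊗ 1 + g_i ⊗ x_i`, `ε(x_i) = 0`. -/
instance : Bialgebra k (Bosonization D) :=
  Bialgebra.ofAlgHom (lift _ _ (compat_comul D)) (lift _ _ (compat_counit D))
    (by
      apply algHom_ext
      · intro i
        simp [comulX, comulH, TensorProduct.add_tmul, TensorProduct.tmul_add, D.g_comul, add_assoc,
          Algebra.TensorProduct.one_def]
      · exact fun h => coassoc_aux (inH D) _ (lift_inH _ _ (compat_comul D)) h)
    (by
      apply algHom_ext
      · intro i
        simp [comulX, D.g_counit]
      · exact fun h => rTensor_aux (inH D) _ (lift_inH _ _ (compat_comul D)) _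
          (lift_inH _ _ (compat_counit D)) h)
    (by
      apply algHom_ext
      · intro i
        simp [comulX]
      · exact fun h => lTensor_aux (inH D) _ (lift_inH _ _ (compat_comul D)) _
          (lift_inH _ _ (compat_counit D)) h)

lemma comul_x (i : Fin θ) :
    comul (R := k) (x D i) = x D i ⊗ₜ 1 + inH D (D.g i) ⊗ₜ x D i :=
  lift_x _ _ (compat_comul D) i

lemma comul_inH (h : H) :
    comul (R := k) (inH D h) = Algebra.TensorProduct.map (inH D) (inH D) (comul h) :=
  lift_inH _ _ (compat_comul D) h

lemma counit_x (i : Fin θ) : counit (R := k) (x D i) = 0 := lift_x _ _ (compat_counit D) i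
lemma counit_inH (h : H) : counit (R := k) (inH D h) = counit (R := k) h :=
  lift_inH _ _ (compat_counit D) h

lemma compat_antipode : Compat D
    (fun i => MulOpposite.op (-(inH D (antipode k (D.g i)) * x D i)))
    ((AlgHom.op (inH D)).comp (HopfAlgebra.antipodeAlgHomOp k H)) := by
  intro i
  have hg := (D.ydPair i).groupLike
  have key : toConv (constMap k H (inH D (antipode k (D.g i)))) * toConv (constMap k H (x D i)) *
      toConv ((inH D).toLinearMap ∘ₗ antipode k) =
      toConv (Algebra.linearMap k _ ∘ₗ (D.χ i).toLinearMap) *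
        toConv ((inH D).toLinearMap ∘ₗ antipode k) *
      (toConv (constMap k H (inH D (antipode k (D.g i)))) * toConv (constMap k H (x D i))) := by
    have one_map : toConv ((inH D).toLinearMap ∘ₗ (1 : WithConv (H →ₗ[k] H)).ofConv) = 1 := by
      ext h; simp
    have one_const : toConv (constMap k H (1 : Bosonization D)) = 1 := by
      ext h; simp [constMap, Algebra.smul_def]
    refine monoid_aux₃ ?_ ?_ ?_ ?_ (scal_comm _ _) (E_mul_C D i) (E_yd_map D (inH D) i)
    · have := algHom_comp_conv (inH D) (toConv (LinearMap.id : H →ₗ[k] H)) (toConv (antipode k))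
      rw [LinearMap.id_mul_antipode, one_map] at this
      exact this.symm
    · have := algHom_comp_conv (inH D) (toConv (antipode k)) (toConv (LinearMap.id : H →ₗ[k] H))
      rw [LinearMap.antipode_mul_id, one_map] at this
      exact this.symm
    · rw [const_mul_const, ← map_mul, hg.mul_antipode_cancel, map_one, one_const]
    · rw [const_mul_const, ← map_mul, hg.antipode_mul_cancel, map_one, one_const]
  ext h
  rw [conv_mul_const, conv_apply _ _ h (ℛ k h)]
  have key' := congr(MulOpposite.op (-($key).ofConv h))
  rw [const_mul_const, const_mul_conv, conv_mul_const, conv_apply _ _ h (ℛ k h)] at key'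
  refine Eq.trans ?_ (key'.trans ?_)
  · simp
  · simp [Finset.sum_mul, ← Algebra.smul_def, mul_assoc]

/-- The antipode, as an algebra map to the opposite algebra: `S(h)` is the antipode of `H` and
`S(x_i) = -g_i⁻¹ x_i`. -/
def antipodeHom : Bosonization D →ₐ[k] (Bosonization D)ᵐᵒᵖ := lift _ _ (compat_antipode D)

lemma induction {P : Bosonization D → Prop} (hx : ∀ i, P (x D i)) (hH : ∀ h, P (inH D h))
    (hadd : ∀ a b, P a → P b → P (a + b)) (hmul : ∀ a b, P a → P b → P (a * b)) (t) : P t := by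
  have hT : ∀ r, P (inT D r) := by
    intro r
    induction r using FreeAlgebra.induction with
    | grade0 c => 
      rw [AlgHom.commutes, ← AlgHom.commutes (inH D)]; exact hH _
    | grade1 i => exact hx i
    | add a b ha hb => rw [map_add]; exact hadd _ _ ha hb
    | mul a b ha hb => rw [map_mul]; exact hmul _ _ ha hb
  induction t using TensorProduct.induction_on with
  | zero => have := hT 0; rwa [map_zero] at this
  | add a b ha hb => exact hadd _ _ ha hb
  | tmul r h => rw [tmul_eq]; exact hmul _ _ (hT r) (hH h)

end Bosonization

section antipode
variable {A : Type*} [Ring A] [Bialgebra k A] (S : A →ₐ[k] Aᵐᵒᵖ)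

lemma conv_apply_end (f g : A →ₗ[k] A) (a : A) {ι : Type*} (R : Repr k a ι) :
    (toConv f * toConv g).ofConv a = ∑ i ∈ R.index, f (R.left i) * g (R.right i) :=
  R.convMul_apply _ _

/-- The linear map underlying an anti-homomorphism. -/
def unopLin : A →ₗ[k] A := (MulOpposite.opLinearEquiv k).symm.toLinearMap ∘ₗ S.toLinearMap

lemma unopLin_mul (a b : A) : unopLin S (a * b) = unopLin S b * unopLin S a := by simp [unopLin]

lemma left_antipode_mul {a b : A}
    (ha : (toConv (unopLin S) * toConv LinearMap.id).ofConv a = algebraMap k A (counit a))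
    (hb : (toConv (unopLin S) * toConv LinearMap.id).ofConv b = algebraMap k A (counit b)) :
    (toConv (unopLin S) * toConv LinearMap.id).ofConv (a * b) =
      algebraMap k A (counit (a * b)) := by
  rw [conv_apply_end _ _ a (ℛ k a)] at ha
  rw [conv_apply_end _ _ b (ℛ k b)] at hb
  rw [conv_apply_end _ _ (a * b) ((ℛ k a).mul (ℛ k b))]
  simp only [LinearMap.id_apply] at ha hb ⊢
  rw [Bialgebra.counit_mul, map_mul]
  simp only [Coalgebra.Repr.mul_index, Coalgebra.Repr.mul_left, Coalgebra.Repr.mul_right, Finset.sum_product_right, unopLin_mul]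
  have : ∀ j i, unopLin S ((ℛ k b).left j) * unopLin S ((ℛ k a).left i) *
      ((ℛ k a).right i * (ℛ k b).right j) = unopLin S ((ℛ k b).left j) *
      (unopLin S ((ℛ k a).left i) * (ℛ k a).right i) * (ℛ k b).right j := by
    intro i j; simp only [mul_assoc]
  simp only [this, ← Finset.sum_mul, ← Finset.mul_sum, ha]
  simp only [← Algebra.commutes (counit a), mul_assoc, ← Finset.mul_sum, hb]

lemma right_antipode_mul {a b : A}
    (ha : (toConv LinearMap.id * toConv (unopLin S)).ofConv a = algebraMap k A (counit a))
    (hb : (toConv LinearMap.id * toConv (unopLin S)).ofConv b = algebraMap k A (counit b)) :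
    (toConv LinearMap.id * toConv (unopLin S)).ofConv (a * b) =
      algebraMap k A (counit (a * b)) := by
  rw [conv_apply_end _ _ a (ℛ k a)] at ha
  rw [conv_apply_end _ _ b (ℛ k b)] at hb
  rw [conv_apply_end _ _ (a * b) ((ℛ k a).mul (ℛ k b))]
  simp only [LinearMap.id_apply] at ha hb ⊢
  rw [Bialgebra.counit_mul, map_mul]
  simp only [Coalgebra.Repr.mul_index, Coalgebra.Repr.mul_left, Coalgebra.Repr.mul_right, Finset.sum_product, unopLin_mul]
  have : ∀ i j, (ℛ k a).left i * (ℛ k b).left j *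
      (unopLin S ((ℛ k b).right j) * unopLin S ((ℛ k a).right i)) = (ℛ k a).left i *
      ((ℛ k b).left j * unopLin S ((ℛ k b).right j)) * unopLin S ((ℛ k a).right i) := by
    intro i j; simp only [mul_assoc]
  simp only [this, ← Finset.sum_mul, ← Finset.mul_sum, hb]
  simp only [← Algebra.commutes (counit b), mul_assoc, ← Finset.mul_sum, ha]

end antipode

namespace Bosonization

variable (D : PrincipalRealization k H θ)

lemma unop_x (i : Fin θ) : unopLin (antipodeHom D) (x D i) = -(inH D (antipode k (D.g i)) * x D i) := by
  simp [unopLin, antipodeHom]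

lemma unop_inH (h : H) : unopLin (antipodeHom D) (inH D h) = inH D (antipode k h) := by
  simp [unopLin, antipodeHom]

lemma conv_eq (f g : Bosonization D →ₗ[k] Bosonization D) (t : Bosonization D) :
    (toConv f * toConv g).ofConv t = LinearMap.mul' k _ (TensorProduct.map f g (comul t)) := rfl

lemma conv_inH (f g : Bosonization D →ₗ[k] Bosonization D) (f' g' : H →ₗ[k] H)
    (hf : ∀ h, f (inH D h) = inH D (f' h)) (hg : ∀ h, g (inH D h) = inH D (g' h)) (h : H) :
    (toConv f * toConv g).ofConv (inH D h) = inH D ((toConv f' * toConv g').ofConv h) := by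
  rw [conv_eq, comul_inH, conv_apply _ _ h (ℛ k h)]
  conv_lhs => rw [← (ℛ k h).eq]
  simp [hf, hg]

instance : HopfAlgebra k (Bosonization D) :=
  HopfAlgebra.ofConvInverse (unopLin (antipodeHom D))
    (by
      ext t
      refine induction D (P := fun t => (toConv (unopLin (antipodeHom D)) *
        toConv LinearMap.id).ofConv t = algebraMap k _ (counit t)) ?_ ?_ ?_ ?_ t
      · intro i
        have hg := (D.ydPair i).groupLike
        rw [conv_eq, comul_x, counit_x]
        simp [unop_x, unop_inH]
      · intro h
        rw [conv_inH D _ _ _ LinearMap.id (unop_inH D) (fun _ => rfl)]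
        change inH D ((toConv (antipode k (A := H)) * toConv (LinearMap.id : H →ₗ[k] H)).ofConv h) = _
        rw [LinearMap.antipode_mul_id, counit_inH]
        simp
      · intro a b ha hb
        rw [map_add, map_add, map_add, ha, hb]
      · intro a b ha hb
        exact left_antipode_mul _ ha hb)
    (by
      ext t
      refine induction D (P := fun t => (toConv LinearMap.id *
        toConv (unopLin (antipodeHom D))).ofConv t = algebraMap k _ (counit t)) ?_ ?_ ?_ ?_ t
      · intro i
        have hg := (D.ydPair i).groupLike
        rw [conv_eq, comul_x, counit_x]
        have h1 : unopLin (antipodeHom D) 1 = 1 := by simp [unopLin]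
        simp [h1, unop_x, ← mul_assoc, ← map_mul, hg.mul_antipode_cancel]
      · intro h
        rw [conv_inH D _ _ LinearMap.id _ (fun _ => rfl) (unop_inH D)]
        change inH D ((toConv (LinearMap.id : H →ₗ[k] H) * toConv (antipode k (A := H))).ofConv h) = _
        rw [LinearMap.id_mul_antipode, counit_inH]
        simp
      · intro a b ha hb
        rw [map_add, map_add, map_add, ha, hb]
      · intro a b ha hb
        exact right_antipode_mul _ ha hb)

end Bosonization

section CleftObjects

variable {K : Type*} [Ring K] [HopfAlgebra k K] {A : Type*} [Ring A] [Algebra k A]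

/-- `A` with the algebra map `ρ : A → A ⊗ K`, `ρ(a) = a₀ ⊗ a₁`, is a right
`K`-comodule algebra. -/
structure IsComoduleAlgebra (ρ : A →ₐ[k] A ⊗[k] K) : Prop where
  coassoc : ∀ a, TensorProduct.assoc k A K K (ρ.toLinearMap.rTensor K (ρ a)) =
    (comul (R := k) (A := K)).lTensor A (ρ a)
  counit : ∀ a, TensorProduct.rid k A ((counit (R := k) (A := K)).lTensor A (ρ a)) = a

/-- `A` is a (right) cleft object of `K`: a right `K`-comodule algebra whose coinvariants are
`k`, and which has a convolution-invertible `K`-colinear section `γ : K → A`. -/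
structure IsCleftObject (ρ : A →ₐ[k] A ⊗[k] K) : Prop where
  comoduleAlgebra : IsComoduleAlgebra ρ
  algebraMap_injective : Function.Injective (algebraMap k A)
  coinvariants : ∀ a : A, ρ a = a ⊗ₜ 1 → ∃ c : k, a = algebraMap k A c
  exists_section : ∃ γ : K →ₗ[k] A,
    (∀ h, ρ (γ h) = γ.rTensor K (comul (R := k) h)) ∧ IsUnit (toConv γ)

/-- The Galois map `A ⊗ A → A ⊗ K`, `x ⊗ y ↦ x y₀ ⊗ y₁`. -/
def galoisMap (ρ : A →ₐ[k] A ⊗[k] K) : A ⊗[k] A →ₗ[k] A ⊗[k] K :=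
  (LinearMap.mul' k A).rTensor K ∘ₗ (TensorProduct.assoc k A A K).symm.toLinearMap ∘ₗ
    ρ.toLinearMap.lTensor A

lemma galoisMap_tmul (ρ : A →ₐ[k] A ⊗[k] K) (x y : A) :
    galoisMap ρ (x ⊗ₜ y) = (x ⊗ₜ 1) * ρ y := by
  have : ∀ t : A ⊗[k] K, (LinearMap.mul' k A).rTensor K
      ((TensorProduct.assoc k A A K).symm (x ⊗ₜ t)) = (x ⊗ₜ 1) * t := by
    intro t
    induction t with
    | zero => simp
    | add s t hs ht => simp only [TensorProduct.tmul_add, map_add, hs, ht, mul_add]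
    | tmul a h => simp
  simpa [galoisMap] using this (ρ y)

/-- The coaction of `K` on the opposite algebra, `op a ↦ op a₀ ⊗ a₁` (as a linear map). -/
def opCoaction (ρ : A →ₐ[k] A ⊗[k] K) : Aᵐᵒᵖ →ₗ[k] Aᵐᵒᵖ ⊗[k] K :=
  (MulOpposite.opLinearEquiv k).toLinearMap.rTensor K ∘ₗ ρ.toLinearMap ∘ₗ
    (MulOpposite.opLinearEquiv k).symm.toLinearMap

/-- The codiagonal coaction of `K` on `A ⊗ Aᵒᵖ`, `x ⊗ y ↦ (x₀ ⊗ y₀) ⊗ x₁ y₁`. -/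
def codiagonal (ρ : A →ₐ[k] A ⊗[k] K) : A ⊗[k] Aᵐᵒᵖ →ₗ[k] (A ⊗[k] Aᵐᵒᵖ) ⊗[k] K :=
  (LinearMap.mul' k K).lTensor (A ⊗[k] Aᵐᵒᵖ) ∘ₗ
    (TensorProduct.tensorTensorTensorComm k A K Aᵐᵒᵖ K).toLinearMap ∘ₗ
    TensorProduct.map ρ.toLinearMap (opCoaction ρ)

/-- The map `x ⊗ (p ⊗ q) ↦ (x ⊗ op p) ⊗ q`. -/
def regroup : A ⊗[k] (A ⊗[k] A) →ₗ[k] (A ⊗[k] Aᵐᵒᵖ) ⊗[k] A :=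
  ((MulOpposite.opLinearEquiv k).toLinearMap.lTensor A).rTensor A ∘ₗ
    (TensorProduct.assoc k A A A).symm.toLinearMap

/-- For `τ : K → A ⊗ A`, `τ(h) = τ'(h) ⊗ τ''(h)`, the map
`x ⊗ op y ↦ (x₀ ⊗ op τ'(x₁)) ⊗ (τ''(x₁) ⊗ op y)`. -/
def translationComul (ρ : A →ₐ[k] A ⊗[k] K) (τ : K →ₗ[k] A ⊗[k] A) :
    A ⊗[k] Aᵐᵒᵖ →ₗ[k] (A ⊗[k] Aᵐᵒᵖ) ⊗[k] (A ⊗[k] Aᵐᵒᵖ) :=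
  (TensorProduct.assoc k (A ⊗[k] Aᵐᵒᵖ) A Aᵐᵒᵖ).toLinearMap ∘ₗ
    (regroup ∘ₗ τ.lTensor A ∘ₗ ρ.toLinearMap).rTensor Aᵐᵒᵖ

/-- The linear map `A ⊗ Aᵒᵖ → A`, `x ⊗ op y ↦ x y`. -/
def mulOpMap : A ⊗[k] Aᵐᵒᵖ →ₗ[k] A :=
  LinearMap.mul' k A ∘ₗ (MulOpposite.opLinearEquiv k).symm.toLinearMap.lTensor A

/-- `L` is the Hopf algebra `L(A, K)` of the Galois object `A`: as an algebra,
`L(A, K) = (A ⊗ Aᵒᵖ)^{co K}` for the codiagonal coaction; the comultiplication is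
`x ⊗ op y ↦ (x₀ ⊗ op τ'(x₁)) ⊗ (τ''(x₁) ⊗ op y)`, where `τ` is the translation map
`τ(h) = can⁻¹(1 ⊗ h)` for the (bijective) Galois map `can`; the counit is given by
`x ⊗ op y ↦ x y ∈ k`. -/
def IsSchauenburgHopfAlgebra (ρ : A →ₐ[k] A ⊗[k] K) (L : Type*) [Ring L] [HopfAlgebra k L] :
    Prop :=
  Function.Bijective (galoisMap ρ) ∧
  ∃ τ : K →ₗ[k] A ⊗[k] A, (∀ h, galoisMap ρ (τ h) = 1 ⊗ₜ h) ∧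
  ∃ ι : L →ₐ[k] A ⊗[k] Aᵐᵒᵖ, Function.Injective ι ∧
    (∀ z, z ∈ Set.range ι ↔ codiagonal ρ z = z ⊗ₜ 1) ∧
    (∀ l, TensorProduct.map ι.toLinearMap ι.toLinearMap (comul (R := k) l) =
      translationComul ρ τ (ι l)) ∧
    (∀ l, mulOpMap (ι l) = algebraMap k A (counit l))

end CleftObjects

section CocycleDeformations

variable (K : Type*) [Ring K] [HopfAlgebra k K]

/-- `σ : K ⊗ K → k` is a (normalized, convolution-invertible) Hopf 2-cocycle:
`σ(x₁, y₁) σ(x₂ y₂, z) = σ(y₁, z₁) σ(x, y₂ z₂)` and `σ(x, 1) = ε(x) = σ(1, x)`. The first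
identity is an equality in the convolution algebra of linear forms on `(K ⊗ K) ⊗ K`. -/
structure IsHopfTwoCocycle (σ : K ⊗[k] K →ₗ[k] k) : Prop where
  isUnit : IsUnit (toConv σ)
  map_tmul_one : ∀ x, σ (x ⊗ₜ 1) = counit x
  map_one_tmul : ∀ x, σ (1 ⊗ₜ x) = counit x
  cocycle :
    toConv (LinearMap.mul' k k ∘ₗ TensorProduct.map σ (counit (R := k) (A := K))) *
      toConv (σ ∘ₗ (LinearMap.mul' k K).rTensor K) =
    toConv (LinearMap.mul' k k ∘ₗ TensorProduct.map (counit (R := k) (A := K)) σ ∘ₗ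
        (TensorProduct.assoc k K K K).toLinearMap) *
      toConv (σ ∘ₗ (LinearMap.mul' k K).lTensor K ∘ₗ
        (TensorProduct.assoc k K K K).toLinearMap)

/-- The multiplication `x ⊗ y ↦ σ(x₁, y₁) x₂ y₂ τ(x₃, y₃)` on `K`. -/
def twistedMul (σ τ : K ⊗[k] K →ₗ[k] k) : K ⊗[k] K →ₗ[k] K :=
  (toConv (Algebra.linearMap k K ∘ₗ σ) * toConv (LinearMap.mul' k K) *
    toConv (Algebra.linearMap k K ∘ₗ τ)).ofConv

/-- `L` is a cocycle deformation of `K`: it is isomorphic to `K_σ` for a Hopf 2-cocycle `σ`,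
where `K_σ` is the coalgebra `K` with unit `1` and the multiplication
`x · y = σ(x₁, y₁) x₂ y₂ σ⁻¹(x₃, y₃)`. -/
def IsCocycleDeformation (L : Type*) [Ring L] [HopfAlgebra k L] : Prop :=
  ∃ σ τ : K ⊗[k] K →ₗ[k] k, IsHopfTwoCocycle K σ ∧
    toConv σ * toConv τ = 1 ∧ toConv τ * toConv σ = 1 ∧
    ∃ f : K ≃ₗc[k] L, f 1 = 1 ∧ ∀ x y, f (twistedMul K σ τ (x ⊗ₜ y)) = f x * f y

end CocycleDeformations

section Graded

variable {L : Type*} [Ring L] [HopfAlgebra k L] {G : Type*} [Ring G] [HopfAlgebra k G]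

/-- The part of degree `n` of `L ⊗ L`, for a family of subspaces `F` of `L`. -/
def tensorDegree (F : ℕ → Submodule k L) (n : ℕ) : Submodule k (L ⊗[k] L) :=
  ⨆ p ∈ Finset.HasAntidiagonal.antidiagonal n,
    LinearMap.range (TensorProduct.map (F p.1).subtype (F p.2).subtype)

/-- `F` is an exhaustive increasing Hopf algebra filtration of `L`. -/
structure IsHopfFiltration (F : ℕ → Submodule k L) : Prop where
  mono : Monotone F
  iSup_eq_top : ⨆ n, F n = ⊤
  one_mem : 1 ∈ F 0
  mul_mem : ∀ m n, ∀ x ∈ F m, ∀ y ∈ F n, x * y ∈ F (m + n)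
  comul_mem : ∀ n, ∀ x ∈ F n, comul (R := k) x ∈ tensorDegree F n
  antipode_mem : ∀ n, ∀ x ∈ F n, antipode k x ∈ F n

/-- `G = ⨁ G(n)` is a graded Hopf algebra. -/
structure IsHopfGrading (𝒢 : ℕ → Submodule k G) : Prop where
  isInternal : DirectSum.IsInternal 𝒢
  one_mem : 1 ∈ 𝒢 0
  mul_mem : ∀ m n, ∀ x ∈ 𝒢 m, ∀ y ∈ 𝒢 n, x * y ∈ 𝒢 (m + n)
  comul_mem : ∀ n, ∀ x ∈ 𝒢 n, comul (R := k) x ∈ tensorDegree 𝒢 n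
  counit_eq_zero : ∀ n, n ≠ 0 → ∀ x ∈ 𝒢 n, counit (R := k) x = 0
  antipode_mem : ∀ n, ∀ x ∈ 𝒢 n, antipode k x ∈ 𝒢 n

/-- An isomorphism of graded Hopf algebras from the associated graded Hopf algebra
`gr L = ⨁ F n / F (n - 1)` of a Hopf algebra filtration `F` (with `F (-1) = 0`) to
`G = ⨁ G(n)`, described by the surjective linear maps `s n : F n → G(n)` with kernel
`F (n - 1)` that it induces. The products, coproducts and antipodes of
`gr L` are those of representatives in `L`, and its counit is that of `L` on `F 0`. -/
structure IsAssociatedGradedIso (F : ℕ → Submodule k L) (𝒢 : ℕ → Submodule k G)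
    (s : ∀ n, F n →ₗ[k] G) : Prop where
  range_eq : ∀ n, LinearMap.range (s n) = 𝒢 n
  ker_zero : LinearMap.ker (s 0) = ⊥
  ker_succ : ∀ n, LinearMap.ker (s (n + 1)) = (F n).comap (F (n + 1)).subtype
  map_one : ∀ h : 1 ∈ F 0, s 0 ⟨1, h⟩ = 1
  map_mul : ∀ m n, ∀ (x : F m) (y : F n) (h : (x * y : L) ∈ F (m + n)),
    s (m + n) ⟨x * y, h⟩ = s m x * s n y
  map_comul : ∀ n, ∀ x : F n, ∃ t : ∀ p : ℕ × ℕ, F p.1 ⊗[k] F p.2,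
    comul (R := k) (x : L) = ∑ p ∈ Finset.HasAntidiagonal.antidiagonal n,
      TensorProduct.map (F p.1).subtype (F p.2).subtype (t p) ∧
    comul (R := k) (s n x) = ∑ p ∈ Finset.HasAntidiagonal.antidiagonal n,
      TensorProduct.map (s p.1) (s p.2) (t p)
  map_counit : ∀ x : F 0, counit (R := k) (s 0 x) = counit (R := k) (x : L)
  map_antipode : ∀ n, ∀ (x : F n) (h : antipode k (x : L) ∈ F n),
    s n ⟨antipode k (x : L), h⟩ = antipode k (s n x)

/-- `gr L ≅ G` as graded Hopf algebras, for the associated graded Hopf algebra of the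
Hopf algebra filtration `F` of `L` and the Hopf algebra grading `𝒢` of `G`. -/
def GrIsomorphic (F : ℕ → Submodule k L) (𝒢 : ℕ → Submodule k G) : Prop :=
  IsHopfFiltration F ∧ IsHopfGrading 𝒢 ∧ ∃ s, IsAssociatedGradedIso F 𝒢 s

end Graded

section TypeA

variable (D : PrincipalRealization k H θ)

/-- `V` is of type `A_θ` at `-1`: `q_{ii} = -1`, `q_{ij} q_{ji} = -1` if `|i - j| = 1` and
`q_{ij} q_{ji} = 1` if `|i - j| > 1`. -/
structure IsTypeA : Prop where
  diag : ∀ i, D.q i i = -1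
  adjacent : ∀ i j : Fin θ, (i : ℕ) + 1 = j → D.q i j * D.q j i = -1
  distant : ∀ i j : Fin θ, (i : ℕ) + 1 < j → D.q i j * D.q j i = 1

/-- Families of scalars `λ_{ij}` (used for `i < j - 1`), `μ_k` and `ν_j` (used for `j` with both
neighbours in the index set), with `λ_{ij} = 0` if `χ_i χ_j ≠ ε`, `μ_k = 0` if
`χ_k² ≠ ε` and `ν_j = 0` if `χ_j² χ_{j-1} χ_{j+1} ≠ ε`. Products of characters are
convolution products, with unit `ε`. -/
structure DeformationData where
  lam : Fin θ → Fin θ → k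
  mu : Fin θ → k
  nu : Fin θ → k
  lam_eq_zero : ∀ i j : Fin θ, (i : ℕ) + 1 < j →
    toConv (D.χ i) * toConv (D.χ j) ≠ 1 → lam i j = 0
  mu_eq_zero : ∀ i : Fin θ, toConv (D.χ i) ^ 2 ≠ 1 → mu i = 0
  nu_eq_zero : ∀ i j l : Fin θ, (i : ℕ) + 1 = j → (j : ℕ) + 1 = l →
    toConv (D.χ j) ^ 2 * toConv (D.χ i) * toConv (D.χ l) ≠ 1 → nu j = 0

/-- `q_{αβ} = ∏ q_{ij}^{α_i β_j}` for degrees `α, β ∈ ℕ^θ`. -/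
def bichar (α β : Fin θ → ℕ) : k := ∏ i, ∏ j, D.q i j ^ (α i * β j)

/-- The braided commutator `[u, v]_c = u v - q_{αβ} v u` of elements `u`, `v` of `T(V)` of
degrees `α`, `β ∈ ℕ^θ`. -/
def braidedComm (α β : Fin θ → ℕ) (u v : FreeAlgebra k (Fin θ)) : FreeAlgebra k (Fin θ) :=
  u * v - bichar D α β • (v * u)

/-- The `i`-th basis vector of `ℕ^θ`. -/
def deg (i : Fin θ) : Fin θ → ℕ := Pi.single i 1

/-- `x_{ij} = [x_i, x_j]_c`. -/
def xPair (i j : Fin θ) : FreeAlgebra k (Fin θ) :=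
  braidedComm D (deg i) (deg j) (FreeAlgebra.ι k i) (FreeAlgebra.ι k j)

/-- `[x_i, [x_j, x_l]_c]_c`; this is `x_{(i l)}` when `j = i + 1` and `l = i + 2`. -/
def xTriple (i j l : Fin θ) : FreeAlgebra k (Fin θ) :=
  braidedComm D (deg i) (deg j + deg l) (FreeAlgebra.ι k i) (xPair D j l)

/-- `[[x_i, [x_j, x_l]_c]_c, x_j]_c`; for `i = j - 1` and `l = j + 1` this is
`[x_{(j-1 j+1)}, x_j]_c`. -/
def xSerre (i j l : Fin θ) : FreeAlgebra k (Fin θ) :=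
  braidedComm D (deg i + deg j + deg l) (deg j) (xTriple D i j l) (FreeAlgebra.ι k j)

/-- The relators of the quotient of `T(V) # H` by `x_{ij} = a_{ij}` for `i < j - 1`,
`x_i² = b_i`, and `[x_{(j-1 j+1)}, x_j]_c = c_{j-1,j,j+1}`. -/
inductive Relator (a : Fin θ → Fin θ → Bosonization D) (b : Fin θ → Bosonization D)
    (c : Fin θ → Fin θ → Fin θ → Bosonization D) : Bosonization D → Prop
  | pair (i j : Fin θ) (hij : (i : ℕ) + 1 < j) :
      Relator a b c (Bosonization.inT D (xPair D i j) - a i j)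
  | square (i : Fin θ) : Relator a b c (Bosonization.x D i ^ 2 - b i)
  | serre (i j l : Fin θ) (hij : (i : ℕ) + 1 = j) (hjl : (j : ℕ) + 1 = l) :
      Relator a b c (Bosonization.inT D (xSerre D i j l) - c i j l)

/-- The two-sided ideal generated by the relators. -/
def relIdeal (a : Fin θ → Fin θ → Bosonization D) (b : Fin θ → Bosonization D)
    (c : Fin θ → Fin θ → Fin θ → Bosonization D) : Ideal (Bosonization D) :=
  (TwoSidedIdeal.span {z | Relator D a b c z}).asIdeal

instance (a : Fin θ → Fin θ → Bosonization D) (b : Fin θ → Bosonization D)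
    (c : Fin θ → Fin θ → Fin θ → Bosonization D) : (relIdeal D a b c).IsTwoSided :=
  inferInstanceAs (TwoSidedIdeal.span {z | Relator D a b c z}).asIdeal.IsTwoSided

/-- The ideal of `T(V) # H` whose quotient is the bosonization of the pre-Nichols algebra with
relations `x_{ij} = 0` for `i < j - 1`, `x_i² = 0`, `[x_{(i-1 i+1)}, x_i]_c = 0`. -/
def preNicholsIdeal : Ideal (Bosonization D) := relIdeal D 0 0 0

instance : (preNicholsIdeal D).IsTwoSided :=
  inferInstanceAs (relIdeal D _ _ _).IsTwoSided

variable {D}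
variable (P : DeformationData D)

/-- The ideal of `T(V) # H` generated by `y_{ij} - λ_{ij}` for `i < j - 1`, `y_i² - μ_i`
and `[y_{(i-1 i+1)}, y_i]_c - ν_i`. -/
def cleftIdeal : Ideal (Bosonization D) :=
  relIdeal D (fun i j => algebraMap k _ (P.lam i j)) (fun i => algebraMap k _ (P.mu i))
    (fun _ j _ => algebraMap k _ (P.nu j))

instance : (cleftIdeal P).IsTwoSided := inferInstanceAs (relIdeal D _ _ _).IsTwoSided

/-- The ideal of `T(V) # H` generated by the relators of
`a_{ij} = λ_{ij} (1 - g_i g_j)` for `i < j - 1`, `a_i² = μ_i (1 - g_i²)` and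
`[a_{(j-1 j+1)}, a_j]_c = ν_j (1 - g_j² g_{j-1} g_{j+1})
  - 4 χ_j(g_{j-1}) μ_j λ_{j-1,j+1} g_{j-1} g_{j+1} (1 - g_j²)`. -/
def liftingIdeal : Ideal (Bosonization D) :=
  relIdeal D (fun i j => P.lam i j • Bosonization.inH D (1 - D.g i * D.g j))
    (fun i => P.mu i • Bosonization.inH D (1 - D.g i ^ 2))
    (fun i j l => P.nu j • Bosonization.inH D (1 - D.g j ^ 2 * D.g i * D.g l) -
      (4 * D.χ j (D.g i) * P.mu j * P.lam i l) •
        Bosonization.inH D (D.g i * D.g l * (1 - D.g j ^ 2)))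

instance : (liftingIdeal P).IsTwoSided := inferInstanceAs (relIdeal D _ _ _).IsTwoSided

/-- Write `Â` and `Ĥ` for the quotients of `T(V) # H` by `cleftIdeal` and `preNicholsIdeal`. The
algebra map `ρ : Â → Â ⊗ Ĥ` is the standard coaction: `ρ(y_i) = y_i ⊗ 1 + g_i ⊗ x_i` and
`ρ(h) = h₁ ⊗ h₂` for `h ∈ H`. There is at most one such algebra map. -/
structure IsStandardCoaction
    (ρ : (Bosonization D ⧸ cleftIdeal P) →ₐ[k]
      (Bosonization D ⧸ cleftIdeal P) ⊗[k] (Bosonization D ⧸ preNicholsIdeal D)) : Prop where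
  map_x : ∀ i, ρ (Ideal.Quotient.mk _ (Bosonization.x D i)) =
    Ideal.Quotient.mk _ (Bosonization.x D i) ⊗ₜ 1 +
      Ideal.Quotient.mk _ (Bosonization.inH D (D.g i)) ⊗ₜ
        Ideal.Quotient.mk _ (Bosonization.x D i)
  map_inH : ∀ h : H, ρ (Ideal.Quotient.mk _ (Bosonization.inH D h)) =
    TensorProduct.map
      ((Ideal.Quotient.mkₐ k (cleftIdeal P)).toLinearMap ∘ₗ (Bosonization.inH D).toLinearMap)
      ((Ideal.Quotient.mkₐ k (preNicholsIdeal D)).toLinearMap ∘ₗ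
        (Bosonization.inH D).toLinearMap)
      (comul h)

variable (D)

/-- The part `T^n(V) # H` of degree `n` of `T(V) # H`. -/
def degreePart (n : ℕ) : Submodule k (Bosonization D) :=
  Submodule.span k {t | ∃ r ∈ Submodule.span k (Set.range (FreeAlgebra.ι k (X := Fin θ))) ^ n,
    ∃ h : H, t = Bosonization.inT D r * Bosonization.inH D h}

variable {D}

/-- The image of `T^n(V) # H` in a quotient of `T(V) # H`. -/
def quotDegree (J : Ideal (Bosonization D)) [J.IsTwoSided] (n : ℕ) :
    Submodule k (Bosonization D ⧸ J) :=
  (degreePart D n).map (Ideal.Quotient.mkₐ k J).toLinearMap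

/-- The filtration of a quotient of `T(V) # H` induced by the degree: `F n` is the image of
`⨁_{i ≤ n} T^i(V) # H`. -/
def quotFiltration (J : Ideal (Bosonization D)) [J.IsTwoSided] (n : ℕ) :
    Submodule k (Bosonization D ⧸ J) :=
  ⨆ i ≤ n, quotDegree J i

end TypeA

end ALift

end

open ALift

open scoped TensorProduct
open Coalgebra HopfAlgebra WithConv
noncomputable section
namespace ALift
universe u v

section
section QComm

variable {k : Type*} [Field k] {B : Type*} [Ring B] [Algebra k B]

/-- The `c`-commutator `u v - c v u`. -/
def qcomm (c : k) (u v : B) : B := u * v - c • (v * u)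

/-- `[[a, [b, c]], b]` for braided commutators with `q_{ab} = p`, `q_{bc} = r`, `q_{ac} = s`,
`q_{bb} = -1` and `q_{bc} q_{cb} = -1`. -/
def serreComm (p r s : k) (a b c : B) : B := qcomm (p / r) (qcomm (p * s) a (qcomm r b c)) b

lemma map_qcomm {C : Type*} [Ring C] [Algebra k C] (F : B →ₐ[k] C) (c : k) (u v : B) :
    F (qcomm c u v) = qcomm c (F u) (F v) := by simp [qcomm]

lemma map_serreComm {C : Type*} [Ring C] [Algebra k C] (F : B →ₐ[k] C) (p r s : k) (a b c : B) :
    F (serreComm p r s a b c) = serreComm p r s (F a) (F b) (F c) := by simp [serreComm, map_qcomm]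

lemma qcomm_add {p p' : k} (hp : p * p' = 1) {P Q P' Q' : B}
    (h : Q * P' = p • (P' * Q)) (h' : Q' * P = p' • (P * Q')) :
    qcomm p (P + Q) (P' + Q') = qcomm p P P' + qcomm p Q Q' := by
  simp only [qcomm, add_mul, mul_add, h, h', smul_add, smul_smul, hp, one_smul]
  abel

lemma sq_add_of_anticomm {P Q : B} (h : Q * P = (-1 : k) • (P * Q)) :
    (P + Q) ^ 2 = P ^ 2 + Q ^ 2 := by
  simp only [pow_two, add_mul, mul_add, h]
  module

lemma serreComm_add {p r s : k} (hp : p ≠ 0) (hr : r ≠ 0) (hs : s ≠ 0) {a b c a' b' c' : B}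
    (hab : a' * b = p • (b * a')) (hac : a' * c = s • (c * a'))
    (hba : b' * a = (-p⁻¹) • (a * b')) (hbb : b' * b = (-1 : k) • (b * b'))
    (hbc : b' * c = r • (c * b')) (hca : c' * a = s⁻¹ • (a * c'))
    (hcb : c' * b = (-r⁻¹) • (b * c')) :
    serreComm p r s (a + a') (b + b') (c + c') =
      serreComm p r s a b c + serreComm p r s a' b' c' +
      (2 : k) • (a * (r⁻¹ • (b' ^ 2 * c') - r • (c' * b' ^ 2))) -
      (2 * r⁻¹) • ((a * b ^ 2 - p ^ 2 • (b ^ 2 * a)) * c') -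
      (4 * p ^ 2 * r⁻¹) • (b ^ 2 * qcomm s a' c') +
      (2 * p) • (b * (qcomm s a' c' * b' + (p * r⁻¹) • (b' * qcomm s a' c'))) := by
  have e : ∀ {x y : B} {c : k}, x * y = c • (y * x) → ∀ z, x * (y * z) = c • (y * (x * z)) := by
    intro x y c h z; rw [← mul_assoc, h, smul_mul_assoc, mul_assoc]
  simp only [serreComm, qcomm, pow_two, add_mul, mul_add, sub_mul, mul_sub, smul_add, smul_sub,
    smul_mul_assoc, mul_smul_comm, mul_assoc, smul_smul, hab, hac, hba, hbb, hbc, hca, hcb,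
    e hab, e hac, e hba, e hbb, e hbc, e hca, e hcb]
  match_scalars <;> field_simp <;> ring

end QComm
end

section
variable {k : Type u} [Field k] {H : Type v} [Ring H] [HopfAlgebra k H] {θ : ℕ}

section bichar
variable (D : PrincipalRealization k H θ)

lemma bichar_deg (i j : Fin θ) : bichar D (deg i) (deg j) = D.q i j := by
  unfold bichar deg
  rw [Finset.prod_eq_single i, Finset.prod_eq_single j]
  · simp
  · intro b _ hb; simp [Pi.single_eq_of_ne hb]
  · simp
  · intro b _ hb; simp [Pi.single_eq_of_ne hb]
  · simp

lemma bichar_add_left (α β γ : Fin θ → ℕ) :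
    bichar D (α + β) γ = bichar D α γ * bichar D β γ := by
  simp [bichar, add_mul, pow_add, Finset.prod_mul_distrib]

lemma bichar_add_right (α β γ : Fin θ → ℕ) :
    bichar D α (β + γ) = bichar D α β * bichar D α γ := by
  simp [bichar, mul_add, pow_add, Finset.prod_mul_distrib]

lemma inT_xPair (i j : Fin θ) : Bosonization.inT D (xPair D i j) =
    qcomm (D.q i j) (Bosonization.x D i) (Bosonization.x D j) := by
  simp [xPair, braidedComm, bichar_deg, qcomm, Bosonization.x]

end bichar

lemma conv_of_groupLike {B : Type*} [Ring B] [Algebra k B] {g : H} (hg : IsGroupLikeElem k g)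
    (f f' : WithConv (H →ₗ[k] B)) : (f * f').ofConv g = f.ofConv g * f'.ofConv g := by
  change LinearMap.mul' k B (TensorProduct.map f.ofConv f'.ofConv (comul g)) = _
  rw [hg.comul_eq_tmul_self]; simp

namespace PrincipalRealization
variable (D : PrincipalRealization k H θ)

lemma q_ne_zero (i j : Fin θ) : D.q i j ≠ 0 := by
  intro h
  have hg := (D.ydPair i).groupLike
  have := congr(D.χ j $(hg.mul_antipode_cancel))
  rw [map_mul, map_one, show D.χ j (D.g i) = 0 from h, zero_mul] at this
  exact zero_ne_one this

lemma g_comm (i j : Fin θ) : D.g i * D.g j = D.g j * D.g i := by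
  have h := congr(($(D.yd_comm j)).ofConv (D.g i))
  have hg := (D.ydPair i).groupLike
  simp only [conv_of_groupLike hg] at h
  simp only [LinearMap.id_apply, LinearMap.comp_apply, Algebra.linearMap_apply,
    AlgHom.toLinearMap_apply, ← Algebra.commutes, ← Algebra.smul_def, smul_mul_assoc, constMap,
    LinearMap.toSpanSingleton_apply, D.g_counit, one_smul] at h
  exact (smul_right_injective H (D.q_ne_zero i j)) h

end PrincipalRealization

lemma IsTypeA.inT_xSerre {D : PrincipalRealization k H θ} (hD : IsTypeA D) {i j l : Fin θ}
    (hjl : (j : ℕ) + 1 = l) :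
    Bosonization.inT D (xSerre D i j l) = serreComm (D.q i j) (D.q j l) (D.q i l)
      (Bosonization.x D i) (Bosonization.x D j) (Bosonization.x D l) := by
  have h := hD.adjacent j l hjl
  have hp : D.q i j * D.q j j * D.q l j = D.q i j / D.q j l := by
    rw [hD.diag, eq_div_iff (D.q_ne_zero j l)]; linear_combination -D.q i j * h
  simp [serreComm, xSerre, xTriple, xPair, braidedComm, bichar_deg, bichar_add_left,
    bichar_add_right, qcomm, Bosonization.x, hp]

namespace Bosonization
variable (D : PrincipalRealization k H θ)

lemma inH_g_mul_x (i j : Fin θ) : inH D (D.g i) * x D j = D.q i j • (x D j * inH D (D.g i)) := by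
  have h := congr(($(compat_in D j)).ofConv (D.g i))
  simpa [conv_of_groupLike (D.ydPair i).groupLike, constMap, D.g_counit,
    PrincipalRealization.q] using h

lemma commute_inH_g (i j : Fin θ) : inH D (D.g i) * inH D (D.g j) = inH D (D.g j) * inH D (D.g i) := by
  rw [← map_mul, D.g_comm, map_mul]

end Bosonization

namespace DeformationData
variable {D : PrincipalRealization k H θ} (P : DeformationData D)

lemma conv_algHom_apply (χ ψ : H →ₐ[k] k) {g : H} (hg : IsGroupLikeElem k g) :
    (toConv χ * toConv ψ).ofConv g = χ g * ψ g := by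
  rw [AlgHom.convMul_def]
  simp [hg.comul_eq_tmul_self]

lemma lam_q {i j : Fin θ} (hij : (i : ℕ) + 1 < j) (h : P.lam i j ≠ 0) (l : Fin θ) :
    D.q l i * D.q l j = 1 := by
  have h1 : toConv (D.χ i) * toConv (D.χ j) = 1 := by
    by_contra h2; exact h (P.lam_eq_zero i j hij h2)
  have hg := (D.ydPair l).groupLike
  rw [PrincipalRealization.q, PrincipalRealization.q, ← conv_algHom_apply _ _ hg, h1]
  exact hg.counit_eq_one

lemma mu_q {i : Fin θ} (h : P.mu i ≠ 0) (l : Fin θ) : D.q l i ^ 2 = 1 := by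
  have h1 : toConv (D.χ i) ^ 2 = 1 := by
    by_contra h2; exact h (P.mu_eq_zero i h2)
  have hg := (D.ydPair l).groupLike
  rw [PrincipalRealization.q, pow_two, ← conv_algHom_apply _ _ hg, ← pow_two, h1]
  exact hg.counit_eq_one

lemma nu_q {i j m : Fin θ} (hij : (i : ℕ) + 1 = j) (hjm : (j : ℕ) + 1 = m) (h : P.nu j ≠ 0)
    (l : Fin θ) : D.q l j ^ 2 * D.q l i * D.q l m = 1 := by
  have h1 : toConv (D.χ j) ^ 2 * toConv (D.χ i) * toConv (D.χ m) = 1 := by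
    by_contra h2; exact h (P.nu_eq_zero i j m hij hjm h2)
  have hg := (D.ydPair l).groupLike
  have h2 := congr(($h1).ofConv (D.g l))
  simp only [PrincipalRealization.q]
  rw [pow_two] at h2 ⊢
  have e := fun χ ψ => conv_algHom_apply (k := k) χ ψ hg
  rw [← e, ← WithConv.toConv_ofConv (toConv (D.χ j) * toConv (D.χ j)), ← e,
    ← WithConv.toConv_ofConv (_ * toConv (D.χ i)), ← e]
  exact h2.trans hg.counit_eq_one

instance : Zero (DeformationData D) :=
  ⟨⟨0, 0, 0, fun _ _ _ _ => rfl, fun _ _ => rfl, fun _ _ _ _ _ _ => rfl⟩⟩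

@[simp] lemma zero_lam (i j : Fin θ) : (0 : DeformationData D).lam i j = 0 := rfl
@[simp] lemma zero_mu (i : Fin θ) : (0 : DeformationData D).mu i = 0 := rfl
@[simp] lemma zero_nu (i : Fin θ) : (0 : DeformationData D).nu i = 0 := rfl

end DeformationData

section relIdeal
variable {D : PrincipalRealization k H θ} {a : Fin θ → Fin θ → Bosonization D}
  {b : Fin θ → Bosonization D} {c : Fin θ → Fin θ → Fin θ → Bosonization D}

lemma relator_mem {z : Bosonization D} (hz : Relator D a b c z) : z ∈ relIdeal D a b c :=
  TwoSidedIdeal.mem_asIdeal.2 (TwoSidedIdeal.subset_span hz)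

lemma relIdeal_induction {p : Bosonization D → Prop} (hr : ∀ z, Relator D a b c z → p z)
    (h0 : p 0) (hadd : ∀ z w, p z → p w → p (z + w)) (hneg : ∀ z, p z → p (-z))
    (hl : ∀ t z, p z → p (t * z)) (hrm : ∀ z t, p z → p (z * t)) {z : Bosonization D}
    (hz : z ∈ relIdeal D a b c) : p z := by
  refine TwoSidedIdeal.span_induction (p := fun z _ => p z) (fun z h => hr z h) h0
    (fun x y _ _ => hadd x y) (fun x _ => hneg x) (fun t x _ => hl t x) (fun x t _ => hrm t x)
    (TwoSidedIdeal.mem_asIdeal.1 hz)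

lemma eq_zero_of_mem_relIdeal {B : Type*} [Ring B] [Algebra k B] (F : Bosonization D →ₐ[k] B)
    (hr : ∀ z, Relator D a b c z → F z = 0) {z : Bosonization D} (hz : z ∈ relIdeal D a b c) :
    F z = 0 := by
  refine relIdeal_induction (p := fun z => F z = 0) hr (map_zero F) ?_ ?_ ?_ ?_ hz
  · intro z w h1 h2; rw [map_add, h1, h2, add_zero]
  · intro z h; rw [map_neg, h, neg_zero]
  · intro t z h; rw [map_mul, h, mul_zero]
  · intro z t h; rw [map_mul, h, zero_mul]

end relIdeal

section biIdeal
variable {D : PrincipalRealization k H θ} (P P' P'' : DeformationData D)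

open Bosonization

/-- The right hand sides `λ_{ij} - λ'_{ij} g_i g_j`. -/
def biPair (i j : Fin θ) : Bosonization D :=
  algebraMap k _ (P.lam i j) - P'.lam i j • (inH D (D.g i) * inH D (D.g j))

/-- The right hand sides `μ_i - μ'_i g_i²`. -/
def biSquare (i : Fin θ) : Bosonization D :=
  algebraMap k _ (P.mu i) - P'.mu i • inH D (D.g i) ^ 2

/-- The right hand sides of the Serre relations for a pair of deformation data. -/
def biSerre (i j l : Fin θ) : Bosonization D :=
  algebraMap k _ (P.nu j) - P'.nu j • (inH D (D.g j) ^ 2 * (inH D (D.g i) * inH D (D.g l))) -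
    (4 * D.q i j) • ((P.mu j * P'.lam i l) • (inH D (D.g i) * inH D (D.g l)) -
      (P'.mu j * P'.lam i l) • (inH D (D.g j) ^ 2 * (inH D (D.g i) * inH D (D.g l))))

/-- The ideal of `T(V) # H` with the relations attached to the pair `(P, P')`; it specializes to
the ideals defining the pre-Nichols bosonization, the cleft object and the lifting. -/
def biIdeal : Ideal (Bosonization D) := relIdeal D (biPair P P') (biSquare P P') (biSerre P P')

instance : (biIdeal P P').IsTwoSided := inferInstanceAs (relIdeal D _ _ _).IsTwoSided

lemma cleftIdeal_eq : cleftIdeal P = biIdeal P 0 := by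
  have h1 : biPair P 0 = fun i j => algebraMap k _ (P.lam i j) := by
    funext i j; simp [biPair]
  have h2 : biSquare P 0 = fun i => algebraMap k _ (P.mu i) := by
    funext i; simp [biSquare]
  have h3 : biSerre P 0 = fun _ j _ => algebraMap k _ (P.nu j) := by
    funext i j l; simp [biSerre]
  rw [biIdeal, h1, h2, h3]; rfl

lemma liftingIdeal_eq : liftingIdeal P = biIdeal P P := by
  have h1 : biPair P P = fun i j => P.lam i j • inH D (1 - D.g i * D.g j) := by
    funext i j; simp [biPair, Algebra.algebraMap_eq_smul_one, smul_sub]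
  have h2 : biSquare P P = fun i => P.mu i • inH D (1 - D.g i ^ 2) := by
    funext i; simp [biSquare, Algebra.algebraMap_eq_smul_one, smul_sub]
  have h3 : biSerre P P = fun i j l => P.nu j • inH D (1 - D.g j ^ 2 * D.g i * D.g l) -
      (4 * D.χ j (D.g i) * P.mu j * P.lam i l) • inH D (D.g i * D.g l * (1 - D.g j ^ 2)) := by
    funext i j l
    have e : inH D (D.g i) * (inH D (D.g l) * inH D (D.g j) ^ 2) =
        inH D (D.g j) ^ 2 * (inH D (D.g i) * inH D (D.g l)) := by
      rw [← mul_assoc, ← map_mul, ← map_pow, ← map_mul, ← map_mul]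
      congr 1
      rw [pow_two, mul_assoc, ← mul_assoc (D.g l), D.g_comm l j, mul_assoc, D.g_comm l j,
        ← mul_assoc, D.g_comm i j, mul_assoc, ← mul_assoc (D.g i), D.g_comm i j]
      simp only [mul_assoc]
    simp only [biSerre, Algebra.algebraMap_eq_smul_one, smul_sub, map_sub, map_one, map_mul,
      map_pow, mul_sub, mul_one, e, PrincipalRealization.q, mul_assoc, smul_smul]
  rw [biIdeal, h1, h2, h3]; rfl

lemma preNicholsIdeal_eq : preNicholsIdeal D = biIdeal (0 : DeformationData D) 0 := by
  have h1 : biPair (0 : DeformationData D) 0 = 0 := by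
    funext i j; simp [biPair]
  have h2 : biSquare (0 : DeformationData D) 0 = 0 := by
    funext i; simp [biSquare]
  have h3 : biSerre (0 : DeformationData D) 0 = 0 := by
    funext i j l; simp [biSerre]
  rw [biIdeal, h1, h2, h3]; rfl

/-- `F` satisfies the relations attached to `(P, P')` of degree two. -/
structure QuadRel {B : Type*} [Ring B] [Algebra k B] (F : Bosonization D →ₐ[k] B) : Prop where
  pair : ∀ i j : Fin θ, (i : ℕ) + 1 < j →
    qcomm (D.q i j) (F (x D i)) (F (x D j)) = F (biPair P P' i j)
  square : ∀ i : Fin θ, F (x D i) ^ 2 = F (biSquare P P' i)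

/-- `F` satisfies the relations attached to `(P, P')`. -/
structure AllRel {B : Type*} [Ring B] [Algebra k B] (F : Bosonization D →ₐ[k] B) : Prop extends
    QuadRel P P' F where
  serre : ∀ i j l : Fin θ, (i : ℕ) + 1 = j → (j : ℕ) + 1 = l →
    serreComm (D.q i j) (D.q j l) (D.q i l) (F (x D i)) (F (x D j)) (F (x D l)) =
      F (biSerre P P' i j l)

variable {P P'} {B : Type*} [Ring B] [Algebra k B] {F : Bosonization D →ₐ[k] B}

lemma AllRel.eq_zero (hD : IsTypeA D) (h : AllRel P P' F) {z : Bosonization D}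
    (hz : z ∈ biIdeal P P') : F z = 0 := by
  refine eq_zero_of_mem_relIdeal F (fun z hz => ?_) hz
  cases hz with
  | pair i j hij => rw [map_sub, inT_xPair, map_qcomm, h.pair i j hij, sub_self]
  | square i => rw [map_sub, map_pow, h.square i, sub_self]
  | serre i j l hij hjl =>
    rw [map_sub, hD.inT_xSerre hjl, map_serreComm, h.serre i j l hij hjl, sub_self]

lemma allRel_of_eq_zero (hD : IsTypeA D) (h : ∀ z ∈ biIdeal P P', F z = 0) : AllRel P P' F where
  pair i j hij := by
    have := h _ (relator_mem (Relator.pair i j hij))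
    rwa [map_sub, inT_xPair, map_qcomm, sub_eq_zero] at this
  square i := by
    have := h _ (relator_mem (Relator.square i))
    rwa [map_sub, map_pow, sub_eq_zero] at this
  serre i j l hij hjl := by
    have := h _ (relator_mem (Relator.serre i j l hij hjl))
    rwa [map_sub, hD.inT_xSerre hjl, map_serreComm, sub_eq_zero] at this

lemma allRel_mk (hD : IsTypeA D) (P P' : DeformationData D) :
    AllRel P P' (Ideal.Quotient.mkₐ k (biIdeal P P')) :=
  allRel_of_eq_zero hD fun _ hz => Ideal.Quotient.eq_zero_iff_mem.2 hz

end biIdeal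
end

section
open Bosonization
variable {k : Type u} [Field k] {H : Type v} [Ring H] [HopfAlgebra k H] {θ : ℕ}

section twist
variable {D : PrincipalRealization k H θ}
  {B₁ : Type*} [Ring B₁] [Algebra k B₁] {B₂ : Type*} [Ring B₂] [Algebra k B₂]
  (F₁ : Bosonization D →ₐ[k] B₁) (F₂ : Bosonization D →ₐ[k] B₂)

/-- The algebra map `t ↦ F₁(t₁) ⊗ F₂(t₂)`. -/
def mapComul : Bosonization D →ₐ[k] B₁ ⊗[k] B₂ :=
  (Algebra.TensorProduct.map F₁ F₂).comp (Bialgebra.comulAlgHom k _)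

lemma mapComul_apply (t : Bosonization D) :
    mapComul F₁ F₂ t = Algebra.TensorProduct.map F₁ F₂ (comul t) := rfl

lemma mapComul_x (i : Fin θ) : mapComul F₁ F₂ (x D i) =
    F₁ (x D i) ⊗ₜ 1 + F₁ (inH D (D.g i)) ⊗ₜ F₂ (x D i) := by
  simp [mapComul_apply, comul_x]

lemma mapComul_g (i : Fin θ) : mapComul F₁ F₂ (inH D (D.g i)) =
    F₁ (inH D (D.g i)) ⊗ₜ F₂ (inH D (D.g i)) := by
  simp [mapComul_apply, comul_inH, D.g_comul]

/-- The relator `x_{ij} - λ_{ij} + λ'_{ij} g_i g_j`. -/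
def pairRel (P P' : DeformationData D) (i j : Fin θ) : Bosonization D :=
  qcomm (D.q i j) (x D i) (x D j) - biPair P P' i j

/-- The relator `x_i² - μ_i + μ'_i g_i²`. -/
def squareRel (P P' : DeformationData D) (i : Fin θ) : Bosonization D :=
  x D i ^ 2 - biSquare P P' i

/-- The Serre relator for a pair of deformation data. -/
def serreRel (P P' : DeformationData D) (i j l : Fin θ) : Bosonization D :=
  serreComm (D.q i j) (D.q j l) (D.q i l) (x D i) (x D j) (x D l) - biSerre P P' i j l

lemma qcomm_tmul (c : k) (g h : B₁) (hgh : h * g = g * h) (y z : B₂) :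
    qcomm c (g ⊗ₜ[k] y) (h ⊗ₜ[k] z) = (g * h) ⊗ₜ[k] qcomm c y z := by
  simp [qcomm, hgh, TensorProduct.tmul_sub]

lemma map_inH_g_mul_x (i j : Fin θ) : F₁ (inH D (D.g i)) * F₁ (x D j) =
    D.q i j • (F₁ (x D j) * F₁ (inH D (D.g i))) := by
  rw [← map_mul, inH_g_mul_x, map_smul, map_mul]

lemma map_commute_g (i j : Fin θ) : F₁ (inH D (D.g i)) * F₁ (inH D (D.g j)) =
    F₁ (inH D (D.g j)) * F₁ (inH D (D.g i)) := by
  rw [← map_mul, commute_inH_g, map_mul]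

lemma mixed_comm (i j : Fin θ) :
    (F₁ (inH D (D.g i)) ⊗ₜ[k] F₂ (x D i)) * (F₁ (x D j) ⊗ₜ[k] 1) =
      D.q i j • ((F₁ (x D j) ⊗ₜ[k] 1) * (F₁ (inH D (D.g i)) ⊗ₜ[k] F₂ (x D i))) := by
  simp [map_inH_g_mul_x, TensorProduct.smul_tmul']

lemma mapComul_pairRel (hD : IsTypeA D) (P P' P'' : DeformationData D) {i j : Fin θ}
    (hij : (i : ℕ) + 1 < j) :
    mapComul F₁ F₂ (pairRel P P'' i j) = F₁ (pairRel P P' i j) ⊗ₜ 1 +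
      F₁ (inH D (D.g i) * inH D (D.g j)) ⊗ₜ F₂ (pairRel P' P'' i j) := by
  rw [pairRel, map_sub, map_qcomm, mapComul_x, mapComul_x,
    qcomm_add (hD.distant i j hij) (mixed_comm F₁ F₂ i j) (mixed_comm F₁ F₂ j i),
    qcomm_tmul _ _ _ (map_commute_g F₁ j i)]
  have h : qcomm (D.q i j) (F₁ (x D i) ⊗ₜ[k] (1 : B₂)) (F₁ (x D j) ⊗ₜ[k] 1) =
      F₁ (qcomm (D.q i j) (x D i) (x D j)) ⊗ₜ 1 := by
    rw [map_qcomm]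
    exact (map_qcomm (Algebra.TensorProduct.includeLeft : B₁ →ₐ[k] B₁ ⊗[k] B₂) _ _ _).symm
  rw [h]
  simp only [pairRel, biPair, map_sub, map_qcomm, map_smul, map_mul, mapComul_g,
    Algebra.algebraMap_eq_smul_one, Algebra.TensorProduct.tmul_mul_tmul, TensorProduct.tmul_sub,
    TensorProduct.sub_tmul, TensorProduct.tmul_smul, TensorProduct.smul_tmul', mul_one,
    Algebra.TensorProduct.one_def, smul_sub, map_one]
  module

lemma mapComul_squareRel (hD : IsTypeA D) (P P' P'' : DeformationData D) (i : Fin θ) :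
    mapComul F₁ F₂ (squareRel P P'' i) = F₁ (squareRel P P' i) ⊗ₜ 1 +
      F₁ (inH D (D.g i) ^ 2) ⊗ₜ F₂ (squareRel P' P'' i) := by
  have h := mixed_comm F₁ F₂ i i
  rw [hD.diag] at h
  rw [squareRel, map_sub, map_pow, mapComul_x, sq_add_of_anticomm h]
  simp only [squareRel, biSquare, map_sub, map_smul, map_pow, mapComul_g,
    Algebra.algebraMap_eq_smul_one, Algebra.TensorProduct.tmul_pow, TensorProduct.tmul_sub,
    TensorProduct.sub_tmul, TensorProduct.tmul_smul, TensorProduct.smul_tmul', one_pow,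
    Algebra.TensorProduct.one_def, smul_sub, map_one]
  module

variable {F₁ F₂}

lemma mapComul_serreRel (hD : IsTypeA D) {P P' P'' : DeformationData D}
    (h₁ : QuadRel P P' F₁) (h₂ : QuadRel P' P'' F₂) {i j l : Fin θ}
    (hij : (i : ℕ) + 1 = j) (hjl : (j : ℕ) + 1 = l) :
    mapComul F₁ F₂ (serreRel P P'' i j l) = F₁ (serreRel P P' i j l) ⊗ₜ 1 +
      F₁ (inH D (D.g j) ^ 2 * (inH D (D.g i) * inH D (D.g l))) ⊗ₜ
        F₂ (serreRel P' P'' i j l) := by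
  have hil : (i : ℕ) + 1 < l := by omega
  have hp := D.q_ne_zero i j
  have hr := D.q_ne_zero j l
  have hs := D.q_ne_zero i l
  have qji : D.q j i = -(D.q i j)⁻¹ := by
    field_simp; linear_combination hD.adjacent i j hij
  have qlj : D.q l j = -(D.q j l)⁻¹ := by
    field_simp; linear_combination hD.adjacent j l hjl
  have qli : D.q l i = (D.q i l)⁻¹ := by
    field_simp; linear_combination hD.distant i l hil
  have mc := mixed_comm F₁ F₂
  have g1 := map_inH_g_mul_x F₁
  have g2 := map_inH_g_mul_x F₂
  have gc1 := map_commute_g F₁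
  have gC : ∀ i j, Commute (F₁ (inH D (D.g i))) (F₁ (inH D (D.g j))) := gc1
  have gC2 : ∀ i j, Commute (F₂ (inH D (D.g i))) (F₂ (inH D (D.g j))) := map_commute_g F₂
  have m1 := mc j i
  have m2 := mc l i
  have m3 := mc l j
  have m4 := mc j j
  rw [qji] at m1; rw [qli] at m2; rw [qlj] at m3; rw [hD.diag] at m4
  have key := serreComm_add hp hr hs (mc i j) (mc i l) m1 m4 (mc j l) m2 m3
  have sP : serreComm (D.q i j) (D.q j l) (D.q i l) (F₁ (x D i) ⊗ₜ[k] (1 : B₂))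
      (F₁ (x D j) ⊗ₜ[k] 1) (F₁ (x D l) ⊗ₜ[k] 1) =
      F₁ (serreComm (D.q i j) (D.q j l) (D.q i l) (x D i) (x D j) (x D l)) ⊗ₜ 1 := by
    rw [map_serreComm]
    exact (map_serreComm (Algebra.TensorProduct.includeLeft : B₁ →ₐ[k] B₁ ⊗[k] B₂) _ _ _ _ _ _).symm
  have sQ : serreComm (D.q i j) (D.q j l) (D.q i l) (F₁ (inH D (D.g i)) ⊗ₜ[k] F₂ (x D i))
      (F₁ (inH D (D.g j)) ⊗ₜ[k] F₂ (x D j)) (F₁ (inH D (D.g l)) ⊗ₜ[k] F₂ (x D l)) =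
      F₁ (inH D (D.g j) ^ 2 * (inH D (D.g i) * inH D (D.g l))) ⊗ₜ
      F₂ (serreComm (D.q i j) (D.q j l) (D.q i l) (x D i) (x D j) (x D l)) := by
    rw [map_serreComm, serreComm, qcomm_tmul _ _ _ (gc1 l j),
      qcomm_tmul _ _ _ ((gC j i).mul_left (gC l i)).eq,
      qcomm_tmul _ _ _ ((gC j i).mul_right ((gC j j).mul_right (gC j l))).eq]
    simp only [map_mul, map_pow, pow_two, serreComm]
    congr 1
    rw [mul_assoc, mul_assoc, gc1 l j, ← mul_assoc, ← mul_assoc, ← mul_assoc, gc1 i j,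
      mul_assoc (F₁ (inH D (D.g j))), gc1 i j]
    simp only [mul_assoc]
  have hPb : (F₁ (x D j) ⊗ₜ[k] (1 : B₂)) ^ 2 = F₁ (biSquare P P' j) ⊗ₜ 1 := by
    rw [Algebra.TensorProduct.tmul_pow, h₁.square, one_pow]
  have hQb : (F₁ (inH D (D.g j)) ⊗ₜ[k] F₂ (x D j)) ^ 2 =
      F₁ (inH D (D.g j) ^ 2) ⊗ₜ F₂ (biSquare P' P'' j) := by
    rw [Algebra.TensorProduct.tmul_pow, h₂.square, map_pow]
  have hR : qcomm (D.q i l) (F₁ (inH D (D.g i)) ⊗ₜ[k] F₂ (x D i))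
      (F₁ (inH D (D.g l)) ⊗ₜ[k] F₂ (x D l)) =
      F₁ (inH D (D.g i) * inH D (D.g l)) ⊗ₜ F₂ (biPair P' P'' i l) := by
    rw [qcomm_tmul _ _ _ (gc1 l i), h₂.pair i l hil, map_mul]
  have gx2 : ∀ i l : Fin θ, F₁ (inH D (D.g i)) ^ 2 * F₁ (x D l) =
      D.q i l ^ 2 • (F₁ (x D l) * F₁ (inH D (D.g i)) ^ 2) := by
    intro i l
    rw [pow_two, mul_assoc, g1, mul_smul_comm, ← mul_assoc, g1, smul_mul_assoc, mul_assoc,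
      smul_smul, pow_two]
  have gx2' : ∀ i l : Fin θ, F₂ (inH D (D.g i)) ^ 2 * F₂ (x D l) =
      D.q i l ^ 2 • (F₂ (x D l) * F₂ (inH D (D.g i)) ^ 2) := by
    intro i l
    rw [pow_two, mul_assoc, g2, mul_smul_comm, ← mul_assoc, g2, smul_mul_assoc, mul_assoc,
      smul_smul, pow_two]
  have z1 : (D.q j l)⁻¹ • ((F₁ (inH D (D.g j)) ⊗ₜ[k] F₂ (x D j)) ^ 2 *
        F₁ (inH D (D.g l)) ⊗ₜ[k] F₂ (x D l)) - D.q j l • (F₁ (inH D (D.g l)) ⊗ₜ[k] F₂ (x D l) *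
          (F₁ (inH D (D.g j)) ⊗ₜ[k] F₂ (x D j)) ^ 2) = 0 := by
    rw [hQb, biSquare]
    by_cases hr2 : D.q j l ^ 2 = 1
    · have e : (D.q j l)⁻¹ = D.q j l := by field_simp; rw [hr2]
      rw [e, ← smul_sub]
      simp only [map_sub, AlgHom.commutes, map_smul, Algebra.TensorProduct.tmul_mul_tmul, sub_mul,
        mul_sub, smul_mul_assoc, mul_smul_comm, gx2', hr2, one_smul, ← Algebra.commutes,
        map_pow, ((gC l j).pow_right 2).eq, sub_self, smul_zero]
    · have h1 : P'.mu j = 0 := by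
        by_contra h; apply hr2
        have := P'.mu_q h l
        rw [qlj] at this; field_simp at this; exact this.symm
      have h2 : P''.mu j = 0 := by
        by_contra h; apply hr2
        have := P''.mu_q h l
        rw [qlj] at this; field_simp at this; exact this.symm
      simp [h1, h2]
  have z2 : F₁ (x D i) ⊗ₜ[k] (1 : B₂) * (F₁ (x D j) ⊗ₜ[k] 1) ^ 2 -
      D.q i j ^ 2 • ((F₁ (x D j) ⊗ₜ[k] (1 : B₂)) ^ 2 * F₁ (x D i) ⊗ₜ[k] 1) = 0 := by
    rw [hPb, biSquare]
    by_cases hr2 : D.q i j ^ 2 = 1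
    · have e : D.q j i ^ 2 = 1 := by rw [qji, neg_sq, inv_pow, hr2, inv_one]
      simp only [map_sub, AlgHom.commutes, map_smul, map_pow, Algebra.TensorProduct.tmul_mul_tmul,
        sub_mul, mul_sub, smul_mul_assoc, mul_smul_comm, gx2, e, hr2, one_smul, ← Algebra.commutes,
        sub_self]
    · have h1 : P.mu j = 0 := by
        by_contra h; exact hr2 (P.mu_q h i)
      have h2 : P'.mu j = 0 := by
        by_contra h; exact hr2 (P'.mu_q h i)
      simp [h1, h2]
  have lam_r : ∀ P : DeformationData D, P.lam i l ≠ 0 → D.q j l = -D.q i j := by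
    intro P h
    have := P.lam_q hil h j
    rw [qji] at this; field_simp at this; rw [← this, neg_neg]
  have z4 : qcomm (D.q i l) (F₁ (inH D (D.g i)) ⊗ₜ[k] F₂ (x D i))
        (F₁ (inH D (D.g l)) ⊗ₜ[k] F₂ (x D l)) * F₁ (inH D (D.g j)) ⊗ₜ[k] F₂ (x D j) +
      (D.q i j * (D.q j l)⁻¹) • (F₁ (inH D (D.g j)) ⊗ₜ[k] F₂ (x D j) *
        qcomm (D.q i l) (F₁ (inH D (D.g i)) ⊗ₜ[k] F₂ (x D i))
          (F₁ (inH D (D.g l)) ⊗ₜ[k] F₂ (x D l))) = 0 := by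
    rw [hR, biPair]
    by_cases hpr : D.q j l = -D.q i j
    · have e : D.q i j * (D.q j l)⁻¹ = -1 := by rw [hpr]; field_simp
      have e2 : F₂ (inH D (D.g i)) * (F₂ (inH D (D.g l)) * F₂ (x D j)) =
          F₂ (x D j) * (F₂ (inH D (D.g i)) * F₂ (inH D (D.g l))) := by
        rw [g2, mul_smul_comm, ← mul_assoc, g2, smul_mul_assoc, mul_assoc, smul_smul, qlj, hpr]
        have : -(-D.q i j)⁻¹ * D.q i j = 1 := by field_simp
        rw [this, one_smul]
      rw [e]
      simp only [map_sub, AlgHom.commutes, map_smul, map_mul, Algebra.TensorProduct.tmul_mul_tmul,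
        sub_mul, mul_sub, smul_mul_assoc, mul_smul_comm, ← Algebra.commutes, mul_assoc, e2]
      have e3 : F₁ (inH D (D.g j)) * (F₁ (inH D (D.g i)) * F₁ (inH D (D.g l))) =
          F₁ (inH D (D.g i)) * (F₁ (inH D (D.g l)) * F₁ (inH D (D.g j))) :=
        ((gC i j).mul_left (gC l j)).eq.symm.trans (mul_assoc _ _ _)
      rw [e3, neg_one_smul, add_neg_cancel]
    · have h1 : P'.lam i l = 0 := by
        by_contra h; exact hpr (lam_r P' h)
      have h2 : P''.lam i l = 0 := by
        by_contra h; exact hpr (lam_r P'' h)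
      simp [h1, h2]
  rw [sP, sQ, z1, z2, z4, hPb, hR] at key
  rw [serreRel, map_sub, map_serreComm, mapComul_x, mapComul_x, mapComul_x, key]
  by_cases hpr : D.q j l = -D.q i j
  · have e : D.q i j ^ 2 * (D.q j l)⁻¹ = -D.q i j := by rw [hpr]; field_simp
    simp only [mul_zero, zero_mul, smul_zero, add_zero, sub_zero, mul_assoc, e, serreRel, biSerre,
      biSquare, biPair, map_sub, map_smul, map_mul, map_pow, mapComul_g, AlgHom.commutes,
      Algebra.algebraMap_eq_smul_one, Algebra.TensorProduct.tmul_pow,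
      Algebra.TensorProduct.tmul_mul_tmul, TensorProduct.tmul_sub,
      TensorProduct.sub_tmul, TensorProduct.tmul_smul, ← TensorProduct.smul_tmul', one_pow, mul_one,
      one_mul, Algebra.TensorProduct.one_def, smul_sub, map_one, sub_mul, mul_sub, smul_mul_assoc, mul_smul_comm]
    module
  · have h0 : P.lam i l = 0 := by
      by_contra h; exact hpr (lam_r P h)
    have h1 : P'.lam i l = 0 := by
      by_contra h; exact hpr (lam_r P' h)
    have h2 : P''.lam i l = 0 := by
      by_contra h; exact hpr (lam_r P'' h)
    simp only [mul_zero, zero_mul, zero_smul, smul_zero, add_zero, sub_zero, serreRel, biSerre,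
      biPair, h0, h1, h2, map_sub, map_smul, map_mul, map_pow, map_zero, mapComul_g,
      AlgHom.commutes, Algebra.algebraMap_eq_smul_one, Algebra.TensorProduct.tmul_pow,
      Algebra.TensorProduct.tmul_mul_tmul, TensorProduct.tmul_sub, TensorProduct.tmul_zero,
      TensorProduct.sub_tmul, TensorProduct.tmul_smul, ← TensorProduct.smul_tmul', mul_one,
      Algebra.TensorProduct.one_def, map_one]
    module
end twist
end

section
open Bosonization
variable {k : Type u} [Field k] {H : Type v} [Ring H] [HopfAlgebra k H] {θ : ℕ}

section hopf
variable {D : PrincipalRealization k H θ} {P P' P'' : DeformationData D}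
  {B : Type*} [Ring B] [Algebra k B] {F : Bosonization D →ₐ[k] B}

lemma quadRel_iff : QuadRel P P' F ↔ (∀ i j : Fin θ, (i : ℕ) + 1 < j → F (pairRel P P' i j) = 0) ∧
    ∀ i, F (squareRel P P' i) = 0 := by
  refine ⟨fun h => ⟨fun i j hij => ?_, fun i => ?_⟩, fun h => ⟨fun i j hij => ?_, fun i => ?_⟩⟩
  · rw [pairRel, map_sub, map_qcomm, h.pair i j hij, sub_self]
  · rw [squareRel, map_sub, map_pow, h.square i, sub_self]
  · have := h.1 i j hij
    rwa [pairRel, map_sub, map_qcomm, sub_eq_zero] at this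
  · have := h.2 i
    rwa [squareRel, map_sub, map_pow, sub_eq_zero] at this

lemma allRel_iff : AllRel P P' F ↔ QuadRel P P' F ∧ ∀ i j l : Fin θ, (i : ℕ) + 1 = j →
    (j : ℕ) + 1 = l → F (serreRel P P' i j l) = 0 := by
  refine ⟨fun h => ⟨h.toQuadRel, fun i j l hij hjl => ?_⟩,
    fun h => ⟨h.1, fun i j l hij hjl => ?_⟩⟩
  · rw [serreRel, map_sub, map_serreComm, h.serre i j l hij hjl, sub_self]
  · have := h.2 i j l hij hjl
    rwa [serreRel, map_sub, map_serreComm, sub_eq_zero] at this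

lemma AllRel.mapComul (hD : IsTypeA D) {B₁ : Type*} [Ring B₁] [Algebra k B₁]
    {B₂ : Type*} [Ring B₂] [Algebra k B₂] {F₁ : Bosonization D →ₐ[k] B₁}
    {F₂ : Bosonization D →ₐ[k] B₂} (h₁ : AllRel P P' F₁) (h₂ : AllRel P' P'' F₂) :
    AllRel P P'' (mapComul F₁ F₂) := by
  have q₁ := quadRel_iff.1 h₁.toQuadRel
  have q₂ := quadRel_iff.1 h₂.toQuadRel
  refine allRel_iff.2 ⟨quadRel_iff.2 ⟨fun i j hij => ?_, fun i => ?_⟩, fun i j l hij hjl => ?_⟩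
  · rw [mapComul_pairRel F₁ F₂ hD P P' P'' hij, q₁.1 i j hij, q₂.1 i j hij]; simp
  · rw [mapComul_squareRel F₁ F₂ hD P P' P'' i, q₁.2 i, q₂.2 i]; simp
  · rw [mapComul_serreRel hD h₁.toQuadRel h₂.toQuadRel hij hjl, (allRel_iff.1 h₁).2 i j l hij hjl,
      (allRel_iff.1 h₂).2 i j l hij hjl]; simp

lemma allRel_counit (hD : IsTypeA D) (P : DeformationData D) :
    AllRel P P (Bialgebra.counitAlgHom k (Bosonization D)) where
  pair i j hij := by simp [counit_x, biPair, qcomm, counit_inH, D.g_counit]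
  square i := by simp [counit_x, biSquare, counit_inH, D.g_counit]
  serre i j l _ _ := by simp [counit_x, biSerre, qcomm, serreComm, counit_inH, D.g_counit]

variable (F) in
/-- The algebra map `t ↦ F(S(t))` to the opposite algebra. -/
def mapAntipode : Bosonization D →ₐ[k] Bᵐᵒᵖ :=
  (AlgHom.op F).comp (HopfAlgebra.antipodeAlgHomOp k _)

lemma mapAntipode_apply (t : Bosonization D) :
    mapAntipode F t = MulOpposite.op (F (antipode k t)) := rfl

lemma mulOpMap_mapComul (t : Bosonization D) :
    mulOpMap (mapComul F (mapAntipode F) t) = algebraMap k B (counit t) := by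
  have h := congr(F $(mul_antipode_lTensor_comul_apply (R := k) t))
  rw [AlgHom.commutes] at h
  rw [← h, mapComul_apply]
  generalize (comul (R := k) t) = y
  induction y with
  | zero => simp
  | add a b ha hb => simp only [map_add, ha, hb]
  | tmul a b => simp [mulOpMap, mapAntipode_apply]

lemma mulOpMap_tmul (a : B) (b : Bᵐᵒᵖ) : mulOpMap (k := k) (a ⊗ₜ b) = a * b.unop := by
  simp [mulOpMap]

lemma mapAntipode_eq_zero {z w r : Bosonization D} {g : Bosonization D} (hg : IsUnit g)
    (h : mapComul F (mapAntipode F) z = F w ⊗ₜ 1 + F g ⊗ₜ mapAntipode F r)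
    (hw : F w = 0) (hz : counit (R := k) z = 0) : mapAntipode F r = 0 := by
  have e := mulOpMap_mapComul (F := F) z
  rw [h, hw, TensorProduct.zero_tmul, zero_add, mulOpMap_tmul, hz, map_zero] at e
  exact MulOpposite.unop_injective (((hg.map F).mul_right_eq_zero).1 e)

lemma isUnit_inH_g (i : Fin θ) : IsUnit (inH D (D.g i)) := by
  have hg := (D.ydPair i).groupLike
  exact IsUnit.map (inH D) ⟨⟨D.g i, _, hg.mul_antipode_cancel, hg.antipode_mul_cancel⟩, rfl⟩

lemma AllRel.mapAntipode (hD : IsTypeA D) (h : AllRel P' P F) : AllRel P P' (mapAntipode F) := by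
  have e := allRel_iff.1 (allRel_counit hD P')
  have q := quadRel_iff.1 h.toQuadRel
  have eq := quadRel_iff.1 e.1
  have hq : QuadRel P P' (ALift.mapAntipode F) := by
    refine quadRel_iff.2 ⟨fun i j hij => ?_, fun i => ?_⟩
    · exact mapAntipode_eq_zero ((isUnit_inH_g i).mul (isUnit_inH_g j))
        (mapComul_pairRel F _ hD P' P P' hij) (q.1 i j hij) (eq.1 i j hij)
    · exact mapAntipode_eq_zero ((isUnit_inH_g i).pow 2)
        (mapComul_squareRel F _ hD P' P P' i) (q.2 i) (eq.2 i)
  refine allRel_iff.2 ⟨hq, fun i j l hij hjl => ?_⟩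
  exact mapAntipode_eq_zero
    (((isUnit_inH_g j).pow 2).mul ((isUnit_inH_g i).mul (isUnit_inH_g l)))
    (mapComul_serreRel hD h.toQuadRel hq hij hjl) ((allRel_iff.1 h).2 i j l hij hjl)
    (e.2 i j l hij hjl)

lemma isHopfIdeal_biIdeal (hD : IsTypeA D) (P : DeformationData D) :
    (biIdeal P P).IsHopfIdeal k where
  counit_eq_zero x hx := (allRel_counit hD P).eq_zero hD hx
  map_mkQ_comul_eq_zero x hx := by
    have h := (allRel_mk hD P P)
    exact (h.mapComul hD h).eq_zero hD hx
  antipode_mem x hx := by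
    have h := (((allRel_mk hD P P).mapAntipode hD).eq_zero hD hx)
    exact Ideal.Quotient.eq_zero_iff_mem.1 (MulOpposite.op_injective h)

end hopf
end

section
open Bosonization
variable {k : Type u} [Field k] {H : Type v} [Ring H] [HopfAlgebra k H] {θ : ℕ}

section grading
variable (D : PrincipalRealization k H θ)

lemma compat_iff {B : Type*} [Ring B] [Algebra k B] {b : Fin θ → B} {f : H →ₐ[k] B} :
    Compat D b f ↔ ∀ i h, f h * b i =
      ∑ j ∈ (ℛ k h).index, D.χ i ((ℛ k h).left j) • (b i * f ((ℛ k h).right j)) := by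
  refine forall_congr' fun i => ⟨fun h h' => ?_, fun h => ?_⟩
  · have := congr(($h).ofConv h')
    rw [conv_mul_const, conv_apply _ _ h' (ℛ k h')] at this
    simpa using this
  · ext h'
    rw [conv_mul_const, conv_apply _ _ h' (ℛ k h')]
    simpa using h h'

lemma inH_mul_x (i : Fin θ) (h : H) : inH D h * x D i =
    ∑ j ∈ (ℛ k h).index, D.χ i ((ℛ k h).left j) • (x D i * inH D ((ℛ k h).right j)) :=
  (compat_iff D).1 (compat_in D) i h

/-- The span of the generators `x_i` in `T(V) # H`. -/
def xSpan : Submodule k (Bosonization D) := Submodule.span k (Set.range (x D))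

/-- The image of `H` in `T(V) # H`. -/
def hSpan : Submodule k (Bosonization D) := LinearMap.range (inH D).toLinearMap

lemma hSpan_mul_xSpan : hSpan D * xSpan D ≤ xSpan D * hSpan D := by
  rw [Submodule.mul_le]
  rintro _ ⟨h, rfl⟩ y hy
  induction hy using Submodule.span_induction with
  | zero => simp
  | add y z _ _ hy hz => rw [mul_add]; exact add_mem hy hz
  | smul c y _ hy => rw [mul_smul_comm]; exact Submodule.smul_mem _ c hy
  | mem y hy =>
    obtain ⟨i, rfl⟩ := hy
    rw [AlgHom.toLinearMap_apply, inH_mul_x]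
    refine Submodule.sum_mem _ fun j _ => Submodule.smul_mem _ _ ?_
    exact Submodule.mul_mem_mul (Submodule.subset_span ⟨i, rfl⟩) ⟨_, rfl⟩

lemma hSpan_mul_hSpan : hSpan D * hSpan D ≤ hSpan D := by
  rw [Submodule.mul_le]
  rintro _ ⟨h, rfl⟩ _ ⟨l, rfl⟩
  exact ⟨h * l, by simp⟩

lemma hSpan_mul_xSpan_pow (n : ℕ) : hSpan D * xSpan D ^ n ≤ xSpan D ^ n * hSpan D := by
  induction n with
  | zero => simp
  | succ n ih =>
    calc hSpan D * xSpan D ^ (n + 1) = (hSpan D * xSpan D ^ n) * xSpan D := by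
          rw [pow_succ, mul_assoc]
      _ ≤ xSpan D ^ n * hSpan D * xSpan D := mul_le_mul' ih le_rfl
      _ ≤ xSpan D ^ n * (xSpan D * hSpan D) := by
          rw [mul_assoc]; exact mul_le_mul' le_rfl (hSpan_mul_xSpan D)
      _ = _ := by rw [← mul_assoc, ← pow_succ]

lemma degreePart_eq (n : ℕ) : degreePart D n = xSpan D ^ n * hSpan D := by
  have e : (Submodule.span k (Set.range (FreeAlgebra.ι k (X := Fin θ))) ^ n).map
      (inT D).toLinearMap = xSpan D ^ n := by
    rw [Submodule.map_pow, Submodule.map_span, ← Set.range_comp]; rfl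
  apply le_antisymm
  · refine Submodule.span_le.2 ?_
    rintro _ ⟨r, hr, h, rfl⟩
    refine Submodule.mul_mem_mul ?_ ⟨h, rfl⟩
    rw [← e]; exact ⟨r, hr, rfl⟩
  · rw [← e, Submodule.mul_le]
    rintro _ ⟨r, hr, rfl⟩ _ ⟨h, rfl⟩
    exact Submodule.subset_span ⟨r, hr, h, rfl⟩

lemma degreePart_mul_le (m n : ℕ) : degreePart D m * degreePart D n ≤ degreePart D (m + n) := by
  simp only [degreePart_eq]
  calc xSpan D ^ m * hSpan D * (xSpan D ^ n * hSpan D)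
      = xSpan D ^ m * (hSpan D * xSpan D ^ n) * hSpan D := by simp only [mul_assoc]
    _ ≤ xSpan D ^ m * (xSpan D ^ n * hSpan D) * hSpan D :=
        mul_le_mul' (mul_le_mul' le_rfl (hSpan_mul_xSpan_pow D n)) le_rfl
    _ = xSpan D ^ (m + n) * (hSpan D * hSpan D) := by rw [pow_add]; simp only [mul_assoc]
    _ ≤ _ := mul_le_mul' le_rfl (hSpan_mul_hSpan D)

lemma degreePart_mul_mem {m n : ℕ} {a b : Bosonization D} (ha : a ∈ degreePart D m)
    (hb : b ∈ degreePart D n) : a * b ∈ degreePart D (m + n) :=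
  degreePart_mul_le D m n (Submodule.mul_mem_mul ha hb)

lemma inH_mem_degreePart (h : H) : inH D h ∈ degreePart D 0 := by
  rw [degreePart_eq, pow_zero, one_mul]; exact ⟨h, rfl⟩

lemma one_mem_degreePart : 1 ∈ degreePart D 0 := by
  rw [← map_one (inH D)]; exact inH_mem_degreePart D 1

lemma x_mem_degreePart (i : Fin θ) : x D i ∈ degreePart D 1 := by
  rw [degreePart_eq, pow_one, ← mul_one (x D i)]
  exact Submodule.mul_mem_mul (Submodule.subset_span ⟨i, rfl⟩) ⟨1, by simp⟩

lemma mem_degreePart_zero {t : Bosonization D} (ht : t ∈ degreePart D 0) : ∃ h, inH D h = t := by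
  rw [degreePart_eq, pow_zero, one_mul] at ht; exact ht

/-- An induction principle for the parts of fixed degree. -/
lemma degreePart_induction {p : ℕ → Bosonization D → Prop} (hH : ∀ h, p 0 (inH D h))
    (hx : ∀ i n a, a ∈ degreePart D n → p n a → p (n + 1) (x D i * a)) (h0 : ∀ n, p n 0)
    (hadd : ∀ n a b, p n a → p n b → p n (a + b)) (hs : ∀ n (c : k) a, p n a → p n (c • a))
    {n : ℕ} {a : Bosonization D} (ha : a ∈ degreePart D n) : p n a := by
  induction n generalizing a with
  | zero => obtain ⟨h, rfl⟩ := mem_degreePart_zero D ha; exact hH h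
  | succ n ih =>
    rw [degreePart_eq, pow_succ', mul_assoc, ← degreePart_eq] at ha
    induction ha using Submodule.mul_induction_on' with
    | add a _ b _ ha hb => exact hadd _ _ _ ha hb
    | mem_mul_mem y hy b hb =>
      induction hy using Submodule.span_induction with
      | zero => rw [zero_mul]; exact h0 _
      | add y z _ _ hy hz => rw [add_mul]; exact hadd _ _ _ hy hz
      | smul c y _ hy => rw [smul_mul_assoc]; exact hs _ _ _ hy
      | mem y hy => obtain ⟨i, rfl⟩ := hy; exact hx i n b hb (ih hb)

lemma iSup_degreePart : ⨆ n, degreePart D n = ⊤ := by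
  rw [eq_top_iff]
  rintro t -
  have hle : ∀ n, degreePart D n ≤ ⨆ n, degreePart D n := le_iSup _
  refine Bosonization.induction D (P := fun t => t ∈ ⨆ n, degreePart D n)
    (fun i => hle 1 (x_mem_degreePart D i)) (fun h => hle 0 (inH_mem_degreePart D h))
    (fun a b => add_mem) (fun a b ha hb => ?_) t
  have : (⨆ n, degreePart D n) * (⨆ n, degreePart D n) ≤ ⨆ n, degreePart D n := by
    simp only [Submodule.iSup_mul, Submodule.mul_iSup]
    exact iSup_le fun i => iSup_le fun j => (degreePart_mul_le D _ _).trans (hle _)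
  exact this (Submodule.mul_mem_mul ha hb)

open Polynomial in
/-- The algebra map `T(V) # H → (T(V) # H)[X]` sending a homogeneous `t` of degree `n` to
`t X^n`. -/
def homogenize {B : Type*} [Ring B] [Algebra k B] (F : Bosonization D →ₐ[k] B) :
    Bosonization D →ₐ[k] B[X] :=
  lift (fun i => C (F (x D i)) * X) ((Polynomial.CAlgHom.comp F).comp (inH D)) (by
    rw [compat_iff]
    intro i h
    have e := congr(C (F $(inH_mul_x D i h)) * X)
    simp only [map_mul, map_sum, map_smul, Finset.sum_mul, ← smul_C, smul_mul_assoc] at e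
    simp only [AlgHom.comp_apply, CAlgHom_apply, ← mul_assoc]
    rw [e]
    refine Finset.sum_congr rfl fun j _ => ?_
    rw [mul_assoc, mul_assoc, X_mul_C])

open Polynomial in
lemma homogenize_eq {B : Type*} [Ring B] [Algebra k B] (F : Bosonization D →ₐ[k] B) {n : ℕ}
    {a : Bosonization D} (ha : a ∈ degreePart D n) : homogenize D F a = monomial n (F a) := by
  refine degreePart_induction D (p := fun n a => homogenize D F a = monomial n (F a))
    ?_ ?_ ?_ ?_ ?_ ha
  · intro h; simp [homogenize]
  · intro i n a _ ha
    rw [map_mul, ha, map_mul, homogenize, lift_x, ← monomial_one_one_eq_X, C_mul_monomial, mul_one,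
      monomial_mul_monomial, add_comm]
  · simp
  · intro n a b ha hb; rw [map_add, ha, hb, map_add, map_add]
  · intro n c a ha; rw [map_smul, ha, map_smul, smul_monomial]

end grading

section tensorDegree
variable {L : Type*} [Ring L] [HopfAlgebra k L] {F : ℕ → Submodule k L}

lemma tmul_mem_tensorDegree {a b : L} {m n : ℕ} (ha : a ∈ F m) (hb : b ∈ F n) :
    a ⊗ₜ b ∈ tensorDegree F (m + n) := by
  have h : LinearMap.range (TensorProduct.map (F m).subtype (F n).subtype) ≤
      tensorDegree F (m + n) :=
    le_iSup₂_of_le (m, n) (Finset.HasAntidiagonal.mem_antidiagonal.2 rfl) le_rfl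
  exact h ⟨(⟨a, ha⟩ : F m) ⊗ₜ (⟨b, hb⟩ : F n), by simp⟩

lemma tensorDegree_le {n : ℕ} {S : Submodule k (L ⊗[k] L)}
    (h : ∀ i j, i + j = n → ∀ a ∈ F i, ∀ b ∈ F j, a ⊗ₜ b ∈ S) : tensorDegree F n ≤ S := by
  refine iSup₂_le fun p hp => ?_
  rintro _ ⟨t, rfl⟩
  induction t with
  | zero => simp
  | add a b ha hb => rw [map_add]; exact add_mem ha hb
  | tmul a b => exact h _ _ (Finset.HasAntidiagonal.mem_antidiagonal.1 hp) _ a.2 _ b.2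

lemma tensorDegree_mul_mem (hF : ∀ m n, ∀ a ∈ F m, ∀ b ∈ F n, a * b ∈ F (m + n)) {m n : ℕ}
    {y z : L ⊗[k] L} (hy : y ∈ tensorDegree F m) (hz : z ∈ tensorDegree F n) :
    y * z ∈ tensorDegree F (m + n) := by
  have h1 : tensorDegree F m ≤ (tensorDegree F (m + n)).comap (LinearMap.mulRight k z) := by
    refine tensorDegree_le fun i j hij a ha b hb => ?_
    have h2 : tensorDegree F n ≤
        (tensorDegree F (m + n)).comap (LinearMap.mulLeft k (a ⊗ₜ[k] b)) := by
      refine tensorDegree_le fun i' j' hij' a' ha' b' hb' => ?_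
      simp only [Submodule.mem_comap, LinearMap.mulLeft_apply, Algebra.TensorProduct.tmul_mul_tmul]
      have : m + n = (i + i') + (j + j') := by omega
      rw [this]
      exact tmul_mem_tensorDegree (hF _ _ _ ha _ ha') (hF _ _ _ hb _ hb')
    exact h2 hz
  exact h1 hy

lemma comul_mem_tensorDegree (D : PrincipalRealization k H θ) {n : ℕ} {a : Bosonization D}
    (ha : a ∈ degreePart D n) : comul (R := k) a ∈ tensorDegree (degreePart D) n := by
  refine degreePart_induction D (p := fun n a => comul (R := k) a ∈ tensorDegree (degreePart D) n)
    ?_ ?_ ?_ ?_ ?_ ha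
  · intro h
    rw [comul_inH]
    generalize (comul (R := k) h) = y
    induction y with
    | zero => simp
    | add a b ha hb => rw [map_add]; exact add_mem ha hb
    | tmul a b =>
      rw [Algebra.TensorProduct.map_tmul]
      exact tmul_mem_tensorDegree (m := 0) (n := 0) (inH_mem_degreePart D a)
        (inH_mem_degreePart D b)
  · intro i n a _ ha
    rw [Bialgebra.comul_mul, add_comm]
    refine tensorDegree_mul_mem (fun m n a ha b hb => degreePart_mul_mem D ha hb) ?_ ha
    rw [comul_x]
    exact add_mem (tmul_mem_tensorDegree (m := 1) (n := 0) (x_mem_degreePart D i) (one_mem_degreePart D))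
      (tmul_mem_tensorDegree (m := 0) (n := 1) (inH_mem_degreePart D _) (x_mem_degreePart D i))
  · simp
  · intro n a b ha hb; rw [map_add]; exact add_mem ha hb
  · intro n c a ha; rw [map_smul]; exact Submodule.smul_mem _ _ ha

lemma antipode_mem_degreePart (D : PrincipalRealization k H θ) {n : ℕ} {a : Bosonization D}
    (ha : a ∈ degreePart D n) : antipode k a ∈ degreePart D n := by
  refine degreePart_induction D (p := fun n a => antipode k a ∈ degreePart D n)
    ?_ ?_ ?_ ?_ ?_ ha
  · intro h
    have : antipode k (inH D h) = inH D (antipode k h) := unop_inH D h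
    rw [this]; exact inH_mem_degreePart D _
  · intro i n a _ ha
    have e : antipode k (x D i) = -(inH D (antipode k (D.g i)) * x D i) := unop_x D i
    rw [HopfAlgebra.antipode_mul_antidistrib, e]
    refine degreePart_mul_mem D ha (neg_mem ?_)
    rw [← zero_add 1]
    exact degreePart_mul_mem D (inH_mem_degreePart D _) (x_mem_degreePart D i)
  · simp
  · intro n a b ha hb; rw [map_add]; exact add_mem ha hb
  · intro n c a ha; rw [map_smul]; exact Submodule.smul_mem _ _ ha

end tensorDegree
end

section
section conv
variable {k : Type*} [Field k]
  {C : Type*} [AddCommGroup C] [Module k C] [Coalgebra k C]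
  {C' : Type*} [AddCommGroup C'] [Module k C'] [Coalgebra k C']
  {B : Type*} [Ring B] [Algebra k B] {B' : Type*} [Ring B'] [Algebra k B']

/-- Composition with an algebra map, as a ring homomorphism of convolution algebras. -/
def convPost (F : B →ₐ[k] B') : WithConv (C →ₗ[k] B) →+* WithConv (C →ₗ[k] B') where
  toFun f := toConv (F.toLinearMap ∘ₗ f.ofConv)
  map_one' := by ext c; simp
  map_mul' f g := by
    ext c
    exact congr($(LinearMap.algHom_comp_convMul_distrib F f g) c)
  map_zero' := by ext c; simp
  map_add' f g := by ext c; simp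

/-- Composition with a coalgebra map, as a ring homomorphism of convolution algebras. -/
def convPre (φ : C' →ₗc[k] C) : WithConv (C →ₗ[k] B) →+* WithConv (C' →ₗ[k] B) where
  toFun f := toConv (f.ofConv ∘ₗ φ.toLinearMap)
  map_one' := by ext c; simp
  map_mul' f g := by
    ext c
    exact congr($(LinearMap.convMul_comp_coalgHom_distrib f g φ) c)
  map_zero' := by ext c; simp
  map_add' f g := by ext c; simp

@[simp] lemma convPost_apply (F : B →ₐ[k] B') (f : WithConv (C →ₗ[k] B)) (c : C) :
    (convPost F f).ofConv c = F (f.ofConv c) := rfl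

@[simp] lemma convPre_apply (φ : C' →ₗc[k] C) (f : WithConv (C →ₗ[k] B)) (c : C') :
    (convPre φ f).ofConv c = f.ofConv (φ c) := rfl

lemma convMul_eq (f g : WithConv (C →ₗ[k] B)) (c : C) :
    (f * g).ofConv c = LinearMap.mul' k B (TensorProduct.map f.ofConv g.ofConv (comul c)) := rfl

/-- `f(c₁) ⊗ g(c₂)` as a convolution product. -/
lemma inl_mul_inr (f : WithConv (C →ₗ[k] B)) (g : WithConv (C →ₗ[k] B')) (c : C) :
    (convPost (Algebra.TensorProduct.includeLeft : B →ₐ[k] B ⊗[k] B') f *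
      convPost (Algebra.TensorProduct.includeRight : B' →ₐ[k] B ⊗[k] B') g).ofConv c =
      TensorProduct.map f.ofConv g.ofConv (comul c) := by
  rw [convMul_eq]
  generalize (comul (R := k) c) = y
  induction y with
  | zero => simp
  | add a b ha hb => simp only [map_add, ha, hb]
  | tmul a b => simp

/-- A linear form, as a map to an algebra. -/
def convScalar (B : Type*) [Ring B] [Algebra k B] :
    WithConv (C →ₗ[k] k) →+* WithConv (C →ₗ[k] B) := convPost (Algebra.ofId k B)

lemma convScalar_apply (s : WithConv (C →ₗ[k] k)) (c : C) :
    (convScalar B s).ofConv c = algebraMap k B (s.ofConv c) := rfl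

lemma convPost_convScalar (F : B →ₐ[k] B') (s : WithConv (C →ₗ[k] k)) :
    convPost F (convScalar B s) = convScalar B' s := by
  ext c; simp [convScalar_apply]

lemma convPre_convScalar (φ : C' →ₗc[k] C) (s : WithConv (C →ₗ[k] k)) :
    convPre φ (convScalar B s) = convScalar B (convPre φ s) := rfl

lemma convScalar_injective [Nontrivial B] :
    Function.Injective (convScalar (k := k) (C := C) B) := by
  intro s t h
  ext c
  exact (algebraMap k B).injective congr(($h).ofConv c)

/-- A linear map commutes with convolution by scalars on the left. -/
lemma comp_convScalar_mul (φ : B →ₗ[k] B') (s : WithConv (C →ₗ[k] k)) (f : WithConv (C →ₗ[k] B)) :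
    toConv (φ ∘ₗ (convScalar B s * f).ofConv) = convScalar B' s * toConv (φ ∘ₗ f.ofConv) := by
  ext c
  simp only [LinearMap.comp_apply, convMul_eq]
  generalize (comul (R := k) c) = y
  induction y with
  | zero => simp
  | add a b ha hb => simp only [map_add, ha, hb]
  | tmul a b => simp [convScalar_apply, ← Algebra.smul_def]

/-- A linear map commutes with convolution by scalars on the right. -/
lemma comp_mul_convScalar (φ : B →ₗ[k] B') (s : WithConv (C →ₗ[k] k)) (f : WithConv (C →ₗ[k] B)) :
    toConv (φ ∘ₗ (f * convScalar B s).ofConv) = toConv (φ ∘ₗ f.ofConv) * convScalar B' s := by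
  ext c
  simp only [LinearMap.comp_apply, convMul_eq]
  generalize (comul (R := k) c) = y
  induction y with
  | zero => simp
  | add a b ha hb => simp only [map_add, ha, hb]
  | tmul a b => simp [convScalar_apply, ← Algebra.commutes, ← Algebra.smul_def]

end conv

section nilpotent
variable {k : Type*} [Field k] {C : Type*} [AddCommGroup C] [Module k C] [Coalgebra k C]
  {B : Type*} [Ring B] [Algebra k B]

/-- An exhaustive coalgebra filtration. -/
structure IsCoalgFiltration (E : ℕ → Submodule k C) : Prop where
  mono : Monotone E
  exhaustive : ∀ c, ∃ n, c ∈ E n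
  comul_mem : ∀ n, ∀ c ∈ E n, comul (R := k) c ∈
    LinearMap.range (TensorProduct.map (E n).subtype (E n).subtype)
  comul_succ : ∀ n, ∀ c ∈ E (n + 1), comul (R := k) c ∈
    LinearMap.range (TensorProduct.map (E n).subtype (LinearMap.id : C →ₗ[k] C)) ⊔
    LinearMap.range (TensorProduct.map (LinearMap.id : C →ₗ[k] C) (E 0).subtype)

variable {E : ℕ → Submodule k C}

lemma IsCoalgFiltration.pow_eq_zero (hE : IsCoalgFiltration E) {f : WithConv (C →ₗ[k] B)}
    (hf : ∀ c ∈ E 0, f.ofConv c = 0) (n : ℕ) : ∀ c ∈ E n, (f ^ (n + 1)).ofConv c = 0 := by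
  induction n with
  | zero => simpa using hf
  | succ n ih =>
    intro c hc
    have h : LinearMap.range (TensorProduct.map (E n).subtype (LinearMap.id : C →ₗ[k] C)) ⊔
        LinearMap.range (TensorProduct.map (LinearMap.id : C →ₗ[k] C) (E 0).subtype) ≤
        LinearMap.ker (LinearMap.mul' k B ∘ₗ
          TensorProduct.map (f ^ (n + 1)).ofConv f.ofConv) := by
      refine sup_le ?_ ?_
      all_goals
        rintro _ ⟨t, rfl⟩
        rw [LinearMap.mem_ker]
        induction t with
        | zero => simp
        | add a b ha hb => rw [map_add, map_add, ha, hb, add_zero]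
        | tmul a b => simp [ih, hf]
    rw [pow_succ, convMul_eq]
    exact h (hE.comul_succ n c hc)

lemma IsCoalgFiltration.mul_apply_congr (hE : IsCoalgFiltration E) {f f' g g' : WithConv (C →ₗ[k] B)}
    {n : ℕ} (hf : ∀ c ∈ E n, f.ofConv c = f'.ofConv c) (hg : ∀ c ∈ E n, g.ofConv c = g'.ofConv c)
    {c : C} (hc : c ∈ E n) : (f * g).ofConv c = (f' * g').ofConv c := by
  obtain ⟨t, ht⟩ := hE.comul_mem n c hc
  rw [convMul_eq, convMul_eq, ← ht]
  clear ht
  induction t with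
  | zero => simp
  | add a b ha hb => simp only [map_add, ha, hb]
  | tmul a b => simp [hf, hg]

/-- A linear map which agrees with the unit of convolution on the first step of an exhaustive
coalgebra filtration is convolution invertible. -/
lemma IsCoalgFiltration.isUnit_one_sub (hE : IsCoalgFiltration E) {f : WithConv (C →ₗ[k] B)}
    (hf : ∀ c ∈ E 0, f.ofConv c = 0) : IsUnit (1 - f) := by
  have hz : ∀ n i, n < i → ∀ c ∈ E n, (f ^ i).ofConv c = 0 := by
    intro n i hi c hc
    have := hE.pow_eq_zero hf (i - 1) c (hE.mono (by omega) hc)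
    rwa [Nat.sub_add_cancel (by omega)] at this
  have hfin : ∀ c, (Function.support fun i => (f ^ i).ofConv c).Finite := by
    intro c
    obtain ⟨n, hn⟩ := hE.exhaustive c
    refine (Set.finite_Iic n).subset fun i hi => ?_
    by_contra h
    exact hi (hz n i (by simpa using h) c hn)
  let u : WithConv (C →ₗ[k] B) := toConv
    { toFun := fun c => ∑ᶠ i, (f ^ i).ofConv c
      map_add' := fun c d => by
        rw [← finsum_add_distrib (hfin c) (hfin d)]; simp
      map_smul' := fun a c => by
        rw [RingHom.id_apply, smul_finsum' a (hfin c)]; simp }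
  have hu : ∀ n, ∀ c ∈ E n, u.ofConv c = (∑ i ∈ Finset.range (n + 1), f ^ i).ofConv c := by
    intro n c hc
    change ∑ᶠ i, (f ^ i).ofConv c = _
    rw [finsum_eq_sum_of_support_subset (s := Finset.range (n + 1))]
    · simp [LinearMap.sum_apply]
    · intro i hi
      by_contra h
      exact hi (hz n i (by simpa using h) c hc)
  have h1 : (1 - f) * u = 1 := by
    ext c
    obtain ⟨n, hn⟩ := hE.exhaustive c
    rw [hE.mul_apply_congr (fun _ _ => rfl) (hu n) hn, mul_neg_geom_sum]
    simp [hE.pow_eq_zero hf n c hn]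
  have h2 : u * (1 - f) = 1 := by
    ext c
    obtain ⟨n, hn⟩ := hE.exhaustive c
    rw [hE.mul_apply_congr (hu n) (fun _ _ => rfl) hn, geom_sum_mul_neg]
    simp [hE.pow_eq_zero hf n c hn]
  exact ⟨⟨1 - f, u, h1, h2⟩, rfl⟩

/-- A linear map whose restriction to the first step of an exhaustive coalgebra filtration is
inverse to that of another one is convolution invertible. -/
lemma IsCoalgFiltration.isUnit_of_mul (hE : IsCoalgFiltration E) {f g : WithConv (C →ₗ[k] B)}
    (h1 : ∀ c ∈ E 0, (f * g).ofConv c = algebraMap k B (counit c))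
    (h2 : ∀ c ∈ E 0, (g * f).ofConv c = algebraMap k B (counit c)) : IsUnit f := by
  have e1 := hE.isUnit_one_sub (f := 1 - f * g) (by intro c hc; simp [h1 c hc])
  have e2 := hE.isUnit_one_sub (f := 1 - g * f) (by intro c hc; simp [h2 c hc])
  rw [sub_sub_cancel] at e1 e2
  obtain ⟨u, hu⟩ := e1
  obtain ⟨v, hv⟩ := e2
  refine isUnit_iff_exists_and_exists.2 ⟨⟨g * ↑u⁻¹, ?_⟩, ⟨↑v⁻¹ * g, ?_⟩⟩
  · rw [← mul_assoc, ← hu, Units.mul_inv]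
  · rw [mul_assoc, ← hv, Units.inv_mul]

end nilpotent
end

section
section cleft
variable {k : Type*} [Field k] {K : Type*} [Ring K] [HopfAlgebra k K]
  {A : Type*} [Ring A] [Algebra k A]

open Algebra.TensorProduct (includeLeft includeRight)

/-- A bijective, unital, convolution-invertible colinear map `K → A`. -/
structure CleftSection (ρ : A →ₐ[k] A ⊗[k] K) where
  γ : K ≃ₗ[k] A
  colinear : ∀ h, ρ (γ h) = TensorProduct.map γ.toLinearMap LinearMap.id (comul (R := k) h)
  map_one : γ 1 = 1
  inv : WithConv (K →ₗ[k] A)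
  mul_inv : toConv γ.toLinearMap * inv = 1
  inv_mul : inv * toConv γ.toLinearMap = 1

namespace CleftSection
variable {ρ : A →ₐ[k] A ⊗[k] K} (S : CleftSection ρ)

/-- The section as an element of the convolution algebra. -/
def c : WithConv (K →ₗ[k] A) := toConv S.γ.toLinearMap

@[simp] lemma c_apply (h : K) : S.c.ofConv h = S.γ h := rfl

lemma c_mul_inv : S.c * S.inv = 1 := S.mul_inv
lemma inv_mul_c : S.inv * S.c = 1 := S.inv_mul

lemma convPost_c : convPost ρ S.c = convPost includeLeft S.c * convPost includeRight (toConv LinearMap.id) := by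
  ext h
  rw [inl_mul_inr]
  exact S.colinear h

lemma convPost_inv : convPost ρ S.inv =
    convPost includeRight (toConv (antipode k)) * convPost includeLeft S.inv := by
  have h1 : convPost ρ S.c * convPost ρ S.inv = 1 := by rw [← map_mul, c_mul_inv, _root_.map_one]
  have h2 : convPost includeRight (toConv (antipode k (A := K))) * convPost includeLeft S.inv *
      convPost ρ S.c = (1 : WithConv (K →ₗ[k] A ⊗[k] K)) := by
    rw [convPost_c, mul_assoc, ← mul_assoc (convPost includeLeft S.inv), ← map_mul (convPost includeLeft), inv_mul_c,
      _root_.map_one, one_mul, ← map_mul, LinearMap.antipode_mul_id, _root_.map_one]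
  exact (left_inv_eq_right_inv h2 h1).symm

lemma isCleftObject (S : CleftSection ρ) [Nontrivial A] (hρ : IsComoduleAlgebra ρ) : IsCleftObject ρ where
  comoduleAlgebra := hρ
  algebraMap_injective := (algebraMap k A).injective
  coinvariants a ha := by
    obtain ⟨h, rfl⟩ := S.γ.surjective a
    rw [S.colinear] at ha
    have e : ∀ y : K ⊗[k] K, TensorProduct.map S.γ.symm.toLinearMap LinearMap.id
        (TensorProduct.map S.γ.toLinearMap LinearMap.id y) = y := by
      intro y
      induction y with
      | zero => simp
      | add a b ha hb => simp only [map_add, ha, hb]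
      | tmul a b => simp
    have h2 := e (comul h)
    rw [ha] at h2
    have h3 := congr(TensorProduct.lid k K ((counit (R := k) (A := K)).rTensor K $h2))
    rw [rTensor_counit_comul] at h3
    simp at h3
    refine ⟨counit h, ?_⟩
    rw [← h3, map_smul, S.map_one, Algebra.algebraMap_eq_smul_one]
    simp
  exists_section := ⟨S.γ.toLinearMap, S.colinear, ⟨⟨_, _, S.mul_inv, S.inv_mul⟩, rfl⟩⟩

/-- The translation map. -/
def τ : K →ₗ[k] A ⊗[k] A :=
  (convPost includeLeft S.inv * convPost includeRight S.c).ofConv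

lemma τ_eq (h : K) : S.τ h = TensorProduct.map S.inv.ofConv S.c.ofConv (comul h) := inl_mul_inr _ _ h

lemma galoisMap_mul (a : A) (z : A ⊗[k] A) :
    galoisMap ρ ((a ⊗ₜ 1) * z) = (a ⊗ₜ 1) * galoisMap ρ z := by
  induction z with
  | zero => simp
  | add x y hx hy => simp only [mul_add, map_add, hx, hy]
  | tmul x y => rw [Algebra.TensorProduct.tmul_mul_tmul, one_mul, galoisMap_tmul, galoisMap_tmul,
      ← mul_assoc, Algebra.TensorProduct.tmul_mul_tmul, one_mul]

lemma galoisMap_τ (h : K) : galoisMap ρ (S.τ h) = 1 ⊗ₜ h := by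
  have e : toConv (galoisMap ρ ∘ₗ S.τ) = convPost includeRight (toConv LinearMap.id) := by
    have : toConv (galoisMap ρ ∘ₗ S.τ) = convPost includeLeft S.inv * convPost ρ S.c := by
      ext h
      rw [convMul_eq]
      change galoisMap ρ (S.τ h) = _
      rw [τ_eq]
      generalize (comul (R := k) h) = y
      induction y with
      | zero => simp
      | add x y hx hy => simp only [map_add, hx, hy]
      | tmul x y => simp [galoisMap_tmul]
    rw [this, convPost_c, ← mul_assoc, ← map_mul, inv_mul_c, _root_.map_one, one_mul]
  simpa using congr(($e).ofConv h)

/-- The inverse of the Galois map. -/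
def galoisInv : A ⊗[k] K →ₗ[k] A ⊗[k] A :=
  LinearMap.mul' k (A ⊗[k] A) ∘ₗ
    TensorProduct.map (includeLeft : A →ₐ[k] A ⊗[k] A).toLinearMap S.τ

lemma galoisInv_tmul (a : A) (h : K) : S.galoisInv (a ⊗ₜ h) = (a ⊗ₜ 1) * S.τ h := by
  simp [galoisInv]

lemma galoisInv_mul (a : A) (z : A ⊗[k] K) :
    S.galoisInv ((a ⊗ₜ 1) * z) = (a ⊗ₜ 1) * S.galoisInv z := by
  induction z with
  | zero => simp
  | add x y hx hy => simp only [mul_add, map_add, hx, hy]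
  | tmul x y => rw [Algebra.TensorProduct.tmul_mul_tmul, one_mul, galoisInv_tmul, galoisInv_tmul,
      ← mul_assoc, Algebra.TensorProduct.tmul_mul_tmul, one_mul]

lemma galoisInv_ρ_γ (h : K) : S.galoisInv (ρ (S.γ h)) = 1 ⊗ₜ S.γ h := by
  have e : toConv (S.galoisInv ∘ₗ (convPost ρ S.c).ofConv) = convPost includeRight S.c := by
    have : toConv (S.galoisInv ∘ₗ (convPost ρ S.c).ofConv) = convPost includeLeft S.c * toConv S.τ := by
      ext h
      rw [convMul_eq]
      change S.galoisInv (ρ (S.γ h)) = _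
      rw [S.colinear]
      generalize (comul (R := k) h) = y
      induction y with
      | zero => simp
      | add x y hx hy => simp only [map_add, hx, hy]
      | tmul x y => simp [galoisInv_tmul]
    rw [this, τ, toConv_ofConv, ← mul_assoc, ← map_mul, c_mul_inv, _root_.map_one, one_mul]
  exact congr(($e).ofConv h)

lemma galoisMap_bijective (S : CleftSection ρ) : Function.Bijective (galoisMap ρ) := by
  refine Function.bijective_iff_has_inverse.2 ⟨S.galoisInv, fun z => ?_, fun z => ?_⟩
  · induction z with
    | zero => simp
    | add x y hx hy => simp only [map_add, hx, hy]
    | tmul x y =>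
      obtain ⟨h, rfl⟩ := S.γ.surjective y
      rw [galoisMap_tmul, galoisInv_mul, galoisInv_ρ_γ, Algebra.TensorProduct.tmul_mul_tmul, mul_one, one_mul]
  · induction z with
    | zero => simp
    | add x y hx hy => simp only [map_add, hx, hy]
    | tmul x y =>
      rw [galoisInv_tmul, galoisMap_mul, galoisMap_τ, Algebra.TensorProduct.tmul_mul_tmul, mul_one, one_mul]

/-- The linear map `a ↦ op a`. -/
def opL : A →ₗ[k] Aᵐᵒᵖ := (MulOpposite.opLinearEquiv k).toLinearMap

@[simp] lemma opL_apply (a : A) : opL (k := k) a = MulOpposite.op a := rfl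

/-- The inverse of the section as a map to the opposite algebra. -/
def invOp : WithConv (K →ₗ[k] Aᵐᵒᵖ) := toConv (opL ∘ₗ S.inv.ofConv)

@[simp] lemma invOp_apply (h : K) : S.invOp.ofConv h = MulOpposite.op (S.inv.ofConv h) := rfl

/-- `h ↦ γ(h₁) ⊗ γ⁻¹(h₂)`. -/
def j : WithConv (K →ₗ[k] A ⊗[k] Aᵐᵒᵖ) :=
  convPost includeLeft S.c * convPost includeRight S.invOp

lemma j_eq (h : K) : S.j.ofConv h = TensorProduct.map S.c.ofConv S.invOp.ofConv (comul h) :=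
  inl_mul_inr _ _ h

lemma mulOpMap_j (h : K) : mulOpMap (S.j.ofConv h) = algebraMap k A (counit h) := by
  have e := congr(($S.c_mul_inv).ofConv h)
  rw [convMul_eq] at e
  simp only [LinearMap.convOne_apply] at e
  rw [j_eq, ← e]
  generalize (comul (R := k) h) = y
  induction y with
  | zero => simp
  | add x y hx hy => simp only [map_add, hx, hy]
  | tmul x y => simp [mulOpMap]

lemma conv_coaction {B : Type*} [Ring B] [Algebra k B] (i : A →ₐ[k] B) (i' : A →ₗ[k] B) :
    convPost (Algebra.TensorProduct.map i (.id k K)) (convPost ρ S.c) *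
      toConv (TensorProduct.map i' LinearMap.id ∘ₗ (convPost ρ S.inv).ofConv) =
    convPost includeLeft (convPost i S.c * toConv (i' ∘ₗ S.inv.ofConv)) := by
  have e2 : toConv (TensorProduct.map i' LinearMap.id ∘ₗ (convPost ρ S.inv).ofConv) =
      convPost includeRight (toConv (antipode k)) *
        convPost includeLeft (toConv (i' ∘ₗ S.inv.ofConv)) := by
    rw [convPost_inv]
    ext h
    rw [convMul_eq]
    change TensorProduct.map i' LinearMap.id ((convPost includeRight (toConv (antipode k)) *
      convPost (includeLeft : A →ₐ[k] A ⊗[k] K) S.inv).ofConv h) = _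
    rw [convMul_eq]
    generalize (comul (R := k) h) = y
    induction y with
    | zero => simp
    | add x y hx hy => simp only [map_add, hx, hy]
    | tmul x y => simp
  have e3 : convPost (Algebra.TensorProduct.map i (.id k K)) (convPost ρ S.c) =
      convPost includeLeft (convPost i S.c) * convPost includeRight (toConv LinearMap.id) := by
    rw [convPost_c, map_mul]
    congr 1
    ext h; simp
  have e4 : convPost (includeRight : K →ₐ[k] B ⊗[k] K) (toConv LinearMap.id) *
      convPost (includeRight : K →ₐ[k] B ⊗[k] K) (toConv (antipode k)) = 1 := by
    rw [← map_mul, LinearMap.id_mul_antipode, _root_.map_one]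
  rw [e2, e3, map_mul, mul_assoc]
  congr 1
  refine (mul_assoc _ _ _).symm.trans ?_
  rw [e4, one_mul]

lemma codiagonal_tmul (x y : A) : codiagonal ρ (x ⊗ₜ MulOpposite.op y) =
    Algebra.TensorProduct.map (includeLeft : A →ₐ[k] A ⊗[k] Aᵐᵒᵖ) (.id k K) (ρ x) *
    TensorProduct.map ((includeRight : Aᵐᵒᵖ →ₐ[k] A ⊗[k] Aᵐᵒᵖ).toLinearMap ∘ₗ opL)
      LinearMap.id (ρ y) := by
  change (LinearMap.mul' k K).lTensor (A ⊗[k] Aᵐᵒᵖ) (TensorProduct.tensorTensorTensorComm k A K Aᵐᵒᵖ K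
    ((ρ x) ⊗ₜ ((MulOpposite.opLinearEquiv k).toLinearMap.rTensor K (ρ y)))) = _
  generalize ρ x = z
  generalize ρ y = w
  induction z with
  | zero => rw [TensorProduct.zero_tmul, map_zero, map_zero, map_zero, zero_mul]
  | add x y hx hy => simp only [map_add, TensorProduct.add_tmul, hx, hy, add_mul]
  | tmul a b =>
    induction w with
    | zero => rw [map_zero, map_zero, TensorProduct.tmul_zero, map_zero, map_zero, mul_zero]
    | add x y hx hy => simp only [map_add, TensorProduct.tmul_add, hx, hy, mul_add]
    | tmul c d => simp

lemma codiagonal_j (h : K) : codiagonal ρ (S.j.ofConv h) = S.j.ofConv h ⊗ₜ 1 := by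
  have e := congr(($(S.conv_coaction (includeLeft : A →ₐ[k] A ⊗[k] Aᵐᵒᵖ)
    ((includeRight : Aᵐᵒᵖ →ₐ[k] A ⊗[k] Aᵐᵒᵖ).toLinearMap ∘ₗ opL))).ofConv h)
  refine Eq.trans ?_ e
  rw [convMul_eq, j_eq]
  generalize (comul (R := k) h) = y
  induction y with
  | zero => simp
  | add x y hx hy => simp only [map_add, hx, hy]
  | tmul x y =>
    rw [TensorProduct.map_tmul, TensorProduct.map_tmul, LinearMap.mul'_apply, invOp_apply,
      codiagonal_tmul]
    rfl

end CleftSection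
end cleft
end

section
section cleft
variable {k : Type*} [Field k] {K : Type*} [Ring K] [HopfAlgebra k K]
  {A : Type*} [Ring A] [Algebra k A]

open Algebra.TensorProduct (includeLeft includeRight)

namespace CleftSection
variable {ρ : A →ₐ[k] A ⊗[k] K} (S : CleftSection ρ)

/-- `h ↦ h₁ ⊗ γ(h₂)`. -/
def u : WithConv (K →ₗ[k] K ⊗[k] A) :=
  convPost includeLeft (toConv LinearMap.id) * convPost includeRight S.c

lemma u_eq (h : K) : S.u.ofConv h = TensorProduct.map LinearMap.id S.c.ofConv (comul h) :=
  inl_mul_inr _ _ h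

/-- The linear map `γ(h) ⊗ op y ↦ h₁ ⊗ γ(h₂) y`. -/
def U : A ⊗[k] Aᵐᵒᵖ →ₗ[k] K ⊗[k] A :=
  LinearMap.mul' k (K ⊗[k] A) ∘ₗ TensorProduct.map (S.u.ofConv ∘ₗ S.γ.symm.toLinearMap)
    ((includeRight : A →ₐ[k] K ⊗[k] A).toLinearMap ∘ₗ (MulOpposite.opLinearEquiv k).symm.toLinearMap)

lemma U_tmul (h : K) (y : A) :
    S.U (S.γ h ⊗ₜ MulOpposite.op y) = S.u.ofConv h * (1 ⊗ₜ y) := by simp [U]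

lemma U_j (h : K) : S.U (S.j.ofConv h) = h ⊗ₜ 1 := by
  have e : toConv (S.U ∘ₗ S.j.ofConv) = S.u * convPost includeRight S.inv := by
    ext h
    rw [convMul_eq]
    change S.U (S.j.ofConv h) = _
    rw [j_eq]
    generalize (comul (R := k) h) = y
    induction y with
    | zero => simp
    | add x y hx hy => simp only [map_add, hx, hy]
    | tmul x y => simp [U_tmul]
  rw [u, mul_assoc, ← map_mul, c_mul_inv, _root_.map_one, mul_one] at e
  simpa using congr(($e).ofConv h)

lemma j_injective (S : CleftSection ρ) [Nontrivial A] : Function.Injective S.j.ofConv := by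
  intro h h' e
  have := congr(S.U $e)
  rw [U_j, U_j] at this
  exact Algebra.TensorProduct.includeLeft_injective (S := k) (algebraMap k A).injective this

/-- The linear map `h ⊗ a ↦ γ(h₁) ⊗ op (γ⁻¹(h₂) a)`. -/
def V : K ⊗[k] A →ₗ[k] A ⊗[k] Aᵐᵒᵖ :=
  LinearMap.mul' k (A ⊗[k] Aᵐᵒᵖ) ∘ₗ (TensorProduct.comm k _ _).toLinearMap ∘ₗ TensorProduct.map S.j.ofConv
    ((includeRight : Aᵐᵒᵖ →ₐ[k] A ⊗[k] Aᵐᵒᵖ).toLinearMap ∘ₗ opL)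

lemma V_tmul (h : K) (y : A) : S.V (h ⊗ₜ y) = (1 ⊗ₜ MulOpposite.op y) * S.j.ofConv h := by simp [V]

lemma V_mul (z : K ⊗[k] A) (y : A) : S.V (z * (1 ⊗ₜ y)) = (1 ⊗ₜ MulOpposite.op y) * S.V z := by
  induction z with
  | zero => simp
  | add a b ha hb => simp only [map_add, add_mul, mul_add, ha, hb]
  | tmul a b => simp only [Algebra.TensorProduct.tmul_mul_tmul, V_tmul, mul_one, ← mul_assoc,
      MulOpposite.op_mul]

lemma V_u (h : K) : S.V (S.u.ofConv h) = S.γ h ⊗ₜ 1 := by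
  have e1 : ∀ y : K ⊗[k] K, S.V (TensorProduct.map LinearMap.id S.c.ofConv y) =
      TensorProduct.map S.c.ofConv (opL ∘ₗ LinearMap.mul' k A ∘ₗ TensorProduct.map S.inv.ofConv S.c.ofConv)
        (TensorProduct.assoc k K K K (comul.rTensor K y)) := by
    intro y
    induction y with
    | zero => simp
    | add a b ha hb => simp only [map_add, ha, hb]
    | tmul a b =>
      rw [TensorProduct.map_tmul, LinearMap.id_apply, V_tmul, j_eq, LinearMap.rTensor_tmul]
      generalize (comul (R := k) a) = z
      induction z with
      | zero => simp
      | add x y hx hy => simp only [map_add, TensorProduct.add_tmul, mul_add, hx, hy]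
      | tmul x y => simp
  have e2 : LinearMap.mul' k A ∘ₗ TensorProduct.map S.inv.ofConv S.c.ofConv ∘ₗ comul =
      Algebra.linearMap k A ∘ₗ counit := by
    have := congr(($S.inv_mul_c).ofConv)
    exact this
  have e3 : ∀ y : K ⊗[k] K, TensorProduct.map S.c.ofConv (opL ∘ₗ LinearMap.mul' k A ∘ₗ
      TensorProduct.map S.inv.ofConv S.c.ofConv) (comul.lTensor K y) =
      TensorProduct.map S.c.ofConv (opL ∘ₗ Algebra.linearMap k A) (counit.lTensor K y) := by
    intro y
    induction y with
    | zero => simp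
    | add a b ha hb => simp only [map_add, ha, hb]
    | tmul a b =>
      have := congr($e2 b)
      simp only [LinearMap.comp_apply] at this
      simp [this]
  rw [u_eq, e1, coassoc_apply, e3, lTensor_counit_comul]
  simp

lemma V_U (z : A ⊗[k] Aᵐᵒᵖ) : S.V (S.U z) = z := by
  induction z with
  | zero => simp
  | add a b ha hb => simp only [map_add, ha, hb]
  | tmul x y =>
    obtain ⟨h, rfl⟩ := S.γ.surjective x
    obtain ⟨y, rfl⟩ := MulOpposite.op_surjective y
    rw [U_tmul, V_mul, V_u]
    simp

lemma coaction_U (z : A ⊗[k] Aᵐᵒᵖ) : Algebra.TensorProduct.map (.id k K) ρ (S.U z) =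
    TensorProduct.assoc k K A K (TensorProduct.map S.U LinearMap.id (codiagonal ρ z)) := by
  induction z with
  | zero => simp
  | add a b ha hb => simp only [map_add, ha, hb]
  | tmul x y =>
    obtain ⟨h, rfl⟩ := S.γ.surjective x
    obtain ⟨y, rfl⟩ := MulOpposite.op_surjective y
    have e1 : convPost (Algebra.TensorProduct.map (.id k K) ρ) S.u =
        toConv ((TensorProduct.assoc k K A K).toLinearMap ∘ₗ
          TensorProduct.map S.u.ofConv LinearMap.id ∘ₗ comul) := by
      have h1 : convPost (Algebra.TensorProduct.map (.id k K) ρ) S.u =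
          convPost includeLeft (toConv LinearMap.id) * convPost includeRight (convPost includeLeft S.c) *
            convPost includeRight (convPost includeRight (toConv LinearMap.id)) := by
        have h3 : convPost (Algebra.TensorProduct.map (.id k K) ρ) (convPost includeRight S.c) =
            convPost (includeRight : A ⊗[k] K →ₐ[k] K ⊗[k] (A ⊗[k] K)) (convPost ρ S.c) := by
          ext h; simp
        rw [u, map_mul, h3, convPost_c, map_mul, mul_assoc]
        congr 1
        ext h; simp [Algebra.TensorProduct.one_def]
      have h2 : convPost includeLeft (toConv LinearMap.id) * convPost includeRight (convPost includeLeft S.c) =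
          convPost (Algebra.TensorProduct.assoc k k k K A K).toAlgHom (convPost includeLeft S.u) := by
        rw [u, map_mul, map_mul]
        congr 1
      rw [h1, h2]
      ext h
      rw [convMul_eq]
      simp only [LinearMap.comp_apply]
      generalize (comul (R := k) h) = y
      induction y with
      | zero => simp
      | add x y hx hy => simp only [map_add, hx, hy]
      | tmul x y =>
        simp only [TensorProduct.map_tmul, LinearMap.mul'_apply, convPost_apply, LinearMap.id_apply]
        generalize S.u.ofConv x = w
        induction w with
        | zero => simp
        | add x y hx hy => simp only [map_add, TensorProduct.add_tmul, Algebra.TensorProduct.includeLeft_apply, add_mul] at *; rw [hx, hy]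
        | tmul x y => simp
    have e2 := congr(($e1).ofConv h)
    simp only [convPost_apply, LinearMap.comp_apply] at e2
    rw [U_tmul, map_mul, e2, codiagonal_tmul, S.colinear, Algebra.TensorProduct.map_tmul]
    generalize (comul (R := k) h) = v
    simp only [AlgHom.id_apply]
    generalize ρ y = w
    induction v with
    | zero => simp
    | add a b ha hb => simp only [map_add, add_mul, ha, hb]
    | tmul a b =>
      induction w with
      | zero => simp
      | add a b ha hb => simp only [map_add, TensorProduct.tmul_add, mul_add, ha, hb]
      | tmul c d =>
        simp only [TensorProduct.map_tmul, LinearMap.id_apply, LinearEquiv.coe_coe,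
          Algebra.TensorProduct.map_tmul, AlgHom.id_apply, LinearMap.comp_apply, opL_apply,
          AlgHom.toLinearMap_apply, Algebra.TensorProduct.includeLeft_apply,
          Algebra.TensorProduct.includeRight_apply, Algebra.TensorProduct.tmul_mul_tmul, mul_one,
          one_mul, U_tmul]
        generalize S.u.ofConv a = t
        induction t with
        | zero => simp
        | add x y hx hy => simp only [map_add, TensorProduct.add_tmul, add_mul, hx, hy]
        | tmul x y => simp

lemma eq_tmul_one_of_coinvariant (S : CleftSection ρ) {w : K ⊗[k] A}
    (hw : Algebra.TensorProduct.map (.id k K) ρ w = TensorProduct.assoc k K A K (w ⊗ₜ 1)) :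
    ∃ h : K, w = h ⊗ₜ 1 := by
  let f : A →ₗ[k] k := counit ∘ₗ S.γ.symm.toLinearMap
  have e : ∀ w : K ⊗[k] A, TensorProduct.map LinearMap.id
      (S.γ.toLinearMap ∘ₗ (TensorProduct.lid k K).toLinearMap ∘ₗ TensorProduct.map f LinearMap.id)
      (Algebra.TensorProduct.map (.id k K) ρ w) = w := by
    intro w
    induction w with
    | zero => simp
    | add a b ha hb => simp only [map_add, ha, hb]
    | tmul a y =>
      obtain ⟨h, rfl⟩ := S.γ.surjective y
      have : TensorProduct.map f LinearMap.id (ρ (S.γ h)) = 1 ⊗ₜ h := by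
        rw [S.colinear, ← rTensor_counit_comul]
        generalize (comul (R := k) h) = y
        induction y with
        | zero => simp
        | add x y hx hy => simp only [map_add, hx, hy]
        | tmul x y => simp [f]
      simp [this]
  have h2 := e w
  rw [hw] at h2
  refine ⟨TensorProduct.rid k K (TensorProduct.map LinearMap.id f w), h2.symm.trans ?_⟩
  clear h2 hw
  have hs : S.γ.symm 1 = 1 := S.γ.symm_apply_eq.2 S.map_one.symm
  induction w with
  | zero => simp
  | add a b ha hb => simp only [map_add, TensorProduct.add_tmul, ha, hb]
  | tmul a y => simp [f, S.map_one, TensorProduct.smul_tmul']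

lemma mem_range_j_iff (z : A ⊗[k] Aᵐᵒᵖ) :
    z ∈ Set.range S.j.ofConv ↔ codiagonal ρ z = z ⊗ₜ 1 := by
  constructor
  · rintro ⟨h, rfl⟩; exact S.codiagonal_j h
  · intro hz
    obtain ⟨h, hh⟩ := S.eq_tmul_one_of_coinvariant (w := S.U z) (by rw [coaction_U, hz]; simp)
    refine ⟨h, ?_⟩
    rw [← S.V_U z, hh, V_tmul]
    simp [← Algebra.TensorProduct.one_def]

lemma regroup_τ (h : K) : regroup (S.τ.lTensor A (ρ (S.γ h))) =
    TensorProduct.map S.j.ofConv S.c.ofConv (comul h) := by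
  have e1 : ∀ y : K ⊗[k] K, regroup (S.τ.lTensor A (TensorProduct.map S.γ.toLinearMap LinearMap.id y)) =
      TensorProduct.map (TensorProduct.map S.c.ofConv S.invOp.ofConv) S.c.ofConv
        ((TensorProduct.assoc k K K K).symm (comul.lTensor K y)) := by
    intro y
    induction y with
    | zero => simp
    | add a b ha hb => simp only [map_add, ha, hb]
    | tmul a b =>
      simp only [TensorProduct.map_tmul, LinearMap.lTensor_tmul, τ_eq, LinearMap.id_apply]
      generalize (comul (R := k) b) = z
      induction z with
      | zero => simp
      | add x y hx hy => simp only [map_add, TensorProduct.tmul_add, hx, hy]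
      | tmul x y => simp [regroup]
  have e2 : ∀ y : K ⊗[k] K, TensorProduct.map (TensorProduct.map S.c.ofConv S.invOp.ofConv) S.c.ofConv
      (comul.rTensor K y) = TensorProduct.map S.j.ofConv S.c.ofConv y := by
    intro y
    induction y with
    | zero => simp
    | add a b ha hb => simp only [map_add, ha, hb]
    | tmul a b => simp [j_eq]
  rw [S.colinear, e1, coassoc_symm_apply, e2]

lemma translationComul_j (h : K) : translationComul ρ S.τ (S.j.ofConv h) =
    TensorProduct.map S.j.ofConv S.j.ofConv (comul h) := by
  have e1 : ∀ y : K ⊗[k] K, translationComul ρ S.τ (TensorProduct.map S.c.ofConv S.invOp.ofConv y) =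
      TensorProduct.map S.j.ofConv (TensorProduct.map S.c.ofConv S.invOp.ofConv)
        (TensorProduct.assoc k K K K (comul.rTensor K y)) := by
    intro y
    induction y with
    | zero => simp
    | add a b ha hb => simp only [map_add, ha, hb]
    | tmul a b =>
      have := S.regroup_τ a
      simp only [translationComul, TensorProduct.map_tmul, LinearMap.comp_apply, LinearMap.rTensor_tmul,
        c_apply, AlgHom.toLinearMap_apply, this]
      generalize (comul (R := k) a) = z
      induction z with
      | zero => simp
      | add x y hx hy => simp only [map_add, TensorProduct.add_tmul, hx, hy]
      | tmul x y => simp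
  have e2 : ∀ y : K ⊗[k] K, TensorProduct.map S.j.ofConv (TensorProduct.map S.c.ofConv S.invOp.ofConv)
      (comul.lTensor K y) = TensorProduct.map S.j.ofConv S.j.ofConv y := by
    intro y
    induction y with
    | zero => simp
    | add a b ha hb => simp only [map_add, ha, hb]
    | tmul a b => simp [j_eq]
  rw [j_eq, e1, coassoc_apply, e2]

end CleftSection
end cleft
end

section
section coalgebra
variable (k : Type*) [Field k] (C : Type*) [AddCommGroup C] [Module k C] [Coalgebra k C]
  (C' : Type*) [AddCommGroup C'] [Module k C'] [Coalgebra k C']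

/-- The projection `c ⊗ d ↦ ε(d) c`. -/
def coalgFst : C ⊗[k] C' →ₗc[k] C :=
  (Coalgebra.TensorProduct.rid k k C).toCoalgHom.comp
    (Coalgebra.TensorProduct.map (CoalgHom.id k C) (Coalgebra.counitCoalgHom k C'))

/-- The projection `c ⊗ d ↦ ε(c) d`. -/
def coalgSnd : C ⊗[k] C' →ₗc[k] C' :=
  (Coalgebra.TensorProduct.lid k C').toCoalgHom.comp
    (Coalgebra.TensorProduct.map (Coalgebra.counitCoalgHom k C) (CoalgHom.id k C'))

variable {k C C'}

@[simp] lemma coalgFst_tmul (c : C) (d : C') : coalgFst k C C' (c ⊗ₜ d) = counit (R := k) d • c := by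
  simp [coalgFst]

@[simp] lemma coalgSnd_tmul (c : C) (d : C') : coalgSnd k C C' (c ⊗ₜ d) = counit (R := k) c • d := by
  simp [coalgSnd]

variable {B : Type*} [Ring B] [Algebra k B]

lemma conv_fst_snd (f : WithConv (C →ₗ[k] B)) (g : WithConv (C' →ₗ[k] B)) (c : C) (d : C') :
    (convPre (coalgFst k C C') f * convPre (coalgSnd k C C') g).ofConv (c ⊗ₜ d) =
      f.ofConv c * g.ofConv d := by
  have e : ∀ (y : C ⊗[k] C) (z : C' ⊗[k] C'), LinearMap.mul' k B
      (TensorProduct.map (convPre (coalgFst k C C') f).ofConv (convPre (coalgSnd k C C') g).ofConv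
        (TensorProduct.AlgebraTensorModule.tensorTensorTensorComm k k k k C C C' C' (y ⊗ₜ z))) =
      f.ofConv (TensorProduct.rid k C (counit.lTensor C y)) *
        g.ofConv (TensorProduct.lid k C' (counit.rTensor C' z)) := by
    intro y z
    induction y with
    | zero => simp
    | add a b ha hb => simp only [TensorProduct.add_tmul, map_add, ha, hb, add_mul]
    | tmul a b =>
      induction z with
      | zero => simp
      | add a b ha hb => simp only [TensorProduct.tmul_add, map_add, ha, hb, mul_add]
      | tmul a b => simp; rw [smul_comm]
  rw [convMul_eq, TensorProduct.comul_tmul, e]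
  simp

lemma conv_snd_fst (f : WithConv (C →ₗ[k] B)) (g : WithConv (C' →ₗ[k] B)) (c : C) (d : C') :
    (convPre (coalgSnd k C C') g * convPre (coalgFst k C C') f).ofConv (c ⊗ₜ d) =
      g.ofConv d * f.ofConv c := by
  have e : ∀ (y : C ⊗[k] C) (z : C' ⊗[k] C'), LinearMap.mul' k B
      (TensorProduct.map (convPre (coalgSnd k C C') g).ofConv (convPre (coalgFst k C C') f).ofConv
        (TensorProduct.AlgebraTensorModule.tensorTensorTensorComm k k k k C C C' C' (y ⊗ₜ z))) =
      g.ofConv (TensorProduct.rid k C' (counit.lTensor C' z)) *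
      f.ofConv (TensorProduct.lid k C (counit.rTensor C y)) := by
    intro y z
    induction y with
    | zero => simp
    | add a b ha hb => simp only [TensorProduct.add_tmul, map_add, ha, hb, mul_add]
    | tmul a b =>
      induction z with
      | zero => simp
      | add a b ha hb => simp only [TensorProduct.tmul_add, map_add, ha, hb, add_mul]
      | tmul a b => simp [smul_smul, mul_comm]
  rw [convMul_eq, TensorProduct.comul_tmul, e]
  simp

lemma conv_fst_snd_comm {f : WithConv (C →ₗ[k] B)} {g : WithConv (C' →ₗ[k] B)}
    (h : ∀ c d, f.ofConv c * g.ofConv d = g.ofConv d * f.ofConv c) :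
    convPre (coalgFst k C C') f * convPre (coalgSnd k C C') g =
      convPre (coalgSnd k C C') g * convPre (coalgFst k C C') f := by
  refine WithConv.ext (TensorProduct.ext' fun c d => ?_)
  rw [conv_fst_snd, conv_snd_fst, h]

end coalgebra

section coalgebra
variable {k : Type*} [Field k] {K : Type*} [AddCommGroup K] [Module k K] [Coalgebra k K]
  {C : Type*} [AddCommGroup C] [Module k C] [Coalgebra k C]

lemma coalgHom_ext₃ {φ ψ : (K ⊗[k] K) ⊗[k] K →ₗc[k] C}
    (h : ∀ x y z, φ (x ⊗ₜ y ⊗ₜ z) = ψ (x ⊗ₜ y ⊗ₜ z)) : φ = ψ := by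
  have : φ.toLinearMap = ψ.toLinearMap := TensorProduct.ext_threefold h
  exact CoalgHom.ext fun x => congr($this x)

end coalgebra

section bialgebra
variable (k : Type*) [Field k] (K : Type*) [Ring K] [HopfAlgebra k K]

/-- The coalgebra map `x ↦ x ⊗ 1`. -/
def coalgInl : K →ₗc[k] K ⊗[k] K where
  toLinearMap := (Algebra.TensorProduct.includeLeft : K →ₐ[k] K ⊗[k] K).toLinearMap
  counit_comp := by ext x; simp
  map_comp_comul := by
    ext x
    simp only [LinearMap.comp_apply, AlgHom.toLinearMap_apply, Algebra.TensorProduct.includeLeft_apply,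
      TensorProduct.comul_tmul, Bialgebra.comul_one]
    generalize (comul (R := k) x) = y
    induction y with
    | zero => simp
    | add x y hx hy => simp only [map_add, TensorProduct.add_tmul, hx, hy]
    | tmul x y => simp [Algebra.TensorProduct.one_def]

/-- The coalgebra map `x ↦ 1 ⊗ x`. -/
def coalgInr : K →ₗc[k] K ⊗[k] K where
  toLinearMap := (Algebra.TensorProduct.includeRight : K →ₐ[k] K ⊗[k] K).toLinearMap
  counit_comp := by ext x; simp
  map_comp_comul := by
    ext x
    simp only [LinearMap.comp_apply, AlgHom.toLinearMap_apply, Algebra.TensorProduct.includeRight_apply,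
      TensorProduct.comul_tmul, Bialgebra.comul_one]
    generalize (comul (R := k) x) = y
    induction y with
    | zero => simp
    | add x y hx hy => simp only [map_add, TensorProduct.tmul_add, hx, hy]
    | tmul x y => simp [Algebra.TensorProduct.one_def]

variable {k K}

@[simp] lemma coalgInl_apply (x : K) : coalgInl k K x = x ⊗ₜ 1 := rfl
@[simp] lemma coalgInr_apply (x : K) : coalgInr k K x = 1 ⊗ₜ x := rfl

end bialgebra

section monoid
variable {M : Type*} [Monoid M]

lemma inv_unique_of_mul_eq {a b a' b' r r' : M} (h : b = a * r) (hb : b' * b = 1) (ha : a * a' = 1)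
    (hr : r * r' = 1) : b' = r' * a' := by
  have : b * (r' * a') = 1 := by rw [h, mul_assoc, ← mul_assoc r, hr, one_mul, ha]
  exact left_inv_eq_right_inv hb this
end monoid

section cleft
variable {k : Type*} [Field k] {K : Type*} [Ring K] [HopfAlgebra k K]
  {A : Type*} [Ring A] [Algebra k A]

open Algebra.TensorProduct (includeLeft includeRight)

namespace CleftSection
variable {ρ : A →ₐ[k] A ⊗[k] K} (S : CleftSection ρ)

variable {C : Type*} [AddCommGroup C] [Module k C] [Coalgebra k C]

lemma pre_c_mul_inv (φ : C →ₗc[k] K) : convPre φ S.c * convPre φ S.inv = 1 := by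
  rw [← map_mul, c_mul_inv, _root_.map_one]

lemma pre_inv_mul_c (φ : C →ₗc[k] K) : convPre φ S.inv * convPre φ S.c = 1 := by
  rw [← map_mul, inv_mul_c, _root_.map_one]

/-- `x ⊗ y ↦ γ(x₁) γ(y₁) γ⁻¹(x₂ y₂)`. -/
def sigmaA : WithConv (K ⊗[k] K →ₗ[k] A) :=
  convPre (coalgFst k K K) S.c * convPre (coalgSnd k K K) S.c *
    convPre (Bialgebra.mulCoalgHom k K) S.inv

/-- `x ⊗ y ↦ γ(x₁ y₁) γ⁻¹(y₂) γ⁻¹(x₂)`. -/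
def tauA : WithConv (K ⊗[k] K →ₗ[k] A) :=
  convPre (Bialgebra.mulCoalgHom k K) S.c *
    (convPre (coalgSnd k K K) S.inv * convPre (coalgFst k K K) S.inv)

lemma sigmaA_mul_tauA : S.sigmaA * S.tauA = 1 := by
  rw [sigmaA, tauA, mul_assoc, ← mul_assoc (convPre (Bialgebra.mulCoalgHom k K) S.inv), pre_inv_mul_c,
    one_mul, mul_assoc, ← mul_assoc (convPre (coalgSnd k K K) S.c), pre_c_mul_inv, one_mul,
    pre_c_mul_inv]

lemma tauA_mul_sigmaA : S.tauA * S.sigmaA = 1 := by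
  rw [sigmaA, tauA, mul_assoc, mul_assoc, mul_assoc, ← mul_assoc (convPre (coalgFst k K K) S.inv),
    pre_inv_mul_c, one_mul, ← mul_assoc (convPre (coalgSnd k K K) S.inv), pre_inv_mul_c, one_mul,
    pre_c_mul_inv]

lemma inv_one : S.inv.ofConv 1 = 1 := by
  have := congr(($S.c_mul_inv).ofConv 1)
  rw [convMul_eq] at this
  simpa [Algebra.TensorProduct.one_def, S.map_one] using this

lemma j_one : S.j.ofConv 1 = 1 := by
  rw [j_eq]
  simp [Algebra.TensorProduct.one_def, S.map_one, S.inv_one]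

lemma inclL_sigmaA : convPre (coalgInl k K) S.sigmaA = 1 := by
  have h1 : convPre (coalgInl k K) (convPre (coalgFst k K K) S.c) = S.c := by ext x; simp
  have h2 : convPre (coalgInl k K) (convPre (coalgSnd k K K) S.c) = 1 := by
    ext x; simp [S.map_one, Algebra.algebraMap_eq_smul_one]
  have h3 : convPre (coalgInl k K) (convPre (Bialgebra.mulCoalgHom k K) S.inv) = S.inv := by ext x; simp
  rw [sigmaA, map_mul, map_mul, h1, h2, h3, mul_one, c_mul_inv]

lemma inclR_sigmaA : convPre (coalgInr k K) S.sigmaA = 1 := by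
  have h1 : convPre (coalgInr k K) (convPre (coalgFst k K K) S.c) = 1 := by
    ext x; simp [S.map_one, Algebra.algebraMap_eq_smul_one]
  have h2 : convPre (coalgInr k K) (convPre (coalgSnd k K K) S.c) = S.c := by ext x; simp
  have h3 : convPre (coalgInr k K) (convPre (Bialgebra.mulCoalgHom k K) S.inv) = S.inv := by ext x; simp
  rw [sigmaA, map_mul, map_mul, h1, h2, h3, one_mul, c_mul_inv]

lemma convPost_pre_c (φ : C →ₗc[k] K) : convPost ρ (convPre φ S.c) =
    convPost includeLeft (convPre φ S.c) *
      convPre φ (convPost includeRight (toConv LinearMap.id)) := by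
  change convPre φ (convPost ρ S.c) = _
  rw [convPost_c, map_mul]; rfl

lemma mulCoalgHom_eq {B : Type*} [Ring B] [Algebra k B] (F : K →ₐ[k] B) :
    convPre (Bialgebra.mulCoalgHom k K) (convPost F (toConv LinearMap.id)) =
      convPre (coalgFst k K K) (convPost F (toConv LinearMap.id)) *
        convPre (coalgSnd k K K) (convPost F (toConv LinearMap.id)) := by
  refine WithConv.ext (TensorProduct.ext' fun c d => ?_)
  rw [conv_fst_snd]; simp

lemma convPost_sigmaA : convPost ρ S.sigmaA = convPost includeLeft S.sigmaA := by
  set R : WithConv (K →ₗ[k] A ⊗[k] K) := convPost includeRight (toConv LinearMap.id)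
  set R' : WithConv (K →ₗ[k] A ⊗[k] K) := convPost includeRight (toConv (antipode k))
  have hR : R * R' = 1 := by rw [← map_mul, LinearMap.id_mul_antipode, _root_.map_one]
  have h1 : convPost ρ (convPre (Bialgebra.mulCoalgHom k K) S.inv) =
      convPre (Bialgebra.mulCoalgHom k K) R' *
        convPost includeLeft (convPre (Bialgebra.mulCoalgHom k K) S.inv) := by
    refine inv_unique_of_mul_eq (S.convPost_pre_c (Bialgebra.mulCoalgHom k K)) ?_ ?_ ?_
    · rw [← map_mul, pre_inv_mul_c, _root_.map_one]
    · rw [← map_mul, pre_c_mul_inv, _root_.map_one]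
    · rw [← map_mul, hR, _root_.map_one]
  have h2 : convPre (Bialgebra.mulCoalgHom k K) R * convPre (Bialgebra.mulCoalgHom k K) R' = 1 := by
    rw [← map_mul, hR, _root_.map_one]
  have h3 : convPre (coalgFst k K K) R * convPost includeLeft (convPre (coalgSnd k K K) S.c) =
      convPost includeLeft (convPre (coalgSnd k K K) S.c) * convPre (coalgFst k K K) R :=
    conv_fst_snd_comm (g := convPost includeLeft S.c) (fun c d => by simp [R])
  rw [sigmaA, map_mul, map_mul, convPost_pre_c, convPost_pre_c, h1, map_mul, map_mul]
  rw [mulCoalgHom_eq] at h2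
  generalize convPost (includeLeft : A →ₐ[k] A ⊗[k] K) (convPre (coalgFst k K K) S.c) = a1 at *
  generalize convPost (includeLeft : A →ₐ[k] A ⊗[k] K) (convPre (coalgSnd k K K) S.c) = a2 at *
  change a1 * convPre (coalgFst k K K) R * (a2 * convPre (coalgSnd k K K) R) * _ = _
  calc _ = a1 * (convPre (coalgFst k K K) R * a2) * convPre (coalgSnd k K K) R *
        (convPre (Bialgebra.mulCoalgHom k K) R' * convPost includeLeft (convPre (Bialgebra.mulCoalgHom k K) S.inv)) := by
        simp only [mul_assoc]
    _ = a1 * a2 * (convPre (coalgFst k K K) R * convPre (coalgSnd k K K) R *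
        convPre (Bialgebra.mulCoalgHom k K) R') * convPost includeLeft (convPre (Bialgebra.mulCoalgHom k K) S.inv) := by
        rw [h3]; simp only [mul_assoc]
    _ = _ := by rw [h2, mul_one]

lemma convPost_tauA : convPost ρ S.tauA = convPost includeLeft S.tauA := by
  have h1 : convPost ρ S.tauA * convPost ρ S.sigmaA = 1 := by
    rw [← map_mul, tauA_mul_sigmaA, _root_.map_one]
  have h2 : convPost ρ S.sigmaA * convPost includeLeft S.tauA = 1 := by
    rw [convPost_sigmaA, ← map_mul, sigmaA_mul_tauA, _root_.map_one]
  exact left_inv_eq_right_inv h1 h2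

/-- The linear form on coinvariants. -/
def form {C : Type*} [AddCommGroup C] [Module k C] (f : WithConv (C →ₗ[k] A)) : WithConv (C →ₗ[k] k) :=
  toConv (counit ∘ₗ S.γ.symm.toLinearMap ∘ₗ f.ofConv)

lemma convScalar_form [Nontrivial A] (hρ : IsComoduleAlgebra ρ) {f : WithConv (C →ₗ[k] A)}
    (hf : convPost ρ f = convPost includeLeft f) : convScalar A (S.form f) = f := by
  ext c
  obtain ⟨a, ha⟩ := (S.isCleftObject hρ).coinvariants (f.ofConv c) congr(($hf).ofConv c)
  have hs : S.γ.symm 1 = 1 := S.γ.symm_apply_eq.2 S.map_one.symm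
  rw [convScalar_apply, form]
  simp [ha, Algebra.algebraMap_eq_smul_one, hs]

variable [Nontrivial A] (hρ : IsComoduleAlgebra ρ)
include hρ

lemma sigma_spec : convScalar A (S.form S.sigmaA) = S.sigmaA := S.convScalar_form hρ S.convPost_sigmaA

lemma tau_spec : convScalar A (S.form S.tauA) = S.tauA := S.convScalar_form hρ S.convPost_tauA

lemma sigma_mul_tau : S.form S.sigmaA * S.form S.tauA = 1 := by
  apply convScalar_injective (B := A)
  rw [map_mul, S.sigma_spec hρ, S.tau_spec hρ, sigmaA_mul_tauA, _root_.map_one]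

lemma tau_mul_sigma : S.form S.tauA * S.form S.sigmaA = 1 := by
  apply convScalar_injective (B := A)
  rw [map_mul, S.sigma_spec hρ, S.tau_spec hρ, tauA_mul_sigmaA, _root_.map_one]

/-- Two cocycle conditions in terms of maps to `A`. -/
lemma sigmaA_cocycle :
    convPre (coalgFst k (K ⊗[k] K) K) S.sigmaA *
      convPre (Coalgebra.TensorProduct.map (Bialgebra.mulCoalgHom k K) (CoalgHom.id k K)) S.sigmaA =
    convPre ((coalgSnd k K (K ⊗[k] K)).comp (Coalgebra.TensorProduct.assoc k k K K K).toCoalgHom) S.sigmaA *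
      convPre ((Coalgebra.TensorProduct.map (CoalgHom.id k K) (Bialgebra.mulCoalgHom k K)).comp
        (Coalgebra.TensorProduct.assoc k k K K K).toCoalgHom) S.sigmaA := by
  have hc : convPre (coalgSnd k K (K ⊗[k] K)) S.sigmaA * convPre (coalgFst k K (K ⊗[k] K)) S.c =
      convPre (coalgFst k K (K ⊗[k] K)) S.c * convPre (coalgSnd k K (K ⊗[k] K)) S.sigmaA := by
    refine (conv_fst_snd_comm fun c d => ?_).symm
    rw [← S.sigma_spec hρ, convScalar_apply]
    exact (Algebra.commutes _ _).symm
  have hc' := congr(convPre (Coalgebra.TensorProduct.assoc k k K K K).toCoalgHom $hc)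
  rw [map_mul, map_mul] at hc'
  let m := Bialgebra.mulCoalgHom k K
  let φ₁ := (coalgFst k K K).comp (coalgFst k (K ⊗[k] K) K)
  let φ₂ := (coalgSnd k K K).comp (coalgFst k (K ⊗[k] K) K)
  let φ₃ := coalgSnd k (K ⊗[k] K) K
  let φ₁₂ := m.comp (coalgFst k (K ⊗[k] K) K)
  let α := (Coalgebra.TensorProduct.assoc k k K K K).toCoalgHom
  let φ₂₃ := m.comp ((coalgSnd k K (K ⊗[k] K)).comp α)
  let φ := m.comp (Coalgebra.TensorProduct.map m (CoalgHom.id k K))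
  have a1 : (coalgFst k K K).comp (Coalgebra.TensorProduct.map m (CoalgHom.id k K)) = φ₁₂ :=
    coalgHom_ext₃ fun x y z => by simp [φ₁₂, m]
  have a2 : (coalgSnd k K K).comp (Coalgebra.TensorProduct.map m (CoalgHom.id k K)) = φ₃ :=
    coalgHom_ext₃ fun x y z => by simp [φ₃, m, mul_comm]
  have b1 : (coalgFst k K K).comp ((coalgSnd k K (K ⊗[k] K)).comp α) = φ₂ :=
    coalgHom_ext₃ fun x y z => by simp [φ₂, α]; rw [smul_comm]
  have b2 : (coalgSnd k K K).comp ((coalgSnd k K (K ⊗[k] K)).comp α) = φ₃ :=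
    coalgHom_ext₃ fun x y z => by simp [φ₃, α, smul_smul, mul_comm]
  have c1 : (coalgFst k K K).comp ((Coalgebra.TensorProduct.map (CoalgHom.id k K) m).comp α) = φ₁ :=
    coalgHom_ext₃ fun x y z => by simp [φ₁, α, m, smul_smul, mul_comm]
  have c2 : (coalgSnd k K K).comp ((Coalgebra.TensorProduct.map (CoalgHom.id k K) m).comp α) = φ₂₃ :=
    coalgHom_ext₃ fun x y z => by simp [φ₂₃, α, m]
  have c3 : m.comp ((Coalgebra.TensorProduct.map (CoalgHom.id k K) m).comp α) = φ :=
    coalgHom_ext₃ fun x y z => by simp [φ, α, m, mul_assoc]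
  have d1 : (coalgFst k K (K ⊗[k] K)).comp α = φ₁ :=
    coalgHom_ext₃ fun x y z => by simp [φ₁, α, smul_smul, mul_comm]
  have e1 : convPre (coalgFst k (K ⊗[k] K) K) S.sigmaA =
      convPre φ₁ S.c * convPre φ₂ S.c * convPre φ₁₂ S.inv := by
    rw [sigmaA, map_mul, map_mul]; rfl
  have e2 : convPre (Coalgebra.TensorProduct.map m (CoalgHom.id k K)) S.sigmaA =
      convPre φ₁₂ S.c * convPre φ₃ S.c * convPre φ S.inv := by
    rw [sigmaA, map_mul, map_mul, ← a1, ← a2]; rfl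
  have e3 : convPre ((coalgSnd k K (K ⊗[k] K)).comp α) S.sigmaA =
      convPre φ₂ S.c * convPre φ₃ S.c * convPre φ₂₃ S.inv := by
    rw [sigmaA, map_mul, map_mul, ← b1, ← b2]; rfl
  have e4 : convPre ((Coalgebra.TensorProduct.map (CoalgHom.id k K) m).comp α) S.sigmaA =
      convPre φ₁ S.c * convPre φ₂₃ S.c * convPre φ S.inv := by
    rw [sigmaA, map_mul, map_mul, ← c1, ← c2, ← c3]; rfl
  have e5 : convPre ((coalgSnd k K (K ⊗[k] K)).comp α) S.sigmaA * convPre φ₁ S.c =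
      convPre φ₁ S.c * convPre ((coalgSnd k K (K ⊗[k] K)).comp α) S.sigmaA := by
    rw [← d1]; exact hc'
  refine Eq.trans (b := convPre φ₁ S.c * convPre φ₂ S.c * convPre φ₃ S.c * convPre φ S.inv) ?_ ?_
  · refine (congrArg₂ (· * ·) e1 e2).trans ?_
    have := S.pre_inv_mul_c φ₁₂
    calc _ = convPre φ₁ S.c * convPre φ₂ S.c * (convPre φ₁₂ S.inv * convPre φ₁₂ S.c) *
          convPre φ₃ S.c * convPre φ S.inv := by simp only [mul_assoc]
      _ = _ := by rw [this, mul_one]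
  · refine Eq.trans ?_ (congrArg₂ (· * ·) rfl e4.symm)
    have := S.pre_inv_mul_c φ₂₃
    calc _ = convPre φ₁ S.c * (convPre φ₂ S.c * convPre φ₃ S.c * (convPre φ₂₃ S.inv *
          convPre φ₂₃ S.c)) * convPre φ S.inv := by rw [this, mul_one]; simp only [mul_assoc]
      _ = convPre φ₁ S.c * convPre ((coalgSnd k K (K ⊗[k] K)).comp α) S.sigmaA *
          convPre φ₂₃ S.c * convPre φ S.inv := by rw [e3]; simp only [mul_assoc]
      _ = _ := by rw [← e5]; simp only [mul_assoc]; rfl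

lemma isHopfTwoCocycle : IsHopfTwoCocycle K (S.form S.sigmaA).ofConv where
  isUnit := isUnit_iff_exists_and_exists.2 ⟨⟨_, S.sigma_mul_tau hρ⟩, ⟨_, S.tau_mul_sigma hρ⟩⟩
  map_tmul_one x := by
    have e := congr(($(S.inclL_sigmaA)).ofConv x)
    have e2 := congr(($(S.sigma_spec hρ)).ofConv (x ⊗ₜ 1))
    apply (algebraMap k A).injective
    exact e2.trans (e.trans (by simp))
  map_one_tmul x := by
    have e := congr(($(S.inclR_sigmaA)).ofConv x)
    have e2 := congr(($(S.sigma_spec hρ)).ofConv (1 ⊗ₜ x))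
    apply (algebraMap k A).injective
    exact e2.trans (e.trans (by simp))
  cocycle := by
    have e := S.sigmaA_cocycle hρ
    rw [← S.sigma_spec hρ] at e
    simp only [convPre_convScalar, ← map_mul] at e
    have e2 := convScalar_injective e
    have h1 : toConv (LinearMap.mul' k k ∘ₗ TensorProduct.map (S.form S.sigmaA).ofConv
        (counit (R := k) (A := K))) = convPre (coalgFst k (K ⊗[k] K) K) (S.form S.sigmaA) :=
      WithConv.ext (TensorProduct.ext' fun c d => by simp [mul_comm])
    have h2 : toConv (LinearMap.mul' k k ∘ₗ TensorProduct.map (counit (R := k) (A := K))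
        (S.form S.sigmaA).ofConv ∘ₗ (TensorProduct.assoc k K K K).toLinearMap) =
        convPre ((coalgSnd k K (K ⊗[k] K)).comp (Coalgebra.TensorProduct.assoc k k K K K).toCoalgHom)
          (S.form S.sigmaA) := by
      refine WithConv.ext (TensorProduct.ext_threefold fun c d e => by simp)
    rw [h1, h2]
    refine Eq.trans ?_ (e2.trans ?_)
    · congr 1
    · congr 1

omit hρ [Nontrivial A]

lemma invOp_mul (f g : WithConv (K →ₗ[k] A)) :
    toConv ((opL : A →ₗ[k] Aᵐᵒᵖ) ∘ₗ (convPre (coalgSnd k K K) g * convPre (coalgFst k K K) f).ofConv) =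
      convPre (coalgFst k K K) (toConv (opL ∘ₗ f.ofConv)) *
        convPre (coalgSnd k K K) (toConv (opL ∘ₗ g.ofConv)) := by
  refine WithConv.ext (TensorProduct.ext' fun c d => ?_)
  rw [conv_fst_snd]
  simp only [LinearMap.comp_apply, conv_snd_fst]
  simp

lemma j_twistedMul [Nontrivial A] (hρ : IsComoduleAlgebra ρ) (x y : K) :
    S.j.ofConv (twistedMul K (S.form S.sigmaA).ofConv (S.form S.tauA).ofConv (x ⊗ₜ y)) =
      S.j.ofConv x * S.j.ofConv y := by
  have e1 : toConv (S.j.ofConv ∘ₗ twistedMul K (S.form S.sigmaA).ofConv (S.form S.tauA).ofConv) =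
      convScalar _ (S.form S.sigmaA) * convPre (Bialgebra.mulCoalgHom k K) S.j *
        convScalar _ (S.form S.tauA) := by
    rw [twistedMul]
    exact (comp_mul_convScalar _ _ _).trans (congrArg (· * _) (comp_convScalar_mul _ _ _))
  have e2 : convPre (coalgFst k K K) S.j * convPre (coalgSnd k K K) S.j =
      convScalar _ (S.form S.sigmaA) * convPre (Bialgebra.mulCoalgHom k K) S.j *
        convScalar _ (S.form S.tauA) := by
    have h1 : convScalar (A ⊗[k] Aᵐᵒᵖ) (S.form S.sigmaA) =
        convPost includeLeft S.sigmaA := by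
      rw [← convPost_convScalar (includeLeft : A →ₐ[k] A ⊗[k] Aᵐᵒᵖ), S.sigma_spec hρ]
    have h2 : convScalar (A ⊗[k] Aᵐᵒᵖ) (S.form S.tauA) =
        convPost includeRight (convScalar Aᵐᵒᵖ (S.form S.tauA)) := by
      rw [← convPost_convScalar (includeRight : Aᵐᵒᵖ →ₐ[k] A ⊗[k] Aᵐᵒᵖ)]
    have h3 : convPre (Bialgebra.mulCoalgHom k K) S.invOp * convScalar Aᵐᵒᵖ (S.form S.tauA) =
        convPre (coalgFst k K K) S.invOp * convPre (coalgSnd k K K) S.invOp := by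
      refine (comp_mul_convScalar (opL : A →ₗ[k] Aᵐᵒᵖ) (S.form S.tauA)
        (convPre (Bialgebra.mulCoalgHom k K) S.inv)).symm.trans ?_
      rw [S.tau_spec hρ, tauA, ← mul_assoc, pre_inv_mul_c, one_mul, invOp_mul]
      rfl
    have h4 : convPost includeLeft S.sigmaA * convPost (includeLeft : A →ₐ[k] A ⊗[k] Aᵐᵒᵖ)
        (convPre (Bialgebra.mulCoalgHom k K) S.c) =
        convPost includeLeft (convPre (coalgFst k K K) S.c) *
          convPost includeLeft (convPre (coalgSnd k K K) S.c) := by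
      rw [← map_mul, sigmaA, mul_assoc, pre_inv_mul_c, mul_one, map_mul]
    have h5 : convPre (coalgFst k K K) (convPost (includeRight : Aᵐᵒᵖ →ₐ[k] A ⊗[k] Aᵐᵒᵖ) S.invOp) *
        convPre (coalgSnd k K K) (convPost includeLeft S.c) =
        convPre (coalgSnd k K K) (convPost includeLeft S.c) *
        convPre (coalgFst k K K) (convPost includeRight S.invOp) :=
      conv_fst_snd_comm fun c d => by simp
    have h6 := congr(convPost (includeRight : Aᵐᵒᵖ →ₐ[k] A ⊗[k] Aᵐᵒᵖ) $h3)
    rw [map_mul, map_mul] at h6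
    rw [h1, h2, j, map_mul, map_mul, map_mul]
    calc _ = convPre (coalgFst k K K) (convPost includeLeft S.c) *
          (convPre (coalgFst k K K) (convPost includeRight S.invOp) *
            convPre (coalgSnd k K K) (convPost includeLeft S.c)) *
          convPre (coalgSnd k K K) (convPost includeRight S.invOp) := by simp only [mul_assoc]
      _ = convPost includeLeft (convPre (coalgFst k K K) S.c) *
          convPost includeLeft (convPre (coalgSnd k K K) S.c) *
          (convPost includeRight (convPre (coalgFst k K K) S.invOp) *
            convPost includeRight (convPre (coalgSnd k K K) S.invOp)) := by
          rw [h5]; simp only [mul_assoc]; rfl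
      _ = _ := by rw [← h4, ← h6]; simp only [mul_assoc]; rfl
  have e3 := congr(($(e2.trans e1.symm)).ofConv (x ⊗ₜ y))
  rw [conv_fst_snd] at e3
  exact e3.symm

/-- A Hopf algebra which is isomorphic to the image of `j`, as an algebra with the coalgebra structure of
`K`, is a cocycle deformation of `K`. -/
lemma isCocycleDeformation [Nontrivial A] (hρ : IsComoduleAlgebra ρ) {L : Type*} [Ring L] [HopfAlgebra k L] (ι : L →ₐ[k] A ⊗[k] Aᵐᵒᵖ)
    (f : K ≃ₗc[k] L) (hf : ∀ h, ι (f h) = S.j.ofConv h) : IsCocycleDeformation (k := k) K L := by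
  have hι : Function.Injective ι := by
    intro x y e
    obtain ⟨x, rfl⟩ := EquivLike.surjective f x
    obtain ⟨y, rfl⟩ := EquivLike.surjective f y
    rw [hf, hf] at e
    rw [S.j_injective e]
  refine ⟨_, _, S.isHopfTwoCocycle hρ, S.sigma_mul_tau hρ, S.tau_mul_sigma hρ, f, ?_, ?_⟩
  · apply hι
    rw [hf, S.j_one, _root_.map_one]
  · intro x y
    apply hι
    rw [hf, _root_.map_mul, hf, hf]
    exact S.j_twistedMul hρ x y

/-- A Hopf algebra which is isomorphic to the image of `j`, as an algebra with the coalgebra structure of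
`K`, is the Schauenburg Hopf algebra. -/
lemma isSchauenburgHopfAlgebra [Nontrivial A] {L : Type*} [Ring L] [HopfAlgebra k L] (ι : L →ₐ[k] A ⊗[k] Aᵐᵒᵖ)
    (f : K ≃ₗc[k] L) (hf : ∀ h, ι (f h) = S.j.ofConv h) : IsSchauenburgHopfAlgebra ρ L := by
  refine ⟨S.galoisMap_bijective, S.τ, S.galoisMap_τ, ι, ?_, ?_, ?_, ?_⟩
  · intro x y e
    obtain ⟨x, rfl⟩ := EquivLike.surjective f x
    obtain ⟨y, rfl⟩ := EquivLike.surjective f y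
    rw [hf, hf] at e
    rw [S.j_injective e]
  · intro z
    rw [← S.mem_range_j_iff]
    constructor
    · rintro ⟨l, rfl⟩
      obtain ⟨x, rfl⟩ := EquivLike.surjective f l
      exact ⟨x, (hf x).symm⟩
    · rintro ⟨x, rfl⟩
      exact ⟨f x, hf x⟩
  · intro l
    obtain ⟨x, rfl⟩ := EquivLike.surjective f l
    rw [hf, S.translationComul_j, ← CoalgHomClass.map_comp_comul_apply f x]
    generalize (comul (R := k) x) = y
    induction y with
    | zero => simp
    | add x y hx hy => simp only [map_add, hx, hy]
    | tmul x y => simp [hf]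
  · intro l
    obtain ⟨x, rfl⟩ := EquivLike.surjective f l
    rw [hf, S.mulOpMap_j]
    simp

end CleftSection
end cleft
end

section
open Bosonization
variable {k : Type u} [Field k] {H : Type v} [Ring H] [HopfAlgebra k H] {θ : ℕ}
variable {D : PrincipalRealization k H θ}

section below
variable (J : Ideal (Bosonization D)) [J.IsTwoSided]

/-- The image in a quotient of `T(V) # H` of the elements of degree less than `n`. -/
def below (n : ℕ) : Submodule k (Bosonization D ⧸ J) := ⨆ i < n, quotDegree J i

lemma mk_mem_quotDegree {n : ℕ} {t : Bosonization D} (ht : t ∈ degreePart D n) :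
    Ideal.Quotient.mkₐ k J t ∈ quotDegree J n := ⟨t, ht, rfl⟩

lemma mk_mem_below {m n : ℕ} (hmn : m < n) {t : Bosonization D} (ht : t ∈ degreePart D m) :
    Ideal.Quotient.mkₐ k J t ∈ below J n :=
  (le_iSup₂_of_le m hmn le_rfl : quotDegree J m ≤ below J n) ⟨t, ht, rfl⟩

lemma below_le_iff {n : ℕ} {S : Submodule k (Bosonization D ⧸ J)} :
    below J n ≤ S ↔ ∀ m < n, ∀ t ∈ degreePart D m, Ideal.Quotient.mkₐ k J t ∈ S := by
  simp only [below, iSup_le_iff, quotDegree, Submodule.map_le_iff_le_comap]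
  rfl

lemma quotFiltration_eq (n : ℕ) : quotFiltration J n = below J (n + 1) := by
  simp only [quotFiltration, below, Nat.lt_succ_iff]

lemma below_mono : Monotone (below (k := k) J) := fun _ _ h =>
  (below_le_iff J).2 fun _ hm _ ht => mk_mem_below J (hm.trans_le h) ht

lemma below_zero : below (k := k) J 0 = ⊥ := by simp [below]

lemma below_succ (n : ℕ) : below (k := k) J (n + 1) = quotDegree J n ⊔ below J n := by
  apply le_antisymm
  · rw [below_le_iff]
    intro m hm t ht
    rcases Nat.lt_succ_iff_lt_or_eq.1 hm with h | rfl
    · exact Submodule.mem_sup_right (mk_mem_below J h ht)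
    · exact Submodule.mem_sup_left (mk_mem_quotDegree J ht)
  · refine sup_le ?_ (below_mono J n.le_succ)
    rintro _ ⟨t, ht, rfl⟩
    exact mk_mem_below J n.lt_succ_self ht

lemma mem_below_succ {n : ℕ} {a : Bosonization D ⧸ J} (ha : a ∈ below (k := k) J (n + 1)) :
    ∃ t ∈ degreePart D n, a - Ideal.Quotient.mkₐ k J t ∈ below (k := k) J n := by
  rw [below_succ] at ha
  obtain ⟨_, ⟨t, ht, rfl⟩, b, hb, rfl⟩ := Submodule.mem_sup.1 ha
  exact ⟨t, ht, by simpa using hb⟩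

lemma iSup_below : ⨆ n, below (k := k) J n = ⊤ := by
  rw [eq_top_iff]
  rintro a -
  obtain ⟨t, rfl⟩ := Ideal.Quotient.mkₐ_surjective k J a
  have : (⊤ : Submodule k (Bosonization D)) ≤
      (⨆ n, below (k := k) J n).comap (Ideal.Quotient.mkₐ k J).toLinearMap := by
    rw [← iSup_degreePart D]
    exact iSup_le fun n t ht => (le_iSup (below (k := k) J) (n + 1)) (mk_mem_below J n.lt_succ_self ht)
  exact this trivial

lemma exists_mem_below (a : Bosonization D ⧸ J) : ∃ n, a ∈ below (k := k) J n := by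
  have : a ∈ ⨆ n, below (k := k) J n := iSup_below (k := k) J ▸ trivial
  rwa [Submodule.mem_iSup_of_directed _ (below_mono J).directed_le] at this

/-- Products: degrees below `m + 1` and below `n` give a degree below `m + n`. -/
lemma below_mul_mem {m n l : ℕ} (h : m + n ≤ l + 1) {a b : Bosonization D ⧸ J} (ha : a ∈ below (k := k) J m)
    (hb : b ∈ below (k := k) J n) : a * b ∈ below (k := k) J l := by
  have h1 : below J m ≤ (below J l).comap (LinearMap.mulRight k b) := by
    refine (below_le_iff J).2 fun i hi t ht => ?_
    have h2 : below J n ≤ (below J l).comap (LinearMap.mulLeft k (Ideal.Quotient.mkₐ k J t)) := by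
      refine (below_le_iff J).2 fun j hj s hs => ?_
      rw [Submodule.mem_comap, LinearMap.mulLeft_apply, ← map_mul]
      exact mk_mem_below J (by omega) (degreePart_mul_mem D ht hs)
    exact h2 hb
  exact h1 ha

end below

section grading
variable {J₀ : Ideal (Bosonization D)} [J₀.IsTwoSided]

open Polynomial in
/-- The algebra map `K → K[X]` describing the grading of a quotient by a homogeneous ideal. -/
def grade (h₀ : ∀ z ∈ J₀, homogenize D (Ideal.Quotient.mkₐ k J₀) z = 0) :
    (Bosonization D ⧸ J₀) →ₐ[k] (Bosonization D ⧸ J₀)[X] := Ideal.Quotient.liftₐ J₀ _ h₀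

variable (h₀ : ∀ z ∈ J₀, homogenize D (Ideal.Quotient.mkₐ k J₀) z = 0)

lemma grade_mk {n : ℕ} {t : Bosonization D} (ht : t ∈ degreePart D n) :
    grade h₀ (Ideal.Quotient.mkₐ k J₀ t) = Polynomial.monomial n (Ideal.Quotient.mkₐ k J₀ t) :=
  homogenize_eq D _ ht

/-- The projection to the part of degree `n`. -/
def pr (n : ℕ) : (Bosonization D ⧸ J₀) →ₗ[k] Bosonization D ⧸ J₀ :=
  (Polynomial.lcoeff (Bosonization D ⧸ J₀) n).restrictScalars k ∘ₗ (grade h₀).toLinearMap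

lemma pr_mk {m n : ℕ} {t : Bosonization D} (ht : t ∈ degreePart D n) :
    pr h₀ m (Ideal.Quotient.mkₐ k J₀ t) = if n = m then Ideal.Quotient.mkₐ k J₀ t else 0 := by
  change Polynomial.coeff (grade h₀ (Ideal.Quotient.mkₐ k J₀ t)) m = _
  rw [grade_mk h₀ ht, Polynomial.coeff_monomial]

lemma pr_mem (n : ℕ) (a : Bosonization D ⧸ J₀) : pr h₀ n a ∈ quotDegree J₀ n := by
  obtain ⟨t, rfl⟩ := Ideal.Quotient.mkₐ_surjective k J₀ a
  have : (⊤ : Submodule k (Bosonization D)) ≤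
      (quotDegree J₀ n).comap (pr h₀ n ∘ₗ (Ideal.Quotient.mkₐ k J₀).toLinearMap) := by
    rw [← iSup_degreePart D]
    refine iSup_le fun m t ht => ?_
    simp only [Submodule.mem_comap, LinearMap.comp_apply, AlgHom.toLinearMap_apply, pr_mk h₀ ht]
    split_ifs with h
    · subst h; exact mk_mem_quotDegree J₀ ht
    · exact zero_mem _
  exact this trivial

lemma pr_of_mem {m n : ℕ} {a : Bosonization D ⧸ J₀} (ha : a ∈ quotDegree (k := k) J₀ n) :
    pr h₀ m a = if n = m then a else 0 := by
  obtain ⟨t, ht, rfl⟩ := ha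
  exact pr_mk h₀ ht

lemma pr_of_mem_below {m n : ℕ} (h : n ≤ m) {a : Bosonization D ⧸ J₀} (ha : a ∈ below (k := k) J₀ n) :
    pr h₀ m a = 0 := by
  have : below J₀ n ≤ LinearMap.ker (pr h₀ m) := by
    refine (below_le_iff J₀).2 fun i hi t ht => ?_
    rw [LinearMap.mem_ker, pr_mk h₀ ht, if_neg (by omega)]
  exact this ha

include h₀ in
lemma isInternal_quotDegree : DirectSum.IsInternal (quotDegree (k := k) J₀) := by
  rw [DirectSum.isInternal_submodule_iff_iSupIndep_and_iSup_eq_top]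
  constructor
  · intro n
    rw [Submodule.disjoint_def]
    intro a ha hb
    have : ⨆ j, ⨆ (_ : j ≠ n), quotDegree J₀ j ≤ LinearMap.ker (pr h₀ n) := by
      refine iSup₂_le fun j hj b hb => ?_
      rw [LinearMap.mem_ker, pr_of_mem h₀ hb, if_neg hj]
    have h1 := this hb
    rwa [LinearMap.mem_ker, pr_of_mem h₀ ha, if_pos rfl] at h1
  · rw [eq_top_iff, ← iSup_below J₀]
    exact iSup_le fun n => iSup₂_le fun i _ => le_iSup _ i

end grading

section leading
variable {J₀ : Ideal (Bosonization D)} [J₀.IsTwoSided]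
  (h₀ : ∀ z ∈ J₀, homogenize D (Ideal.Quotient.mkₐ k J₀) z = 0)
  {J : Ideal (Bosonization D)} [J.IsTwoSided]

variable (J₀ J) in
/-- The relations of the quotient by `J` degenerate to those of the quotient by `J₀`. -/
def Degenerates : Prop := ∀ n, ∀ t ∈ degreePart D n, t ∈ J₀ → Ideal.Quotient.mkₐ k J t ∈ below (k := k) J n

/-- The linear map `Ψ` has the identity as its leading term. -/
def HasLeadingTerm (Ψ : (Bosonization D ⧸ J) →ₗ[k] Bosonization D ⧸ J₀) : Prop :=
  ∀ n, ∀ t ∈ degreePart D n, Ψ (Ideal.Quotient.mkₐ k J t) - Ideal.Quotient.mkₐ k J₀ t ∈ below (k := k) J₀ n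

variable {Ψ : (Bosonization D ⧸ J) →ₗ[k] Bosonization D ⧸ J₀}

lemma HasLeadingTerm.mem_below (hΨ : HasLeadingTerm Ψ) {n : ℕ} {a : Bosonization D ⧸ J}
    (ha : a ∈ below (k := k) J n) : Ψ a ∈ below (k := k) J₀ n := by
  have : below J n ≤ (below J₀ n).comap Ψ := by
    refine (below_le_iff J).2 fun i hi t ht => ?_
    rw [Submodule.mem_comap, ← sub_add_cancel (Ψ _) (Ideal.Quotient.mkₐ k J₀ t)]
    exact add_mem (below_mono J₀ hi.le (hΨ i t ht)) (mk_mem_below J₀ hi ht)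
  exact this ha

include h₀ in
lemma HasLeadingTerm.pr_eq (hΨ : HasLeadingTerm Ψ) {n : ℕ} {a : Bosonization D ⧸ J} {t : Bosonization D}
    (ht : t ∈ degreePart D n) (ha : a - Ideal.Quotient.mkₐ k J t ∈ below (k := k) J n) :
    pr h₀ n (Ψ a) = Ideal.Quotient.mkₐ k J₀ t := by
  have h1 := pr_of_mem_below h₀ le_rfl (hΨ.mem_below ha)
  have h2 := pr_of_mem_below h₀ le_rfl (hΨ n t ht)
  rw [map_sub, map_sub, sub_eq_zero] at h1
  rw [map_sub, sub_eq_zero, pr_mk h₀ ht, if_pos rfl] at h2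
  rw [h1, h2]

include h₀ in
lemma HasLeadingTerm.mem_below_of_pr (hΨ : HasLeadingTerm Ψ) (hJ : Degenerates J₀ J) {n : ℕ}
    {a : Bosonization D ⧸ J} (ha : a ∈ below (k := k) J (n + 1)) (h : pr h₀ n (Ψ a) = 0) :
    a ∈ below (k := k) J n := by
  obtain ⟨t, ht, hb⟩ := mem_below_succ J ha
  have := hΨ.pr_eq h₀ ht hb
  rw [h] at this
  rw [← sub_add_cancel a (Ideal.Quotient.mkₐ k J t)]
  exact add_mem hb (hJ n t ht (Ideal.Quotient.eq_zero_iff_mem.1 this.symm))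

include h₀ in
lemma HasLeadingTerm.injective (hΨ : HasLeadingTerm Ψ) (hJ : Degenerates J₀ J) : Function.Injective Ψ := by
  rw [injective_iff_map_eq_zero]
  intro a ha
  obtain ⟨n, hn⟩ := exists_mem_below (k := k) J a
  induction n with
  | zero => simpa [below_zero] using hn
  | succ n ih => exact ih (hΨ.mem_below_of_pr h₀ hJ hn (by rw [ha, map_zero]))

lemma HasLeadingTerm.exists_below (hΨ : HasLeadingTerm Ψ) {n : ℕ} {b : Bosonization D ⧸ J₀}
    (hb : b ∈ below (k := k) J₀ n) : ∃ a ∈ below (k := k) J n, Ψ a = b := by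
  induction n generalizing b with
  | zero =>
    rw [below_zero, Submodule.mem_bot] at hb
    exact ⟨0, zero_mem _, by rw [map_zero, hb]⟩
  | succ n ih =>
    obtain ⟨t, ht, hc⟩ := mem_below_succ J₀ hb
    obtain ⟨a, ha, e⟩ := ih (sub_mem hc (hΨ n t ht))
    refine ⟨a + Ideal.Quotient.mkₐ k J t, add_mem (below_mono J n.le_succ ha)
      (mk_mem_below J n.lt_succ_self ht), ?_⟩
    rw [map_add, e]; abel

include h₀ in
lemma HasLeadingTerm.bijective (hΨ : HasLeadingTerm Ψ) (hJ : Degenerates J₀ J) : Function.Bijective Ψ := by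
  refine ⟨hΨ.injective h₀ hJ, fun b => ?_⟩
  obtain ⟨n, hn⟩ := exists_mem_below (k := k) J₀ b
  obtain ⟨a, -, ha⟩ := hΨ.exists_below hn
  exact ⟨a, ha⟩

end leading

section hopf
variable {J : Ideal (Bosonization D)} [J.IsTwoSided] [J.IsHopfIdeal k]

lemma comul_mk (t : Bosonization D) : comul (R := k) (Ideal.Quotient.mkₐ k J t) =
    Algebra.TensorProduct.map (Ideal.Quotient.mkₐ k J) (Ideal.Quotient.mkₐ k J) (comul t) := by
  exact rfl

lemma counit_mk (t : Bosonization D) : counit (R := k) (Ideal.Quotient.mkₐ k J t) = counit (R := k) t := by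
  exact rfl

lemma antipode_mk (t : Bosonization D) : antipode k (Ideal.Quotient.mkₐ k J t) =
    Ideal.Quotient.mkₐ k J (antipode k t) := by
  exact rfl

end hopf
end

section
open Bosonization
variable {k : Type u} [Field k] {H : Type v} [Ring H] [HopfAlgebra k H] {θ : ℕ}
variable {D : PrincipalRealization k H θ}

section hopf
variable {J : Ideal (Bosonization D)} [J.IsTwoSided] [J.IsHopfIdeal k]

lemma comul_mk_mem {R : Type*} [AddCommGroup R] [Module k R] {n : ℕ} {S : Submodule k R}
    (φ : Bosonization D ⊗[k] Bosonization D →ₗ[k] R)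
    (h : ∀ i j, i + j = n → ∀ a ∈ degreePart D i, ∀ b ∈ degreePart D j, φ (a ⊗ₜ b) ∈ S)
    {t : Bosonization D} (ht : t ∈ degreePart D n) : φ (comul (R := k) t) ∈ S :=
  (tensorDegree_le (S := S.comap φ) h) (comul_mem_tensorDegree D ht)

lemma comul_quotDegree {n : ℕ} {a : Bosonization D ⧸ J} (ha : a ∈ quotDegree (k := k) J n) :
    comul (R := k) a ∈ tensorDegree (quotDegree J) n := by
  obtain ⟨t, ht, rfl⟩ := ha
  rw [AlgHom.toLinearMap_apply, comul_mk]
  refine comul_mk_mem (Algebra.TensorProduct.map (Ideal.Quotient.mkₐ k J) (Ideal.Quotient.mkₐ k J)).toLinearMap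
    (fun i j hij a ha b hb => ?_) ht
  subst hij
  exact tmul_mem_tensorDegree (mk_mem_quotDegree J ha) (mk_mem_quotDegree J hb)

lemma antipode_below {n : ℕ} {a : Bosonization D ⧸ J} (ha : a ∈ below (k := k) J n) :
    antipode k a ∈ below (k := k) J n := by
  have : below J n ≤ (below J n).comap (antipode k) := by
    refine (below_le_iff J).2 fun i hi t ht => ?_
    rw [Submodule.mem_comap, antipode_mk]
    exact mk_mem_below J hi (antipode_mem_degreePart D ht)
  exact this ha

lemma isHopfGrading_quotDegree (h₀ : ∀ z ∈ J, homogenize D (Ideal.Quotient.mkₐ k J) z = 0) :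
    IsHopfGrading (quotDegree (k := k) J) where
  isInternal := isInternal_quotDegree h₀
  one_mem := by rw [← map_one (Ideal.Quotient.mkₐ k J)]; exact mk_mem_quotDegree J (one_mem_degreePart D)
  mul_mem := by
    rintro m n _ ⟨s, hs, rfl⟩ _ ⟨t, ht, rfl⟩
    simp only [AlgHom.toLinearMap_apply, ← map_mul]
    exact mk_mem_quotDegree J (degreePart_mul_mem D hs ht)
  comul_mem n a ha := comul_quotDegree ha
  counit_eq_zero := by
    rintro n hn _ ⟨t, ht, rfl⟩
    rw [AlgHom.toLinearMap_apply, counit_mk]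
    have := degreePart_induction D (p := fun n t => n ≠ 0 → counit (R := k) t = 0)
      (by simp) (by intros; simp [counit_x]) (by simp)
      (by intro n a b ha hb hn; rw [map_add, ha hn, hb hn, add_zero])
      (by intro n c a ha hn; rw [map_smul, ha hn, smul_zero]) ht
    exact this hn
  antipode_mem := by
    rintro n _ ⟨t, ht, rfl⟩
    rw [AlgHom.toLinearMap_apply, antipode_mk]
    exact mk_mem_quotDegree J (antipode_mem_degreePart D ht)

lemma isHopfFiltration_quotFiltration : IsHopfFiltration (quotFiltration (k := k) J) := by
  rw [show quotFiltration (k := k) J = fun n => below J (n + 1) from funext (quotFiltration_eq J)]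
  exact
  { mono := fun m n h => below_mono J (by omega)
    iSup_eq_top := by
      rw [eq_top_iff, ← iSup_below J]
      exact iSup_le fun n => (below_mono J n.le_succ).trans (le_iSup (fun n => below (k := k) J (n + 1)) n)
    one_mem := by
      rw [← map_one (Ideal.Quotient.mkₐ k J)]
      exact mk_mem_below J Nat.zero_lt_one (one_mem_degreePart D)
    mul_mem := fun m n x hx y hy => below_mul_mem J (by omega) hx hy
    comul_mem := by
      intro n x hx
      have : below J (n + 1) ≤ (tensorDegree (fun n => below (k := k) J (n + 1)) n).comap comul := by
        refine (below_le_iff J).2 fun i hi t ht => ?_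
        rw [Submodule.mem_comap, comul_mk]
        refine comul_mk_mem (Algebra.TensorProduct.map (Ideal.Quotient.mkₐ k J) (Ideal.Quotient.mkₐ k J)).toLinearMap
          (fun i' j hij a ha b hb => ?_) ht
        have hn : n = (n - j) + j := by omega
        rw [hn]
        exact tmul_mem_tensorDegree (mk_mem_below J (by omega) ha) (mk_mem_below J (by omega) hb)
      exact this hx
    antipode_mem := fun n x hx => antipode_below hx }

end hopf

section gr
variable {J₀ : Ideal (Bosonization D)} [J₀.IsTwoSided] [J₀.IsHopfIdeal k]
  (h₀ : ∀ z ∈ J₀, homogenize D (Ideal.Quotient.mkₐ k J₀) z = 0)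
  {J : Ideal (Bosonization D)} [J.IsTwoSided] [J.IsHopfIdeal k]
  {Ψ : (Bosonization D ⧸ J) →ₗ[k] Bosonization D ⧸ J₀}

open Classical in
lemma range_aux {F : ℕ → Submodule k (Bosonization D ⧸ J)} (s : ∀ n, F n →ₗ[k] Bosonization D ⧸ J₀) (n : ℕ) :
    ∃ R : Submodule k (((Bosonization D ⧸ J) ⊗[k] (Bosonization D ⧸ J)) ×
      ((Bosonization D ⧸ J₀) ⊗[k] (Bosonization D ⧸ J₀))),
    (∀ z, z ∈ R ↔ ∃ t : ∀ p : ℕ × ℕ, F p.1 ⊗[k] F p.2,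
      z.1 = ∑ p ∈ Finset.HasAntidiagonal.antidiagonal n,
        TensorProduct.map (F p.1).subtype (F p.2).subtype (t p) ∧
      z.2 = ∑ p ∈ Finset.HasAntidiagonal.antidiagonal n, TensorProduct.map (s p.1) (s p.2) (t p)) ∧
    ∀ i j, i + j = n → ∀ (a : F i) (b : F j), ((a : Bosonization D ⧸ J) ⊗ₜ (b : Bosonization D ⧸ J),
      s i a ⊗ₜ s j b) ∈ R := by
  let f : (∀ p : ℕ × ℕ, F p.1 ⊗[k] F p.2) →ₗ[k] ((Bosonization D ⧸ J) ⊗[k] (Bosonization D ⧸ J)) ×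
      ((Bosonization D ⧸ J₀) ⊗[k] (Bosonization D ⧸ J₀)) :=
    LinearMap.prod (∑ p ∈ Finset.HasAntidiagonal.antidiagonal n,
        TensorProduct.map (F p.1).subtype (F p.2).subtype ∘ₗ LinearMap.proj p)
      (∑ p ∈ Finset.HasAntidiagonal.antidiagonal n, TensorProduct.map (s p.1) (s p.2) ∘ₗ LinearMap.proj p)
  have hR : ∀ z, z ∈ LinearMap.range f ↔ ∃ t : ∀ p : ℕ × ℕ, F p.1 ⊗[k] F p.2,
      z.1 = ∑ p ∈ Finset.HasAntidiagonal.antidiagonal n,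
        TensorProduct.map (F p.1).subtype (F p.2).subtype (t p) ∧
      z.2 = ∑ p ∈ Finset.HasAntidiagonal.antidiagonal n, TensorProduct.map (s p.1) (s p.2) (t p) := by
    intro z
    constructor
    · rintro ⟨t, rfl⟩
      exact ⟨t, by simp [f, LinearMap.sum_apply], by simp [f, LinearMap.sum_apply]⟩
    · rintro ⟨t, h1, h2⟩
      exact ⟨t, Prod.ext (by simp [f, LinearMap.sum_apply, h1]) (by simp [f, LinearMap.sum_apply, h2])⟩
  refine ⟨LinearMap.range f, hR, fun i j hij a b => (hR _).2 ?_⟩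
  have hm : (i, j) ∈ Finset.HasAntidiagonal.antidiagonal n := Finset.HasAntidiagonal.mem_antidiagonal.2 hij
  refine ⟨Pi.single (i, j) (a ⊗ₜ b), ?_, ?_⟩
  · rw [Finset.sum_eq_single_of_mem (i, j) hm]
    · simp
    · intro p _ hp; simp [Pi.single_eq_of_ne hp]
  · rw [Finset.sum_eq_single_of_mem (i, j) hm]
    · simp
    · intro p _ hp; simp [Pi.single_eq_of_ne hp]

/-- The leading term of elements of degree at most `n`. -/
def symbol (Ψ : (Bosonization D ⧸ J) →ₗ[k] Bosonization D ⧸ J₀) (n : ℕ) :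
    quotFiltration (k := k) J n →ₗ[k] Bosonization D ⧸ J₀ :=
  pr h₀ n ∘ₗ Ψ ∘ₗ Submodule.subtype _

lemma symbol_mk (hΨ : HasLeadingTerm Ψ) {n : ℕ} {t : Bosonization D} (ht : t ∈ degreePart D n)
    {a : quotFiltration (k := k) J n} (ha : (a : Bosonization D ⧸ J) - Ideal.Quotient.mkₐ k J t ∈ below (k := k) J n) :
    symbol h₀ Ψ n a = Ideal.Quotient.mkₐ k J₀ t := hΨ.pr_eq h₀ ht ha

lemma exists_rep (n : ℕ) (a : quotFiltration (k := k) J n) : ∃ t ∈ degreePart D n,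
    (a : Bosonization D ⧸ J) - Ideal.Quotient.mkₐ k J t ∈ below (k := k) J n :=
  mem_below_succ J (quotFiltration_eq (k := k) J n ▸ a.2)

lemma mk_mem_quotFiltration {i n : ℕ} (h : i ≤ n) {t : Bosonization D} (ht : t ∈ degreePart D i) :
    Ideal.Quotient.mkₐ k J t ∈ quotFiltration (k := k) J n := by
  rw [quotFiltration_eq]; exact mk_mem_below J (by omega) ht

lemma symbol_mk_self (hΨ : HasLeadingTerm Ψ) {n : ℕ} {t : Bosonization D} (ht : t ∈ degreePart D n) :
    symbol h₀ Ψ n ⟨_, mk_mem_quotFiltration le_rfl ht⟩ = Ideal.Quotient.mkₐ k J₀ t :=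
  symbol_mk h₀ hΨ ht (by simp)

lemma symbol_of_mem_below (hΨ : HasLeadingTerm Ψ) {n : ℕ} {a : quotFiltration (k := k) J n}
    (ha : (a : Bosonization D ⧸ J) ∈ below (k := k) J n) : symbol h₀ Ψ n a = 0 := by
  rw [symbol_mk h₀ hΨ (zero_mem (degreePart D n)) (by simpa using ha), map_zero]

include h₀ in
lemma grIsomorphic (hJ : Degenerates J₀ J) (hΨ : HasLeadingTerm Ψ) :
    GrIsomorphic (quotFiltration (k := k) J) (quotDegree (k := k) J₀) := by
  refine ⟨isHopfFiltration_quotFiltration, isHopfGrading_quotDegree h₀, symbol h₀ Ψ, ?_⟩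
  have hker : ∀ n (a : quotFiltration (k := k) J n), symbol h₀ Ψ n a = 0 →
      (a : Bosonization D ⧸ J) ∈ below (k := k) J n := fun n a ha =>
    hΨ.mem_below_of_pr h₀ hJ (quotFiltration_eq (k := k) J n ▸ a.2) ha
  exact
  { range_eq := by
      intro n
      apply le_antisymm
      · rintro _ ⟨a, rfl⟩
        exact pr_mem h₀ n _
      · rintro _ ⟨t, ht, rfl⟩
        exact ⟨_, symbol_mk_self h₀ hΨ ht⟩
    ker_zero := by
      rw [eq_bot_iff]
      intro a ha
      have := hker 0 a ha
      rw [below_zero, Submodule.mem_bot] at this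
      exact Subtype.ext this
    ker_succ := by
      intro n
      ext a
      rw [LinearMap.mem_ker, Submodule.mem_comap, Submodule.subtype_apply]
      refine Iff.trans ?_ (iff_of_eq (congrArg (_ ∈ ·) (quotFiltration_eq (k := k) J n).symm))
      exact ⟨hker _ a, symbol_of_mem_below h₀ hΨ⟩
    map_one := fun h => by
      rw [symbol_mk h₀ hΨ (one_mem_degreePart D) (by simp), map_one]
    map_mul := by
      intro m n x y h
      obtain ⟨s, hs, hs'⟩ := exists_rep m x
      obtain ⟨t, ht, ht'⟩ := exists_rep n y
      rw [symbol_mk h₀ hΨ hs hs', symbol_mk h₀ hΨ ht ht', ← map_mul]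
      refine symbol_mk h₀ hΨ (degreePart_mul_mem D hs ht) ?_
      have hx : (x : Bosonization D ⧸ J) ∈ below (k := k) J (m + 1) := quotFiltration_eq (k := k) J m ▸ x.2
      rw [map_mul, show (x * y : Bosonization D ⧸ J) - Ideal.Quotient.mkₐ k J s * Ideal.Quotient.mkₐ k J t =
        x * (y - Ideal.Quotient.mkₐ k J t) + (x - Ideal.Quotient.mkₐ k J s) * Ideal.Quotient.mkₐ k J t by noncomm_ring]
      exact add_mem (below_mul_mem J (by omega) hx ht')
        (below_mul_mem J (by omega) hs' (mk_mem_below J n.lt_succ_self ht))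
    map_comul := by
      intro n x
      obtain ⟨R, hR, hmem⟩ := range_aux (symbol h₀ Ψ) n
      obtain ⟨t, ht, ht'⟩ := exists_rep n x
      refine (hR (comul (R := k) (x : Bosonization D ⧸ J), comul (R := k) (symbol h₀ Ψ n x))).1 ?_
      rw [symbol_mk h₀ hΨ ht ht']
      have h1 : (comul (R := k) (Ideal.Quotient.mkₐ k J t), comul (R := k) (Ideal.Quotient.mkₐ k J₀ t)) ∈ R := by
        rw [comul_mk, comul_mk]
        refine comul_mk_mem (LinearMap.prod (Algebra.TensorProduct.map (Ideal.Quotient.mkₐ k J)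
            (Ideal.Quotient.mkₐ k J)).toLinearMap (Algebra.TensorProduct.map (Ideal.Quotient.mkₐ k J₀)
            (Ideal.Quotient.mkₐ k J₀)).toLinearMap) (fun i j hij a ha b hb => ?_) ht
        have := hmem i j hij ⟨_, mk_mem_quotFiltration le_rfl ha⟩ ⟨_, mk_mem_quotFiltration le_rfl hb⟩
        rwa [symbol_mk_self h₀ hΨ ha, symbol_mk_self h₀ hΨ hb] at this
      have h2 : below J n ≤ (R.comap (LinearMap.inl k _ _)).comap comul := by
        refine (below_le_iff J).2 fun i hi t ht => ?_
        rw [Submodule.mem_comap, comul_mk]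
        refine comul_mk_mem (Algebra.TensorProduct.map (Ideal.Quotient.mkₐ k J)
            (Ideal.Quotient.mkₐ k J)).toLinearMap (fun i' j hij a ha b hb => ?_) ht
        have := hmem (n - j) j (by omega) ⟨_, mk_mem_quotFiltration (by omega) ha⟩
          ⟨_, mk_mem_quotFiltration le_rfl hb⟩
        rwa [symbol_of_mem_below h₀ hΨ (a := ⟨_, mk_mem_quotFiltration (by omega) ha⟩)
          (mk_mem_below J (by omega) ha), TensorProduct.zero_tmul] at this
      have h3 := add_mem h1 (h2 ht')
      rw [LinearMap.inl_apply, Prod.mk_add_mk, ← map_add, add_sub_cancel, add_zero] at h3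
      exact h3
    map_counit := by
      intro x
      obtain ⟨t, ht, ht'⟩ := exists_rep 0 x
      rw [symbol_mk h₀ hΨ ht ht', counit_mk]
      rw [below_zero, Submodule.mem_bot, sub_eq_zero] at ht'
      rw [ht', counit_mk]
    map_antipode := by
      intro n x h
      obtain ⟨t, ht, ht'⟩ := exists_rep n x
      rw [symbol_mk h₀ hΨ ht ht', antipode_mk]
      refine symbol_mk h₀ hΨ (antipode_mem_degreePart D ht) ?_
      have := antipode_below ht'
      rwa [map_sub, antipode_mk] at this }

end gr

section biIdeal
variable {P P' : DeformationData D}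

lemma mul_mem_degreePart {m n l : ℕ} (h : m + n = l) {a b : Bosonization D} (ha : a ∈ degreePart D m)
    (hb : b ∈ degreePart D n) : a * b ∈ degreePart D l := by
  subst h
  exact degreePart_mul_mem D ha hb

lemma qcomm_mem_degreePart (c : k) {m n l : ℕ} (h : m + n = l) {a b : Bosonization D} (ha : a ∈ degreePart D m)
    (hb : b ∈ degreePart D n) : qcomm c a b ∈ degreePart D l := by
  rw [qcomm]
  subst h
  refine sub_mem (degreePart_mul_mem D ha hb) (Submodule.smul_mem _ _ ?_)
  rw [add_comm]
  exact degreePart_mul_mem D hb ha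

lemma serreComm_mem_degreePart (p r s : k) {a b c : Bosonization D} (ha : a ∈ degreePart D 1)
    (hb : b ∈ degreePart D 1) (hc : c ∈ degreePart D 1) : serreComm p r s a b c ∈ degreePart D 4 := by
  rw [serreComm]
  have h2 := qcomm_mem_degreePart r (l := 2) rfl hb hc
  have h3 := qcomm_mem_degreePart (p * s) (l := 3) rfl ha h2
  exact qcomm_mem_degreePart _ (l := 4) rfl h3 hb

lemma sq_mem_degreePart {a : Bosonization D} (ha : a ∈ degreePart D 1) : a ^ 2 ∈ degreePart D 2 := by
  rw [pow_two]
  exact mul_mem_degreePart (m := 1) (n := 1) rfl ha ha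

lemma homogenize_biIdeal_zero (hD : IsTypeA D) : ∀ z ∈ biIdeal (0 : DeformationData D) 0,
    homogenize D (Ideal.Quotient.mkₐ k (biIdeal (0 : DeformationData D) 0)) z = 0 := by
  have h := allRel_iff.1 (allRel_mk hD (0 : DeformationData D) 0)
  have q := quadRel_iff.1 h.1
  intro z hz
  refine AllRel.eq_zero hD (allRel_iff.2 ⟨quadRel_iff.2 ⟨fun i j hij => ?_, fun i => ?_⟩,
    fun i j l hij hjl => ?_⟩) hz
  · rw [homogenize_eq D _ (n := 2), q.1 i j hij, map_zero]
    simpa [pairRel, biPair] using qcomm_mem_degreePart _ (l := 2) rfl (x_mem_degreePart D i) (x_mem_degreePart D j)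
  · rw [homogenize_eq D _ (n := 2), q.2 i, map_zero]
    simpa [squareRel, biSquare] using sq_mem_degreePart (x_mem_degreePart D i)
  · rw [homogenize_eq D _ (n := 4), h.2 i j l hij hjl, map_zero]
    simpa [serreRel, biSerre] using serreComm_mem_degreePart _ _ _ (x_mem_degreePart D i) (x_mem_degreePart D j) (x_mem_degreePart D l)

lemma biPair_mem_degreePart (i j : Fin θ) : biPair P P' i j ∈ degreePart D 0 := by
  have : biPair P P' i j = inH D (algebraMap k H (P.lam i j) - P'.lam i j • (D.g i * D.g j)) := by
    simp [biPair]
  rw [this]; exact inH_mem_degreePart D _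

lemma biSquare_mem_degreePart (i : Fin θ) : biSquare P P' i ∈ degreePart D 0 := by
  have : biSquare P P' i = inH D (algebraMap k H (P.mu i) - P'.mu i • D.g i ^ 2) := by
    simp [biSquare]
  rw [this]; exact inH_mem_degreePart D _

lemma biSerre_mem_degreePart (i j l : Fin θ) : biSerre P P' i j l ∈ degreePart D 0 := by
  have : biSerre P P' i j l = inH D (algebraMap k H (P.nu j) -
      P'.nu j • (D.g j ^ 2 * (D.g i * D.g l)) -
      (4 * D.q i j) • ((P.mu j * P'.lam i l) • (D.g i * D.g l) -
      (P'.mu j * P'.lam i l) • (D.g j ^ 2 * (D.g i * D.g l)))) := by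
    simp [biSerre]
  rw [this]; exact inH_mem_degreePart D _

lemma biPair_zero (i j : Fin θ) : biPair (0 : DeformationData D) 0 i j = 0 := by simp [biPair]

lemma biSquare_zero (i : Fin θ) : biSquare (0 : DeformationData D) 0 i = 0 := by simp [biSquare]

lemma biSerre_zero (i j l : Fin θ) : biSerre (0 : DeformationData D) 0 i j l = 0 := by simp [biSerre]

open Polynomial in
lemma homogenize_mul_mem (J : Ideal (Bosonization D)) [J.IsTwoSided] (t : Bosonization D)
    {w : (Bosonization D ⧸ J)[X]} (hw : ∀ n, w.coeff n ∈ below (k := k) J n) :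
    (∀ n, (homogenize D (Ideal.Quotient.mkₐ k J) t * w).coeff n ∈ below (k := k) J n) ∧
    ∀ n, (w * homogenize D (Ideal.Quotient.mkₐ k J) t).coeff n ∈ below (k := k) J n := by
  have hmono : ∀ m t, t ∈ degreePart D m → ∀ w : (Bosonization D ⧸ J)[X],
      (∀ n, w.coeff n ∈ below (k := k) J n) →
      (∀ n, (homogenize D (Ideal.Quotient.mkₐ k J) t * w).coeff n ∈ below (k := k) J n) ∧
      ∀ n, (w * homogenize D (Ideal.Quotient.mkₐ k J) t).coeff n ∈ below (k := k) J n := by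
    intro m t ht w hw
    rw [homogenize_eq D _ ht, ← C_mul_X_pow_eq_monomial]
    refine ⟨fun n => ?_, fun n => ?_⟩
    · rw [mul_assoc, coeff_C_mul, coeff_X_pow_mul']
      split_ifs with hmn
      · exact below_mul_mem J (by omega) (mk_mem_below J m.lt_succ_self ht) (hw (n - m))
      · rw [mul_zero]; exact zero_mem _
    · rw [← X_pow_mul_C, ← mul_assoc, coeff_mul_C, coeff_mul_X_pow']
      split_ifs with hmn
      · exact below_mul_mem (m := n - m) (n := m + 1) J (by omega) (hw (n - m)) (mk_mem_below J m.lt_succ_self ht)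
      · rw [zero_mul]; exact zero_mem _
  refine Bosonization.induction D (P := fun t => ∀ w : (Bosonization D ⧸ J)[X],
      (∀ n, w.coeff n ∈ below (k := k) J n) →
      (∀ n, (homogenize D (Ideal.Quotient.mkₐ k J) t * w).coeff n ∈ below (k := k) J n) ∧
      ∀ n, (w * homogenize D (Ideal.Quotient.mkₐ k J) t).coeff n ∈ below (k := k) J n)
    (fun i => hmono 1 _ (x_mem_degreePart D i)) (fun h => hmono 0 _ (inH_mem_degreePart D h))
    (fun a b ha hb w hw => ?_) (fun a b ha hb w hw => ?_) t w hw
  · rw [map_add, add_mul, mul_add]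
    simp only [coeff_add]
    exact ⟨fun n => add_mem ((ha w hw).1 n) ((hb w hw).1 n), fun n => add_mem ((ha w hw).2 n) ((hb w hw).2 n)⟩
  · rw [map_mul]
    refine ⟨?_, ?_⟩
    · rw [mul_assoc]; exact (ha _ (hb w hw).1).1
    · rw [← mul_assoc]; exact (hb _ (ha w hw).2).2

lemma degenerates_biIdeal (hD : IsTypeA D) :
    Degenerates (biIdeal (0 : DeformationData D) 0) (biIdeal P P') := by
  set J := biIdeal P P'
  have h := allRel_mk hD P P'
  have key : ∀ z ∈ biIdeal (0 : DeformationData D) 0, ∀ n,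
      (homogenize D (Ideal.Quotient.mkₐ k J) z).coeff n ∈ below (k := k) J n := by
    have hmono : ∀ m n t, t ∈ degreePart D m → Ideal.Quotient.mkₐ k J t ∈ below (k := k) J m →
        (homogenize D (Ideal.Quotient.mkₐ k J) t).coeff n ∈ below (k := k) J n := by
      intro m n t ht ht'
      rw [homogenize_eq D _ ht, Polynomial.coeff_monomial]
      split_ifs with e
      · exact e ▸ ht'
      · exact zero_mem _
    have hlow : ∀ n z, 0 < n → z ∈ degreePart D 0 → Ideal.Quotient.mkₐ k J z ∈ below (k := k) J n :=
      fun n z hn hz => mk_mem_below J hn hz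
    intro z hz
    refine relIdeal_induction (p := fun z => ∀ n,
      (homogenize D (Ideal.Quotient.mkₐ k J) z).coeff n ∈ below (k := k) J n) ?_ ?_ ?_ ?_ ?_ ?_ hz
    · intro z hz n
      cases hz with
      | pair i j hij =>
        rw [biPair_zero, sub_zero, inT_xPair]
        refine hmono 2 n _ (qcomm_mem_degreePart (D.q i j) (l := 2) rfl (x_mem_degreePart D i)
          (x_mem_degreePart D j)) ?_
        rw [map_qcomm, h.pair i j hij]
        exact hlow _ _ two_pos (biPair_mem_degreePart i j)
      | square i =>
        rw [biSquare_zero, sub_zero]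
        refine hmono 2 n _ (sq_mem_degreePart (x_mem_degreePart D i)) ?_
        rw [map_pow, h.square i]
        exact hlow _ _ two_pos (biSquare_mem_degreePart i)
      | serre i j l hij hjl =>
        rw [biSerre_zero, sub_zero, hD.inT_xSerre hjl]
        refine hmono 4 n _ (serreComm_mem_degreePart _ _ _ (x_mem_degreePart D i)
          (x_mem_degreePart D j) (x_mem_degreePart D l)) ?_
        rw [map_serreComm, h.serre i j l hij hjl]
        exact hlow _ _ four_pos (biSerre_mem_degreePart i j l)
    · intro n; simp
    · intro z w hz hw n
      rw [map_add, Polynomial.coeff_add]; exact add_mem (hz n) (hw n)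
    · intro z hz n
      rw [map_neg, Polynomial.coeff_neg]; exact neg_mem (hz n)
    · intro t z hz n
      rw [map_mul]
      exact (homogenize_mul_mem J t hz).1 n
    · intro z t hz n
      rw [map_mul]
      exact (homogenize_mul_mem J t hz).2 n
  intro n t ht hz
  have := key t hz n
  rwa [homogenize_eq D _ ht, Polynomial.coeff_monomial, if_pos rfl] at this

end biIdeal
end

section
open Bosonization
variable {k : Type u} [Field k] {H : Type v} [Ring H] [HopfAlgebra k H] {θ : ℕ}
variable {D : PrincipalRealization k H θ}

section general
lemma exists_comp_eq {M N P : Type*} [AddCommGroup M] [Module k M] [AddCommGroup N] [Module k N]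
    [AddCommGroup P] [Module k P] (f : M →ₗ[k] N) (g : M →ₗ[k] P) (h : LinearMap.ker f ≤ LinearMap.ker g) :
    ∃ e : N →ₗ[k] P, ∀ m, e (f m) = g m := by
  obtain ⟨e, he⟩ := LinearMap.exists_extend
    ((LinearMap.ker f).liftQ g h ∘ₗ (LinearMap.quotKerEquivRange f).symm.toLinearMap)
  refine ⟨e, fun m => ?_⟩
  have := congr($he ⟨f m, m, rfl⟩)
  rw [LinearMap.comp_apply, Submodule.subtype_apply] at this
  rw [this, LinearMap.comp_apply, LinearEquiv.coe_coe]
  have h2 : (LinearMap.quotKerEquivRange f).symm ⟨f m, m, rfl⟩ = (LinearMap.ker f).mkQ m :=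
    LinearMap.quotKerEquivRange_symm_apply_image f m ⟨m, rfl⟩
  rw [h2]
  simp

section comodule
variable {T : Type*} [Ring T] [Bialgebra k T] {A : Type*} [Ring A] [Algebra k A]
  {K : Type*} [Ring K] [HopfAlgebra k K] {ρ : A →ₐ[k] A ⊗[k] K}

lemma isComoduleAlgebra_of_surjective (f : T →ₐ[k] A) (hf : Function.Surjective f) (p : T →ₐ[k] K)
    (hp : ∀ t, comul (R := k) (p t) = Algebra.TensorProduct.map p p (comul t))
    (hp' : ∀ t, counit (R := k) (p t) = counit (R := k) t)
    (hρ : ∀ t, ρ (f t) = Algebra.TensorProduct.map f p (comul t)) : IsComoduleAlgebra ρ where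
  coassoc a := by
    obtain ⟨t, rfl⟩ := hf a
    have e1 : ∀ y : T ⊗[k] T,
        TensorProduct.assoc k _ _ _ (ρ.toLinearMap.rTensor _ (Algebra.TensorProduct.map f p y)) =
        TensorProduct.map f.toLinearMap (TensorProduct.map p.toLinearMap p.toLinearMap)
          (TensorProduct.assoc k _ _ _ (comul.rTensor _ y)) := by
      intro y
      induction y with
      | zero => simp
      | add a b ha hb => simp only [map_add, ha, hb]
      | tmul a b =>
        simp only [Algebra.TensorProduct.map_tmul, LinearMap.rTensor_tmul, AlgHom.toLinearMap_apply, hρ]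
        generalize (comul (R := k) a) = z
        induction z with
        | zero => simp
        | add a b ha hb => simp only [map_add, TensorProduct.add_tmul, ha, hb]
        | tmul a b => simp
    have e2 : ∀ y : T ⊗[k] T, comul.lTensor _ (Algebra.TensorProduct.map f p y) =
        TensorProduct.map f.toLinearMap (TensorProduct.map p.toLinearMap p.toLinearMap)
          (comul.lTensor _ y) := by
      intro y
      induction y with
      | zero => simp
      | add a b ha hb => simp only [map_add, ha, hb]
      | tmul a b =>
        simp only [Algebra.TensorProduct.map_tmul, LinearMap.lTensor_tmul, hp, TensorProduct.map_tmul,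
          AlgHom.toLinearMap_apply]
        rfl
    rw [hρ, e1, e2, coassoc_apply]
  counit a := by
    obtain ⟨t, rfl⟩ := hf a
    have e2 : ∀ y : T ⊗[k] T, counit.lTensor _ (Algebra.TensorProduct.map f p y) =
        TensorProduct.map f.toLinearMap LinearMap.id (counit.lTensor _ y) := by
      intro y
      induction y with
      | zero => simp
      | add a b ha hb => simp only [map_add, ha, hb]
      | tmul a b => simp only [Algebra.TensorProduct.map_tmul, LinearMap.lTensor_tmul, hp',
          TensorProduct.map_tmul, AlgHom.toLinearMap_apply, LinearMap.id_apply]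
    rw [hρ, e2, lTensor_counit_comul]
    simp

variable (ρ) in
/-- The colinear map `a ↦ f(a₀) a₁`. -/
def formMap (f : A →ₗ[k] k) : A →ₗ[k] K :=
  (TensorProduct.lid k _).toLinearMap ∘ₗ TensorProduct.map f LinearMap.id ∘ₗ ρ.toLinearMap

lemma comul_formMap (hρ : IsComoduleAlgebra ρ) (f : A →ₗ[k] k) (a : A) :
    comul (R := k) (formMap ρ f a) = TensorProduct.map (formMap ρ f) LinearMap.id (ρ a) := by
  have e1 : ∀ y : A ⊗[k] K, comul (R := k) (TensorProduct.lid k _ (TensorProduct.map f LinearMap.id y)) =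
      TensorProduct.lid k _ (TensorProduct.map f LinearMap.id (comul.lTensor _ y)) := by
    intro y
    induction y with
    | zero => simp
    | add a b ha hb => simp only [map_add, ha, hb]
    | tmul a b => simp
  have e2 : ∀ y : A ⊗[k] K, TensorProduct.map (formMap ρ f) LinearMap.id y =
      TensorProduct.lid k _ (TensorProduct.map f LinearMap.id
        (TensorProduct.assoc k _ _ _ (ρ.toLinearMap.rTensor _ y))) := by
    intro y
    induction y with
    | zero => simp
    | add a b ha hb => simp only [map_add, ha, hb]
    | tmul a b =>
      simp only [formMap, TensorProduct.map_tmul, LinearMap.comp_apply, LinearMap.rTensor_tmul,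
        AlgHom.toLinearMap_apply]
      generalize ρ a = z
      induction z with
      | zero => simp
      | add a b ha hb => simp only [map_add, TensorProduct.add_tmul, ha, hb]
      | tmul a b => simp [TensorProduct.smul_tmul']
  rw [e2, hρ.coassoc, ← e1]
  rfl

end comodule

variable (D) in
/-- The projection `T(V) # H → H`. -/
def projH : Bosonization D →ₐ[k] H :=
  lift (fun _ => 0) (AlgHom.id k H) (by rw [compat_iff]; intro i h; simp)

lemma projH_inH (h : H) : projH D (inH D h) = h := lift_inH _ _ _ h
lemma projH_x (i : Fin θ) : projH D (x D i) = 0 := lift_x _ _ _ i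
end general

section cleft
variable {J₀ : Ideal (Bosonization D)} [J₀.IsTwoSided] {J : Ideal (Bosonization D)} [J.IsTwoSided]
  (hρ : ∀ z ∈ J, mapComul (Ideal.Quotient.mkₐ k J) (Ideal.Quotient.mkₐ k J₀) z = 0)

/-- The coaction induced by the comultiplication of `T(V) # H`. -/
def coact : (Bosonization D ⧸ J) →ₐ[k] (Bosonization D ⧸ J) ⊗[k] (Bosonization D ⧸ J₀) :=
  Ideal.Quotient.liftₐ J _ hρ

lemma coact_mk (t : Bosonization D) : coact hρ (Ideal.Quotient.mkₐ k J t) =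
    Algebra.TensorProduct.map (Ideal.Quotient.mkₐ k J) (Ideal.Quotient.mkₐ k J₀) (comul t) := rfl

lemma coact_mk_x (i : Fin θ) : coact hρ (Ideal.Quotient.mkₐ k J (x D i)) =
    Ideal.Quotient.mkₐ k J (x D i) ⊗ₜ 1 +
      Ideal.Quotient.mkₐ k J (inH D (D.g i)) ⊗ₜ Ideal.Quotient.mkₐ k J₀ (x D i) := by
  rw [coact_mk, comul_x]; simp

lemma coact_mk_inH (h : H) : coact hρ (Ideal.Quotient.mkₐ k J (inH D h)) =
    TensorProduct.map ((Ideal.Quotient.mkₐ k J).toLinearMap ∘ₗ (inH D).toLinearMap)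
      ((Ideal.Quotient.mkₐ k J₀).toLinearMap ∘ₗ (inH D).toLinearMap) (comul h) := by
  rw [coact_mk, comul_inH]
  generalize (comul (R := k) h) = y
  induction y with
  | zero => simp
  | add a b ha hb => simp only [map_add, ha, hb]
  | tmul a b => simp

variable [J₀.IsHopfIdeal k]

lemma isComoduleAlgebra_coact : IsComoduleAlgebra (coact hρ) :=
  isComoduleAlgebra_of_surjective _ (Ideal.Quotient.mkₐ_surjective k J) (Ideal.Quotient.mkₐ k J₀)
    comul_mk counit_mk (coact_mk hρ)

variable (f₀ : (Bosonization D ⧸ J) →ₗ[k] k)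

/-- The colinear map `a ↦ f₀(a₀) a₁`. -/
def colinMap : (Bosonization D ⧸ J) →ₗ[k] Bosonization D ⧸ J₀ := formMap (coact hρ) f₀

lemma colinMap_mk (t : Bosonization D) : colinMap hρ f₀ (Ideal.Quotient.mkₐ k J t) =
    TensorProduct.lid k _ (TensorProduct.map (f₀ ∘ₗ (Ideal.Quotient.mkₐ k J).toLinearMap)
      (Ideal.Quotient.mkₐ k J₀).toLinearMap (comul t)) := by
  change TensorProduct.lid k _ (TensorProduct.map f₀ LinearMap.id (coact hρ (Ideal.Quotient.mkₐ k J t))) = _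
  rw [coact_mk]
  generalize (comul (R := k) t) = y
  induction y with
  | zero => simp
  | add a b ha hb => simp only [map_add, ha, hb]
  | tmul a b => simp

lemma comul_colinMap (a : Bosonization D ⧸ J) : comul (R := k) (colinMap hρ f₀ a) =
    TensorProduct.map (colinMap hρ f₀) LinearMap.id (coact hρ a) :=
  comul_formMap (isComoduleAlgebra_coact hρ) f₀ a

variable {f₀} (hf₀ : ∀ h, f₀ (Ideal.Quotient.mkₐ k J (inH D h)) = counit h)
include hf₀

lemma colinMap_inH (h : H) : colinMap hρ f₀ (Ideal.Quotient.mkₐ k J (inH D h)) =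
    Ideal.Quotient.mkₐ k J₀ (inH D h) := by
  have e : ∀ y : H ⊗[k] H, TensorProduct.lid k _ (TensorProduct.map (f₀ ∘ₗ (Ideal.Quotient.mkₐ k J).toLinearMap)
      (Ideal.Quotient.mkₐ k J₀).toLinearMap (Algebra.TensorProduct.map (inH D) (inH D) y)) =
      Ideal.Quotient.mkₐ k J₀ (inH D (TensorProduct.lid k _ (counit.rTensor H y))) := by
    intro y
    induction y with
    | zero => simp
    | add a b ha hb => simp only [map_add, ha, hb]
    | tmul a b => simp [-Ideal.Quotient.mkₐ_eq_mk, hf₀]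
  rw [colinMap_mk, comul_inH, e, rTensor_counit_comul]
  simp

lemma hasLeadingTerm_colinMap : HasLeadingTerm (colinMap hρ f₀) := by
  intro n t ht
  let φ : Bosonization D ⊗[k] Bosonization D →ₗ[k] Bosonization D ⧸ J₀ :=
    (TensorProduct.lid k _).toLinearMap ∘ₗ TensorProduct.map (f₀ ∘ₗ (Ideal.Quotient.mkₐ k J).toLinearMap - counit)
      (Ideal.Quotient.mkₐ k J₀).toLinearMap
  have e : ∀ y : Bosonization D ⊗[k] Bosonization D, φ y = TensorProduct.lid k _
      (TensorProduct.map (f₀ ∘ₗ (Ideal.Quotient.mkₐ k J).toLinearMap) (Ideal.Quotient.mkₐ k J₀).toLinearMap y) -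
      Ideal.Quotient.mkₐ k J₀ (TensorProduct.lid k _ (counit.rTensor _ y)) := by
    intro y
    induction y with
    | zero => simp
    | add a b ha hb => simp only [map_add, ha, hb]; abel
    | tmul a b => simp [φ, sub_smul]
  have e2 := e (comul t)
  rw [← colinMap_mk hρ, rTensor_counit_comul, TensorProduct.lid_tmul, one_smul] at e2
  rw [← e2]
  refine comul_mk_mem φ (fun i j hij a ha b hb => ?_) ht
  simp only [φ, LinearMap.comp_apply, TensorProduct.map_tmul, LinearEquiv.coe_coe, TensorProduct.lid_tmul]
  rcases Nat.eq_zero_or_pos i with rfl | hi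
  · obtain ⟨h, rfl⟩ := mem_degreePart_zero D ha
    simp [-Ideal.Quotient.mkₐ_eq_mk, hf₀, counit_inH]
  · exact Submodule.smul_mem _ _ (mk_mem_below J₀ (by omega) hb)

end cleft

section filtration
variable {J₀ : Ideal (Bosonization D)} [J₀.IsTwoSided] [J₀.IsHopfIdeal k]

lemma isCoalgFiltration_below : IsCoalgFiltration fun n => below (k := k) J₀ (n + 1) where
  mono m n h := below_mono J₀ (by omega)
  exhaustive c := by
    obtain ⟨n, hn⟩ := exists_mem_below (k := k) J₀ c
    exact ⟨n, below_mono J₀ n.le_succ hn⟩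
  comul_mem n c hc := by
    have : below J₀ (n + 1) ≤ (LinearMap.range (TensorProduct.map (below (k := k) J₀ (n + 1)).subtype
        (below (k := k) J₀ (n + 1)).subtype)).comap comul := by
      refine (below_le_iff J₀).2 fun i hi t ht => ?_
      rw [Submodule.mem_comap, comul_mk]
      refine comul_mk_mem (Algebra.TensorProduct.map (Ideal.Quotient.mkₐ k J₀) (Ideal.Quotient.mkₐ k J₀)).toLinearMap
        (fun i' j hij a ha b hb => ?_) ht
      exact ⟨(⟨_, mk_mem_below J₀ (by omega) ha⟩ : below (k := k) J₀ (n + 1)) ⊗ₜ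
        (⟨_, mk_mem_below J₀ (by omega) hb⟩ : below (k := k) J₀ (n + 1)), by simp⟩
    exact this hc
  comul_succ n c hc := by
    have : below J₀ (n + 1 + 1) ≤ (LinearMap.range (TensorProduct.map (below (k := k) J₀ (n + 1)).subtype
        (LinearMap.id : (Bosonization D ⧸ J₀) →ₗ[k] _)) ⊔
        LinearMap.range (TensorProduct.map (LinearMap.id : (Bosonization D ⧸ J₀) →ₗ[k] _)
          (below (k := k) J₀ (0 + 1)).subtype)).comap comul := by
      refine (below_le_iff J₀).2 fun i hi t ht => ?_
      rw [Submodule.mem_comap, comul_mk]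
      refine comul_mk_mem (Algebra.TensorProduct.map (Ideal.Quotient.mkₐ k J₀) (Ideal.Quotient.mkₐ k J₀)).toLinearMap
        (fun i' j hij a ha b hb => ?_) ht
      by_cases h : i' < n + 1
      · exact Submodule.mem_sup_left ⟨(⟨_, mk_mem_below J₀ h ha⟩ : below (k := k) J₀ (n + 1)) ⊗ₜ
          (Ideal.Quotient.mkₐ k J₀ b), by simp⟩
      · exact Submodule.mem_sup_right ⟨(Ideal.Quotient.mkₐ k J₀ a) ⊗ₜ
          (⟨_, mk_mem_below J₀ (by omega) hb⟩ : below (k := k) J₀ (0 + 1)), by simp⟩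
    exact this hc

end filtration

section section_
variable {J₀ : Ideal (Bosonization D)} [J₀.IsTwoSided] [J₀.IsHopfIdeal k]
  {J : Ideal (Bosonization D)} [J.IsTwoSided]
  (hH : ∀ z ∈ J₀, projH D z = 0)

/-- `a ↦ S(π(a))` for the projection `π : K → H`, with values in a quotient of `T(V) # H`. -/
def antiProj (J : Ideal (Bosonization D)) [J.IsTwoSided] : WithConv ((Bosonization D ⧸ J₀) →ₗ[k] Bosonization D ⧸ J) :=
  toConv ((Ideal.Quotient.mkₐ k J).toLinearMap ∘ₗ (inH D).toLinearMap ∘ₗ antipode k ∘ₗ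
    (Ideal.Quotient.liftₐ J₀ _ hH).toLinearMap)

lemma antiProj_inH (h : H) : (antiProj hH J).ofConv (Ideal.Quotient.mkₐ k J₀ (inH D h)) =
    Ideal.Quotient.mkₐ k J (inH D (antipode k h)) := by
  have : Ideal.Quotient.liftₐ J₀ _ hH (Ideal.Quotient.mkₐ k J₀ (inH D h)) = h := projH_inH (D := D) h
  simp only [antiProj, LinearMap.comp_apply, AlgHom.toLinearMap_apply, this]

lemma conv_inH {B : Type*} [Ring B] [Algebra k B] {f g : WithConv ((Bosonization D ⧸ J₀) →ₗ[k] B)}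
    {f' g' : H →ₗ[k] B}
    (hf : ∀ h, f.ofConv (Ideal.Quotient.mkₐ k J₀ (inH D h)) = f' h)
    (hg : ∀ h, g.ofConv (Ideal.Quotient.mkₐ k J₀ (inH D h)) = g' h) (h : H) :
    (f * g).ofConv (Ideal.Quotient.mkₐ k J₀ (inH D h)) = (toConv f' * toConv g').ofConv h := by
  rw [convMul_eq, comul_mk, comul_inH, convMul_eq]
  generalize (comul (R := k) h) = y
  induction y with
  | zero => simp
  | add a b ha hb => simp only [map_add, ha, hb]
  | tmul a b => simp [-Ideal.Quotient.mkₐ_eq_mk, hf, hg]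

variable (J) in
/-- The map from `H` to a quotient of `T(V) # H`. -/
def quotH : H →ₐ[k] Bosonization D ⧸ J := (Ideal.Quotient.mkₐ k J).comp (inH D)

lemma quotH_mul_antipode : toConv (quotH J).toLinearMap * toConv ((quotH J).toLinearMap ∘ₗ antipode k) = 1 := by
  have := congr(convPost (quotH J) $(LinearMap.id_mul_antipode (R := k) (C := H)))
  rw [map_mul, map_one] at this
  exact this

lemma antipode_mul_quotH : toConv ((quotH J).toLinearMap ∘ₗ antipode k) * toConv (quotH J).toLinearMap = 1 := by
  have := congr(convPost (quotH J) $(LinearMap.antipode_mul_id (R := k) (C := H)))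
  rw [map_mul, map_one] at this
  exact this

variable (hρ : ∀ z ∈ J, mapComul (Ideal.Quotient.mkₐ k J) (Ideal.Quotient.mkₐ k J₀) z = 0)

include hH hρ in
lemma exists_form [Nontrivial (Bosonization D ⧸ J)] : ∃ f₀ : (Bosonization D ⧸ J) →ₗ[k] k,
    ∀ h, f₀ (Ideal.Quotient.mkₐ k J (inH D h)) = counit h := by
  refine exists_comp_eq ((Ideal.Quotient.mkₐ k J).toLinearMap ∘ₗ (inH D).toLinearMap) counit fun h hh => ?_
  have e1 := congr(LinearMap.mul' k _ (TensorProduct.map LinearMap.id (antiProj hH J).ofConv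
    $(coact_mk_inH hρ h)))
  have hh' : Ideal.Quotient.mkₐ k J (inH D h) = 0 := hh
  rw [hh', map_zero, map_zero, map_zero] at e1
  have e2 := congr(($(quotH_mul_antipode (J := J))).ofConv h)
  rw [LinearMap.mem_ker]
  apply (algebraMap k (Bosonization D ⧸ J)).injective
  rw [map_zero, e1]
  refine e2.symm.trans ?_
  rw [convMul_eq]
  generalize (comul (R := k) h) = y
  induction y with
  | zero => simp
  | add a b ha hb => simp only [map_add, ha, hb]
  | tmul a b =>
    simp only [TensorProduct.map_tmul, LinearMap.comp_apply, AlgHom.toLinearMap_apply, antiProj_inH]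
    rfl

variable (h₀ : ∀ z ∈ J₀, homogenize D (Ideal.Quotient.mkₐ k J₀) z = 0) (hJ : Degenerates J₀ J)
  {f₀ : (Bosonization D ⧸ J) →ₗ[k] k} (hf₀ : ∀ h, f₀ (Ideal.Quotient.mkₐ k J (inH D h)) = counit h)

/-- The colinear map as an isomorphism. -/
def colinEquiv : (Bosonization D ⧸ J₀) ≃ₗ[k] Bosonization D ⧸ J :=
  (LinearEquiv.ofBijective (colinMap hρ f₀) ((hasLeadingTerm_colinMap hρ hf₀).bijective h₀ hJ)).symm

lemma colinMap_colinEquiv (a : Bosonization D ⧸ J₀) : colinMap hρ f₀ (colinEquiv hρ h₀ hJ hf₀ a) = a :=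
  (LinearEquiv.ofBijective (colinMap hρ f₀) ((hasLeadingTerm_colinMap hρ hf₀).bijective h₀ hJ)).apply_symm_apply a

lemma colinEquiv_colinMap (a : Bosonization D ⧸ J) : colinEquiv hρ h₀ hJ hf₀ (colinMap hρ f₀ a) = a :=
  (LinearEquiv.ofBijective (colinMap hρ f₀) ((hasLeadingTerm_colinMap hρ hf₀).bijective h₀ hJ)).symm_apply_apply a

lemma colinEquiv_inH (h : H) : colinEquiv hρ h₀ hJ hf₀ (Ideal.Quotient.mkₐ k J₀ (inH D h)) =
    Ideal.Quotient.mkₐ k J (inH D h) := by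
  rw [← colinMap_inH hρ hf₀ h, colinEquiv_colinMap]

include hH in
lemma isUnit_colinEquiv : IsUnit (toConv (colinEquiv hρ h₀ hJ hf₀).toLinearMap) := by
  have hE : ∀ c ∈ below (k := k) J₀ (0 + 1), ∃ h, Ideal.Quotient.mkₐ k J₀ (inH D h) = c := by
    intro c hc
    obtain ⟨t, ht, hb⟩ := mem_below_succ J₀ hc
    rw [below_zero, Submodule.mem_bot, sub_eq_zero] at hb
    obtain ⟨h, rfl⟩ := mem_degreePart_zero D ht
    exact ⟨h, hb.symm⟩
  refine isCoalgFiltration_below.isUnit_of_mul (f := toConv (colinEquiv hρ h₀ hJ hf₀).toLinearMap) (g := antiProj hH J) ?_ ?_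
  · intro c hc
    obtain ⟨h, rfl⟩ := hE c hc
    rw [conv_inH (f := toConv (colinEquiv hρ h₀ hJ hf₀).toLinearMap) (f' := (quotH J).toLinearMap) (g' := (quotH J).toLinearMap ∘ₗ antipode k)
      (fun h => colinEquiv_inH hρ h₀ hJ hf₀ h) (fun h => antiProj_inH hH h), quotH_mul_antipode,
      counit_mk, counit_inH]
    simp
  · intro c hc
    obtain ⟨h, rfl⟩ := hE c hc
    rw [conv_inH (g := toConv (colinEquiv hρ h₀ hJ hf₀).toLinearMap) (g' := (quotH J).toLinearMap) (f' := (quotH J).toLinearMap ∘ₗ antipode k)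
      (fun h => antiProj_inH hH h) (fun h => colinEquiv_inH hρ h₀ hJ hf₀ h), antipode_mul_quotH,
      counit_mk, counit_inH]
    simp

/-- The section of the cleft object attached to a linear form. -/
def cleftSection : CleftSection (coact hρ) where
  γ := colinEquiv hρ h₀ hJ hf₀
  colinear a := by
    have e := comul_colinMap hρ f₀ (colinEquiv hρ h₀ hJ hf₀ a)
    rw [colinMap_colinEquiv] at e
    rw [e]
    generalize coact hρ (colinEquiv hρ h₀ hJ hf₀ a) = y
    induction y with
    | zero => simp
    | add a b ha hb => simp only [map_add, ← ha, ← hb]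
    | tmul a b => simp [colinEquiv_colinMap]
  map_one := by
    rw [← map_one (Ideal.Quotient.mkₐ k J₀), ← map_one (inH D), colinEquiv_inH, map_one, map_one]
  inv := ↑(isUnit_colinEquiv hH hρ h₀ hJ hf₀).unit⁻¹
  mul_inv := (isUnit_colinEquiv hH hρ h₀ hJ hf₀).mul_val_inv
  inv_mul := (isUnit_colinEquiv hH hρ h₀ hJ hf₀).val_inv_mul

end section_
end

section
open Bosonization
variable {k : Type u} [Field k] {H : Type v} [Ring H] [HopfAlgebra k H] {θ : ℕ}
variable {D : PrincipalRealization k H θ}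

section cleft
open Algebra.TensorProduct (includeLeft includeRight)
variable {T : Type*} [Ring T] [HopfAlgebra k T] {A : Type*} [Ring A] [Algebra k A]
  {K : Type*} [Ring K] [HopfAlgebra k K] {ρ : A →ₐ[k] A ⊗[k] K} (S : CleftSection ρ)
  (a : T →ₐ[k] A) (p : T →ₗc[k] K)

/-- The convolution inverse of an algebra map. -/
def antipodeComp : WithConv (T →ₗ[k] A) := toConv (a.toLinearMap ∘ₗ antipode k)

lemma mul_antipodeComp : toConv a.toLinearMap * antipodeComp a = 1 := by
  have := congr(convPost a $(LinearMap.id_mul_antipode (R := k) (C := T)))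
  rw [map_mul, map_one] at this
  exact this

lemma antipodeComp_mul : antipodeComp a * toConv a.toLinearMap = 1 := by
  have := congr(convPost a $(LinearMap.antipode_mul_id (R := k) (C := T)))
  rw [map_mul, map_one] at this
  exact this

/-- The gauge transformation `t ↦ a(t₁) γ⁻¹(p(t₂))`. -/
def gaugeA : WithConv (T →ₗ[k] A) := toConv a.toLinearMap * convPre p S.inv

/-- The inverse gauge transformation `t ↦ γ(p(t₁)) a(S(t₂))`. -/
def gaugeInvA : WithConv (T →ₗ[k] A) := convPre p S.c * antipodeComp a

lemma gaugeA_mul_gaugeInvA : gaugeA S a p * gaugeInvA S a p = 1 := by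
  rw [gaugeA, gaugeInvA, mul_assoc, ← mul_assoc (convPre p S.inv), S.pre_inv_mul_c, one_mul, mul_antipodeComp]

lemma gaugeInvA_mul_gaugeA : gaugeInvA S a p * gaugeA S a p = 1 := by
  rw [gaugeA, gaugeInvA, mul_assoc, ← mul_assoc (antipodeComp a), antipodeComp_mul, one_mul, S.pre_c_mul_inv]

variable (hρ : ∀ t, ρ (a t) = TensorProduct.map a.toLinearMap p.toLinearMap (comul t))
include hρ

lemma convPost_gaugeA : convPost ρ (gaugeA S a p) = convPost includeLeft (gaugeA S a p) := by
  have h1 : convPost ρ (toConv a.toLinearMap) = convPost includeLeft (toConv a.toLinearMap) *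
      convPre p (convPost includeRight (toConv LinearMap.id)) := by
    ext t
    refine (hρ t).trans (inl_mul_inr (toConv a.toLinearMap) (toConv p.toLinearMap) t).symm
  have h2 : convPost ρ (convPre p S.inv) =
      convPre p (convPost includeRight (toConv (antipode k))) * convPost includeLeft (convPre p S.inv) := by
    change convPre p (convPost ρ S.inv) = _
    rw [S.convPost_inv, map_mul]; rfl
  have h3 : convPost (includeRight : K →ₐ[k] A ⊗[k] K) (toConv LinearMap.id) *
      convPost (includeRight : K →ₐ[k] A ⊗[k] K) (toConv (antipode k)) = 1 := by
    rw [← map_mul, LinearMap.id_mul_antipode, map_one]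
  have h4 := congr(convPre p $h3)
  rw [map_mul, map_one] at h4
  rw [gaugeA, map_mul, h1, h2, map_mul]
  refine Eq.trans (by simp only [mul_assoc]; rfl) (congrArg₂ (· * ·) rfl ((mul_assoc _ _ _).symm.trans ?_))
  rw [h4, one_mul]

lemma convPost_gaugeInvA : convPost ρ (gaugeInvA S a p) = convPost includeLeft (gaugeInvA S a p) := by
  have h1 : convPost ρ (gaugeInvA S a p) * convPost ρ (gaugeA S a p) = 1 := by
    rw [← map_mul, gaugeInvA_mul_gaugeA, map_one]
  have h2 : convPost ρ (gaugeA S a p) * convPost includeLeft (gaugeInvA S a p) = 1 := by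
    rw [convPost_gaugeA S a p hρ, ← map_mul, gaugeA_mul_gaugeInvA, map_one]
  exact left_inv_eq_right_inv h1 h2

variable [Nontrivial A] (hA : IsComoduleAlgebra ρ)
include hA

lemma gauge_spec : convScalar A (S.form (gaugeA S a p)) = gaugeA S a p :=
  S.convScalar_form hA (convPost_gaugeA S a p hρ)

lemma gaugeInv_spec : convScalar A (S.form (gaugeInvA S a p)) = gaugeInvA S a p :=
  S.convScalar_form hA (convPost_gaugeInvA S a p hρ)

lemma gauge_mul_gaugeInv : S.form (gaugeA S a p) * S.form (gaugeInvA S a p) = 1 := by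
  apply convScalar_injective (B := A)
  rw [map_mul, gauge_spec S a p hρ hA, gaugeInv_spec S a p hρ hA, gaugeA_mul_gaugeInvA, map_one]

lemma gaugeInv_mul_gauge : S.form (gaugeInvA S a p) * S.form (gaugeA S a p) = 1 := by
  apply convScalar_injective (B := A)
  rw [map_mul, gauge_spec S a p hρ hA, gaugeInv_spec S a p hρ hA, gaugeInvA_mul_gaugeA, map_one]

omit hρ hA [Nontrivial A]

/-- The coalgebra map `t ↦ E(t₁) p(t₂) E⁻¹(t₃)` for the gauge transformation `E`. -/
def gaugedLin : WithConv (T →ₗ[k] K) :=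
  convScalar K (S.form (gaugeA S a p)) * toConv p.toLinearMap * convScalar K (S.form (gaugeInvA S a p))

lemma comp_gaugedLin {M : Type*} [Ring M] [Algebra k M] (φ : K →ₗ[k] M) :
    toConv (φ ∘ₗ (gaugedLin S a p).ofConv) =
    convScalar M (S.form (gaugeA S a p)) * toConv (φ ∘ₗ p.toLinearMap) *
      convScalar M (S.form (gaugeInvA S a p)) :=
  (comp_mul_convScalar _ _ _).trans (congrArg (· * _) (comp_convScalar_mul _ _ _))

variable [Nontrivial A]

/-- The gauge transform of `p` as a coalgebra map. -/
def gauged (hρ : ∀ t, ρ (a t) = TensorProduct.map a.toLinearMap p.toLinearMap (comul t))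
    (hA : IsComoduleAlgebra ρ) : T →ₗc[k] K where
  toLinearMap := (gaugedLin S a p).ofConv
  counit_comp := by
    have e : toConv ((counit : K →ₗ[k] k) ∘ₗ (gaugedLin S a p).ofConv) = 1 := by
      rw [comp_gaugedLin]
      have : toConv ((counit : K →ₗ[k] k) ∘ₗ p.toLinearMap) = 1 := by ext t; simp
      rw [this, mul_one, ← map_mul, gauge_mul_gaugeInv S a p hρ hA, map_one]
    ext t
    simpa using congr(($e).ofConv t)
  map_comp_comul := by
    have e : toConv ((comul : K →ₗ[k] K ⊗[k] K) ∘ₗ (gaugedLin S a p).ofConv) =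
        convPost includeLeft (gaugedLin S a p) * convPost includeRight (gaugedLin S a p) := by
      have h1 : toConv ((comul : K →ₗ[k] K ⊗[k] K) ∘ₗ p.toLinearMap) =
          convPost includeLeft (toConv p.toLinearMap) * convPost includeRight (toConv p.toLinearMap) := by
        ext t
        rw [inl_mul_inr]
        exact (congr($(p.map_comp_comul) t)).symm
      rw [comp_gaugedLin, h1, gaugedLin, map_mul, map_mul, map_mul, map_mul, convPost_convScalar,
        convPost_convScalar, convPost_convScalar, convPost_convScalar]
      have h2 := congr(convScalar (K ⊗[k] K) $(gaugeInv_mul_gauge S a p hρ hA))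
      rw [map_mul, map_one] at h2
      generalize convScalar (K ⊗[k] K) (S.form (gaugeA S a p)) = E at *
      generalize convScalar (K ⊗[k] K) (S.form (gaugeInvA S a p)) = E' at *
      generalize convPost (includeLeft : K →ₐ[k] K ⊗[k] K) (toConv p.toLinearMap) = X
      generalize convPost (includeRight : K →ₐ[k] K ⊗[k] K) (toConv p.toLinearMap) = Y
      calc E * (X * Y) * E' = E * X * 1 * Y * E' := by simp only [mul_one, mul_assoc]
        _ = _ := by rw [← h2]; simp only [mul_assoc]
    ext t
    rw [LinearMap.comp_apply, ← inl_mul_inr]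
    exact (congr(($e).ofConv t)).symm

lemma j_gauged (hρ : ∀ t, ρ (a t) = TensorProduct.map a.toLinearMap p.toLinearMap (comul t))
    (hA : IsComoduleAlgebra ρ) (t : T) : S.j.ofConv (gauged S a p hρ hA t) =
      TensorProduct.map a.toLinearMap (CleftSection.opL ∘ₗ a.toLinearMap ∘ₗ antipode k) (comul t) := by
  have e := comp_gaugedLin S a p S.j.ofConv
  have h1 : toConv (S.j.ofConv ∘ₗ p.toLinearMap) =
      convPost includeLeft (convPre p S.c) * convPost includeRight (convPre p S.invOp) := by
    change convPre p S.j = _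
    rw [CleftSection.j, map_mul]; rfl
  have h2 : convScalar (A ⊗[k] Aᵐᵒᵖ) (S.form (gaugeA S a p)) = convPost includeLeft (gaugeA S a p) := by
    rw [← convPost_convScalar (includeLeft : A →ₐ[k] A ⊗[k] Aᵐᵒᵖ), gauge_spec S a p hρ hA]
  have h3 : convScalar (A ⊗[k] Aᵐᵒᵖ) (S.form (gaugeInvA S a p)) =
      convPost includeRight (convScalar Aᵐᵒᵖ (S.form (gaugeInvA S a p))) := by
    rw [← convPost_convScalar (includeRight : Aᵐᵒᵖ →ₐ[k] A ⊗[k] Aᵐᵒᵖ)]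
  have h4 : convPre p S.invOp * convScalar Aᵐᵒᵖ (S.form (gaugeInvA S a p)) =
      toConv (CleftSection.opL ∘ₗ (antipodeComp a).ofConv) := by
    refine (comp_mul_convScalar (CleftSection.opL : A →ₗ[k] Aᵐᵒᵖ) (S.form (gaugeInvA S a p))
      (convPre p S.inv)).symm.trans ?_
    rw [gaugeInv_spec S a p hρ hA, gaugeInvA, ← mul_assoc, S.pre_inv_mul_c, one_mul]
  have h5 : gaugeA S a p * convPre p S.c = toConv a.toLinearMap := by
    rw [gaugeA, mul_assoc, S.pre_inv_mul_c, mul_one]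
  rw [h1, h2, h3, ← mul_assoc, ← map_mul, h5, mul_assoc, ← map_mul, h4] at e
  exact (congr(($e).ofConv t)).trans (inl_mul_inr _ _ t)

end cleft

section factor
variable {T L K : Type*} [AddCommGroup T] [Module k T] [Coalgebra k T] [AddCommGroup L] [Module k L]
  [Coalgebra k L] [AddCommGroup K] [Module k K] [Coalgebra k K]

lemma exists_coalgHom_comp_eq (p : T →ₗc[k] L) (hp : Function.Surjective p) (g : T →ₗc[k] K)
    (h : ∀ t, p t = 0 → g t = 0) : ∃ e : L →ₗc[k] K, ∀ t, e (p t) = g t := by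
  obtain ⟨e, he⟩ := exists_comp_eq p.toLinearMap g.toLinearMap h
  have he' : ∀ t, e (p t) = g t := he
  refine ⟨{ toLinearMap := e, counit_comp := ?_, map_comp_comul := ?_ }, he⟩
  · ext z
    obtain ⟨t, rfl⟩ := hp z
    rw [LinearMap.comp_apply, he']
    simp
  · ext z
    obtain ⟨t, rfl⟩ := hp z
    rw [LinearMap.comp_apply, LinearMap.comp_apply, he', ← CoalgHomClass.map_comp_comul_apply p,
      ← CoalgHomClass.map_comp_comul_apply g]
    generalize (comul (R := k) t) = y
    induction y with
    | zero => simp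
    | add a b ha hb => simp only [map_add, ha, hb]
    | tmul a b => simp [he']

end factor

section leading
variable {J₀ : Ideal (Bosonization D)} [J₀.IsTwoSided]
  {f : WithConv (Bosonization D →ₗ[k] Bosonization D ⧸ J₀)} {s : WithConv (Bosonization D →ₗ[k] k)}

lemma convScalar_mul_leading (hs : ∀ h, s.ofConv (inH D h) = counit h)
    (hf : ∀ n, ∀ t ∈ degreePart D n, f.ofConv t ∈ below (k := k) J₀ (n + 1)) {n : ℕ} {t : Bosonization D}
    (ht : t ∈ degreePart D n) : (convScalar _ s * f).ofConv t - f.ofConv t ∈ below (k := k) J₀ n := by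
  have e : (convScalar _ s * f).ofConv t - f.ofConv t = (convScalar _ (s - 1) * f).ofConv t := by
    rw [map_sub, map_one, sub_mul, one_mul]; rfl
  rw [e, convMul_eq]
  refine comul_mk_mem (R := Bosonization D ⧸ J₀) (LinearMap.mul' k (Bosonization D ⧸ J₀) ∘ₗ TensorProduct.map (convScalar _ (s - 1)).ofConv f.ofConv) (fun i j hij a ha b hb => ?_) ht
  simp only [LinearMap.comp_apply, TensorProduct.map_tmul, LinearMap.mul'_apply, convScalar_apply,
    ← Algebra.smul_def]
  rcases Nat.eq_zero_or_pos i with rfl | hi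
  · obtain ⟨h, rfl⟩ := mem_degreePart_zero D ha
    have : (s - 1).ofConv (inH D h) = 0 := by
      change s.ofConv (inH D h) - (1 : WithConv (Bosonization D →ₗ[k] k)).ofConv (inH D h) = 0
      rw [hs]; simp [counit_inH]
    rw [this, zero_smul]; exact zero_mem _
  · exact Submodule.smul_mem _ _ (below_mono J₀ (by omega) (hf j b hb))

lemma mul_convScalar_leading (hs : ∀ h, s.ofConv (inH D h) = counit h)
    (hf : ∀ n, ∀ t ∈ degreePart D n, f.ofConv t ∈ below (k := k) J₀ (n + 1)) {n : ℕ} {t : Bosonization D}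
    (ht : t ∈ degreePart D n) : (f * convScalar _ s).ofConv t - f.ofConv t ∈ below (k := k) J₀ n := by
  have e : (f * convScalar _ s).ofConv t - f.ofConv t = (f * convScalar _ (s - 1)).ofConv t := by
    rw [map_sub, map_one, mul_sub, mul_one]; rfl
  rw [e, convMul_eq]
  refine comul_mk_mem (R := Bosonization D ⧸ J₀) (LinearMap.mul' k (Bosonization D ⧸ J₀) ∘ₗ TensorProduct.map f.ofConv (convScalar _ (s - 1)).ofConv) (fun i j hij a ha b hb => ?_) ht
  simp only [LinearMap.comp_apply, TensorProduct.map_tmul, LinearMap.mul'_apply, convScalar_apply,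
    ← Algebra.commutes, ← Algebra.smul_def]
  rcases Nat.eq_zero_or_pos j with rfl | hi
  · obtain ⟨h, rfl⟩ := mem_degreePart_zero D hb
    have : (s - 1).ofConv (inH D h) = 0 := by
      change s.ofConv (inH D h) - (1 : WithConv (Bosonization D →ₗ[k] k)).ofConv (inH D h) = 0
      rw [hs]; simp [counit_inH]
    rw [this, zero_smul]; exact zero_mem _
  · exact Submodule.smul_mem _ _ (below_mono J₀ (by omega) (hf i a ha))

end leading

section main
variable {J₀ : Ideal (Bosonization D)} [J₀.IsTwoSided] [J₀.IsHopfIdeal k]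
  {J : Ideal (Bosonization D)} [J.IsTwoSided]
  {JL : Ideal (Bosonization D)} [JL.IsTwoSided] [JL.IsHopfIdeal k]

variable (J₀) in
/-- The quotient map as a coalgebra map. -/
def mkCoalg : Bosonization D →ₗc[k] Bosonization D ⧸ J₀ where
  toLinearMap := (Ideal.Quotient.mkₐ k J₀).toLinearMap
  counit_comp := rfl
  map_comp_comul := rfl

variable (hH : ∀ z ∈ J₀, projH D z = 0)
  (hρ : ∀ z ∈ J, mapComul (Ideal.Quotient.mkₐ k J) (Ideal.Quotient.mkₐ k J₀) z = 0)
  (h₀ : ∀ z ∈ J₀, homogenize D (Ideal.Quotient.mkₐ k J₀) z = 0) (hJ : Degenerates J₀ J)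
  {f₀ : (Bosonization D ⧸ J) →ₗ[k] k} (hf₀ : ∀ h, f₀ (Ideal.Quotient.mkₐ k J (inH D h)) = counit h)
  [Nontrivial (Bosonization D ⧸ J)]

/-- The coalgebra map `T(V) # H → K` with leading term the projection, which describes the
isomorphism of the lifting with the coalgebra `K`. -/
def gaugedProj : Bosonization D →ₗc[k] Bosonization D ⧸ J₀ :=
  gauged (cleftSection hH hρ h₀ hJ hf₀) (Ideal.Quotient.mkₐ k J) (mkCoalg J₀) (coact_mk hρ)
    (isComoduleAlgebra_coact hρ)

lemma form_inH {F : WithConv (Bosonization D →ₗ[k] Bosonization D ⧸ J)} {h : H} {c : k}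
    (e : F.ofConv (inH D h) = algebraMap k _ c) :
    ((cleftSection hH hρ h₀ hJ hf₀).form F).ofConv (inH D h) = c := by
  set S := cleftSection hH hρ h₀ hJ hf₀
  have hs : S.γ.symm 1 = 1 := S.γ.symm_apply_eq.2 S.map_one.symm
  rw [CleftSection.form]
  simp [e, Algebra.algebraMap_eq_smul_one, hs]

lemma conv_inH' {B : Type*} [Ring B] [Algebra k B] {f g : WithConv (Bosonization D →ₗ[k] B)}
    {f' g' : H →ₗ[k] B} (hf : ∀ h, f.ofConv (inH D h) = f' h)
    (hg : ∀ h, g.ofConv (inH D h) = g' h) (h : H) :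
    (f * g).ofConv (inH D h) = (toConv f' * toConv g').ofConv h := by
  rw [convMul_eq, comul_inH, convMul_eq]
  generalize (comul (R := k) h) = y
  induction y with
  | zero => simp
  | add a b ha hb => simp only [map_add, ha, hb]
  | tmul a b => simp [hf, hg]

lemma gaugeInvA_inH (h : H) : (gaugeInvA (cleftSection hH hρ h₀ hJ hf₀) (Ideal.Quotient.mkₐ k J)
    (mkCoalg J₀)).ofConv (inH D h) = algebraMap k _ (counit h) := by
  rw [gaugeInvA, conv_inH' (f' := (quotH J).toLinearMap) (g' := (quotH J).toLinearMap ∘ₗ antipode k)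
    (fun h => colinEquiv_inH hρ h₀ hJ hf₀ h) (fun h => ?_), quotH_mul_antipode]
  · simp
  · have : antipode k (inH D h) = inH D (antipode k h) := unop_inH D h
    simp only [antipodeComp, LinearMap.comp_apply, this]
    rfl

lemma gaugeA_inH (h : H) : (gaugeA (cleftSection hH hρ h₀ hJ hf₀) (Ideal.Quotient.mkₐ k J)
    (mkCoalg J₀)).ofConv (inH D h) = algebraMap k _ (counit h) := by
  set S := cleftSection hH hρ h₀ hJ hf₀
  have h1 := congr(($(gaugeInvA_mul_gaugeA S (Ideal.Quotient.mkₐ k J) (mkCoalg J₀))).ofConv (inH D h))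
  rw [conv_inH' (f := gaugeInvA S (Ideal.Quotient.mkₐ k J) (mkCoalg J₀))
    (f' := (1 : WithConv (H →ₗ[k] Bosonization D ⧸ J)).ofConv)
    (g' := (gaugeA S (Ideal.Quotient.mkₐ k J) (mkCoalg J₀)).ofConv ∘ₗ (inH D).toLinearMap)
    (fun h => by rw [gaugeInvA_inH]; simp) (fun h => rfl), toConv_ofConv, one_mul] at h1
  refine Eq.trans h1 ?_
  simp [counit_inH]

lemma gaugedProj_leading {n : ℕ} {t : Bosonization D} (ht : t ∈ degreePart D n) :
    gaugedProj hH hρ h₀ hJ hf₀ t - Ideal.Quotient.mkₐ k J₀ t ∈ below (k := k) J₀ n := by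
  change (gaugedLin (cleftSection hH hρ h₀ hJ hf₀) (Ideal.Quotient.mkₐ k J) (mkCoalg J₀)).ofConv t - _ ∈ _
  rw [gaugedLin]
  set S := cleftSection hH hρ h₀ hJ hf₀
  set p : WithConv (Bosonization D →ₗ[k] Bosonization D ⧸ J₀) := toConv (mkCoalg J₀).toLinearMap with hp
  have h1 : ∀ n, ∀ t ∈ degreePart D n, p.ofConv t ∈ below (k := k) J₀ (n + 1) :=
    fun n t ht => mk_mem_below J₀ n.lt_succ_self ht
  have e1 : ∀ h, (S.form (gaugeA S (Ideal.Quotient.mkₐ k J) (mkCoalg J₀))).ofConv (inH D h) = counit h :=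
    fun h => form_inH hH hρ h₀ hJ hf₀ (gaugeA_inH hH hρ h₀ hJ hf₀ h)
  have e2 : ∀ h, (S.form (gaugeInvA S (Ideal.Quotient.mkₐ k J) (mkCoalg J₀))).ofConv (inH D h) = counit h :=
    fun h => form_inH hH hρ h₀ hJ hf₀ (gaugeInvA_inH hH hρ h₀ hJ hf₀ h)
  have h2 := fun n t (ht : t ∈ degreePart D n) => convScalar_mul_leading e1 h1 ht
  have h3 := mul_convScalar_leading e2 (fun n t ht => ?_) ht
    (f := convScalar _ (S.form (gaugeA S (Ideal.Quotient.mkₐ k J) (mkCoalg J₀))) * p)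
  · have := add_mem h3 (h2 n t ht)
    rwa [sub_add_sub_cancel] at this
  · have := add_mem (below_mono J₀ n.le_succ (h2 n t ht)) (h1 n t ht)
    rwa [sub_add_cancel] at this

variable (hL : ∀ z ∈ JL, mapComul (Ideal.Quotient.mkₐ k J) (mapAntipode (Ideal.Quotient.mkₐ k J)) z = 0)

lemma j_gaugedProj (t : Bosonization D) :
    (cleftSection hH hρ h₀ hJ hf₀).j.ofConv (gaugedProj hH hρ h₀ hJ hf₀ t) =
      mapComul (Ideal.Quotient.mkₐ k J) (mapAntipode (Ideal.Quotient.mkₐ k J)) t :=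
  j_gauged _ _ _ _ _ t

include hL in
lemma gaugedProj_eq_zero {z : Bosonization D} (hz : z ∈ JL) : gaugedProj hH hρ h₀ hJ hf₀ z = 0 := by
  apply (cleftSection hH hρ h₀ hJ hf₀).j_injective
  rw [j_gaugedProj, hL z hz, map_zero]

include hL in
lemma exists_liftingToK : ∃ e : (Bosonization D ⧸ JL) →ₗc[k] Bosonization D ⧸ J₀,
    ∀ t, e (mkCoalg JL t) = gaugedProj hH hρ h₀ hJ hf₀ t :=
  exists_coalgHom_comp_eq (mkCoalg JL) (Ideal.Quotient.mkₐ_surjective k JL) _ fun _ hz =>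
    gaugedProj_eq_zero hH hρ h₀ hJ hf₀ hL (Ideal.Quotient.eq_zero_iff_mem.1 hz)

/-- The coalgebra map from the lifting to `K`. -/
def liftingToK : (Bosonization D ⧸ JL) →ₗc[k] Bosonization D ⧸ J₀ :=
  (exists_liftingToK hH hρ h₀ hJ hf₀ hL).choose

lemma liftingToK_mk (t : Bosonization D) : liftingToK hH hρ h₀ hJ hf₀ hL (Ideal.Quotient.mkₐ k JL t) =
    gaugedProj hH hρ h₀ hJ hf₀ t :=
  (exists_liftingToK hH hρ h₀ hJ hf₀ hL).choose_spec t

lemma hasLeadingTerm_liftingToK : HasLeadingTerm (liftingToK hH hρ h₀ hJ hf₀ hL).toLinearMap := by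
  intro n t ht
  have := gaugedProj_leading hH hρ h₀ hJ hf₀ ht
  rw [← liftingToK_mk hH hρ h₀ hJ hf₀ hL] at this
  exact this

variable (hJL : Degenerates J₀ JL)

/-- The coalgebra isomorphism from `K` to the lifting. -/
def kEquivLifting : (Bosonization D ⧸ J₀) ≃ₗc[k] Bosonization D ⧸ JL :=
  (CoalgEquiv.ofBijective (f := liftingToK hH hρ h₀ hJ hf₀ hL)
    ((hasLeadingTerm_liftingToK hH hρ h₀ hJ hf₀ hL).bijective h₀ hJL)).symm

lemma ι_kEquivLifting (a : Bosonization D ⧸ J₀) :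
    Ideal.Quotient.liftₐ JL _ hL (kEquivLifting hH hρ h₀ hJ hf₀ hL hJL a) =
      (cleftSection hH hρ h₀ hJ hf₀).j.ofConv a := by
  obtain ⟨z, rfl⟩ := ((hasLeadingTerm_liftingToK hH hρ h₀ hJ hf₀ hL).bijective h₀ hJL).2 a
  have : kEquivLifting hH hρ h₀ hJ hf₀ hL hJL (liftingToK hH hρ h₀ hJ hf₀ hL z) = z :=
    (CoalgEquiv.ofBijective (f := liftingToK hH hρ h₀ hJ hf₀ hL)
    ((hasLeadingTerm_liftingToK hH hρ h₀ hJ hf₀ hL).bijective h₀ hJL)).symm_apply_apply z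
  obtain ⟨t, rfl⟩ := Ideal.Quotient.mkₐ_surjective k JL z
  refine (congrArg _ this).trans ?_
  refine Eq.trans ?_ (congrArg (cleftSection hH hρ h₀ hJ hf₀).j.ofConv (liftingToK_mk hH hρ h₀ hJ hf₀ hL t).symm)
  rw [j_gaugedProj]
  rfl

include hH h₀ hJ hL hJL in
lemma cleft_properties : IsCleftObject (coact hρ) ∧ IsSchauenburgHopfAlgebra (coact hρ) (Bosonization D ⧸ JL) ∧
    IsCocycleDeformation (k := k) (Bosonization D ⧸ J₀) (Bosonization D ⧸ JL) ∧
    GrIsomorphic (k := k) (quotFiltration JL) (quotDegree J₀) := by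
  obtain ⟨f₀, hf₀⟩ := exists_form hH hρ
  have hA := isComoduleAlgebra_coact hρ
  have hι := ι_kEquivLifting hH hρ h₀ hJ hf₀ hL hJL
  exact ⟨(cleftSection hH hρ h₀ hJ hf₀).isCleftObject hA,
    (cleftSection hH hρ h₀ hJ hf₀).isSchauenburgHopfAlgebra _ _ hι,
    (cleftSection hH hρ h₀ hJ hf₀).isCocycleDeformation hA _ _ hι,
    grIsomorphic h₀ hJL (hasLeadingTerm_liftingToK hH hρ h₀ hJ hf₀ hL)⟩

end main

section biIdeal

lemma projH_eq_zero (hD : IsTypeA D) : ∀ z ∈ biIdeal (0 : DeformationData D) 0, projH D z = 0 := by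
  intro z hz
  refine AllRel.eq_zero hD (P := 0) (P' := 0) (F := projH D) ?_ hz
  exact ⟨⟨fun i j _ => by simp [projH_x, biPair, qcomm], fun i => by simp [projH_x, biSquare]⟩,
    fun i j l _ _ => by simp [projH_x, biSerre, qcomm, serreComm]⟩

lemma biIdeal_properties (hD : IsTypeA D) (P : DeformationData D)
    [Nontrivial (Bosonization D ⧸ biIdeal P 0)] {J₀ J JL : Ideal (Bosonization D)}
    [J₀.IsTwoSided] [J.IsTwoSided] [JL.IsTwoSided] (e₀ : J₀ = biIdeal 0 0) (e : J = biIdeal P 0)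
    (eL : JL = biIdeal P P) : ∃ (_ : J₀.IsHopfIdeal k) (_ : JL.IsHopfIdeal k)
      (hρ : ∀ z ∈ J, mapComul (Ideal.Quotient.mkₐ k J) (Ideal.Quotient.mkₐ k J₀) z = 0),
      IsCleftObject (coact hρ) ∧ IsSchauenburgHopfAlgebra (coact hρ) (Bosonization D ⧸ JL) ∧
      IsCocycleDeformation (k := k) (Bosonization D ⧸ J₀) (Bosonization D ⧸ JL) ∧
      GrIsomorphic (k := k) (quotFiltration JL) (quotDegree J₀) := by
  subst e₀ e eL
  have i₀ := isHopfIdeal_biIdeal hD (0 : DeformationData D)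
  have iL := isHopfIdeal_biIdeal hD P
  have hA := allRel_mk hD P 0
  have hρ : ∀ z ∈ biIdeal P 0, mapComul (Ideal.Quotient.mkₐ k (biIdeal P 0))
      (Ideal.Quotient.mkₐ k (biIdeal (0 : DeformationData D) 0)) z = 0 := fun z hz =>
    (hA.mapComul hD (allRel_mk hD 0 0)).eq_zero hD hz
  refine ⟨i₀, iL, hρ, cleft_properties (projH_eq_zero hD) hρ (homogenize_biIdeal_zero hD)
    (degenerates_biIdeal hD) (fun z hz => ?_) (degenerates_biIdeal hD)⟩
  exact (hA.mapComul hD (hA.mapAntipode hD)).eq_zero hD hz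

end biIdeal
end

section
open Finset

/-- Braiding matrix of type `A` at `-1` on the nodes `0, 1, 2, …` with compatible deformation
parameters: `lam i j` belongs to the pair `i + 2 ≤ j` and `nu i` to the chain `i, i+1, i+2`.
The signs `e` form a second braiding matrix with the same symmetrization. -/
structure ChainData (k : Type u) [Field k] where
  q : ℕ → ℕ → k
  lam : ℕ → ℕ → k
  nu : ℕ → k
  q_self : ∀ i, q i i = -1
  q_adj : ∀ i, q i (i + 1) * q (i + 1) i = -1
  q_far : ∀ i j, i + 2 ≤ j → q i j * q j i = 1
  lam_q : ∀ i j, i + 2 ≤ j → lam i j ≠ 0 → ∀ a, q a i * q a j = 1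
  nu_q : ∀ i, nu i ≠ 0 → ∀ a, q a i * q a (i + 1) ^ 2 * q a (i + 2) = 1
  e : ℕ → ℕ → k
  e_sq : ∀ i j, e i j * e i j = 1
  e_self : ∀ i, e i i = -1
  e_symm : ∀ i j, i ≠ j → e i j * e j i = q i j * q j i
  lam_e : ∀ i j, i + 2 ≤ j → lam i j ≠ 0 → ∀ a, e a i * e a j = 1
  nu_e : ∀ i, nu i ≠ 0 → ∀ a, e a i * e a (i + 2) = 1

namespace ChainData
variable {k : Type u} [Field k] (C : ChainData k)

/-- The same parameters with the braiding matrix of signs. -/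
def sign : ChainData k where
  q := C.e
  lam := C.lam
  nu := C.nu
  q_self := C.e_self
  q_adj i := by rw [C.e_symm i (i + 1) (by omega), C.q_adj]
  q_far i j h := by rw [C.e_symm i j (by omega), C.q_far i j h]
  lam_q := C.lam_e
  nu_q i h a := by rw [pow_two, C.e_sq, mul_one, C.nu_e i h]
  e := C.e
  e_sq := C.e_sq
  e_self := C.e_self
  e_symm _ _ _ := rfl
  lam_e := C.lam_e
  nu_e := C.nu_e

/-- Two nodes which are distinct and not adjacent. -/
def Far (i j : ℕ) : Prop := i + 2 ≤ j ∨ j + 2 ≤ i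

/-- The parameter of the relation `x_i x_j = q_{ij} x_j x_i + lamS i j` for distant nodes in
either order. -/
def lamS (i j : ℕ) : k :=
  if i + 2 ≤ j then C.lam i j else if j + 2 ≤ i then -(C.q i j * C.lam j i) else 0

lemma q_ne_zero (i j : ℕ) : C.q i j ≠ 0 := by
  intro h
  rcases lt_trichotomy i j with hij | rfl | hij
  · rcases Nat.lt_or_ge (i + 1) j with h1 | h1
    · simpa [h] using C.q_far i j h1
    · obtain rfl : j = i + 1 := by omega
      simpa [h] using C.q_adj i
  · simpa [h] using C.q_self i
  · rcases Nat.lt_or_ge (j + 1) i with h1 | h1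
    · simpa [h] using C.q_far j i h1
    · obtain rfl : i = j + 1 := by omega
      simpa [h] using C.q_adj j

variable {C}

lemma Far.symm {i j : ℕ} (h : Far i j) : Far j i := Or.symm h

lemma Far.q_mul {i j : ℕ} (h : Far i j) : C.q i j * C.q j i = 1 := by
  rcases h with h | h
  · exact C.q_far i j h
  · rw [mul_comm, C.q_far j i h]

lemma lamS_q {i j : ℕ} (h : C.lamS i j ≠ 0) (a : ℕ) : C.q a i * C.q a j = 1 := by
  unfold lamS at h
  split_ifs at h with h1 h2
  · exact C.lam_q i j h1 h a
  · rw [mul_comm]; exact C.lam_q j i h2 (by rintro h0; simp [h0] at h) a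
  · exact absurd rfl h

lemma Far.lamS_symm {i j : ℕ} (h : Far i j) : C.lamS j i = -(C.q j i * C.lamS i j) := by
  unfold lamS
  rcases h with h | h
  · rw [if_neg (by omega), if_pos h, if_pos h]
  · rw [if_pos h, if_neg (by omega), if_pos h]
    linear_combination -C.lam j i * C.q_far j i h

variable (C)

/-- The character of `γ_l = e_0 + … + e_{l-1}`, with a sign at the node `0`. -/
def wt (l a : ℕ) : k := (if a = 0 then -1 else 1) * ∏ i ∈ range l, C.q a i

lemma wt_succ (l a : ℕ) : C.wt (l + 1) a = C.q a l * C.wt l a := by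
  rw [wt, wt, prod_range_succ]; ring

lemma wt_zero (a : ℕ) : C.wt 0 a = if a = 0 then -1 else 1 := by simp [wt]

lemma wt_ne_zero (l a : ℕ) : C.wt l a ≠ 0 := by
  induction l with
  | zero => rw [wt_zero]; split_ifs <;> simp
  | succ l ih => rw [wt_succ]; exact mul_ne_zero (C.q_ne_zero _ _) ih

/-- `q(γ_l, γ_m)`. -/
def form₂ (l m : ℕ) : k := ∏ i ∈ range l, ∏ j ∈ range m, C.q i j

lemma form₂_succ_right (l m : ℕ) :
    C.form₂ l (m + 1) = C.form₂ l m * ∏ i ∈ range l, C.q i m := by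
  simp [form₂, prod_range_succ, prod_mul_distrib]

lemma form₂_succ_left (l m : ℕ) :
    C.form₂ (l + 1) m = C.form₂ l m * ∏ j ∈ range m, C.q l j := by
  simp [form₂, prod_range_succ]

/-- The symmetrized form of `e_i` and `γ_l`, with the sign at the node `0`. -/
lemma wt_mul_prod (l i : ℕ) :
    C.wt l i * ∏ a ∈ range l, C.q a i = if l = i ∨ l = i + 1 then -1 else 1 := by
  induction l with
  | zero => rw [wt_zero]; simp [eq_comm]
  | succ l ih =>
    rw [prod_range_succ, wt_succ]
    have e : C.q i l * C.wt l i * ((∏ a ∈ range l, C.q a i) * C.q l i) =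
      (C.wt l i * ∏ a ∈ range l, C.q a i) * (C.q i l * C.q l i) := by ring
    rw [e, ih]
    rcases lt_trichotomy l i with h | rfl | h
    · rcases Nat.lt_or_ge (l + 1) i with h1 | h1
      · rw [mul_comm (C.q i l), C.q_far l i h1, if_neg (by omega), if_neg (by omega), mul_one]
      · obtain rfl : i = l + 1 := by omega
        rw [mul_comm (C.q _ l), C.q_adj, if_neg (by omega), if_pos (by omega), one_mul]
    · rw [C.q_self, if_pos (by omega), if_pos (by omega)]; ring
    · rcases Nat.lt_or_ge (i + 1) l with h1 | h1
      · rw [C.q_far i l h1, if_neg (by omega), if_neg (by omega), mul_one]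
      · obtain rfl : l = i + 1 := by omega
        rw [C.q_adj, if_pos (by omega), if_neg (by omega)]; ring

lemma prod_mul_prod (l i : ℕ) : (∏ j ∈ range l, C.q i j) * ∏ a ∈ range l, C.q a i =
    (if i = 0 then -1 else 1) * if l = i ∨ l = i + 1 then -1 else 1 := by
  rw [← C.wt_mul_prod, wt]
  split_ifs <;> ring

/-- Letters `x, y > 0` that are distinct pair to `-1`. -/
def sgn (x y : ℕ) : k := if x = 0 ∨ y = 0 ∨ x = y then 1 else -1

lemma form₂_symm (l m : ℕ) : C.form₂ l m * C.form₂ m l = sgn l m := by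
  induction m with
  | zero => simp [form₂, sgn]
  | succ m ih =>
    rw [form₂_succ_right, form₂_succ_left]
    have e : C.form₂ l m * (∏ i ∈ range l, C.q i m) * (C.form₂ m l * ∏ j ∈ range l, C.q m j) =
      (C.form₂ l m * C.form₂ m l) * ((∏ j ∈ range l, C.q m j) * ∏ i ∈ range l, C.q i m) := by ring
    rw [e, ih, C.prod_mul_prod, sgn, sgn]
    split_ifs <;> first | (exfalso; simp only [false_or] at *; omega) | (exfalso; omega) | ring

lemma form₂_self (l : ℕ) : C.form₂ l l = if l = 0 then 1 else -1 := by
  induction l with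
  | zero => simp [form₂]
  | succ l ih =>
    rw [form₂_succ_right, form₂_succ_left, ih, prod_range_succ]
    have := C.prod_mul_prod l l
    rw [if_pos (Or.inl rfl)] at this
    have e : (if l = 0 then (1 : k) else -1) * (∏ j ∈ range l, C.q l j) *
      ((∏ x ∈ range l, C.q x l) * C.q l l) = (if l = 0 then (1 : k) else -1) *
      ((∏ j ∈ range l, C.q l j) * (∏ x ∈ range l, C.q x l)) * C.q l l := by ring
    rw [e, this, C.q_self]
    split_ifs <;> first | (exfalso; omega) | ring

/-- `γ_a + γ_b - γ_c - γ_d` pairs trivially with all nodes. -/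
def Rel₄ (a b c d : ℕ) : Prop := ∀ i, C.wt a i * C.wt b i = C.wt c i * C.wt d i

variable {C}

lemma Rel₄.form {a b c d : ℕ} (h : C.Rel₄ a b c d) (l : ℕ) :
    C.form₂ l a * C.form₂ l b = C.form₂ l c * C.form₂ l d := by
  simp only [form₂, ← prod_mul_distrib]
  refine prod_congr rfl fun i _ => ?_
  have := h i
  simp only [wt] at this
  split_ifs at this <;> linear_combination this

/-- The number of coincidences between two words of four letters. -/
def meet (a b c d a' b' c' d' : ℕ) : ℕ :=
  let δ (x y : ℕ) : ℕ := if x = y then 1 else 0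
  δ a a' + δ a b' + δ a c' + δ a d' + δ b a' + δ b b' + δ b c' + δ b d' +
  δ c a' + δ c b' + δ c c' + δ c d' + δ d a' + δ d b' + δ d c' + δ d d'

variable [CharZero k]

/-- Words in the code meet evenly. -/
lemma Rel₄.even {a b c d a' b' c' d' : ℕ} (h : C.Rel₄ a b c d) (h' : C.Rel₄ a' b' c' d') :
    meet a b c d a' b' c' d' % 2 = 0 := by
  have key : ((sgn a a' * sgn b a') * (sgn a b' * sgn b b') : k) *
      ((sgn c c' * sgn d c') * (sgn c d' * sgn d d')) =
      ((sgn c a' * sgn d a') * (sgn c b' * sgn d b')) *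
      ((sgn a c' * sgn b c') * (sgn a d' * sgn b d')) := by
    simp only [← C.form₂_symm]
    have h1 := h.form a'; have h2 := h.form b'; have h3 := h.form c'; have h4 := h.form d'
    have k1 := h'.form a; have k2 := h'.form b; have k3 := h'.form c; have k4 := h'.form d
    calc _ = (C.form₂ a' a * C.form₂ a' b) * (C.form₂ b' a * C.form₂ b' b) *
          (C.form₂ c' c * C.form₂ c' d) * (C.form₂ d' c * C.form₂ d' d) *
          ((C.form₂ a a' * C.form₂ a b') * (C.form₂ b a' * C.form₂ b b') *
          (C.form₂ c c' * C.form₂ c d') * (C.form₂ d c' * C.form₂ d d')) := by ring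
      _ = (C.form₂ a' c * C.form₂ a' d) * (C.form₂ b' c * C.form₂ b' d) *
          (C.form₂ c' a * C.form₂ c' b) * (C.form₂ d' a * C.form₂ d' b) *
          ((C.form₂ a c' * C.form₂ a d') * (C.form₂ b c' * C.form₂ b d') *
          (C.form₂ c a' * C.form₂ c b') * (C.form₂ d a' * C.form₂ d b')) := by
        rw [h1, h2, h3, h4, k1, k2, k3, k4]
      _ = _ := by ring
  have s3 (x y : ℕ) : (sgn x y : k) = (-1) ^ (1 + (if x = 0 then 1 else 0) +
      (if y = 0 then 1 else 0) + (if x = y then 1 else 0) : ℕ) := by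
    unfold sgn
    split_ifs <;> first | omega | norm_num
  simp only [s3, ← pow_add] at key
  have key2 : ∀ m n : ℕ, ((-1 : k) ^ m = (-1) ^ n) → (m + n) % 2 = 0 := by
    intro m n e
    rcases Nat.even_or_odd m with hm | hm <;> rcases Nat.even_or_odd n with hn | hn
    · exact Nat.even_iff.1 (hm.add hn)
    · rw [hm.neg_one_pow, hn.neg_one_pow] at e; norm_num at e
    · rw [hm.neg_one_pow, hn.neg_one_pow] at e; norm_num at e
    · exact Nat.even_iff.1 (hm.add_odd hn)
  have := key2 _ _ key
  unfold meet
  simp only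
  omega

/-- Distinct letters have distinct weights. -/
lemma wt_injective {l m : ℕ} (h : ∀ a, C.wt l a = C.wt m a) : l = m := by
  have hR : C.Rel₄ l 0 m 0 := fun i => by rw [h]
  have h0 (x : ℕ) : C.form₂ x 0 = 1 := by simp [form₂]
  have h1 := hR.form l
  have h2 := hR.form m
  simp only [h0, mul_one] at h1 h2
  have h3 := C.form₂_symm l m
  rw [← h1, h2, form₂_self, form₂_self] at h3
  unfold sgn at h3
  split_ifs at h3 with a b c d e <;> first | omega | norm_num at h3

lemma Rel₄.eq_of_eq {a c d : ℕ} (h : C.Rel₄ a a c d) : c = d := by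
  by_contra hcd
  have ha := h.form a
  have hc := h.form c
  have hd := h.form d
  have s1 := C.form₂_symm a c
  have s2 := C.form₂_symm a d
  have s3 := C.form₂_symm c d
  have sq (x y : ℕ) : (sgn x y : k) ^ 2 = 1 := by unfold sgn; split_ifs <;> simp
  have e1 : (C.form₂ a a) ^ 2 = 1 := by rw [form₂_self]; split_ifs <;> simp
  have e2 : C.form₂ a c * C.form₂ a d = 1 := by rw [← ha, ← e1]; ring
  have e3 : (C.form₂ c a * C.form₂ d a) ^ 2 = 1 := by
    have : C.form₂ c a * C.form₂ d a = sgn a c * sgn a d := by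
      rw [← s1, ← s2]
      linear_combination (-(C.form₂ c a * C.form₂ d a)) * e2
    rw [this, mul_pow, sq, sq, mul_one]
  have e4 : (C.form₂ c a * C.form₂ d a) ^ 2 = C.form₂ c c * C.form₂ d d * sgn c d := by
    rw [← s3]
    linear_combination (C.form₂ d a * C.form₂ d a) * hc + C.form₂ c c * C.form₂ c d * hd
  rw [e3, form₂_self, form₂_self, sgn] at e4
  split_ifs at e4 <;> first | omega | norm_num at e4

end ChainData
end

section
open Finset

namespace ChainData
variable {k : Type u} [Field k] (C : ChainData k)

/-- The basis vectors (letters) of the natural module. -/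
abbrev z (l : ℕ) : ℕ →₀ k := Finsupp.single l 1

/-- The operator with matrix columns `f · j`. -/
def op (f : ℕ → ℕ → ℕ →₀ k) (j : ℕ) : (ℕ →₀ k) →ₗ[k] (ℕ →₀ k) :=
  Finsupp.linearCombination k fun r => f r j

lemma op_z (f : ℕ → ℕ → ℕ →₀ k) (j l : ℕ) : op f j (z l) = f l j := by
  simp [op]

lemma exists_of_op_ne {f : ℕ → ℕ → ℕ →₀ k} {j : ℕ} {v : ℕ →₀ k} {t : ℕ} (h : op f j v t ≠ 0) :
    ∃ r, v r ≠ 0 ∧ f r j t ≠ 0 := by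
  rw [op, Finsupp.linearCombination_apply, Finsupp.sum, Finsupp.finsetSum_apply] at h
  obtain ⟨r, hr, h⟩ := exists_ne_zero_of_sum_ne_zero h
  exact ⟨r, Finsupp.mem_support_iff.1 hr, fun h0 => h (by simp [h0])⟩

lemma op_congr {f g : ℕ → ℕ → ℕ →₀ k} {j : ℕ} {v : ℕ →₀ k}
    (h : ∀ r, v r ≠ 0 → f r j = g r j) : op f j v = op g j v := by
  rw [op, op, Finsupp.linearCombination_apply, Finsupp.linearCombination_apply]
  exact Finsupp.sum_congr fun r hr => by rw [h r (Finsupp.mem_support_iff.1 hr)]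

/-- The scalar by which `λ (1 - g_i g_j)` acts on `z_l`. -/
def defect (i j l : ℕ) : k := C.lamS i j * (1 - C.wt l i * C.wt l j)

/-- The scalar by which `g_i g_{i+1}² g_{i+2}` acts on `z_l`. -/
def wtSerre (i l : ℕ) : k := C.wt l i * C.wt l (i + 1) ^ 2 * C.wt l (i + 2)

/-- The value of `x_{a+1}` at `z_{a+3}` that is forced by the Serre relation at `z_a`. -/
def serreCol (f : ℕ → ℕ → ℕ →₀ k) (a : ℕ) : ℕ →₀ k :=
  (-(C.q a (a + 1) ^ 2 * C.q a (a + 2))⁻¹) •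
    ((C.nu a * (1 - C.wtSerre a a)) • z a -
      (op f a (op f (a + 1) (op f (a + 2) (f a (a + 1)))) +
      (C.q a (a + 1) * C.q a (a + 2) * C.q (a + 1) (a + 2)) •
        op f (a + 2) (op f (a + 1) (op f a (f a (a + 1)))) -
      (C.q a (a + 1) / C.q (a + 1) (a + 2)) •
        op f (a + 1) (op f a (op f (a + 1) (f a (a + 2))))))

/-- The column of `x_i` at `z_l` in terms of the previous columns. -/
def nextCol (f : ℕ → ℕ → ℕ →₀ k) (l i : ℕ) : ℕ →₀ k :=
  if i = l then z (l + 1)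
  else if l = 0 ∨ i + 1 = l then 0
  else if i + 2 = l then (if i = 0 then 0 else C.serreCol f (i - 1))
  else C.q i (l - 1) • op f (l - 1) (f (l - 1) i) + C.defect i (l - 1) (l - 1) • z (l - 1)

/-- The matrices of the natural module. -/
def col (l : ℕ) : ℕ → ℕ →₀ k :=
  C.nextCol (fun r => if _h : r < l then col r else 0) l
termination_by l

/-- The operator `x_i` of the natural module. -/
def A (i : ℕ) : (ℕ →₀ k) →ₗ[k] (ℕ →₀ k) := op C.col i

/-- The scalars by which the letters are rescaled when the order of the tensor factors is
reversed. -/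
def gauge (l : ℕ) : k := ∏ i ∈ range l, C.sign.wt i i

lemma gauge_succ (l : ℕ) : C.gauge (l + 1) = C.sign.wt l l * C.gauge l := by
  rw [gauge, prod_range_succ, mul_comm]; rfl

/-- A step of the operator `x_i` from `z_l` to `z_t`. -/
structure Step (i l t : ℕ) : Prop where
  wt : ∀ a, C.wt t a = C.q a i * C.wt l a
  wt_sign : ∀ a, C.sign.wt t a = C.e a i * C.sign.wt l a
  gauge : C.gauge t = C.sign.wt l i * C.gauge l
  cases : (i = l ∧ t = l + 1) ∨ (i ≠ l ∧ l ≠ i + 1 ∧ t < l ∧ (l + t) % 2 = 1)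

variable {C}

lemma nu_mul_wtSerre (i l : ℕ) : C.nu i * C.wtSerre i l =
    C.nu i * if i ≤ l ∧ l ≤ i + 3 then -1 else 1 := by
  by_cases h : C.nu i = 0
  · simp [h]
  have e : (∏ a ∈ range l, C.q a i) * (∏ a ∈ range l, C.q a (i + 1)) ^ 2 *
      ∏ a ∈ range l, C.q a (i + 2) = 1 := by
    rw [← prod_pow, ← prod_mul_distrib, ← prod_mul_distrib]
    exact prod_eq_one fun a _ => C.nu_q i h a
  have e₀ := C.wt_mul_prod l i
  have e₁ := C.wt_mul_prod l (i + 1)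
  have e₂ := C.wt_mul_prod l (i + 2)
  congr 1
  have e₃ : C.wtSerre i l = (C.wt l i * ∏ a ∈ range l, C.q a i) *
      (C.wt l (i + 1) * ∏ a ∈ range l, C.q a (i + 1)) ^ 2 *
      (C.wt l (i + 2) * ∏ a ∈ range l, C.q a (i + 2)) := by
    rw [wtSerre]
    linear_combination -(C.wt l i * C.wt l (i + 1) ^ 2 * C.wt l (i + 2)) * e
  rw [e₃, e₀, e₁, e₂]
  split_ifs <;> first | (exfalso; omega) | ring

/-- `λ_{ij}` moves the letters `i, i+1, j, j+1` only. -/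
lemma lamS_mul_wt {i j : ℕ} (hij : Far i j) (l : ℕ) : C.lamS i j * (C.wt l i * C.wt l j) =
    C.lamS i j * if l = i ∨ l = i + 1 ∨ l = j ∨ l = j + 1 then -1 else 1 := by
  by_cases h : C.lamS i j = 0
  · simp [h]
  have e : (∏ a ∈ range l, C.q a i) * ∏ a ∈ range l, C.q a j = 1 := by
    rw [← prod_mul_distrib]
    exact prod_eq_one fun a _ => lamS_q h a
  have e₁ := C.wt_mul_prod l i
  have e₂ := C.wt_mul_prod l j
  congr 1
  have e₃ : C.wt l i * C.wt l j = (C.wt l i * ∏ a ∈ range l, C.q a i) *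
      (C.wt l j * ∏ a ∈ range l, C.q a j) := by linear_combination -(C.wt l i * C.wt l j) * e
  rw [e₃, e₁, e₂]
  unfold Far at hij
  split_ifs <;> first | (exfalso; omega) | ring

lemma z_ne_zero {l t : ℕ} (h : (z l : ℕ →₀ k) t ≠ 0) : t = l := by
  by_contra hne
  exact h (Finsupp.single_eq_of_ne hne)

lemma lamS_sign {i j : ℕ} (h : C.lamS i j ≠ 0) : C.sign.lamS i j ≠ 0 := by
  unfold lamS at h ⊢
  split_ifs at h ⊢ with h1 h2
  · exact h
  · refine neg_ne_zero.2 (mul_ne_zero (C.sign.q_ne_zero i j) fun h0 => h ?_)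
    rw [show C.lam j i = 0 from h0, mul_zero, neg_zero]
  · exact absurd rfl h

lemma sign_wt_succ (l a : ℕ) : C.sign.wt (l + 1) a = C.e a l * C.sign.wt l a :=
  C.sign.wt_succ l a

/-- The signs of distinct nodes commute up to the symmetrized braiding. -/
lemma Far.e_comm {i j : ℕ} (h : Far i j) : C.e i j = C.e j i := by
  have h1 : C.e i j * C.e j i = 1 := (h.q_mul (C := C.sign))
  linear_combination C.e j i * h1 - C.e i j * C.e_sq j i

lemma e_succ (a : ℕ) : C.e (a + 1) a = -C.e a (a + 1) := by
  have h1 : C.e a (a + 1) * C.e (a + 1) a = -1 := C.sign.q_adj a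
  linear_combination C.e a (a + 1) * h1 - C.e (a + 1) a * C.e_sq a (a + 1)

lemma gauge_add_three (a : ℕ) : C.sign.wt (a + 3) (a + 1) * C.gauge (a + 3) =
    C.e a (a + 1) ^ 2 * C.e (a + 1) (a + 2) ^ 2 * C.e a (a + 2) *
      (C.sign.wt a a * C.sign.wt a (a + 1) ^ 2 * C.sign.wt a (a + 2)) * C.gauge a := by
  have e₁ : C.e (a + 1) a = -C.e a (a + 1) := e_succ a
  have e₂ : C.e (a + 2) (a + 1) = -C.e (a + 1) (a + 2) := e_succ (a + 1)
  have e₃ : C.e (a + 2) a = C.e a (a + 2) := Far.e_comm (Or.inr le_rfl)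
  simp only [gauge_succ, sign_wt_succ, e₁, e₂, e₃, C.e_self]
  ring

lemma step_nextCol {f : ℕ → ℕ → ℕ →₀ k} {l : ℕ} (hf : ∀ r j t, f r j t ≠ 0 → C.Step j r t)
    {i t : ℕ} (h : C.nextCol f l i t ≠ 0) : C.Step i l t := by
  unfold nextCol at h
  split_ifs at h with h1 h2 h3 h4
  · obtain rfl := z_ne_zero h
    subst h1
    exact ⟨fun a => C.wt_succ _ a, fun a => sign_wt_succ _ a, C.gauge_succ _,
      Or.inl ⟨rfl, rfl⟩⟩
  · simp at h
  · simp at h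
  · obtain ⟨a, rfl⟩ : ∃ a, i = a + 1 := ⟨i - 1, by omega⟩
    obtain rfl : l = a + 3 := by omega
    have hw (x : ℕ) : C.wt (a + 3) x = C.q x (a + 2) * (C.q x (a + 1) * (C.q x a * C.wt a x)) := by
      rw [wt_succ, wt_succ, wt_succ]
    have hws (x : ℕ) : C.sign.wt (a + 3) x =
        C.e x (a + 2) * (C.e x (a + 1) * (C.e x a * C.sign.wt a x)) := by
      rw [sign_wt_succ, sign_wt_succ, sign_wt_succ]
    have e₁ : C.e (a + 1) a = -C.e a (a + 1) := e_succ a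
    have e₂ : C.e (a + 2) (a + 1) = -C.e (a + 1) (a + 2) := e_succ (a + 1)
    have e₃ : C.e (a + 2) a = C.e a (a + 2) := Far.e_comm (Or.inr le_rfl)
    rw [Nat.add_sub_cancel, serreCol, Finsupp.smul_apply, Finsupp.sub_apply, Finsupp.sub_apply,
      Finsupp.add_apply, Finsupp.smul_apply, Finsupp.smul_apply, Finsupp.smul_apply] at h
    rcases ne_or_eq ((C.nu a * (1 - C.wtSerre a a)) • (z a : ℕ →₀ k) t) 0 with h5 | h5
    · obtain rfl := z_ne_zero (right_ne_zero_of_smul h5)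
      have hν := left_ne_zero_of_mul (left_ne_zero_of_smul h5)
      have hνe := C.nu_e t hν
      refine ⟨fun x => ?_, fun x => ?_, ?_, Or.inr (by omega)⟩
      · rw [hw]
        linear_combination (-C.wt t x) * C.nu_q t hν x
      · rw [hws]
        linear_combination (-C.sign.wt t x) * hνe x -
          C.sign.wt t x * C.e x (t + 2) * C.e x t * C.e_sq x (t + 1)
      · have h6 : C.sign.wtSerre t t = -1 := by
          have := nu_mul_wtSerre (C := C.sign) t t
          rw [if_pos (by omega)] at this
          exact mul_left_cancel₀ hν this
        have h7 : C.e t (t + 2) = -1 := by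
          have := hνe t
          rw [C.e_self] at this
          linear_combination -this
        rw [gauge_add_three, h7, pow_two, pow_two, C.e_sq, C.e_sq]
        rw [wtSerre] at h6
        linear_combination C.gauge t * h6
    rcases ne_or_eq (op f a (op f (a + 1) (op f (a + 2) (f a (a + 1)))) t) 0 with h6 | h6
    · obtain ⟨r₁, h6, e₁'⟩ := exists_of_op_ne h6
      obtain ⟨r₂, h6, e₂'⟩ := exists_of_op_ne h6
      obtain ⟨r₃, h6, e₃'⟩ := exists_of_op_ne h6
      have s₁ := hf _ _ _ e₁'; have s₂ := hf _ _ _ e₂'; have s₃ := hf _ _ _ e₃'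
      have s₄ := hf _ _ _ h6
      refine ⟨fun x => ?_, fun x => ?_, ?_, Or.inr ?_⟩
      · rw [s₁.wt, s₂.wt, s₃.wt, s₄.wt, hw]; ring
      · rw [s₁.wt_sign, s₂.wt_sign, s₃.wt_sign, s₄.wt_sign, hws]; ring
      · simp only [gauge_add_three, s₁.gauge, s₂.gauge, s₃.gauge, s₄.gauge, s₂.wt_sign,
          s₃.wt_sign, s₄.wt_sign, e₁, e₂, e₃, C.e_self]
        ring
      · have := s₁.cases; have := s₂.cases; have := s₃.cases; have := s₄.cases
        omega
    rcases ne_or_eq (op f (a + 2) (op f (a + 1) (op f a (f a (a + 1)))) t) 0 with h7 | h7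
    · obtain ⟨r₁, h7, e₁'⟩ := exists_of_op_ne h7
      obtain ⟨r₂, h7, e₂'⟩ := exists_of_op_ne h7
      obtain ⟨r₃, h7, e₃'⟩ := exists_of_op_ne h7
      have s₁ := hf _ _ _ e₁'; have s₂ := hf _ _ _ e₂'; have s₃ := hf _ _ _ e₃'
      have s₄ := hf _ _ _ h7
      refine ⟨fun x => ?_, fun x => ?_, ?_, Or.inr ?_⟩
      · rw [s₁.wt, s₂.wt, s₃.wt, s₄.wt, hw]; ring
      · rw [s₁.wt_sign, s₂.wt_sign, s₃.wt_sign, s₄.wt_sign, hws]; ring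
      · simp only [gauge_add_three, s₁.gauge, s₂.gauge, s₃.gauge, s₄.gauge, s₂.wt_sign,
          s₃.wt_sign, s₄.wt_sign, e₁, e₂, e₃, C.e_self]
        ring
      · have := s₁.cases; have := s₂.cases; have := s₃.cases; have := s₄.cases
        omega
    rcases ne_or_eq (op f (a + 1) (op f a (op f (a + 1) (f a (a + 2)))) t) 0 with h8 | h8
    · obtain ⟨r₁, h8, e₁'⟩ := exists_of_op_ne h8
      obtain ⟨r₂, h8, e₂'⟩ := exists_of_op_ne h8
      obtain ⟨r₃, h8, e₃'⟩ := exists_of_op_ne h8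
      have s₁ := hf _ _ _ e₁'; have s₂ := hf _ _ _ e₂'; have s₃ := hf _ _ _ e₃'
      have s₄ := hf _ _ _ h8
      refine ⟨fun x => ?_, fun x => ?_, ?_, Or.inr ?_⟩
      · rw [s₁.wt, s₂.wt, s₃.wt, s₄.wt, hw]; ring
      · rw [s₁.wt_sign, s₂.wt_sign, s₃.wt_sign, s₄.wt_sign, hws]; ring
      · simp only [gauge_add_three, s₁.gauge, s₂.gauge, s₃.gauge, s₄.gauge, s₂.wt_sign,
          s₃.wt_sign, s₄.wt_sign, e₁, e₂, e₃, C.e_self]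
        ring
      · have := s₁.cases; have := s₂.cases; have := s₃.cases; have := s₄.cases
        omega
    · exfalso
      apply h
      rw [h6, h7, h8]
      rw [h5, smul_zero, smul_zero, add_zero, sub_zero, sub_zero, smul_zero]
  · obtain ⟨c, rfl⟩ : ∃ c, l = c + 1 := ⟨l - 1, by omega⟩
    have hfar : Far i c := by unfold Far; omega
    rw [Nat.add_sub_cancel, Finsupp.add_apply, Finsupp.smul_apply, Finsupp.smul_apply] at h
    rcases ne_or_eq (op f c (f c i) t) 0 with h5 | h5
    · obtain ⟨r₁, h5, e₁⟩ := exists_of_op_ne h5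
      have s₁ := hf _ _ _ e₁; have s₂ := hf _ _ _ h5
      refine ⟨fun x => ?_, fun x => ?_, ?_, Or.inr ?_⟩
      · rw [s₁.wt, s₂.wt, wt_succ]; ring
      · rw [s₁.wt_sign, s₂.wt_sign, sign_wt_succ]; ring
      · rw [s₁.gauge, s₂.gauge, s₂.wt_sign, gauge_succ, sign_wt_succ, hfar.e_comm]; ring
      · have := s₁.cases; have := s₂.cases
        omega
    · rw [h5, smul_zero, zero_add] at h
      obtain rfl := z_ne_zero (right_ne_zero_of_smul h)
      have hl : C.lamS i t ≠ 0 := left_ne_zero_of_mul (left_ne_zero_of_smul h)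
      have hs := lamS_q (lamS_sign hl)
      refine ⟨fun x => ?_, fun x => ?_, ?_, Or.inr (by omega)⟩
      · rw [wt_succ]
        linear_combination (-C.wt t x) * lamS_q hl x
      · rw [sign_wt_succ]
        change ∀ a, C.e a i * C.e a t = 1 at hs
        linear_combination (-C.sign.wt t x) * hs x
      · have h6 := lamS_mul_wt (C := C.sign) hfar t
        rw [if_pos (by omega)] at h6
        have h7 := mul_left_cancel₀ (lamS_sign hl) h6
        have h8 : C.e i i * C.e i t = 1 := hs i
        rw [C.e_self] at h8
        rw [gauge_succ, sign_wt_succ]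
        linear_combination C.gauge t * h7 + C.gauge t * C.sign.wt t i * C.sign.wt t t * h8

lemma step_col (l : ℕ) : ∀ i t, C.col l i t ≠ 0 → C.Step i l t := by
  induction l using Nat.strong_induction_on with
  | _ l ih =>
    intro i t h
    rw [col] at h
    refine step_nextCol (fun r j t hr => ?_) h
    by_cases hrl : r < l
    · rw [dif_pos hrl] at hr; exact ih r hrl j t hr
    · rw [dif_neg hrl] at hr; simp at hr

lemma exists_step {i : ℕ} {v : ℕ →₀ k} {t : ℕ} (h : C.A i v t ≠ 0) :
    ∃ r, v r ≠ 0 ∧ C.Step i r t := by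
  obtain ⟨r, hr, h⟩ := exists_of_op_ne h
  exact ⟨r, hr, step_col r i t h⟩

lemma step_of_ne {i l t : ℕ} (h : C.A i (z l) t ≠ 0) : C.Step i l t := by
  obtain ⟨r, hr, hs⟩ := exists_step h
  obtain rfl := z_ne_zero hr
  exact hs

variable (C)

lemma A_z (i l : ℕ) : C.A i (z l) = C.col l i := op_z _ _ _

lemma A_self (l : ℕ) : C.A l (z l) = z (l + 1) := by
  rw [A_z, col, nextCol, if_pos rfl]

lemma A_pred (l : ℕ) : C.A l (z (l + 1)) = 0 := by
  rw [A_z, col, nextCol, if_neg (by omega), if_pos (by omega)]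

lemma A_zero {i : ℕ} (hi : i ≠ 0) : C.A i (z 0) = 0 := by
  rw [A_z, col, nextCol, if_neg hi, if_pos (by omega)]

lemma A_zero_two : C.A 0 (z 2) = 0 := by
  rw [A_z, col, nextCol, if_neg (by omega), if_neg (by omega), if_pos (by omega), if_pos rfl]

lemma A_far {i l : ℕ} (h : Far i l) : C.A i (z (l + 1)) =
    C.q i l • C.A l (C.A i (z l)) + C.defect i l l • z l := by
  have h' := h
  unfold Far at h'
  rw [A_z, col]
  by_cases hi : i = l + 1
  · omega
  rw [nextCol, if_neg hi, if_neg (by omega), if_neg (by omega), Nat.add_sub_cancel,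
    dif_pos (Nat.lt_succ_self l), ← A_z]
  congr 2
  refine op_congr fun r hr => ?_
  have := (step_of_ne hr).cases
  rw [dif_pos (by omega)]

lemma A_serre (a : ℕ) : C.A a (C.A (a + 1) (C.A (a + 2) (C.A (a + 1) (z a)))) +
    (C.q a (a + 1) * C.q a (a + 2) * C.q (a + 1) (a + 2)) •
      C.A (a + 2) (C.A (a + 1) (C.A a (C.A (a + 1) (z a)))) -
    (C.q a (a + 1) / C.q (a + 1) (a + 2)) •
      C.A (a + 1) (C.A a (C.A (a + 1) (C.A (a + 2) (z a)))) -
    (C.q a (a + 1) ^ 2 * C.q a (a + 2)) • C.A (a + 1) (z (a + 3)) =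
    (C.nu a * (1 - C.wtSerre a a)) • z a := by
  have hne : C.q a (a + 1) ^ 2 * C.q a (a + 2) ≠ 0 :=
    mul_ne_zero (pow_ne_zero 2 (C.q_ne_zero _ _)) (C.q_ne_zero _ _)
  have key : C.A (a + 1) (z (a + 3)) = C.serreCol C.col a := by
    rw [A_z, col, nextCol, if_neg (by omega), if_neg (by omega), if_pos (by omega),
      if_neg (by omega), Nat.add_sub_cancel]
    set g : ℕ → ℕ → ℕ →₀ k := fun r => if h : r < a + 3 then C.col r else 0 with hg
    have e {j : ℕ} {v : ℕ →₀ k} (hv : ∀ r, v r ≠ 0 → r < a + 3) : op g j v = op C.col j v :=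
      op_congr fun r hr => by rw [hg]; simp only [dif_pos (hv r hr)]
    have ea : g a = C.col a := dif_pos (by omega)
    have b {j : ℕ} {v : ℕ →₀ k} {n : ℕ} (hv : ∀ r, v r ≠ 0 → r < n) :
        ∀ r, op C.col j v r ≠ 0 → r < n + 1 := fun r hr => by
      obtain ⟨t, ht, s⟩ := exists_step hr
      have := hv t ht; have := s.cases
      omega
    have c {j : ℕ} (hj : j ≠ a) : ∀ r, C.col a j r ≠ 0 → r < a := fun r hr => by
      have := (step_col a j r hr).cases
      omega
    have c₁ := c (j := a + 1) (by omega)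
    have c₂ := c (j := a + 2) (by omega)
    have w {v : ℕ →₀ k} {m n : ℕ} (h : m ≤ n) (hv : ∀ r, v r ≠ 0 → r < m) :
      ∀ r, v r ≠ 0 → r < n := fun r hr => (hv r hr).trans_le h
    rw [serreCol, serreCol, ea]
    rw [e (j := a + 2) (w (by omega) c₁), e (j := a + 1) (w (by omega) (b c₁)),
      e (j := a) (w (by omega) (b (b c₁))), e (j := a) (w (by omega) c₁),
      e (j := a + 1) (w (by omega) (b c₁)), e (j := a + 2) (w (by omega) (b (b c₁))),
      e (j := a + 1) (w (by omega) c₂), e (j := a) (w (by omega) (b c₂)),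
      e (j := a + 1) (w (by omega) (b (b c₂)))]
  rw [key, serreCol, smul_smul, mul_neg, mul_inv_cancel₀ hne, neg_smul, one_smul]
  simp only [← A_z]
  change _ - -(_ - (C.A _ (C.A _ (C.A _ _)) + _ • C.A _ (C.A _ (C.A _ _)) -
    _ • C.A _ (C.A _ (C.A _ _)))) = _
  abel

end ChainData
end

section
open Finset

section Key
variable {k : Type u} [Field k] {V : Type v} [AddCommGroup V] [Module k V]

/-- The undeformed Serre operator of three consecutive nodes applied to a vector, for
`p = q_{ab}`, `r = q_{bc}`, `s = q_{ac}`. -/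
def serreVec (p r s : k) (A B C : V →ₗ[k] V) (v : V) : V :=
  A (B (C (B v))) + (p * s * r) • C (B (A (B v))) - (p / r) • B (A (B (C v))) -
    (p ^ 2 * s) • B (C (B (A v)))

lemma serreVec_comm {A B C M : V →ₗ[k] V} {v δ : V} {p r s x y w la lb lc lac α β γ μ : k}
    (hp : p ≠ 0) (hr : r ≠ 0) (hs : s ≠ 0) (hx : x ≠ 0) (hy : y ≠ 0) (hw : w ≠ 0)
    (hla : la ≠ 0 → x = -1 ∧ y = -p ∧ w = s)
    (hlb : lb ≠ 0 → x = p⁻¹ ∧ y = -1 ∧ w = -r)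
    (hlc : lc ≠ 0 → x = s⁻¹ ∧ y = r⁻¹ ∧ w = -1)
    (hlac : lac ≠ 0 → s = -1 ∧ r = -p ∧ w = x⁻¹)
    (b₀ : B (M v) = y • M (B v) + (lb * (1 - β * μ)) • v)
    (c_b : C (M (B v)) = w • M (C (B v)) + (lc * (1 - γ * μ * (-r⁻¹ * y⁻¹))) • B v)
    (b_cb : B (M (C (B v))) = y • M (B (C (B v))) +
      (lb * (1 - β * μ * (-y⁻¹) * (r * w⁻¹))) • C (B v))
    (a_bcb : A (M (B (C (B v)))) = x • M (A (B (C (B v)))) +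
      (la * (1 - α * μ * (p * y⁻¹) ^ 2 * (s * w⁻¹))) • B (C (B v)))
    (a_b : A (M (B v)) = x • M (A (B v)) + (la * (1 - α * μ * (p * y⁻¹))) • B v)
    (b_ab : B (M (A (B v))) = y • M (B (A (B v))) +
      (lb * (1 - β * μ * (-y⁻¹) * (-p⁻¹ * x⁻¹))) • A (B v))
    (c_bab : C (M (B (A (B v)))) = w • M (C (B (A (B v)))) +
      (lc * (1 - γ * μ * (-r⁻¹ * y⁻¹) ^ 2 * (s⁻¹ * x⁻¹))) • B (A (B v)))
    (c₀ : C (M v) = w • M (C v) + (lc * (1 - γ * μ)) • v)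
    (b_c : B (M (C v)) = y • M (B (C v)) + (lb * (1 - β * μ * (r * w⁻¹))) • C v)
    (a_bc : A (M (B (C v))) = x • M (A (B (C v))) +
      (la * (1 - α * μ * (s * w⁻¹) * (p * y⁻¹))) • B (C v))
    (b_abc : B (M (A (B (C v)))) = y • M (B (A (B (C v)))) +
      (lb * (1 - β * μ * (r * w⁻¹) * (-y⁻¹) * (-p⁻¹ * x⁻¹))) • A (B (C v)))
    (a₀ : A (M v) = x • M (A v) + (la * (1 - α * μ)) • v)
    (b_a : B (M (A v)) = y • M (B (A v)) + (lb * (1 - β * μ * (-p⁻¹ * x⁻¹))) • A v)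
    (c_ba : C (M (B (A v))) = w • M (C (B (A v))) +
      (lc * (1 - γ * μ * (s⁻¹ * x⁻¹) * (-r⁻¹ * y⁻¹))) • B (A v))
    (b_cba : B (M (C (B (A v)))) = y • M (B (C (B (A v)))) +
      (lb * (1 - β * μ * (-p⁻¹ * x⁻¹) * (-y⁻¹) * (r * w⁻¹))) • C (B (A v)) + δ)
    (bb : B (B v) = 0) (bbc : B (B (C v)) = 0) (bba : B (B (A v)) = 0)
    (ac : A (C v) = s • C (A v) + (lac * (1 - α * γ)) • v)
    (ac_b : A (C (B v)) = s • C (A (B v)) + (lac * (1 - α * γ * (p * -r⁻¹))) • B v) :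
    serreVec p r s A B C (M v) = (x * y ^ 2 * w) • M (serreVec p r s A B C v) -
      (p ^ 2 * s * (x * y * w)) • δ := by
  unfold serreVec
  simp only [b₀, c_b, b_cb, a_bcb, a_b, b_ab, c_bab, c₀, b_c, a_bc, b_abc, a₀, b_a, c_ba, b_cba,
    bb, bbc, bba, ac, ac_b, map_add, map_smul, map_sub, smul_zero, add_zero, map_zero]
  have H₁ : (y * w * y * (la * (1 - α * μ * (p * y⁻¹) ^ 2 * (s * w⁻¹)))) -
      p ^ 2 * s * (la * (1 - α * μ)) = 0 := by
    by_cases h : la = 0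
    · simp [h]
    · obtain ⟨rfl, rfl, rfl⟩ := hla h
      field_simp
      ring
  have H₂ : p * s * r * (y * x * y * (lc * (1 - γ * μ * (-r⁻¹ * y⁻¹) ^ 2 * (s⁻¹ * x⁻¹)))) -
      p / r * (lc * (1 - γ * μ)) = 0 := by
    by_cases h : lc = 0
    · simp [h]
    · obtain ⟨rfl, rfl, rfl⟩ := hlc h
      field_simp
      ring
  have H₃ : lb * (1 - β * μ) - p / r * (w * y * x * (lb *
      (1 - β * μ * (r * w⁻¹) * (-y⁻¹) * (-p⁻¹ * x⁻¹)))) = 0 := by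
    by_cases h : lb = 0
    · simp [h]
    · obtain ⟨rfl, rfl, rfl⟩ := hlb h
      field_simp
      ring
  have H₄ : p * s * r * (lb * (1 - β * μ)) - p ^ 2 * s * (x * y * w * (lb *
      (1 - β * μ * (-p⁻¹ * x⁻¹) * (-y⁻¹) * (r * w⁻¹)))) = 0 := by
    by_cases h : lb = 0
    · simp [h]
    · obtain ⟨rfl, rfl, rfl⟩ := hlb h
      field_simp
      ring
  have H₅ : y * w * (lb * (1 - β * μ * (-y⁻¹) * (r * w⁻¹))) * s +
      p * s * r * (y * x * (lb * (1 - β * μ * (-y⁻¹) * (-p⁻¹ * x⁻¹)))) = 0 := by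
    by_cases h : lb = 0
    · simp [h]
    · obtain ⟨rfl, rfl, rfl⟩ := hlb h
      field_simp
      ring
  have H₆ : -(p / r) * (w * (lb * (1 - β * μ * (r * w⁻¹)))) * s -
      p ^ 2 * s * (x * (lb * (1 - β * μ * (-p⁻¹ * x⁻¹)))) = 0 := by
    by_cases h : lb = 0
    · simp [h]
    · obtain ⟨rfl, rfl, rfl⟩ := hlb h
      field_simp
      ring
  have H₇ : y * w * (lb * (1 - β * μ * (-y⁻¹) * (r * w⁻¹))) *
      (lac * (1 - α * γ * (p * -r⁻¹))) -
      (p / r) * (w * (lb * (1 - β * μ * (r * w⁻¹)))) * (lac * (1 - α * γ)) = 0 := by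
    by_cases h : lb = 0
    · simp [h]
    by_cases h' : lac = 0
    · simp [h']
    · obtain ⟨rfl, rfl, rfl⟩ := hlb h
      obtain ⟨rfl, rfl, -⟩ := hlac h'
      field_simp
      ring
  linear_combination (norm := module) H₁ • B (C (B v)) + H₂ • B (A (B v)) + H₃ • A (B (C v)) +
    H₄ • C (B (A v)) + H₅ • C (A (B v)) + H₆ • B (C (A v)) + H₇ • B v
end Key
end

section
open Finset

namespace ChainData
variable {k : Type u} [Field k] (C : ChainData k)

/-- The operator `g_i` of the natural module. -/
def G (i : ℕ) : (ℕ →₀ k) →ₗ[k] (ℕ →₀ k) :=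
  Finsupp.linearCombination k fun l => C.wt l i • z l

lemma G_z (i l : ℕ) : C.G i (z l) = C.wt l i • z l := by simp [G]

lemma G_apply (i : ℕ) (v : ℕ →₀ k) (l : ℕ) : C.G i v l = C.wt l i * v l := by
  induction v using Finsupp.induction_linear with
  | zero => simp
  | add v w hv hw => simp [hv, hw, mul_add]
  | single m c =>
    rw [← mul_one c, ← smul_eq_mul, ← Finsupp.smul_single, map_smul, G_z]
    by_cases h : l = m
    · subst h; simp [mul_comm]
    · simp [Finsupp.single_eq_of_ne h]

lemma G_A (i j : ℕ) (v : ℕ →₀ k) : C.G i (C.A j v) = C.q i j • C.A j (C.G i v) := by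
  induction v using Finsupp.induction_linear with
  | zero => simp
  | add v w hv hw => simp [hv, hw]
  | single m c =>
    rw [← mul_one c, ← smul_eq_mul, ← Finsupp.smul_single, map_smul, map_smul, map_smul, map_smul,
      G_z, map_smul]
    ext t
    simp only [Finsupp.smul_apply, G_apply, smul_eq_mul]
    by_cases h : C.A j (z m) t = 0
    · simp [h]
    · rw [(step_of_ne h).wt]; ring

/-- The commutation relation of two distant nodes at a vector. -/
def RelAt (i j : ℕ) (v : ℕ →₀ k) : Prop :=
  C.A i (C.A j v) = C.q i j • C.A j (C.A i v) + C.lamS i j • (v - C.G i (C.G j v))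

/-- The Serre relation at a vector. -/
def SerreAt (i : ℕ) (v : ℕ →₀ k) : Prop :=
  serreVec (C.q i (i + 1)) (C.q (i + 1) (i + 2)) (C.q i (i + 2)) (C.A i) (C.A (i + 1))
    (C.A (i + 2)) v = C.nu i • (v - C.G i (C.G (i + 1) (C.G (i + 1) (C.G (i + 2) v))))

/-- All letters of `v` are smaller than `n`. -/
def Below (n : ℕ) (v : ℕ →₀ k) : Prop := ∀ r, v r ≠ 0 → r < n

variable {C}

lemma below_z {l n : ℕ} (h : l < n) : Below n (z l : ℕ →₀ k) := fun _ hr => by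
  rw [z_ne_zero hr]; exact h

lemma Below.mono {m n : ℕ} (h : m ≤ n) {v : ℕ →₀ k} (hv : Below m v) : Below n v :=
  fun r hr => (hv r hr).trans_le h

lemma Below.A {n : ℕ} {v : ℕ →₀ k} (hv : Below n v) {j : ℕ} (hj : j + 1 ≠ n) :
    Below n (C.A j v) := fun r hr => by
  obtain ⟨t, ht, s⟩ := exists_step hr
  have := hv t ht; have := s.cases
  omega

lemma Below.A_succ {n : ℕ} {v : ℕ →₀ k} (hv : Below n v) (j : ℕ) :
    Below (n + 1) (C.A j v) := fun r hr => by
  obtain ⟨t, ht, s⟩ := exists_step hr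
  have := hv t ht; have := s.cases
  omega

lemma below_A_z {j l : ℕ} (h : j ≠ l) : Below l (C.A j (z l)) := fun r hr => by
  have := (step_of_ne hr).cases
  omega

lemma apply_eq_zero_of_below {W : Type*} [AddCommGroup W] [Module k W] (T : (ℕ →₀ k) →ₗ[k] W)
    {n : ℕ} (h : ∀ l < n, T (z l) = 0) {v : ℕ →₀ k} (hv : Below n v) : T v = 0 := by
  rw [← Finsupp.sum_single v, Finsupp.sum, map_sum]
  refine Finset.sum_eq_zero fun l hl => ?_
  rw [← mul_one (v l), ← smul_eq_mul, ← Finsupp.smul_single, map_smul,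
    h l (hv l (Finsupp.mem_support_iff.1 hl)), smul_zero]

lemma relAt_of_below {i j n : ℕ} (h : ∀ l < n, C.RelAt i j (z l)) {v : ℕ →₀ k}
    (hv : Below n v) : C.RelAt i j v := by
  have := apply_eq_zero_of_below (C.A i ∘ₗ C.A j - C.q i j • (C.A j ∘ₗ C.A i) -
    C.lamS i j • (LinearMap.id - C.G i ∘ₗ C.G j))
    (fun l hl => by
      have e := h l hl
      unfold RelAt at e
      simp only [LinearMap.sub_apply, LinearMap.comp_apply, LinearMap.smul_apply,
        LinearMap.id_apply, e]
      abel) hv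
  simp only [LinearMap.sub_apply, LinearMap.comp_apply, LinearMap.smul_apply,
        LinearMap.id_apply] at this
  unfold RelAt
  rw [← sub_eq_zero, ← this]
  abel

lemma serreAt_of_below {i n : ℕ} (h : ∀ l < n, C.SerreAt i (z l)) {v : ℕ →₀ k}
    (hv : Below n v) : C.SerreAt i v := by
  have := apply_eq_zero_of_below (C.A i ∘ₗ C.A (i + 1) ∘ₗ C.A (i + 2) ∘ₗ C.A (i + 1) +
    (C.q i (i + 1) * C.q i (i + 2) * C.q (i + 1) (i + 2)) •
      (C.A (i + 2) ∘ₗ C.A (i + 1) ∘ₗ C.A i ∘ₗ C.A (i + 1)) -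
    (C.q i (i + 1) / C.q (i + 1) (i + 2)) •
      (C.A (i + 1) ∘ₗ C.A i ∘ₗ C.A (i + 1) ∘ₗ C.A (i + 2)) -
    (C.q i (i + 1) ^ 2 * C.q i (i + 2)) •
      (C.A (i + 1) ∘ₗ C.A (i + 2) ∘ₗ C.A (i + 1) ∘ₗ C.A i) -
    C.nu i • (LinearMap.id - C.G i ∘ₗ C.G (i + 1) ∘ₗ C.G (i + 1) ∘ₗ C.G (i + 2)))
    (fun l hl => by
      have e := h l hl
      unfold SerreAt serreVec at e
      simp only [LinearMap.sub_apply, LinearMap.add_apply, LinearMap.comp_apply,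
        LinearMap.smul_apply, LinearMap.id_apply, e]
      abel) hv
  simp only [LinearMap.sub_apply, LinearMap.add_apply, LinearMap.comp_apply, LinearMap.smul_apply,
        LinearMap.id_apply] at this
  unfold SerreAt serreVec
  rw [← sub_eq_zero, ← this]

lemma RelAt.eq {i j : ℕ} {v : ℕ →₀ k} (h : C.RelAt i j v) {ω : k}
    (hω : C.G i (C.G j v) = ω • v) :
    C.A i (C.A j v) = C.q i j • C.A j (C.A i v) + (C.lamS i j * (1 - ω)) • v := by
  rw [h, hω]; module

lemma G_comm (i j : ℕ) (v : ℕ →₀ k) : C.G i (C.G j v) = C.G j (C.G i v) := by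
  ext l; simp only [G_apply]; ring

lemma RelAt.symm {i j : ℕ} (hij : Far i j) {v : ℕ →₀ k} (h : C.RelAt i j v) : C.RelAt j i v := by
  unfold RelAt at h ⊢
  rw [h, hij.lamS_symm, G_comm j i, smul_add, smul_smul, mul_comm (C.q j i), hij.q_mul]
  module

/-- The natural module satisfies the commutation relations on the letters smaller than `n` and the
Serre relations on the letters smaller than `m`. -/
structure RelBelow (n m : ℕ) : Prop where
  rel : ∀ i j, Far i j → ∀ l < n, C.RelAt i j (z l)
  serre : ∀ i, ∀ l < m, C.SerreAt i (z l)

section CharZero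
variable [CharZero k]

lemma Step.rel₄ {i l t : ℕ} (h : C.Step i l t) : C.Rel₄ (i + 1) l i t := fun a => by
  rw [wt_succ, h.wt]; ring

lemma Step.not_mem {i l t : ℕ} (h : C.Step i l t) (hil : i ≠ l) : t ≠ i ∧ t ≠ i + 1 := by
  have h1 := h.rel₄
  have h2 := h.cases
  refine ⟨?_, ?_⟩
  · rintro rfl
    have : C.Rel₄ t t (t + 1) l := fun a => (h1 a).symm
    have := this.eq_of_eq
    omega
  · rintro rfl
    refine hil (wt_injective (C := C) fun a => ?_)
    have := h1 a
    rw [mul_comm (C.wt i a)] at this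
    exact (mul_left_cancel₀ (C.wt_ne_zero _ _) this).symm

/-- Two consecutive lowering steps. -/
lemma Step.even {i l t i' l' t' : ℕ} (h : C.Step i l t) (h' : C.Step i' l' t') :
    meet (i + 1) l i t (i' + 1) l' i' t' % 2 = 0 := h.rel₄.even h'.rel₄

lemma A_apply_succ (j : ℕ) (v : ℕ →₀ k) : C.A j v (j + 1) = v j := by
  have h : Finsupp.lapply (j + 1) ∘ₗ C.A j = (Finsupp.lapply j : (ℕ →₀ k) →ₗ[k] k) := by
    ext l
    simp only [LinearMap.comp_apply, Finsupp.lsingle_apply, Finsupp.lapply_apply]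
    by_cases hjl : j = l
    · subst hjl; rw [A_self]; simp
    · rw [Finsupp.single_eq_of_ne hjl]
      by_contra h0
      exact ((step_of_ne h0).not_mem hjl).2 rfl
  exact LinearMap.congr_fun h v

variable (C) in
lemma A_sq (i : ℕ) (v : ℕ →₀ k) : C.A i (C.A i v) = 0 := by
  ext t
  by_contra h
  obtain ⟨r, hr, s₂⟩ := exists_step h
  obtain ⟨l, hl, s₁⟩ := exists_step hr
  have c₁ := s₁.cases; have c₂ := s₂.cases
  have ev := s₁.even s₂
  by_cases h1 : i = l
  · omega
  have n₁ := s₁.not_mem h1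
  have n₂ := s₂.not_mem (by omega)
  simp (disch := omega) only [meet, if_pos, if_neg, if_true] at ev
  omega

end CharZero

/-- Distant commutation passes through the creation operator of a third distant node. -/
lemma RelAt.step {i j m : ℕ} (hij : Far i j) (him : Far i m) (hjm : Far j m) {v : ℕ →₀ k}
    {χ : ℕ → k} (hv : ∀ a, C.G a v = χ a • v) (h₁ : C.RelAt i m v) (h₂ : C.RelAt j m v)
    (h₃ : C.RelAt i m (C.A j v)) (h₄ : C.RelAt j m (C.A i v)) (h₅ : C.RelAt i j v) :
    C.RelAt i j (C.A m v) := by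
  have e₁ := h₁.eq (ω := χ i * χ m) (by simp only [hv, map_smul, smul_smul]; ring_nf)
  have e₂ := h₂.eq (ω := χ j * χ m) (by simp only [hv, map_smul, smul_smul]; ring_nf)
  have e₃ := h₃.eq (ω := C.q i j * χ i * (C.q m j * χ m))
    (by simp only [hv, G_A, map_smul, smul_smul]; ring_nf)
  have e₄ := h₄.eq (ω := C.q j i * χ j * (C.q m i * χ m))
    (by simp only [hv, G_A, map_smul, smul_smul]; ring_nf)
  have e₅ := h₅.eq (ω := χ i * χ j) (by simp only [hv, map_smul, smul_smul]; ring_nf)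
  unfold RelAt
  have e₆ : C.G i (C.G j (C.A m v)) = (C.q i m * χ i * (C.q j m * χ j)) • C.A m v := by
    simp only [hv, G_A, map_smul, smul_smul]; ring_nf
  rw [e₆]
  simp only [e₁, e₂, e₃, e₄, map_add, map_smul]
  rw [e₅, map_add, map_smul, map_smul]
  have c₁ := hij.q_mul (C := C); have c₂ := him.q_mul (C := C); have c₃ := hjm.q_mul (C := C)
  have H₁ : C.lamS i m * (C.q j m - C.q i j) = 0 := by
    by_cases h : C.lamS i m = 0
    · simp [h]
    · have := lamS_q h j
      have : C.q j m = C.q i j := by linear_combination C.q i j * this - C.q j m * c₁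
      rw [this, sub_self, mul_zero]
  have H₂ : C.lamS j m * (1 - C.q i j * C.q i m) = 0 := by
    by_cases h : C.lamS j m = 0
    · simp [h]
    · rw [lamS_q h i, sub_self, mul_zero]
  have H₃ : C.lamS i j * (1 - C.q i m * C.q j m) = 0 := by
    by_cases h : C.lamS i j = 0
    · simp [h]
    · have := lamS_q h m
      have : C.q i m * C.q j m = 1 := by
        linear_combination C.q j m * C.q m j * c₂ + c₃ - C.q i m * C.q j m * this
      rw [this, sub_self, mul_zero]
  have H₄ : C.lamS i m * (C.q j m * (1 - C.q i j * χ i * (C.q m j * χ m)) -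
      C.q i j * (1 - χ i * χ m)) = 0 := by
    linear_combination (1 : k) * H₁ - C.lamS i m * C.q i j * χ i * χ m * c₃
  have H₅ : C.lamS j m * ((1 - χ j * χ m) -
      C.q i j * C.q i m * (1 - C.q j i * χ j * (C.q m i * χ m))) = 0 := by
    linear_combination (1 : k) * H₂ + C.lamS j m * χ j * χ m * (C.q i m * C.q m i * c₁ + c₂)
  have H₆ : C.lamS i j * (C.q i m * C.q j m * (1 - χ i * χ j) -
      (1 - C.q i m * χ i * (C.q j m * χ j))) = 0 := by
    linear_combination (-1 : k) * H₃
  linear_combination (norm := module) H₄ • C.A j v + H₅ • C.A i v + H₆ • C.A m v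

end ChainData
end

section
open Finset

namespace ChainData
variable {k : Type u} [Field k] {C : ChainData k}

variable (C) in
/-- The undeformed Serre operator at the nodes `a, a+1, a+2` applied to a vector. -/
def serre (a : ℕ) (v : ℕ →₀ k) : ℕ →₀ k :=
  serreVec (C.q a (a + 1)) (C.q (a + 1) (a + 2)) (C.q a (a + 2)) (C.A a) (C.A (a + 1))
    (C.A (a + 2)) v

set_option maxHeartbeats 1000000 in
lemma serre_A {a m : ℕ} (ha : Far a m) (hb : Far (a + 1) m) (hc : Far (a + 2) m)
    {v δ : ℕ →₀ k} {χ : ℕ → k} (hv : ∀ i, C.G i v = χ i • v)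
    (b₀ : C.RelAt (a + 1) m v) (c_b : C.RelAt (a + 2) m (C.A (a + 1) v))
    (b_cb : C.RelAt (a + 1) m (C.A (a + 2) (C.A (a + 1) v)))
    (a_bcb : C.RelAt a m (C.A (a + 1) (C.A (a + 2) (C.A (a + 1) v))))
    (a_b : C.RelAt a m (C.A (a + 1) v)) (b_ab : C.RelAt (a + 1) m (C.A a (C.A (a + 1) v)))
    (c_bab : C.RelAt (a + 2) m (C.A (a + 1) (C.A a (C.A (a + 1) v))))
    (c₀ : C.RelAt (a + 2) m v) (b_c : C.RelAt (a + 1) m (C.A (a + 2) v))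
    (a_bc : C.RelAt a m (C.A (a + 1) (C.A (a + 2) v)))
    (b_abc : C.RelAt (a + 1) m (C.A a (C.A (a + 1) (C.A (a + 2) v))))
    (a₀ : C.RelAt a m v) (b_a : C.RelAt (a + 1) m (C.A a v))
    (c_ba : C.RelAt (a + 2) m (C.A (a + 1) (C.A a v)))
    (b_cba : C.A (a + 1) (C.A m (C.A (a + 2) (C.A (a + 1) (C.A a v)))) =
      C.q (a + 1) m • C.A m (C.A (a + 1) (C.A (a + 2) (C.A (a + 1) (C.A a v)))) +
      C.lamS (a + 1) m • (C.A (a + 2) (C.A (a + 1) (C.A a v)) -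
        C.G (a + 1) (C.G m (C.A (a + 2) (C.A (a + 1) (C.A a v))))) + δ)
    (bb : ∀ w, C.A (a + 1) (C.A (a + 1) w) = 0)
    (ac : C.RelAt a (a + 2) v) (ac_b : C.RelAt a (a + 2) (C.A (a + 1) v)) :
    C.serre a (C.A m v) = (C.q a m * C.q (a + 1) m ^ 2 * C.q (a + 2) m) • C.A m (C.serre a v) -
      (C.q a (a + 1) ^ 2 * C.q a (a + 2) * (C.q a m * C.q (a + 1) m * C.q (a + 2) m)) • δ := by
  have hac : Far a (a + 2) := Or.inl le_rfl
  have hp := C.q_ne_zero a (a + 1); have hr := C.q_ne_zero (a + 1) (a + 2)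
  have hs := C.q_ne_zero a (a + 2); have hx := C.q_ne_zero a m
  have hy := C.q_ne_zero (a + 1) m; have hw := C.q_ne_zero (a + 2) m
  have f₁ : C.q m a = (C.q a m)⁻¹ := eq_inv_of_mul_eq_one_right ha.q_mul
  have f₂ : C.q m (a + 1) = (C.q (a + 1) m)⁻¹ := eq_inv_of_mul_eq_one_right hb.q_mul
  have f₃ : C.q m (a + 2) = (C.q (a + 2) m)⁻¹ := eq_inv_of_mul_eq_one_right hc.q_mul
  have f₄ : C.q (a + 2) a = (C.q a (a + 2))⁻¹ := eq_inv_of_mul_eq_one_right hac.q_mul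
  have f₅ : C.q (a + 1) a = -(C.q a (a + 1))⁻¹ := by
    have := C.q_adj a
    field_simp
    linear_combination this
  have f₆ : C.q (a + 2) (a + 1) = -(C.q (a + 1) (a + 2))⁻¹ := by
    have := C.q_adj (a + 1)
    field_simp
    linear_combination this
  have s₁ := C.q_self a; have s₂ := C.q_self (a + 1); have s₃ := C.q_self (a + 2)
  unfold serre
  refine serreVec_comm (la := C.lamS a m) (lb := C.lamS (a + 1) m) (lc := C.lamS (a + 2) m)
    (lac := C.lamS a (a + 2)) (α := χ a) (β := χ (a + 1)) (γ := χ (a + 2)) (μ := χ m)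
    hp hr hs hx hy hw (fun h => ?_) (fun h => ?_) (fun h => ?_) (fun h => ?_)
    (b₀.eq ?_) (c_b.eq ?_) (b_cb.eq ?_) (a_bcb.eq ?_) (a_b.eq ?_) (b_ab.eq ?_) (c_bab.eq ?_)
    (c₀.eq ?_) (b_c.eq ?_) (a_bc.eq ?_) (b_abc.eq ?_) (a₀.eq ?_) (b_a.eq ?_) (c_ba.eq ?_) ?_
    (bb _) (bb _) (bb _) (ac.eq ?_) (ac_b.eq ?_)
  · have h₁ := lamS_q h a; have h₂ := lamS_q h (a + 1); have h₃ := lamS_q h (a + 2)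
    rw [s₁] at h₁; rw [f₅] at h₂; rw [f₄] at h₃
    refine ⟨by linear_combination -h₁, ?_, ?_⟩
    · field_simp at h₂; linear_combination -h₂
    · field_simp at h₃; linear_combination h₃
  · have h₁ := lamS_q h a; have h₂ := lamS_q h (a + 1); have h₃ := lamS_q h (a + 2)
    rw [s₂] at h₂; rw [f₆] at h₃
    refine ⟨eq_inv_of_mul_eq_one_right h₁, by linear_combination -h₂, ?_⟩
    · field_simp at h₃; linear_combination -h₃
  · have h₁ := lamS_q h a; have h₂ := lamS_q h (a + 1); have h₃ := lamS_q h (a + 2)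
    rw [s₃] at h₃
    exact ⟨eq_inv_of_mul_eq_one_right h₁, eq_inv_of_mul_eq_one_right h₂,
      by linear_combination -h₃⟩
  · have h₁ := lamS_q h a; have h₂ := lamS_q h (a + 1); have h₃ := lamS_q h m
    rw [s₁] at h₁; rw [f₅] at h₂; rw [f₁, f₃] at h₃
    refine ⟨by linear_combination -h₁, ?_, ?_⟩
    · field_simp at h₂; linear_combination -h₂
    · field_simp at h₃ ⊢; linear_combination -h₃
  case refine_19 =>
    have e : C.G (a + 1) (C.G m (C.A (a + 2) (C.A (a + 1) (C.A a v)))) =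
        (χ (a + 1) * χ m * (-(C.q a (a + 1))⁻¹ * (C.q a m)⁻¹) * (-(C.q (a + 1) m)⁻¹) *
          (C.q (a + 1) (a + 2) * (C.q (a + 2) m)⁻¹)) •
        C.A (a + 2) (C.A (a + 1) (C.A a v)) := by
      simp only [hv, G_A, map_smul, smul_smul, f₁, f₂, f₃, f₄, f₅, f₆, s₁, s₂, s₃]
      congr 1; ring
    rw [b_cba, e]
    module
  all_goals
    simp only [hv, G_A, map_smul, smul_smul, f₁, f₂, f₃, f₄, f₅, f₆, s₁, s₂, s₃]
    congr 1; ring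

end ChainData
end

section
open Finset

namespace ChainData
variable {k : Type u} [Field k] {C : ChainData k}

variable (C) in
/-- The operator `g_a g_{a+1}² g_{a+2}`. -/
def GS (a : ℕ) (v : ℕ →₀ k) : ℕ →₀ k := C.G a (C.G (a + 1) (C.G (a + 1) (C.G (a + 2) v)))

lemma GS_A (a m : ℕ) (v : ℕ →₀ k) : C.GS a (C.A m v) =
    (C.q a m * C.q (a + 1) m ^ 2 * C.q (a + 2) m) • C.A m (C.GS a v) := by
  simp only [GS, G_A, map_smul, smul_smul]
  congr 1; ring

lemma nu_mul_q {a m : ℕ} (ha : Far a m) (hb : Far (a + 1) m) (hc : Far (a + 2) m) :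
    C.nu a * (C.q a m * C.q (a + 1) m ^ 2 * C.q (a + 2) m) = C.nu a := by
  by_cases h : C.nu a = 0
  · simp [h]
  have e := C.nu_q a h m
  have e₁ := ha.q_mul (C := C); have e₂ := hb.q_mul (C := C); have e₃ := hc.q_mul (C := C)
  have : (C.q a m * C.q (a + 1) m ^ 2 * C.q (a + 2) m) = 1 := by
    have e₄ : (C.q a m * C.q m a) * (C.q (a + 1) m * C.q m (a + 1)) ^ 2 *
      (C.q (a + 2) m * C.q m (a + 2)) = 1 := by rw [e₁, e₂, e₃]; ring
    linear_combination e₄ - (C.q a m * C.q (a + 1) m ^ 2 * C.q (a + 2) m) * e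
  rw [this, mul_one]

lemma nu_smul_A {a m : ℕ} (ha : Far a m) (hb : Far (a + 1) m) (hc : Far (a + 2) m)
    (v : ℕ →₀ k) : (C.q a m * C.q (a + 1) m ^ 2 * C.q (a + 2) m) •
      C.A m (C.nu a • (v - C.GS a v)) = C.nu a • (C.A m v - C.GS a (C.A m v)) := by
  rw [GS_A, map_smul, map_sub]
  have := nu_mul_q (C := C) ha hb hc
  linear_combination (norm := module) this • C.A m v

lemma relAt_creation {j l : ℕ} (h : Far j l) : C.RelAt j l (z l) := by
  unfold RelAt
  rw [A_self, A_far C h, defect, G_z, map_smul, G_z]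
  module

lemma serreAt_creation (a : ℕ) : C.SerreAt a (z a) := by
  have := C.A_serre a
  unfold SerreAt serreVec
  rw [A_self, A_self, A_self, this]
  simp only [G_z, map_smul, smul_smul, wtSerre]
  module

lemma G_z_weight (l : ℕ) : ∀ i, C.G i (z l) = C.wt l i • z l := fun i => C.G_z i l

section CharZero
variable [CharZero k]

lemma RelBelow.relAt {n m : ℕ} (h : C.RelBelow n m) {i j : ℕ} (hij : Far i j) {v : ℕ →₀ k}
    (hv : Below n v) : C.RelAt i j v := relAt_of_below (h.rel i j hij) hv

lemma RelBelow.serreAt {n m : ℕ} (h : C.RelBelow n m) (a : ℕ) {v : ℕ →₀ k}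
    (hv : Below m v) : C.SerreAt a v := serreAt_of_below (h.serre a) hv

lemma relAt_serre {a m : ℕ} (ha : Far a m) (hb : Far (a + 1) m) (hc : Far (a + 2) m)
    (h : C.RelBelow (a + 1) a) : C.RelAt (a + 1) m (z (a + 3)) := by
  have B₀ : Below (a + 1) (z a : ℕ →₀ k) := below_z (by omega)
  have B₁ : Below a (C.A (a + 1) (z a)) := below_A_z (by omega)
  have B₂ : Below a (C.A (a + 2) (z a)) := below_A_z (by omega)
  have m₁ {v : ℕ →₀ k} (hv : Below a v) : Below (a + 1) v := hv.mono (by omega)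
  have A₀ {v : ℕ →₀ k} (hv : Below a v) : Below a (C.A a v) := hv.A (by omega)
  have A₁ {v : ℕ →₀ k} (hv : Below a v) : Below a (C.A (a + 1) v) := hv.A (by omega)
  have A₂ {v : ℕ →₀ k} (hv : Below a v) : Below a (C.A (a + 2) v) := hv.A (by omega)
  have key := serre_A (C := C) ha hb hc (v := z a) (χ := fun i => C.wt a i) (G_z_weight a)
    (δ := C.A (a + 1) (C.A m (z (a + 3))) - C.q (a + 1) m • C.A m (C.A (a + 1) (z (a + 3))) -
      C.lamS (a + 1) m • (z (a + 3) - C.G (a + 1) (C.G m (z (a + 3)))))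
    (h.relAt hb B₀) (h.relAt hc (m₁ B₁)) (h.relAt hb (m₁ (A₂ B₁)))
    (h.relAt ha (m₁ (A₁ (A₂ B₁)))) (h.relAt ha (m₁ B₁)) (h.relAt hb (m₁ (A₀ B₁)))
    (h.relAt hc (m₁ (A₁ (A₀ B₁)))) (h.relAt hc B₀) (h.relAt hb (m₁ B₂))
    (h.relAt ha (m₁ (A₁ B₂))) (h.relAt hb (m₁ (A₀ (A₁ B₂)))) (h.relAt ha B₀)
    (by rw [A_self]; exact (relAt_creation hb.symm).symm hb.symm)
    (by rw [A_self, A_self]; exact (relAt_creation hc.symm).symm hc.symm)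
    (by rw [A_self, A_self, A_self]; abel)
    (C.A_sq _) (h.relAt (Or.inl le_rfl) B₀) (h.relAt (Or.inl le_rfl) (m₁ B₁))
  have hm : m ≠ a := by unfold Far at ha; omega
  have s₁ : C.serre a (C.A m (z a)) = C.nu a • (C.A m (z a) - C.GS a (C.A m (z a))) :=
    h.serreAt a (below_A_z hm)
  have s₂ : C.serre a (z a) = C.nu a • (z a - C.GS a (z a)) := serreAt_creation a
  rw [s₁, s₂, nu_smul_A ha hb hc, eq_comm, sub_eq_self] at key
  have := (smul_eq_zero.1 key).resolve_left (by simp [q_ne_zero])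
  unfold RelAt
  rw [← sub_eq_zero, ← this]
  abel

lemma relAt_two_steps (n : ℕ) : C.RelAt (n + 2) n (z (n + 4)) := by
  have h₁ : C.A (n + 2) (C.A n (z (n + 4))) = 0 := by
    ext t
    by_contra h
    obtain ⟨r, hr, s₂⟩ := exists_step h
    have s₁ := step_of_ne hr
    have c₁ := s₁.cases; have c₂ := s₂.cases
    have n₁ := s₁.not_mem (by omega); have n₂ := s₂.not_mem (by omega)
    have ev := s₁.even s₂
    simp (disch := omega) only [meet, if_pos, if_neg, if_true] at ev
    omega
  have h₂ : C.A n (C.A (n + 2) (z (n + 4))) = 0 := by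
    ext t
    by_contra h
    obtain ⟨r, hr, s₂⟩ := exists_step h
    have s₁ := step_of_ne hr
    have c₁ := s₁.cases; have c₂ := s₂.cases
    have n₁ := s₁.not_mem (by omega); have n₂ := s₂.not_mem (by omega)
    have ev := s₁.even s₂
    simp (disch := omega) only [meet, if_pos, if_neg, if_true] at ev
    omega
  unfold RelAt
  have e := lamS_mul_wt (C := C) (Or.inr le_rfl : Far (n + 2) n) (n + 4)
  rw [if_neg (by omega)] at e
  rw [h₁, h₂, G_z, map_smul, G_z, smul_zero, zero_add, smul_smul, smul_sub, smul_smul,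
    mul_comm (C.wt _ n), e]
  simp

lemma relAt_zero_two {m : ℕ} (hm : 3 ≤ m) : C.RelAt 0 m (z 2) := by
  have f₁ : Far m 1 := Or.inr hm
  have f₀ : Far m 0 := Or.inr (by omega)
  have e : C.A m (z 2) = C.defect m 1 1 • z 1 := by
    rw [A_far C f₁, A_far C f₀, A_zero C (by omega), map_zero, smul_zero, zero_add, map_smul,
      A_zero C one_ne_zero, smul_zero, smul_zero, zero_add]
  unfold RelAt
  have e' := lamS_mul_wt (C := C) f₀.symm 2
  rw [if_neg (by omega)] at e'
  rw [e, map_smul, A_pred, A_zero_two, G_z, map_smul, G_z, smul_smul, smul_sub, smul_smul,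
    mul_comm (C.wt _ m), e']
  simp

lemma RelBelow.rel_z {l s : ℕ} (h : C.RelBelow l s) (hs : l ≤ s + 3) {i j : ℕ} (hij : Far i j) :
    C.RelAt i j (z l) := by
  -- reduce to special position of the first node
  have top {m : ℕ} (hm : Far m l) : C.RelAt l m (z l) := (relAt_creation hm).symm hm
  have pred {n m : ℕ} (hl : l = n + 1) (hm : Far n m) (hml : m ≠ l) : C.RelAt n m (z l) := by
    subst hl
    unfold RelAt
    rw [A_far C hm.symm, map_add, map_smul, A_sq, map_smul, A_self, A_pred, G_z, map_smul, G_z,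
      defect, map_zero, smul_zero, smul_zero, zero_add, zero_add, hm.lamS_symm, wt_succ, wt_succ]
    by_cases hl : C.lamS n m = 0
    · simp [hl]
    have e₂ := lamS_q hl m
    rw [C.q_self] at e₂
    have e₄ : C.q m n = -1 := by linear_combination -e₂
    rw [e₄, C.q_self]
    match_scalars
    ring
  have ser {n m : ℕ} (hl : l = n + 2) (hm : Far n m) (hml : m ≠ l) : C.RelAt n m (z l) := by
    unfold Far at hm
    rcases Nat.eq_zero_or_pos n with rfl | hn
    · subst hl
      exact relAt_zero_two (by omega)
    · obtain ⟨a, rfl⟩ : ∃ a, n = a + 1 := ⟨n - 1, by omega⟩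
      subst hl
      by_cases ha : m + 1 = a
      · subst ha
        exact relAt_two_steps m
      · have hh : C.RelBelow (a + 1) a := ⟨fun i j hij l hl => h.rel i j hij l (by omega),
          fun i l hl => h.serre i l (by omega)⟩
        refine relAt_serre ?_ hm ?_ hh <;> unfold Far <;> omega
  have hij' := hij
  unfold Far at hij'
  by_cases h₁ : i = l
  · subst h₁; exact top hij.symm
  by_cases h₂ : j = l
  · subst h₂; exact (top hij).symm hij.symm
  by_cases h₃ : i + 1 = l
  · exact pred h₃.symm hij h₂
  by_cases h₄ : j + 1 = l
  · exact (pred h₄.symm hij.symm h₁).symm hij.symm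
  by_cases h₅ : i + 2 = l
  · exact ser h₅.symm hij h₂
  by_cases h₆ : j + 2 = l
  · exact (ser h₆.symm hij.symm h₁).symm hij.symm
  rcases Nat.eq_zero_or_pos l with rfl | hl
  · unfold RelAt
    rw [A_zero C h₁, A_zero C h₂, G_z, map_smul, G_z, wt_zero, wt_zero, if_neg h₁, if_neg h₂]
    simp
  · obtain ⟨m, rfl⟩ : ∃ m, l = m + 1 := ⟨l - 1, by omega⟩
    have him : Far i m := by unfold Far; omega
    have hjm : Far j m := by unfold Far; omega
    have B : Below (m + 1) (z m : ℕ →₀ k) := below_z (by omega)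
    rw [← A_self]
    refine RelAt.step hij him hjm (χ := fun a => C.wt m a) (G_z_weight m) (h.relAt him B)
      (h.relAt hjm B) (h.relAt him ?_) (h.relAt hjm ?_) (h.relAt hij B)
    · exact (below_A_z (by omega)).mono (by omega)
    · exact (below_A_z (by omega)).mono (by omega)

end CharZero

end ChainData
end

section
open Finset

namespace ChainData
variable {k : Type u} [Field k] {C : ChainData k}

section CharZero
variable [CharZero k]

/-- A step is a creation step or lowers the letter. -/
lemma Step.cases' {i l t : ℕ} (h : C.Step i l t) : (i = l ∧ t = l + 1) ∨
    (i ≠ l ∧ l ≠ i + 1 ∧ t < l ∧ (l + t) % 2 = 1 ∧ t ≠ i ∧ t ≠ i + 1) := by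
  have c := h.cases
  by_cases hil : i = l
  · omega
  · have := h.not_mem hil
    omega

lemma Step.adj {i l t i' t' : ℕ} (h : C.Step i l t) (h' : C.Step i' t t') (hl : i ≠ l)
    (ht : i' ≠ t) (hi : i' = i + 1 ∨ i = i' + 1) :
    (l = i' ∨ l = i' + 1) ↔ (t' = i ∨ t' = i + 1) := by
  have c₁ := h.cases'; have c₂ := h'.cases'
  have ev := h.even h'
  by_cases h1 : l = i' ∨ l = i' + 1 <;> by_cases h2 : t' = i ∨ t' = i + 1
  · tauto
  · exfalso
    rcases hi with rfl | rfl <;> rcases h1 with rfl | rfl <;>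
    · simp (disch := omega) only [meet, if_pos, if_neg, if_true] at ev
      omega
  · exfalso
    rcases hi with rfl | rfl <;> rcases h2 with rfl | rfl <;>
    · simp (disch := omega) only [meet, if_pos, if_neg, if_true] at ev
      omega
  · tauto

lemma exists_steps {i₁ i₂ i₃ i₄ l r : ℕ}
    (h : C.A i₁ (C.A i₂ (C.A i₃ (C.A i₄ (z l)))) r ≠ 0) :
    ∃ t₁ t₂ t₃, C.Step i₄ l t₁ ∧ C.Step i₃ t₁ t₂ ∧ C.Step i₂ t₂ t₃ ∧ C.Step i₁ t₃ r := by
  obtain ⟨t₃, h, s₄⟩ := exists_step h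
  obtain ⟨t₂, h, s₃⟩ := exists_step h
  obtain ⟨t₁, h, s₂⟩ := exists_step h
  exact ⟨t₁, t₂, t₃, step_of_ne h, s₂, s₃, s₄⟩

set_option maxHeartbeats 4000000 in
/-- The letters reached by the monomials of the Serre operator near its nodes. -/
lemma serre_paths {a l r : ℕ} (h₁ : a + 1 ≤ l) (h₂ : l ≤ a + 4) :
    (C.A a (C.A (a + 1) (C.A (a + 2) (C.A (a + 1) (z l)))) r ≠ 0 →
      (r = l ∧ l = a + 1) ∨ r + 2 ≤ a) ∧
    (C.A (a + 2) (C.A (a + 1) (C.A a (C.A (a + 1) (z l)))) r ≠ 0 →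
      (r = l ∧ l = a + 3) ∨ r + 2 ≤ a) ∧
    (C.A (a + 1) (C.A a (C.A (a + 1) (C.A (a + 2) (z l)))) r ≠ 0 →
      (r = l ∧ l = a + 2) ∨ r + 2 ≤ a) ∧
    (C.A (a + 1) (C.A (a + 2) (C.A (a + 1) (C.A a (z l)))) r ≠ 0 → r + 2 ≤ a) := by
  have hd : l = a + 1 ∨ l = a + 2 ∨ l = a + 3 ∨ l = a + 4 := by omega
  refine ⟨fun h => ?_, fun h => ?_, fun h => ?_, fun h => ?_⟩ <;>
  obtain ⟨t₁, t₂, t₃, s₁, s₂, s₃, s₄⟩ := exists_steps h <;>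
  · have a₁ := s₁.adj s₂; have a₂ := s₂.adj s₃
    have c₁ := s₁.cases'; have c₂ := s₂.cases'; have c₃ := s₃.cases'; have c₄ := s₄.cases'
    clear h s₁ s₂ s₃ s₄
    rcases hd with rfl | rfl | rfl | rfl <;> rcases c₁ with c₁ | c₁ <;>
    rcases c₂ with c₂ | c₂ <;> rcases c₃ with c₃ | c₃ <;> rcases c₄ with c₄ | c₄ <;> omega

end CharZero

end ChainData
end

section
open Finset

namespace ChainData
variable {k : Type u} [Field k] {C : ChainData k} [CharZero k]

lemma RelBelow.succ {l s : ℕ} (h : C.RelBelow l s) (hs : l ≤ s + 3) : C.RelBelow (l + 1) s :=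
  ⟨fun i j hij t ht => by
    rcases Nat.lt_succ_iff_lt_or_eq.1 ht with ht | rfl
    · exact h.rel i j hij t ht
    · exact h.rel_z hs hij, h.serre⟩

/-- The Serre operator commutes with a distant node at a letter if all vectors met on the way
satisfy the commutation relations. -/
lemma RelBelow.serre_A_z {n s a m l : ℕ} (h : C.RelBelow n s) (ha : Far a m)
    (hb : Far (a + 1) m) (hc : Far (a + 2) m) (hl : l < n) (hn : n ≤ a ∨ a + 4 ≤ n) :
    C.serre a (C.A m (z l)) = (C.q a m * C.q (a + 1) m ^ 2 * C.q (a + 2) m) •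
      C.A m (C.serre a (z l)) := by
  have B₀ : Below n (z l : ℕ →₀ k) := below_z hl
  have A₀ {v : ℕ →₀ k} (hv : Below n v) : Below n (C.A a v) := hv.A (by omega)
  have A₁ {v : ℕ →₀ k} (hv : Below n v) : Below n (C.A (a + 1) v) := hv.A (by omega)
  have A₂ {v : ℕ →₀ k} (hv : Below n v) : Below n (C.A (a + 2) v) := hv.A (by omega)
  have hac : Far a (a + 2) := Or.inl le_rfl
  have key := serre_A (C := C) ha hb hc (v := z l) (χ := fun i => C.wt l i) (G_z_weight l)
    (δ := 0) (h.relAt hb B₀) (h.relAt hc (A₁ B₀)) (h.relAt hb (A₂ (A₁ B₀)))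
    (h.relAt ha (A₁ (A₂ (A₁ B₀)))) (h.relAt ha (A₁ B₀)) (h.relAt hb (A₀ (A₁ B₀)))
    (h.relAt hc (A₁ (A₀ (A₁ B₀)))) (h.relAt hc B₀) (h.relAt hb (A₂ B₀))
    (h.relAt ha (A₁ (A₂ B₀))) (h.relAt hb (A₀ (A₁ (A₂ B₀)))) (h.relAt ha B₀)
    (h.relAt hb (A₀ B₀)) (h.relAt hc (A₁ (A₀ B₀)))
    (by rw [add_zero]; exact h.relAt hb (A₂ (A₁ (A₀ B₀))))
    (C.A_sq _) (h.relAt hac B₀) (h.relAt hac (A₁ B₀))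
  rw [key, smul_zero, sub_zero]

lemma serreAt_iff {a : ℕ} {v : ℕ →₀ k} :
    C.SerreAt a v ↔ C.serre a v = C.nu a • (v - C.GS a v) := Iff.rfl

lemma RelBelow.serreAt_far {l i : ℕ} (h : C.RelBelow l l) (hi : l + 1 ≤ i ∨ i + 5 ≤ l) :
    C.SerreAt i (z l) := by
  rcases Nat.eq_zero_or_pos l with rfl | hl
  · rw [serreAt_iff, ChainData.serre, serreVec, GS, A_zero C (by omega), A_zero C (by omega),
      A_zero C (by omega), G_z, map_smul, G_z]
    simp only [map_zero, smul_zero, add_zero, sub_zero, map_smul, G_z, wt_zero]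
    rw [if_neg (by omega), if_neg (by omega), if_neg (by omega)]
    simp
  · obtain ⟨m, rfl⟩ : ∃ m, l = m + 1 := ⟨l - 1, by omega⟩
    have ha : Far i m := by unfold Far; omega
    have hb : Far (i + 1) m := by unfold Far; omega
    have hc : Far (i + 2) m := by unfold Far; omega
    rw [← A_self, serreAt_iff, h.serre_A_z ha hb hc (by omega) (by omega),
      serreAt_iff.1 (h.serre i m (by omega)), nu_smul_A ha hb hc]

lemma serre_coeff (a : ℕ) : C.A (a + 1) (z (a + 3)) a = 2 * C.nu a := by
  have e := congrArg (fun v => v a) (C.A_serre a)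
  have B₁ : Below a (C.A (a + 1) (z a)) := below_A_z (by omega)
  have B₂ : Below a (C.A (a + 2) (z a)) := below_A_z (by omega)
  have A₀ {v : ℕ →₀ k} (hv : Below a v) : Below a (C.A a v) := hv.A (by omega)
  have A₁ {v : ℕ →₀ k} (hv : Below a v) : Below a (C.A (a + 1) v) := hv.A (by omega)
  have A₂ {v : ℕ →₀ k} (hv : Below a v) : Below a (C.A (a + 2) v) := hv.A (by omega)
  have zero {v : ℕ →₀ k} (hv : Below a v) : v a = 0 := by
    by_contra h0
    exact lt_irrefl _ (hv a h0)
  simp only [Finsupp.sub_apply, Finsupp.add_apply, Finsupp.smul_apply, smul_eq_mul,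
    zero (A₀ (A₁ (A₂ B₁))), zero (A₂ (A₁ (A₀ B₁))), zero (A₁ (A₀ (A₁ B₂))),
    Finsupp.single_eq_same] at e
  have w := nu_mul_wtSerre (C := C) a a
  rw [if_pos (by omega)] at w
  by_cases hν : C.nu a = 0
  · rw [hν] at e ⊢
    have : C.q a (a + 1) ^ 2 * C.q a (a + 2) * C.A (a + 1) (z (a + 3)) a = 0 := by
      linear_combination -e
    rw [mul_zero]
    exact (mul_eq_zero.1 this).resolve_left (by simp [q_ne_zero])
  · have h := C.nu_q a hν a
    rw [C.q_self] at h
    linear_combination e - w - C.A (a + 1) (z (a + 3)) a * h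

lemma nu_mul_scalars (a : ℕ) :
    C.nu a * (C.q a (a + 1) / C.q (a + 1) (a + 2)) = -C.nu a ∧
    C.nu a * (C.q a (a + 1) * C.q a (a + 2) * C.q (a + 1) (a + 2)) = C.nu a := by
  by_cases hν : C.nu a = 0
  · simp [hν]
  have h₁ := C.nu_q a hν a
  have h₂ := C.nu_q a hν (a + 1)
  have h₃ := C.q_adj a
  rw [C.q_self] at h₁ h₂
  have h₄ : C.q (a + 1) (a + 2) = -C.q a (a + 1) := by
    linear_combination C.q (a + 1) (a + 2) * h₃ - C.q a (a + 1) * h₂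
  have h₅ := C.q_ne_zero a (a + 1)
  rw [h₄]
  constructor
  · field_simp
  · linear_combination C.nu a * h₁

lemma serre_apply_self {a l : ℕ} (h₁ : a + 1 ≤ l) (h₂ : l ≤ a + 4) :
    C.serre a (z l) l = (C.nu a * (1 - C.wtSerre a l)) := by
  have w := nu_mul_wtSerre (C := C) a l
  obtain ⟨p₁, p₂, p₃, p₄⟩ := serre_paths (C := C) (r := l) h₁ h₂
  have c₀ := serre_coeff (C := C) a
  obtain ⟨n₁, n₂⟩ := nu_mul_scalars (C := C) a
  have e₄ : C.A (a + 1) (C.A (a + 2) (C.A (a + 1) (C.A a (z l)))) l = 0 := by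
    by_contra h; have := p₄ h; omega
  simp only [serre, serreVec, Finsupp.sub_apply, Finsupp.add_apply, Finsupp.smul_apply,
    smul_eq_mul, e₄, mul_zero, sub_zero]
  have hd : l = a + 1 ∨ l = a + 2 ∨ l = a + 3 ∨ l = a + 4 := by omega
  have e₁ : C.A a (C.A (a + 1) (C.A (a + 2) (C.A (a + 1) (z l)))) l =
      if l = a + 1 then 2 * C.nu a else 0 := by
    split_ifs with h
    · subst h; rw [A_self, A_self, A_apply_succ, c₀]
    · by_contra h'; have := p₁ h'; omega
  have e₂ : C.A (a + 2) (C.A (a + 1) (C.A a (C.A (a + 1) (z l)))) l =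
      if l = a + 3 then C.A (a + 1) (C.A a (C.A (a + 1) (z (a + 3)))) (a + 2) else 0 := by
    split_ifs with h
    · subst h; rw [A_apply_succ]
    · by_contra h'; have := p₂ h'; omega
  have e₃ : C.A (a + 1) (C.A a (C.A (a + 1) (C.A (a + 2) (z l)))) l =
      if l = a + 2 then 2 * C.nu a else 0 := by
    split_ifs with h
    · subst h; rw [A_self, A_apply_succ, A_apply_succ, c₀]
    · by_contra h'; have := p₃ h'; omega
  rw [A_apply_succ, A_apply_succ, c₀] at e₂
  rw [e₁, e₂, e₃]
  rcases hd with rfl | rfl | rfl | rfl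
  · rw [if_pos rfl, if_neg (by omega), if_neg (by omega)]
    rw [if_pos (by omega)] at w
    linear_combination w
  · rw [if_neg (by omega), if_neg (by omega), if_pos rfl]
    rw [if_pos (by omega)] at w
    linear_combination w - 2 * n₁
  · rw [if_neg (by omega), if_pos rfl, if_neg (by omega)]
    rw [if_pos (by omega)] at w
    linear_combination w + 2 * n₂
  · rw [if_neg (by omega), if_neg (by omega), if_neg (by omega)]
    rw [if_neg (by omega)] at w
    linear_combination w

lemma serre_apply_ne {a l r : ℕ} (h₁ : a + 1 ≤ l) (h₂ : l ≤ a + 4) (hr : r ≠ l)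
    (h : C.serre a (z l) r ≠ 0) : r + 2 ≤ a := by
  obtain ⟨p₁, p₂, p₃, p₄⟩ := serre_paths (C := C) (r := r) h₁ h₂
  by_contra hra
  apply h
  have e₁ : C.A a (C.A (a + 1) (C.A (a + 2) (C.A (a + 1) (z l)))) r = 0 := by
    by_contra h; have := p₁ h; omega
  have e₂ : C.A (a + 2) (C.A (a + 1) (C.A a (C.A (a + 1) (z l)))) r = 0 := by
    by_contra h; have := p₂ h; omega
  have e₃ : C.A (a + 1) (C.A a (C.A (a + 1) (C.A (a + 2) (z l)))) r = 0 := by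
    by_contra h; have := p₃ h; omega
  have e₄ : C.A (a + 1) (C.A (a + 2) (C.A (a + 1) (C.A a (z l)))) r = 0 := by
    by_contra h; have := p₄ h; omega
  simp [serre, serreVec, e₁, e₂, e₃, e₄]

lemma GS_z (a l : ℕ) : C.GS a (z l) = C.wtSerre a l • z l := by
  simp only [GS, G_z, map_smul, smul_smul, wtSerre]
  congr 1; ring

lemma RelBelow.serreAt_near {l a : ℕ} (h : C.RelBelow l l) (h₁ : a + 1 ≤ l) (h₂ : l ≤ a + 4) :
    C.SerreAt a (z l) := by
  have h' := ((h.succ (by omega)).succ (by omega)).succ (by omega)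
  rw [serreAt_iff]
  ext r
  by_cases hr : r = l
  · subst hr
    rw [serre_apply_self h₁ h₂, GS_z]
    simp [mul_sub]
  have e₀ : (C.nu a • (z l - C.GS a (z l)) : ℕ →₀ k) r = 0 := by
    rw [GS_z]; simp [Finsupp.single_eq_of_ne hr]
  rw [e₀]
  by_contra hne
  have hra := serre_apply_ne h₁ h₂ hr hne
  have ha : Far a r := by unfold Far; omega
  have hb : Far (a + 1) r := by unfold Far; omega
  have hc : Far (a + 2) r := by unfold Far; omega
  have k₁ := h'.serre_A_z ha hb hc (l := l) (by omega) (Or.inr (by omega))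
  rw [serreAt_iff.1 (h.serreAt a (below_A_z hr)), ← nu_smul_A ha hb hc] at k₁
  have hq : C.q a r * C.q (a + 1) r ^ 2 * C.q (a + 2) r ≠ 0 := by simp [q_ne_zero]
  have k₂ := congrArg (fun v => v (r + 1)) (smul_right_injective _ hq k₁)
  simp only [A_apply_succ, e₀] at k₂
  exact hne k₂.symm

variable (C) in
lemma relBelow (n : ℕ) : C.RelBelow n n := by
  induction n with
  | zero => exact ⟨fun _ _ _ _ h => absurd h (by omega), fun _ _ h => absurd h (by omega)⟩
  | succ n ih =>
    refine ⟨(ih.succ (by omega)).rel, fun i l hl => ?_⟩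
    rcases Nat.lt_succ_iff_lt_or_eq.1 hl with hl | rfl
    · exact ih.serre i l hl
    rcases lt_trichotomy i l with hi | rfl | hi
    · by_cases hi' : l ≤ i + 4
      · exact ih.serreAt_near hi hi'
      · exact ih.serreAt_far (by omega)
    · exact serreAt_creation i
    · exact ih.serreAt_far (by omega)

lemma exists_below (v : ℕ →₀ k) : ∃ n, Below n v :=
  ⟨v.support.sup id + 1, fun _ hr =>
    Nat.lt_succ_of_le (Finset.le_sup (f := id) (Finsupp.mem_support_iff.2 hr))⟩

/-- The commutation relations of the natural module. -/
theorem relAt {i j : ℕ} (h : Far i j) (v : ℕ →₀ k) : C.RelAt i j v := by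
  obtain ⟨n, hn⟩ := exists_below v
  exact (C.relBelow n).relAt h hn

/-- The Serre relations of the natural module. -/
theorem serreAt (i : ℕ) (v : ℕ →₀ k) : C.SerreAt i v := by
  obtain ⟨n, hn⟩ := exists_below v
  exact (C.relBelow n).serreAt i hn

end ChainData
end

section
open Finset

namespace ChainData
variable {k : Type u} [Field k] (C : ChainData k)

section Sum
variable {B : Type*} [Ring B] [Algebra k B]

/-- The left hand side of the Serre relation of the nodes `i, i+1, i+2`. -/
def serreOf (x : ℕ → B) (i : ℕ) : B :=
  serreComm (C.q i (i + 1)) (C.q (i + 1) (i + 2)) (C.q i (i + 2)) (x i) (x (i + 1)) (x (i + 2))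

/-- Two families of elements that `q`-commute with each other. -/
def Mixed (x x' : ℕ → B) : Prop := ∀ i j, x' i * x j = C.q i j • (x j * x' i)

variable {C} {x x' : ℕ → B}

lemma q_succ (i : ℕ) : C.q (i + 1) i = -(C.q i (i + 1))⁻¹ := by
  have := C.q_adj i
  field_simp [C.q_ne_zero]
  linear_combination this

lemma Far.q_inv {i j : ℕ} (h : Far i j) : C.q j i = (C.q i j)⁻¹ :=
  eq_inv_of_mul_eq_one_right h.q_mul

lemma Mixed.sq_add (h : C.Mixed x x') (i : ℕ) : (x i + x' i) ^ 2 = x i ^ 2 + x' i ^ 2 :=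
  sq_add_of_anticomm (by rw [h, C.q_self])

lemma Mixed.qcomm_add (h : C.Mixed x x') {i j : ℕ} (hij : Far i j) :
    qcomm (C.q i j) (x i + x' i) (x j + x' j) =
      qcomm (C.q i j) (x i) (x j) + qcomm (C.q i j) (x' i) (x' j) :=
  ALift.qcomm_add hij.q_mul (h i j) (h j i)

lemma Mixed.serre_add (h : C.Mixed x x') (i : ℕ) (hx : x (i + 1) ^ 2 = 0)
    (hx' : (C.q (i + 1) (i + 2))⁻¹ • (x' (i + 1) ^ 2 * x' (i + 2)) =
      C.q (i + 1) (i + 2) • (x' (i + 2) * x' (i + 1) ^ 2))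
    (hac : qcomm (C.q i (i + 2)) (x' i) (x' (i + 2)) * x' (i + 1) +
      (C.q i (i + 1) * (C.q (i + 1) (i + 2))⁻¹) •
        (x' (i + 1) * qcomm (C.q i (i + 2)) (x' i) (x' (i + 2))) = 0) :
    C.serreOf (fun i => x i + x' i) i = C.serreOf x i + C.serreOf x' i := by
  have hf : Far i (i + 2) := Or.inl le_rfl
  unfold serreOf
  rw [serreComm_add (C.q_ne_zero _ _) (C.q_ne_zero _ _) (C.q_ne_zero _ _) (h _ _) (h _ _)
    (by rw [h, q_succ]) (by rw [h, C.q_self]) (h _ _) (by rw [h, hf.q_inv])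
    (by rw [h, q_succ]), hx, hx', hac]
  simp

end Sum

section Tensor
variable {M M' : Type*} [AddCommGroup M] [Module k M] [AddCommGroup M'] [Module k M']

/-- The operators `x_i ⊗ 1 + g_i ⊗ x_i'` on a tensor product. -/
def tens (x g : ℕ → Module.End k M) (x' : ℕ → Module.End k M') (i : ℕ) :
    Module.End k (M ⊗[k] M') :=
  TensorProduct.map (x i) 1 + TensorProduct.map (g i) (x' i)

lemma tens_tmul (x g : ℕ → Module.End k M) (x' : ℕ → Module.End k M') (i : ℕ) (m : M) (m' : M') :
    tens x g x' i (m ⊗ₜ m') = x i m ⊗ₜ m' + g i m ⊗ₜ x' i m' := rfl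

/-- Operators `g_i`, `x_i` that satisfy `g_i g_j = g_j g_i` and `g_i x_j = q_{ij} x_j g_i`. -/
structure Bos (x g : ℕ → Module.End k M) : Prop where
  gg : ∀ i j, g i * g j = g j * g i
  gx : ∀ i j, g i * x j = C.q i j • (x j * g i)

variable {C} {x g : ℕ → Module.End k M} {x' : ℕ → Module.End k M'}

lemma map_mul_map (f f' : Module.End k M) (h h' : Module.End k M') :
    (TensorProduct.map f h : Module.End k (M ⊗[k] M')) * TensorProduct.map f' h' =
      TensorProduct.map (f * f') (h * h') := (TensorProduct.map_mul f f' h h').symm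

lemma map_sub_left (f f' : Module.End k M) (h : Module.End k M') :
    TensorProduct.map (f - f') h = TensorProduct.map f h - TensorProduct.map f' h :=
  TensorProduct.ext' fun _ _ => TensorProduct.sub_tmul _ _ _

lemma map_sub_right (f : Module.End k M) (h h' : Module.End k M') :
    TensorProduct.map f (h - h') = TensorProduct.map f h - TensorProduct.map f h' :=
  TensorProduct.ext' fun _ _ => TensorProduct.tmul_sub _ _ _

lemma Bos.mixed (h : C.Bos x g) (x' : ℕ → Module.End k M') :
    C.Mixed (fun i => (TensorProduct.map (x i) 1 : Module.End k (M ⊗[k] M')))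
      fun i => TensorProduct.map (g i) (x' i) := fun i j => by
  rw [map_mul_map, map_mul_map, h.gx, mul_one, one_mul, TensorProduct.map_smul_left]

lemma Bos.sq_tens (h : C.Bos x g) (x' : ℕ → Module.End k M') (i : ℕ) :
    tens x g x' i ^ 2 = TensorProduct.map (x i ^ 2) 1 +
      TensorProduct.map (g i ^ 2) (x' i ^ 2) := by
  refine ((h.mixed x').sq_add i).trans ?_
  simp only [pow_two, map_mul_map, mul_one]

lemma Bos.qcomm_tens (h : C.Bos x g) (x' : ℕ → Module.End k M') {i j : ℕ} (hij : Far i j) :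
    qcomm (C.q i j) (tens x g x' i) (tens x g x' j) =
      TensorProduct.map (qcomm (C.q i j) (x i) (x j)) 1 +
      TensorProduct.map (g i * g j) (qcomm (C.q i j) (x' i) (x' j)) := by
  refine ((h.mixed x').qcomm_add hij).trans ?_
  simp only [qcomm, map_mul_map, mul_one, map_sub_left,
    map_sub_right, TensorProduct.map_smul_left, TensorProduct.map_smul_right, h.gg j i]

lemma Bos.serre_tens (h : C.Bos x g) {i : ℕ} (hx : x (i + 1) ^ 2 = 0) (hx' : x' (i + 1) ^ 2 = 0)
    (hac : qcomm (C.q i (i + 2)) (x' i) (x' (i + 2)) * x' (i + 1) +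
      (C.q i (i + 1) * (C.q (i + 1) (i + 2))⁻¹) •
        (x' (i + 1) * qcomm (C.q i (i + 2)) (x' i) (x' (i + 2))) = 0) :
    C.serreOf (tens x g x') i = TensorProduct.map (C.serreOf x i) 1 +
      TensorProduct.map (g i * (g (i + 1) * (g (i + 1) * g (i + 2)))) (C.serreOf x' i) := by
  have g₁ := h.gg (i + 2) (i + 1)
  have g₂ := h.gg (i + 2) i
  have g₃ := h.gg (i + 1) i
  have e {a b : Module.End k M} (hab : a * b = b * a) (c) : a * (b * c) = b * (a * c) := by
    rw [← mul_assoc, hab, mul_assoc]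
  refine ((h.mixed x').serre_add i ?_ ?_ ?_).trans ?_
  · rw [pow_two, map_mul_map, ← pow_two, hx, TensorProduct.map_zero_left]
  · rw [pow_two, map_mul_map, ← pow_two (x' (i + 1)), hx', TensorProduct.map_zero_right]
    simp
  · have e₁ : qcomm (C.q i (i + 2)) (TensorProduct.map (g i) (x' i) : Module.End k (M ⊗[k] M'))
        (TensorProduct.map (g (i + 2)) (x' (i + 2))) = TensorProduct.map (g i * g (i + 2))
          (qcomm (C.q i (i + 2)) (x' i) (x' (i + 2))) := by
      simp only [qcomm, map_mul_map, map_sub_right, TensorProduct.map_smul_right, g₂]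
    rw [e₁, map_mul_map, map_mul_map, ← TensorProduct.map_smul_right, mul_assoc, g₁, e g₃,
      ← TensorProduct.map_add_right, hac, TensorProduct.map_zero_right]
  · congr 1
    · simp only [serreOf, serreComm, qcomm, map_mul_map, mul_one, map_sub_left,
        TensorProduct.map_smul_left, mul_assoc, mul_sub, sub_mul, smul_sub, mul_smul_comm, smul_mul_assoc]
    · simp only [serreOf, serreComm, qcomm, map_mul_map, map_sub_right,
        TensorProduct.map_smul_right, mul_assoc, mul_sub, sub_mul, smul_sub, mul_smul_comm,
        smul_mul_assoc, g₁, g₂, g₃, e g₁, e g₂, e g₃]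

end Tensor

/-- Operators on which the deformed relations hold with right hand sides `λ (1 - g g)` and
`ν (1 - g g g g)`. -/
structure Rep {M : Type*} [AddCommGroup M] [Module k M] (x g : ℕ → Module.End k M) : Prop
    extends C.Bos x g where
  sq : ∀ i, x i ^ 2 = 0
  far : ∀ i j, Far i j → qcomm (C.q i j) (x i) (x j) = C.lamS i j • (1 - g i * g j)
  serre : ∀ i, C.serreOf x i = C.nu i • (1 - g i * (g (i + 1) * (g (i + 1) * g (i + 2))))

variable {C}

lemma lam_adj {i : ℕ} (h : C.lam i (i + 2) ≠ 0) :
    C.q i (i + 1) * (C.q (i + 1) (i + 2))⁻¹ = -1 := by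
  have h₁ := C.lam_q i (i + 2) le_rfl h (i + 1)
  have h₂ := C.q_adj i
  have := C.q_ne_zero (i + 1) (i + 2)
  field_simp
  linear_combination C.q (i + 1) (i + 2) * h₂ - C.q i (i + 1) * h₁

/-- The condition under which the Serre relation is additive. -/
lemma Bos.serre_cond {M : Type*} [AddCommGroup M] [Module k M] {x g : ℕ → Module.End k M}
    (h : C.Bos x g) (i : ℕ) (c : k)
    (hac : qcomm (C.q i (i + 2)) (x i) (x (i + 2)) =
      C.lamS i (i + 2) • (1 - c • (g i * g (i + 2)))) :
    qcomm (C.q i (i + 2)) (x i) (x (i + 2)) * x (i + 1) +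
      (C.q i (i + 1) * (C.q (i + 1) (i + 2))⁻¹) •
        (x (i + 1) * qcomm (C.q i (i + 2)) (x i) (x (i + 2))) = 0 := by
  have e : C.lamS i (i + 2) = C.lam i (i + 2) := if_pos le_rfl
  rw [hac, e]
  by_cases h0 : C.lam i (i + 2) = 0
  · simp [h0]
  have h₁ := C.lam_q i (i + 2) le_rfl h0 (i + 1)
  have h₂ := C.q_adj i
  have h₃ := C.q_adj (i + 1)
  have h₄ : C.q (i + 2) (i + 1) * C.q i (i + 1) = 1 := by
    linear_combination C.q (i + 2) (i + 1) * C.q i (i + 1) * (-h₁) +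
      C.q (i + 1) (i + 2) * C.q (i + 2) (i + 1) * h₂ - h₃
  rw [lam_adj h0]
  simp only [smul_mul_assoc, mul_smul_comm, sub_mul, mul_sub, one_mul, mul_one, mul_assoc, h.gx,
    smul_smul]
  rw [← mul_assoc (g i), h.gx, smul_mul_assoc, smul_smul, mul_assoc c, h₄, mul_assoc]
  module

end ChainData
end

section
open Finset

/-- The vector space with basis `ι`. -/
def Free (ι : Type*) (k : Type u) [Field k] := ι →₀ k

namespace Free
variable {k : Type u} [Field k] {ι : Type*} {U : Type*} [AddCommGroup U] [Module k U]

instance : AddCommGroup (Free ι k) := inferInstanceAs (AddCommGroup (ι →₀ k))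

instance : Module k (Free ι k) := inferInstanceAs (Module k (ι →₀ k))

/-- The basis vectors. -/
def bv (i : ι) : Free ι k := Finsupp.single i (1 : k)

/-- The linear map with given values at the basis. -/
def lift (f : ι → U) : Free ι k →ₗ[k] U := Finsupp.linearCombination k f

/-- The coordinate functionals. -/
def coord (i : ι) : Free ι k →ₗ[k] k := Finsupp.lapply i

@[simp] lemma lift_bv (f : ι → U) (i : ι) : lift f (bv i : Free ι k) = f i := by
  refine (Finsupp.linearCombination_single k _ _).trans (one_smul k _)

lemma coord_bv_self (i : ι) : coord i (bv i : Free ι k) = 1 := Finsupp.single_eq_same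

lemma coord_bv_ne {i j : ι} (h : i ≠ j) : coord i (bv j : Free ι k) = 0 :=
  Finsupp.single_eq_of_ne h

lemma hom_ext {f g : Free ι k →ₗ[k] U} (h : ∀ i, f (bv i) = g (bv i)) : f = g :=
  Finsupp.lhom_ext' fun i => LinearMap.ext_ring (h i)

end Free

namespace ChainData
variable {k : Type u} [Field k] {C : ChainData k}

lemma serreComm_apply {M : Type*} [AddCommGroup M] [Module k M] {p r s : k} (hr : r ≠ 0)
    {a b c : Module.End k M} (hb : b ^ 2 = 0)
    (hac : qcomm s a c * b + (p * r⁻¹) • (b * qcomm s a c) = 0) (v : M) :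
    serreComm p r s a b c v = serreVec p r s a b c v := by
  have hb' : b * b = 0 := by rw [← pow_two, hb]
  have e : b * (qcomm s a c * b) = 0 := by
    rw [eq_neg_of_add_eq_zero_left hac, mul_neg, mul_smul_comm, ← mul_assoc, hb', zero_mul,
      smul_zero, neg_zero]
  have e₁ := LinearMap.congr_fun e v
  have e₂ (w : M) : b (b w) = 0 := LinearMap.congr_fun hb' w
  simp only [qcomm, Module.End.mul_apply, LinearMap.sub_apply, LinearMap.smul_apply, map_sub,
    map_smul, LinearMap.zero_apply] at e₁
  simp only [serreComm, serreVec, qcomm, Module.End.mul_apply, LinearMap.sub_apply,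
    LinearMap.smul_apply, map_sub, map_smul, e₂, map_zero, smul_zero, sub_zero, zero_sub,
    smul_sub, smul_neg, sub_neg_eq_add]
  have : p / r * r = p := div_mul_cancel₀ p hr
  have h2 : p / r * (p * s * r) = p ^ 2 * s := by field_simp
  simp only [smul_smul, this, h2]
  linear_combination (norm := (match_scalars <;> field_simp <;> ring)) p • e₁

/-- The natural module. -/
abbrev Letters (k : Type u) [Field k] : Type u := Free ℕ k

/-- The module spanned by the words in the letters of the natural module. -/
abbrev Words (k : Type u) [Field k] : Type u := Free (List ℕ) k

open Free

variable (C)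

/-- The operator `x_i` of the natural module. -/
def lx (i : ℕ) : Module.End k (Letters k) := C.A i

/-- The operator `g_i` of the natural module. -/
def lg (i : ℕ) : Module.End k (Letters k) := C.G i

lemma lg_bv (i l : ℕ) : C.lg i (bv l) = C.wt l i • bv l := C.G_z i l

lemma bos_letters : C.Bos C.lx C.lg where
  gg i j := LinearMap.ext fun v => C.G_comm i j v
  gx i j := LinearMap.ext fun v => C.G_A i j v

variable {C}

/-- Multiplication of a word by a letter from the left. -/
def cons : Letters k →ₗ[k] Words k →ₗ[k] Words k := lift fun l => lift fun w => bv (l :: w)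

lemma cons_bv (l : ℕ) (w : List ℕ) : cons (bv l : Letters k) (bv w) = bv (l :: w) := by simp [cons]

variable (C)

/-- The operator `x_i` at a word, see `wx_cons`. -/
def wordX (i : ℕ) : List ℕ → Words k
  | [] => 0
  | l :: w => cons (C.lx i (bv l)) (bv w) + C.wt l i • cons (bv l) (wordX i w)

/-- The weight of a word. -/
def wordWt (i : ℕ) : List ℕ → k
  | [] => 1
  | l :: w => C.wt l i * wordWt i w

/-- The operator `x_i` on words. -/
def wx (i : ℕ) : Module.End k (Words k) := lift (C.wordX i)

/-- The operator `g_i` on words. -/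
def wg (i : ℕ) : Module.End k (Words k) := lift fun w => C.wordWt i w • bv w

variable {C}

/-- Linear maps on words vanish if they vanish on the empty word and on products. -/
lemma words_induction {U : Type*} [AddCommGroup U] [Module k U] {T : Words k →ₗ[k] U}
    (h₀ : T (bv []) = 0) (h : ∀ v u, T u = 0 → T (cons v u) = 0) : T = 0 := by
  refine hom_ext fun w => ?_
  induction w with
  | nil => exact h₀
  | cons l w ih => rw [← cons_bv, h _ _ ih]; rfl

lemma cons_ext {U : Type*} [AddCommGroup U] [Module k U]
    {S T : Letters k →ₗ[k] Words k →ₗ[k] U} (h : ∀ l w, S (bv l) (bv w) = T (bv l) (bv w)) : S = T :=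
  hom_ext fun l => hom_ext fun w => h l w

lemma wx_cons (i : ℕ) (v : Letters k) (u : Words k) :
    C.wx i (cons v u) = cons (C.lx i v) u + cons (C.lg i v) (C.wx i u) := by
  have := cons_ext (S := cons.compr₂ (C.wx i)) (T := cons.comp (C.lx i) +
    (cons.comp (C.lg i)).compl₂ (C.wx i)) fun l w => by
      simp only [LinearMap.add_apply, LinearMap.compr₂_apply,
        LinearMap.compl₂_apply, LinearMap.comp_apply, cons_bv, lg_bv]
      simp [wx, wordX]
  exact LinearMap.congr_fun₂ this v u

lemma wg_cons (i : ℕ) (v : Letters k) (u : Words k) :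
    C.wg i (cons v u) = cons (C.lg i v) (C.wg i u) := by
  have := cons_ext (S := cons.compr₂ (C.wg i)) (T :=
    (cons.comp (C.lg i)).compl₂ (C.wg i)) fun l w => by
      simp only [LinearMap.compr₂_apply, LinearMap.compl₂_apply, LinearMap.comp_apply, cons_bv, lg_bv]
      simp [wg, wordWt, cons_bv, smul_smul, mul_comm]
  exact LinearMap.congr_fun₂ this v u

lemma wx_nil (i : ℕ) : C.wx i (bv []) = 0 := by simp [wx, wordX]

lemma wg_nil (i : ℕ) : C.wg i (bv []) = bv [] := by simp [wg, wordWt]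

variable (C)

lemma bos_words : C.Bos C.wx C.wg where
  gg i j := sub_eq_zero.1 <| words_induction (by simp [wg_nil]) fun v u hu => by
    have hu' : C.wg i (C.wg j u) = C.wg j (C.wg i u) := sub_eq_zero.1 hu
    have hv := LinearMap.congr_fun (C.bos_letters.gg i j) v
    simp only [Module.End.mul_apply] at hv
    simp [wg_cons, hu', hv]
  gx i j := sub_eq_zero.1 <| words_induction (by simp [wg_nil, wx_nil]) fun v u hu => by
    have hu' : C.wg i (C.wx j u) = C.q i j • C.wx j (C.wg i u) := sub_eq_zero.1 hu
    have hv := LinearMap.congr_fun (C.bos_letters.gg i j) v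
    have hx := LinearMap.congr_fun (C.bos_letters.gx i j) v
    simp only [Module.End.mul_apply, LinearMap.smul_apply] at hv hx
    simp [wg_cons, wx_cons, hu', hv, hx]

variable {C}

/-- Multiplication of words by letters as a linear map on the tensor product. -/
def consT : Letters k ⊗[k] Words k →ₗ[k] Words k := TensorProduct.lift cons

lemma wx_consT (i : ℕ) (t) : C.wx i (consT t) = consT (tens C.lx C.lg C.wx i t) := by
  induction t with
  | zero => simp
  | add s t hs ht => simp [hs, ht]
  | tmul v u => simp [consT, tens_tmul, wx_cons]

lemma sq_consT (i : ℕ) (t) : (C.wx i ^ 2) (consT t) = consT ((tens C.lx C.lg C.wx i ^ 2) t) := by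
  simp only [pow_two, Module.End.mul_apply, wx_consT]

lemma qcomm_consT (c : k) (i j : ℕ) (t) : qcomm c (C.wx i) (C.wx j) (consT t) =
    consT (qcomm c (tens C.lx C.lg C.wx i) (tens C.lx C.lg C.wx j) t) := by
  simp only [qcomm, Module.End.mul_apply, wx_consT, LinearMap.sub_apply, LinearMap.smul_apply,
    map_sub, map_smul]

lemma serre_consT (i : ℕ) (t) : C.serreOf C.wx i (consT t) =
    consT (C.serreOf (tens C.lx C.lg C.wx) i t) := by
  simp only [serreOf, serreComm, qcomm, Module.End.mul_apply, wx_consT, LinearMap.sub_apply,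
    LinearMap.smul_apply, map_sub, map_smul]

variable (C) [CharZero k]

lemma far_letters {i j : ℕ} (h : Far i j) : qcomm (C.q i j) (C.lx i) (C.lx j) =
    C.lamS i j • (1 - C.lg i * C.lg j) := LinearMap.ext fun v => by
  refine (sub_eq_iff_eq_add.2 ?_ :
    C.lx i (C.lx j v) - C.q i j • C.lx j (C.lx i v) = C.lamS i j • (v - C.lg i (C.lg j v)))
  rw [add_comm]
  exact relAt h v

lemma rep_letters : C.Rep C.lx C.lg where
  toBos := C.bos_letters
  sq i := LinearMap.ext fun v => by rw [pow_two]; exact A_sq C i v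
  far i j h := C.far_letters h
  serre i := LinearMap.ext fun v => by
    refine (serreComm_apply (C.q_ne_zero _ _) (by
      refine LinearMap.ext fun v => ?_
      rw [pow_two]; exact A_sq C _ v) (C.bos_letters.serre_cond i 1 ?_) v).trans (serreAt i v)
    refine LinearMap.ext fun v => ?_
    rw [one_smul]
    exact LinearMap.congr_fun (C.far_letters (Or.inl le_rfl)) v

lemma rep_words : C.Rep C.wx C.wg := by
  have hN := C.rep_letters
  have sq (i : ℕ) : C.wx i ^ 2 = 0 := words_induction (by simp [pow_two, wx_nil]) fun v u hu => by
    change (C.wx i ^ 2) (consT (v ⊗ₜ u)) = 0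
    rw [sq_consT, hN.sq_tens, hN.sq]
    simp [hu]
  have far (i j) (h : Far i j) : qcomm (C.q i j) (C.wx i) (C.wx j) =
      C.lamS i j • (1 - C.wg i * C.wg j) := sub_eq_zero.1 <| words_induction
    (by simp [qcomm, wx_nil, wg_nil]) fun v u hu => by
    have hu' : qcomm (C.q i j) (C.wx i) (C.wx j) u = C.lamS i j • (u - C.wg i (C.wg j u)) :=
      sub_eq_zero.1 hu
    rw [LinearMap.sub_apply, sub_eq_zero]
    change qcomm (C.q i j) (C.wx i) (C.wx j) (consT (v ⊗ₜ u)) =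
      C.lamS i j • (cons v u - C.wg i (C.wg j (cons v u)))
    rw [qcomm_consT, hN.qcomm_tens _ h, hN.far _ _ h, wg_cons, wg_cons]
    simp only [consT, LinearMap.add_apply, TensorProduct.map_tmul, map_add, TensorProduct.lift.tmul,
      hu', LinearMap.smul_apply, LinearMap.sub_apply, Module.End.mul_apply, Module.End.one_apply,
      map_sub, map_smul]
    module
  refine ⟨C.bos_words, sq, far, fun i => sub_eq_zero.1 <| words_induction
    (by simp [serreOf, serreComm, qcomm, wx_nil, wg_nil]) fun v u hu => ?_⟩
  have hu' : C.serreOf C.wx i u = C.nu i • (u - C.wg i (C.wg (i + 1) (C.wg (i + 1)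
    (C.wg (i + 2) u)))) := sub_eq_zero.1 hu
  rw [LinearMap.sub_apply, sub_eq_zero]
  change C.serreOf C.wx i (consT (v ⊗ₜ u)) = C.nu i • (cons v u - C.wg i (C.wg (i + 1)
    (C.wg (i + 1) (C.wg (i + 2) (cons v u)))))
  rw [serre_consT, hN.serre_tens (hN.sq _) (sq _) (C.bos_words.serre_cond i 1 ?_), hN.serre]
  · simp only [wg_cons, consT, LinearMap.add_apply, TensorProduct.map_tmul, map_add,
      TensorProduct.lift.tmul, hu', LinearMap.smul_apply, LinearMap.sub_apply,
      Module.End.mul_apply, Module.End.one_apply, map_sub, map_smul]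
    module
  · rw [far _ _ (Or.inl le_rfl), one_smul]

end ChainData
end

section
open Finset

namespace ChainData
open Free
variable {k : Type u} [Field k] (C : ChainData k)

lemma Rep.tens {C : ChainData k} {M M' : Type*} [AddCommGroup M] [Module k M] [AddCommGroup M']
    [Module k M'] {x g : ℕ → Module.End k M} {x' g' : ℕ → Module.End k M'} (h : C.Rep x g)
    (h' : C.Rep x' g') : C.Rep (tens x g x') fun i => TensorProduct.map (g i) (g' i) where
  gg i j := by rw [map_mul_map, map_mul_map, h.gg, h'.gg]
  gx i j := by
    simp only [ChainData.tens, mul_add, add_mul, map_mul_map, h.gx, h'.gx, h.gg i j, mul_one, one_mul,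
      TensorProduct.map_smul_left, TensorProduct.map_smul_right, smul_add]
  sq i := by rw [h.sq_tens, h.sq, h'.sq]; simp
  far i j hij := by
    rw [h.qcomm_tens _ hij, h.far _ _ hij, h'.far _ _ hij]
    simp only [map_sub_left, map_sub_right, TensorProduct.map_smul_left,
      TensorProduct.map_smul_right, map_mul_map, TensorProduct.map_one]
    module
  serre i := by
    rw [h.serre_tens (h.sq _) (h'.sq _) (h'.serre_cond i 1 ?_), h.serre, h'.serre]
    · simp only [map_sub_left, map_sub_right, TensorProduct.map_smul_left,
        TensorProduct.map_smul_right, map_mul_map, TensorProduct.map_one]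
      module
    · rw [h'.far _ _ (Or.inl le_rfl), one_smul]

/-- The operator `x_i` on pairs of letters. -/
def tx (i : ℕ) : Module.End k (Letters k ⊗[k] Letters k) := tens C.lx C.lg C.lx i

/-- The operator `g_i` on pairs of letters. -/
def tg (i : ℕ) : Module.End k (Letters k ⊗[k] Letters k) := TensorProduct.map (C.lg i) (C.lg i)

lemma tx_tmul (i : ℕ) (v w : Letters k) :
    C.tx i (v ⊗ₜ w) = C.lx i v ⊗ₜ w + C.lg i v ⊗ₜ C.lx i w := rfl

lemma tg_tmul (i : ℕ) (v w : Letters k) : C.tg i (v ⊗ₜ w) = C.lg i v ⊗ₜ C.lg i w := rfl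

lemma lx_self (l : ℕ) : C.lx l (bv l) = bv (l + 1) := C.A_self l

lemma lx_pred (l : ℕ) : C.lx l (bv (l + 1)) = 0 := C.A_pred l

lemma lx_zero {i : ℕ} (hi : i ≠ 0) : C.lx i (bv 0) = 0 := C.A_zero hi

lemma lx_zero_two : C.lx 0 (bv 2) = 0 := C.A_zero_two

lemma tx_bv (l : ℕ) (w : Letters k) :
    C.tx l (bv l ⊗ₜ w) = bv (l + 1) ⊗ₜ w + C.wt l l • bv l ⊗ₜ C.lx l w := by
  rw [tx_tmul, lx_self, lg_bv]; rfl

/-- The columns of `braid`. -/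
def braidCol : ℕ → (Letters k →ₗ[k] Letters k ⊗[k] Letters k)
  | 0 => (TensorProduct.mk k (Letters k) (Letters k)).flip (bv 0) -
      TensorProduct.mk k (Letters k) (Letters k) (bv 0)
  | l + 1 => C.tx l ∘ₗ braidCol l - C.wt l l • (braidCol l ∘ₗ C.lx l)

/-- The endomorphism of the module of pairs of letters that commutes with the operators `x_i` and
maps `z_0 ⊗ w` to `w ⊗ z_0 - z_0 ⊗ w`. -/
def braid : Module.End k (Letters k ⊗[k] Letters k) := TensorProduct.lift (lift C.braidCol)

lemma braid_tmul (l : ℕ) (w : Letters k) : C.braid (bv l ⊗ₜ w) = C.braidCol l w := by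
  simp [braid]

lemma braid_zero (w : Letters k) : C.braid (bv 0 ⊗ₜ w) = w ⊗ₜ bv 0 - bv 0 ⊗ₜ w := by
  rw [braid_tmul]; rfl

lemma braid_succ (l : ℕ) (w : Letters k) : C.braid (bv (l + 1) ⊗ₜ w) =
    C.tx l (C.braid (bv l ⊗ₜ w)) - C.wt l l • C.braid (bv l ⊗ₜ C.lx l w) := by
  simp only [braid_tmul]; rfl

lemma braid_tx_self (l : ℕ) (w : Letters k) :
    C.braid (C.tx l (bv l ⊗ₜ w)) = C.tx l (C.braid (bv l ⊗ₜ w)) := by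
  rw [tx_bv, map_add, braid_succ, map_smul]; abel

variable {C}

lemma pair_eq_zero {U : Type*} [AddCommGroup U] [Module k U]
    {E : Letters k ⊗[k] Letters k →ₗ[k] U} (h : ∀ l w, E (bv l ⊗ₜ w) = 0) : E = 0 := by
  refine TensorProduct.ext (hom_ext fun l => LinearMap.ext fun w => ?_)
  exact h l w

/-- Linear maps on pairs are determined by their values at `z_0 ⊗ w` and by commutation with the
operators `x_i`. -/
lemma pair_induction {U : Type*} [AddCommGroup U] [Module k U]
    {E : Letters k ⊗[k] Letters k →ₗ[k] U} (h₀ : ∀ w, E (bv 0 ⊗ₜ w) = 0)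
    (h : ∀ l, (∀ w, E (bv l ⊗ₜ w) = 0) → ∀ w, E (C.tx l (bv l ⊗ₜ w)) = 0) : E = 0 := by
  refine pair_eq_zero fun l => ?_
  induction l with
  | zero => exact h₀
  | succ l ih =>
    intro w
    have := h l ih w
    rwa [tx_bv, map_add, map_smul, ih, smul_zero, add_zero] at this

/-- `braid` commutes with diagonal operators. -/
lemma braid_comm_diag {d : Module.End k (Letters k)} {γ c : ℕ → k}
    (hd : ∀ l, d (bv l) = γ l • bv l) (hx : ∀ j, d * C.lx j = c j • (C.lx j * d))
    (h₀ : γ 0 * γ 0 = 1) (t) : TensorProduct.map d d (C.braid t) =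
      C.braid (TensorProduct.map d d t) := by
  have hg (j : ℕ) (v : Letters k) : d (C.lg j v) = C.lg j (d v) := by
    have : d ∘ₗ C.lg j = C.lg j ∘ₗ d := hom_ext fun l => by
      simp only [LinearMap.comp_apply, lg_bv, hd, map_smul, smul_smul, mul_comm]
    exact LinearMap.congr_fun this v
  have hx' (j : ℕ) (v : Letters k) : d (C.lx j v) = c j • C.lx j (d v) :=
    LinearMap.congr_fun (hx j) v
  have ht (j : ℕ) (t) : TensorProduct.map d d (C.tx j t) = c j • C.tx j (TensorProduct.map d d t) := by
    induction t with
    | zero => simp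
    | add s t hs ht => simp only [map_add, hs, ht, smul_add]
    | tmul v w =>
      simp only [tx_tmul, map_add, TensorProduct.map_tmul, hx', hg, ← TensorProduct.smul_tmul',
        TensorProduct.tmul_smul, smul_add]
  have : TensorProduct.map d d ∘ₗ C.braid - C.braid ∘ₗ TensorProduct.map d d = 0 := by
    refine pair_induction (C := C) (fun w => ?_) fun l ih w => ?_
    · simp only [LinearMap.sub_apply, LinearMap.comp_apply, braid_zero, map_sub,
        TensorProduct.map_tmul, hd, TensorProduct.tmul_smul, ← TensorProduct.smul_tmul', map_smul, braid_zero]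
      module
    · have ih' : TensorProduct.map d d (C.braid (bv l ⊗ₜ w)) =
        C.braid (TensorProduct.map d d (bv l ⊗ₜ w)) := sub_eq_zero.1 (ih w)
      simp only [LinearMap.sub_apply, LinearMap.comp_apply, ht, map_smul, braid_tx_self, ih']
      simp only [TensorProduct.map_tmul, hd, ← TensorProduct.smul_tmul', map_smul, braid_tx_self,
        sub_self]
  exact sub_eq_zero.1 (LinearMap.congr_fun this t)

lemma braid_tg (i : ℕ) (t) : C.tg i (C.braid t) = C.braid (C.tg i t) :=
  braid_comm_diag (γ := fun l => C.wt l i) (fun l => C.lg_bv i l) (C.bos_letters.gx i)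
    (by rw [wt_zero]; split_ifs <;> simp) t

variable (k) in
/-- The span of the pairs whose first letter is smaller than `n`. -/
def firstBelow (n : ℕ) : Submodule k (Letters k ⊗[k] Letters k) :=
  Submodule.span k {t | ∃ l < n, ∃ w, t = bv l ⊗ₜ w}

lemma bv_tmul_mem {l n : ℕ} (h : l < n) (w : Letters k) : bv l ⊗ₜ w ∈ firstBelow k n :=
  Submodule.subset_span ⟨l, h, w, rfl⟩

lemma tmul_mem {n : ℕ} {v : ℕ →₀ k} (h : Below n v) (w : Letters k) :
    (v : Letters k) ⊗ₜ[k] w ∈ firstBelow k n := by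
  have := apply_eq_zero_of_below ((firstBelow k n).mkQ ∘ₗ
    ((TensorProduct.mk k (Letters k) (Letters k)).flip w : (ℕ →₀ k) →ₗ[k] _)) (n := n)
    (fun l hl => (Submodule.Quotient.mk_eq_zero _).2 (bv_tmul_mem hl w)) h
  exact (Submodule.Quotient.mk_eq_zero _).1 this

lemma firstBelow_mono {m n : ℕ} (h : m ≤ n) : firstBelow k m ≤ firstBelow k n :=
  Submodule.span_mono fun _ ⟨l, hl, w, e⟩ => ⟨l, hl.trans_le h, w, e⟩

lemma tx_mem_succ {n : ℕ} {t} (ht : t ∈ firstBelow k n) (i : ℕ) :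
    C.tx i t ∈ firstBelow k (n + 1) := by
  induction ht using Submodule.span_induction with
  | mem t h =>
    obtain ⟨l, hl, w, rfl⟩ := h
    rw [tx_tmul, lg_bv]
    rw [← TensorProduct.smul_tmul']
    exact add_mem (tmul_mem ((below_z hl).A_succ (C := C) i) w)
      (Submodule.smul_mem _ _ (bv_tmul_mem (by omega) _))
  | zero => simp
  | add s t _ _ hs ht => rw [map_add]; exact add_mem hs ht
  | smul c t _ ht => rw [map_smul]; exact Submodule.smul_mem _ _ ht

lemma tx_mem {n : ℕ} {t} (ht : t ∈ firstBelow k n) {i : ℕ} (hi : i + 1 ≠ n) :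
    C.tx i t ∈ firstBelow k n := by
  induction ht using Submodule.span_induction with
  | mem t h =>
    obtain ⟨l, hl, w, rfl⟩ := h
    rw [tx_tmul, lg_bv]
    rw [← TensorProduct.smul_tmul']
    exact add_mem (tmul_mem ((below_z hl).A (C := C) hi) w)
      (Submodule.smul_mem _ _ (bv_tmul_mem hl _))
  | zero => simp
  | add s t _ _ hs ht => rw [map_add]; exact add_mem hs ht
  | smul c t _ ht => rw [map_smul]; exact Submodule.smul_mem _ _ ht

lemma exists_tx (l : ℕ) (w : Letters k) :
    ∃ t ∈ firstBelow k (l + 1), bv (l + 1) ⊗ₜ w = C.tx l (bv l ⊗ₜ w) + t :=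
  ⟨-(C.wt l l • (bv l ⊗ₜ C.lx l w)), neg_mem (Submodule.smul_mem _ _ (bv_tmul_mem (by omega) _)),
    by rw [tx_bv, TensorProduct.smul_tmul']; abel⟩

/-- `braid` commutes with the operators `x_i` on the pairs whose first letter is smaller than
`n`. -/
def CommBelow (C : ChainData k) (n : ℕ) : Prop :=
  ∀ i, ∀ t ∈ firstBelow k n, C.tx i (C.braid t) = C.braid (C.tx i t)

lemma commBelow_zero : C.CommBelow 0 := fun i t ht => by
  have : firstBelow k 0 = ⊥ := Submodule.span_eq_bot.2 fun _ ⟨l, hl, _⟩ => absurd hl (by omega)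
  rw [this, Submodule.mem_bot] at ht
  simp [ht]

lemma CommBelow.succ {n : ℕ} (h : C.CommBelow n)
    (h' : ∀ i w, C.tx i (C.braid (bv n ⊗ₜ w)) = C.braid (C.tx i (bv n ⊗ₜ w))) :
    C.CommBelow (n + 1) := fun i t ht => by
  induction ht using Submodule.span_induction with
  | mem t ht =>
    obtain ⟨l, hl, w, rfl⟩ := ht
    rcases Nat.lt_succ_iff_lt_or_eq.1 hl with hl | rfl
    · exact h i _ (bv_tmul_mem hl w)
    · exact h' i w
  | zero => simp
  | add s t _ _ hs ht => simp only [map_add, hs, ht]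
  | smul c t _ ht => simp only [map_smul, ht]

lemma comm_zero {i : ℕ} (hi : i ≠ 0) (w : Letters k) :
    C.tx i (C.braid (bv 0 ⊗ₜ w)) = C.braid (C.tx i (bv 0 ⊗ₜ w)) := by
  have hw : C.wt 0 i = 1 := by rw [wt_zero, if_neg hi]
  simp only [braid_zero, tx_tmul, map_sub, map_add, lx_zero C hi, lg_bv, hw, one_smul,
    TensorProduct.tmul_zero, TensorProduct.zero_tmul, map_zero, zero_add, add_zero]

variable [CharZero k]

variable (C) in
lemma rep_pairs : C.Rep C.tx C.tg := C.rep_letters.tens C.rep_letters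

lemma CommBelow.comm_far {m i : ℕ} (h : C.CommBelow (m + 1)) (hi : Far i m) (w : Letters k) :
    C.tx i (C.braid (bv (m + 1) ⊗ₜ w)) = C.braid (C.tx i (bv (m + 1) ⊗ₜ w)) := by
  obtain ⟨t, ht, e⟩ := exists_tx (C := C) m w
  have hu : bv m ⊗ₜ w ∈ firstBelow k (m + 1) := bv_tmul_mem (by omega) w
  rw [e]
  simp only [map_add, h i t ht, ← h m _ hu]
  congr 1
  generalize hu' : (bv m ⊗ₜ w : Letters k ⊗[k] Letters k) = u at *
  have hiu : C.tx i u ∈ firstBelow k (m + 1) := tx_mem hu (by unfold Far at hi; omega)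
  have key (u) : C.tx i (C.tx m u) =
      C.q i m • C.tx m (C.tx i u) + C.lamS i m • (u - C.tg i (C.tg m u)) := by
    have := LinearMap.congr_fun (C.rep_pairs.far i m hi) u
    rw [add_comm]
    exact sub_eq_iff_eq_add.1 this
  simp only [key, map_add, map_smul, map_sub, ← braid_tg, h i u hu, h m _ hiu]

lemma CommBelow.comm_pred {m : ℕ} (h : C.CommBelow (m + 1)) (w : Letters k) :
    C.tx m (C.braid (bv (m + 1) ⊗ₜ w)) = C.braid (C.tx m (bv (m + 1) ⊗ₜ w)) := by
  obtain ⟨t, ht, e⟩ := exists_tx (C := C) m w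
  have hu : bv m ⊗ₜ w ∈ firstBelow k (m + 1) := bv_tmul_mem (by omega) w
  have sq (u) : C.tx m (C.tx m u) = 0 := by
    have := LinearMap.congr_fun (C.rep_pairs.sq m) u
    rwa [pow_two] at this
  rw [e]
  simp only [map_add, h m t ht, ← h m _ hu, sq, map_zero]

lemma CommBelow.comm_serre {a : ℕ} (h : C.CommBelow (a + 3)) (w : Letters k) :
    C.tx (a + 1) (C.braid (bv (a + 3) ⊗ₜ w)) = C.braid (C.tx (a + 1) (bv (a + 3) ⊗ₜ w)) := by
  set u : Letters k ⊗[k] Letters k := bv a ⊗ₜ w with hu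
  obtain ⟨t, ht, e⟩ : ∃ t ∈ firstBelow k (a + 3), bv (a + 3) ⊗ₜ w =
      C.tx (a + 2) (C.tx (a + 1) (C.tx a u)) + t := by
    obtain ⟨t₁, h₁, e₁⟩ := exists_tx (C := C) a w
    obtain ⟨t₂, h₂, e₂⟩ := exists_tx (C := C) (a + 1) w
    obtain ⟨t₃, h₃, e₃⟩ := exists_tx (C := C) (a + 2) w
    refine ⟨C.tx (a + 2) (C.tx (a + 1) t₁) + C.tx (a + 2) t₂ + t₃, add_mem (add_mem ?_ ?_) h₃, ?_⟩
    · exact tx_mem_succ (tx_mem_succ h₁ _) _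
    · exact tx_mem_succ h₂ _
    · rw [e₃, e₂, e₁]; simp only [map_add]; abel
  rw [e]
  simp only [map_add, h (a + 1) t ht]
  congr 1
  have key (u) : serreVec (C.q a (a + 1)) (C.q (a + 1) (a + 2)) (C.q a (a + 2)) (C.tx a)
      (C.tx (a + 1)) (C.tx (a + 2)) u = C.nu a • (u - C.tg a (C.tg (a + 1) (C.tg (a + 1)
        (C.tg (a + 2) u)))) := by
    rw [← serreComm_apply (C.q_ne_zero _ _) (C.rep_pairs.sq _) (C.rep_pairs.serre_cond a 1 ?_)]
    · exact LinearMap.congr_fun (C.rep_pairs.serre a) u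
    · rw [C.rep_pairs.far _ _ (Or.inl le_rfl), one_smul]
  have hne : C.q a (a + 1) ^ 2 * C.q a (a + 2) ≠ 0 :=
    mul_ne_zero (pow_ne_zero 2 (C.q_ne_zero _ _)) (C.q_ne_zero _ _)
  have m₀ : u ∈ firstBelow k (a + 1) := bv_tmul_mem (by omega) w
  have s {n i : ℕ} {t} (ht : t ∈ firstBelow k n) : C.tx i t ∈ firstBelow k (n + 1) :=
    tx_mem_succ ht i
  have s' {n i : ℕ} {t} (ht : t ∈ firstBelow k (a + n + 1)) (hi : i ≠ a + n) :
    C.tx i t ∈ firstBelow k (a + n + 1) := tx_mem ht (by omega)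
  have p {n i : ℕ} {t} (ht : t ∈ firstBelow k n) (hn : n ≤ a + 3 := by omega) :
    C.tx i (C.braid t) = C.braid (C.tx i t) := h i t (firstBelow_mono hn ht)
  have mA : C.tx a u ∈ firstBelow k (a + 2) := s m₀
  have mB : C.tx (a + 1) u ∈ firstBelow k (a + 1) := s' (n := 0) m₀ (by omega)
  have mC : C.tx (a + 2) u ∈ firstBelow k (a + 1) := s' (n := 0) m₀ (by omega)
  have mCB : C.tx (a + 2) (C.tx (a + 1) u) ∈ firstBelow k (a + 1) := s' (n := 0) mB (by omega)
  have mBCB : C.tx (a + 1) (C.tx (a + 2) (C.tx (a + 1) u)) ∈ firstBelow k (a + 1) :=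
    s' (n := 0) mCB (by omega)
  have mAB : C.tx a (C.tx (a + 1) u) ∈ firstBelow k (a + 2) := s mB
  have mBAB : C.tx (a + 1) (C.tx a (C.tx (a + 1) u)) ∈ firstBelow k (a + 3) := s mAB
  have mBC : C.tx (a + 1) (C.tx (a + 2) u) ∈ firstBelow k (a + 1) := s' (n := 0) mC (by omega)
  have mABC : C.tx a (C.tx (a + 1) (C.tx (a + 2) u)) ∈ firstBelow k (a + 2) := s mBC
  have mBA : C.tx (a + 1) (C.tx a u) ∈ firstBelow k (a + 3) := s mA
  have k₁ := key (C.braid u)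
  have k₂ := congrArg C.braid (key u)
  simp only [serreVec, p m₀, p mA, p mB, p mC, p mCB, p mBCB, p mAB, p mBAB, p mBC, p mABC, p mBA]
    at k₁
  simp only [serreVec, map_add, map_sub, map_smul] at k₂
  refine smul_right_injective _ hne ?_
  simp only [braid_tg, map_sub] at k₁
  linear_combination (norm := module) k₂ - k₁

lemma comm_two (w : Letters k) :
    C.tx 0 (C.braid (bv 2 ⊗ₜ w)) = C.braid (C.tx 0 (bv 2 ⊗ₜ w)) := by
  have w0 : C.wt 0 0 = -1 := by simp [wt_zero]
  have w1 : C.wt 1 1 = C.q 1 0 := by simp [wt]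
  have w2 : C.wt 2 0 = C.q 0 1 := by simp [wt, prod_range_succ, C.q_self]
  have hg1 (v : Letters k) : C.lg 0 (C.lx 1 v) = C.q 0 1 • C.lx 1 (C.lg 0 v) :=
    LinearMap.congr_fun (C.bos_letters.gx 0 1) v
  have hg0 (v : Letters k) : C.lg 0 (C.lx 0 v) = -C.lx 0 (C.lg 0 v) := by
    have := LinearMap.congr_fun (C.bos_letters.gx 0 0) v
    rwa [C.q_self, neg_smul, one_smul] at this
  have hg10 (v : Letters k) : C.lg 1 (C.lx 0 v) = C.q 1 0 • C.lx 0 (C.lg 1 v) :=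
    LinearMap.congr_fun (C.bos_letters.gx 1 0) v
  have sq (i : ℕ) (v : Letters k) : C.lx i (C.lx i v) = 0 := C.A_sq i v
  have b1 (w : Letters k) : C.braid (bv 1 ⊗ₜ w) =
      (2 : k) • C.lx 0 w ⊗ₜ bv 0 + C.lg 0 w ⊗ₜ bv 1 - bv 1 ⊗ₜ w := by
    rw [braid_succ, braid_zero, braid_zero, map_sub, tx_tmul, tx_tmul, lg_bv, w0, lx_self]
    simp only [TensorProduct.neg_tmul, neg_smul, one_smul, two_smul, TensorProduct.add_tmul]
    abel
  have b2 (w : Letters k) : C.braid (bv 2 ⊗ₜ w) = (2 : k) • (C.lx 1 (C.lx 0 w) ⊗ₜ bv 0) -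
      (2 * C.q 1 0) • (C.lx 0 (C.lx 1 w) ⊗ₜ bv 0) + (2 : k) • (C.lx 1 (C.lg 0 w) ⊗ₜ bv 1) +
      C.lg 1 (C.lg 0 w) ⊗ₜ bv 2 - bv 2 ⊗ₜ w := by
    rw [braid_succ, b1, b1]
    simp only [map_add, map_sub, tx_tmul, lx_self, lx_zero C one_ne_zero, lg_bv, w1,
      TensorProduct.tmul_zero, hg1, ← TensorProduct.smul_tmul', map_smul]
    have := C.q_adj 0
    linear_combination (norm := module) (-this) • (C.lx 1 (C.lg 0 w) ⊗ₜ[k] bv 1)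
  rw [b2, tx_tmul, lx_zero_two, lg_bv, w2, TensorProduct.zero_tmul, zero_add,
    ← TensorProduct.smul_tmul', map_smul, b2]
  have e := C.q_adj 0
  have l21 : C.lx 0 (bv 1) = 0 := C.lx_pred 0
  simp only [map_add, map_sub, tx_tmul, lx_self, l21, lx_zero_two, lg_bv, w2,
    TensorProduct.tmul_zero, hg1, hg0, hg10, map_smul, ← TensorProduct.smul_tmul', sq, smul_neg,
    TensorProduct.neg_tmul, map_neg, TensorProduct.zero_tmul, smul_zero, TensorProduct.tmul_smul, map_zero]
  match_scalars
  · linear_combination 2 * e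
  · ring
  · linear_combination 2 * e
  · linear_combination e
  · ring

variable (C) in
lemma commBelow (n : ℕ) : C.CommBelow n := by
  induction n with
  | zero => exact commBelow_zero
  | succ n ih =>
    refine ih.succ fun i w => ?_
    by_cases hin : i = n
    · subst hin; exact (braid_tx_self C i w).symm
    rcases n with _ | m
    · exact comm_zero hin w
    by_cases him : i = m
    · subst him; exact ih.comm_pred w
    by_cases hf : Far i m
    · exact ih.comm_far hf w
    obtain rfl : m = i + 1 := by unfold Far at hf; omega
    rcases i with _ | a
    · exact comm_two w
    · exact ih.comm_serre w

/-- `braid` commutes with the operators `x_i`. -/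
theorem braid_tx (i : ℕ) (t) : C.tx i (C.braid t) = C.braid (C.tx i t) := by
  have : C.tx i ∘ₗ C.braid - C.braid ∘ₗ C.tx i = 0 := pair_eq_zero fun l w =>
    sub_eq_zero.2 (C.commBelow (l + 1) i _ (bv_tmul_mem (Nat.lt_succ_self l) w))
  exact sub_eq_zero.1 (LinearMap.congr_fun this t)

end ChainData
end

section
open Finset

namespace ChainData
open Free
variable {k : Type u} [Field k] {C : ChainData k}

lemma form₂_of_wt {i m t : ℕ} (h : ∀ a, C.wt t a = C.q a i * C.wt m a) (l : ℕ) :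
    C.form₂ l t = C.form₂ l m * ∏ a ∈ range l, C.q a i := by
  simp only [form₂, ← prod_mul_distrib]
  refine prod_congr rfl fun a _ => ?_
  have := h a
  simp only [wt] at this
  split_ifs at this
  · linear_combination -this
  · linear_combination this

lemma sign_wt_sq (l i : ℕ) : C.sign.wt l i * C.sign.wt l i = 1 := by
  induction l with
  | zero => rw [wt_zero]; split_ifs <;> simp
  | succ l ih =>
    rw [wt_succ]
    change C.e i l * _ * (C.e i l * _) = _
    linear_combination C.e i l * C.e i l * ih + C.e_sq i l

lemma gauge_sq (l : ℕ) : C.gauge l * C.gauge l = 1 := by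
  rw [gauge, ← prod_mul_distrib]
  exact prod_eq_one fun i _ => sign_wt_sq _ _

variable (C) in
/-- The scalars by which the pairs of letters are rescaled when the factors are exchanged. -/
def pairGauge (l m : ℕ) : k := C.gauge l * C.gauge m * (C.form₂ l m * C.sign.form₂ l m)

lemma pairGauge_self (l : ℕ) : C.pairGauge l l = 1 := by
  have h₁ := C.form₂_self l
  have h₂ := C.sign.form₂_self l
  rw [pairGauge, gauge_sq, h₁, h₂]
  split_ifs <;> ring

lemma pairGauge_zero_left (m : ℕ) : C.pairGauge 0 m = C.gauge m := by
  simp [pairGauge, gauge, form₂]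

lemma pairGauge_zero_right (m : ℕ) : C.pairGauge m 0 = C.gauge m := by
  simp [pairGauge, gauge, form₂]

lemma Step.pairGauge_right {i m t : ℕ} (h : C.Step i m t) (l : ℕ) :
    C.wt l i * C.pairGauge l t = C.sign.wt l i * C.sign.wt m i * C.pairGauge l m := by
  rw [pairGauge, pairGauge, h.gauge, form₂_of_wt h.wt, form₂_of_wt (C := C.sign) h.wt_sign]
  have h₁ := C.wt_mul_prod l i
  have h₂ := C.sign.wt_mul_prod l i
  have h₃ : ∀ a b : Prop, [Decidable a] → [Decidable b] →
    (if a ∨ b then (-1 : k) else 1) * (if a ∨ b then -1 else 1) = 1 := fun a b => by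
      intros; split_ifs <;> ring
  have h₄ := h₃ (l = i) (l = i + 1)
  have h₅ := sign_wt_sq (C := C) l i
  rw [← h₁] at h₄
  nth_rewrite 2 [h₁] at h₄
  rw [← h₂] at h₄
  linear_combination (C.sign.wt m i * C.gauge m * C.gauge l * C.form₂ l m * C.sign.form₂ l m *
    C.sign.wt l i) * h₄ - (C.sign.wt m i * C.gauge m * C.gauge l * C.form₂ l m *
    C.sign.form₂ l m * C.wt l i * (∏ a ∈ range l, C.q a i) * ∏ a ∈ range l, C.sign.q a i) * h₅

lemma pairGauge_mul_swap (l m : ℕ) : C.pairGauge l m * C.pairGauge m l = 1 := by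
  have h₁ := C.form₂_symm l m
  have h₂ := C.sign.form₂_symm l m
  have h₃ : (sgn l m : k) * sgn l m = 1 := by unfold sgn; split_ifs <;> ring
  have h₄ := gauge_sq (C := C) l
  have h₅ := gauge_sq (C := C) m
  rw [pairGauge, pairGauge]
  linear_combination (C.form₂ l m * C.form₂ m l * (C.sign.form₂ l m * C.sign.form₂ m l)) *
    (C.gauge m * C.gauge m * h₄ + h₅) + h₁ * (C.sign.form₂ l m * C.sign.form₂ m l) +
    sgn l m * h₂ + h₃

lemma Step.pairGauge_left {i l t : ℕ} (h : C.Step i l t) (m : ℕ) :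
    C.pairGauge t m = C.sign.wt l i * C.sign.wt m i * C.wt m i * C.pairGauge l m := by
  have h₁ := h.pairGauge_right m
  have h₂ := pairGauge_mul_swap (C := C) t m
  have h₃ := pairGauge_mul_swap (C := C) l m
  have h₄ := sign_wt_sq (C := C) l i
  have h₅ := sign_wt_sq (C := C) m i
  linear_combination C.sign.wt l i * C.sign.wt m i * C.wt m i * C.pairGauge l m * h₂ -
    C.pairGauge t m * h₃ * (C.sign.wt l i * C.sign.wt m i) ^ 2 +
    (- C.sign.wt l i * C.sign.wt m i * C.pairGauge l m * C.pairGauge t m) * h₁ -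
    C.pairGauge t m * (C.sign.wt m i * C.sign.wt m i * h₄ + h₅)

lemma lx_congr {U : Type*} [AddCommGroup U] [Module k U] {F F' : Letters k →ₗ[k] U} {i l : ℕ}
    (h : ∀ t, C.Step i l t → F (bv t) = F' (bv t)) : F (C.lx i (bv l)) = F' (C.lx i (bv l)) := by
  rw [← sub_eq_zero, ← LinearMap.sub_apply]
  have e : (C.A i (z l) : ℕ →₀ k) = (C.A i (z l)).sum fun t c => c • (z t : ℕ →₀ k) := by
    simp
  obtain ⟨D, hD⟩ : ∃ D : (ℕ →₀ k) →ₗ[k] U, D = F - F' := ⟨_, rfl⟩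
  rw [← hD]
  change D (C.A i (z l)) = 0
  rw [e, Finsupp.sum, map_sum]
  refine sum_eq_zero fun t ht => ?_
  have h' : D (z t) = 0 := by
    rw [hD]; exact sub_eq_zero.2 (h t (step_of_ne (Finsupp.mem_support_iff.1 ht)))
  rw [map_smul, h', smul_zero]

variable (C)

/-- The diagonal operators given by the signs. -/
def ls (i : ℕ) : Module.End k (Letters k) := lift fun l => C.sign.wt l i • bv l

lemma ls_bv (i l : ℕ) : C.ls i (bv l) = C.sign.wt l i • bv l := by simp [ls]

lemma ls_lx (i j : ℕ) : C.ls i * C.lx j = C.e i j • (C.lx j * C.ls i) := by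
  refine hom_ext fun l => ?_
  simp only [Module.End.mul_apply, LinearMap.smul_apply, ls_bv, map_smul, smul_smul]
  exact lx_congr (C := C) (F := C.ls i) (F' := (C.e i j * C.sign.wt l i) • LinearMap.id)
    fun t ht => by rw [ls_bv, ht.wt_sign]; rfl

/-- Rescaling of the pairs of letters. -/
def rescale : Module.End k (Letters k ⊗[k] Letters k) :=
  TensorProduct.lift (lift fun l => lift fun m => C.pairGauge l m • bv l ⊗ₜ bv m)

lemma rescale_bv (l m : ℕ) :
    C.rescale (bv l ⊗ₜ bv m) = C.pairGauge l m • (bv l ⊗ₜ bv m) := by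
  simp [rescale, TensorProduct.smul_tmul']

/-- The exchange of the two letters. -/
abbrev swap : Letters k ⊗[k] Letters k →ₗ[k] Letters k ⊗[k] Letters k :=
  (TensorProduct.comm k (Letters k) (Letters k)).toLinearMap

variable {C}

lemma pair_ext {U : Type*} [AddCommGroup U] [Module k U]
    {E F : Letters k ⊗[k] Letters k →ₗ[k] U} (h : ∀ l m, E (bv l ⊗ₜ bv m) = F (bv l ⊗ₜ bv m)) :
    E = F :=
  TensorProduct.ext (hom_ext fun l => hom_ext fun m => h l m)

lemma swap_swap (t : Letters k ⊗[k] Letters k) : swap (swap t) = t :=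
  (TensorProduct.comm k (Letters k) (Letters k)).symm_apply_apply t

lemma rescale_tx (i : ℕ) (t) : C.rescale (C.tx i t) =
    swap (C.tx i (swap (C.rescale (TensorProduct.map (C.ls i) (C.ls i) t)))) := by
  have : C.rescale ∘ₗ C.tx i = swap ∘ₗ C.tx i ∘ₗ swap ∘ₗ C.rescale ∘ₗ
      TensorProduct.map (C.ls i) (C.ls i) := pair_ext fun l m => by
    have h₁ := lx_congr (C := C) (i := i) (l := l)
      (F := C.rescale ∘ₗ (TensorProduct.mk k (Letters k) (Letters k)).flip (bv m))
      (F' := (C.sign.wt l i * C.sign.wt m i * C.wt m i * C.pairGauge l m) •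
        (TensorProduct.mk k (Letters k) (Letters k)).flip (bv m)) fun t ht => by
          simp [rescale_bv, ht.pairGauge_left]
    have h₂ := lx_congr (C := C) (i := i) (l := m)
      (F := C.wt l i • (C.rescale ∘ₗ TensorProduct.mk k (Letters k) (Letters k) (bv l)))
      (F' := (C.sign.wt l i * C.sign.wt m i * C.pairGauge l m) •
        TensorProduct.mk k (Letters k) (Letters k) (bv l)) fun t ht => by
          simp [rescale_bv, smul_smul, ht.pairGauge_right]
    simp only [LinearMap.comp_apply, LinearMap.smul_apply, LinearMap.flip_apply,
      TensorProduct.mk_apply] at h₁ h₂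
    simp only [LinearMap.comp_apply, tx_tmul, map_add, lg_bv, ← TensorProduct.smul_tmul', map_smul,
      h₁, h₂, TensorProduct.map_tmul, ls_bv, TensorProduct.tmul_smul, rescale_bv,
      LinearEquiv.coe_coe, TensorProduct.comm_tmul]
    module
  exact LinearMap.congr_fun this t

variable [CharZero k]

omit [CharZero k] in
lemma braid_bv_zero (l : ℕ) : C.braid (bv l ⊗ₜ bv 0) = bv l ⊗ₜ bv 0 - bv 0 ⊗ₜ bv l := by
  induction l with
  | zero => rw [braid_zero]
  | succ l ih =>
    rw [braid_succ, ih, map_sub, tx_bv, tx_tmul, lx_self]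
    rcases l with _ | l
    · rw [lx_self, braid_zero, wt_zero, if_pos rfl, lg_bv, wt_zero, if_pos rfl,
        TensorProduct.smul_tmul']
      module
    · rw [lx_zero C (by omega), lg_bv, wt_zero, if_neg (by omega)]
      simp

/-- Exchanging the letters changes the sign of `braid` up to rescaling. -/
lemma braid_swap (t) : swap (C.braid (swap (C.rescale t))) = -C.rescale (C.braid t) := by
  have : swap ∘ₗ C.braid ∘ₗ swap ∘ₗ C.rescale + C.rescale ∘ₗ C.braid = 0 := by
    refine pair_induction (C := C) (fun w => ?_) fun l ih w => ?_
    · have : (swap ∘ₗ C.braid ∘ₗ swap ∘ₗ C.rescale + C.rescale ∘ₗ C.braid) ∘ₗ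
          TensorProduct.mk k (Letters k) (Letters k) (bv 0) = 0 := hom_ext fun m => by
        simp only [LinearMap.comp_apply, LinearMap.add_apply, TensorProduct.mk_apply, rescale_bv,
          map_smul, LinearEquiv.coe_coe, TensorProduct.comm_tmul, braid_bv_zero, braid_zero,
          map_sub, pairGauge_zero_left, pairGauge_zero_right, LinearMap.zero_apply]
        module
      exact LinearMap.congr_fun this w
    · have hK := braid_comm_diag (C := C) (C.ls_bv l) (C.ls_lx l) (sign_wt_sq 0 l) (bv l ⊗ₜ w)
      have ih' := ih (C.ls l w)
      simp only [LinearMap.add_apply, LinearMap.comp_apply] at ih' ⊢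
      rw [rescale_tx, swap_swap, ← braid_tx, ← braid_tx, rescale_tx, hK]
      simp only [TensorProduct.map_tmul, ls_bv, ← TensorProduct.smul_tmul', map_smul, ← smul_add]
      rw [eq_neg_of_add_eq_zero_right ih', map_neg, swap_swap, map_neg, map_neg, add_neg_cancel,
        smul_zero]
  exact eq_neg_of_add_eq_zero_left (LinearMap.congr_fun this t)

variable (k) in
/-- The coefficient of `z_0 ⊗ z_0`. -/
def vac : Letters k ⊗[k] Letters k →ₗ[k] k :=
  TensorProduct.lift ((LinearMap.mul k k).compl₁₂ (coord 0) (coord 0))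

omit [CharZero k] in
lemma vac_tmul (v w : Letters k) : vac k (v ⊗ₜ w) = coord 0 v * coord 0 w := rfl

omit [CharZero k] in
lemma vac_rescale (t) : vac k (C.rescale t) = vac k t := by
  have : vac k ∘ₗ C.rescale = vac k := pair_ext fun l m => by
    rw [LinearMap.comp_apply, rescale_bv, map_smul, vac_tmul]
    rcases eq_or_ne 0 l with rfl | hl
    · rcases eq_or_ne 0 m with rfl | hm
      · rw [pairGauge_self, one_smul]
      · rw [coord_bv_ne hm]; simp
    · rw [coord_bv_ne hl]; simp
  exact LinearMap.congr_fun this t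

omit [CharZero k] in
lemma vac_swap (t) : vac k (swap t) = vac k t := by
  have : vac k ∘ₗ swap = vac k := pair_ext fun l m => mul_comm _ _
  exact LinearMap.congr_fun this t

omit [CharZero k] in
lemma vac_tg (i : ℕ) (t) : vac k (C.tg i t) = vac k t := by
  have h (v : Letters k) : coord 0 (C.lg i v) = C.wt 0 i * coord 0 v := C.G_apply i v 0
  have : vac k ∘ₗ C.tg i = vac k := pair_ext fun l m => by
    rw [LinearMap.comp_apply, tg_tmul, vac_tmul, vac_tmul, h, h, wt_zero]
    split_ifs <;> ring
  exact LinearMap.congr_fun this t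

theorem vac_braid (t) : vac k (C.braid t) = 0 := by
  have : vac k ∘ₗ C.braid = 0 := pair_ext fun l m => by
    rw [LinearMap.comp_apply, LinearMap.zero_apply]
    by_cases hlm : l = m
    · subst hlm
      have h := congrArg (vac k) (braid_swap (C := C) (bv l ⊗ₜ bv l))
      rw [vac_swap, map_neg, vac_rescale, rescale_bv, pairGauge_self, one_smul,
        LinearEquiv.coe_coe, TensorProduct.comm_tmul] at h
      exact self_eq_neg.1 h
    · by_contra hne
      refine hlm (Rel₄.eq_of_eq (C := C) (a := 0) fun i => ?_)
      have h := vac_tg (C := C) i (C.braid (bv l ⊗ₜ bv m))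
      rw [braid_tg, tg_tmul, lg_bv, lg_bv, TensorProduct.smul_tmul_smul, map_smul, map_smul,
        smul_eq_mul] at h
      rw [mul_right_cancel₀ hne (h.trans (one_mul _).symm), wt_zero]
      split_ifs <;> simp
  exact LinearMap.congr_fun this t

end ChainData
end

section
open Finset

namespace ChainData
open Free

/-- The largest submodule of the kernel of `f` that is stable under the operators `x_1, x_2, …`. -/
def core {k : Type u} [Field k] {M : Type v} [AddCommGroup M] [Module k M]
    (x : ℕ → Module.End k M) (f : M →ₗ[k] k) : Submodule k M :=
  ⨅ is : List ℕ, LinearMap.ker (f ∘ₗ (is.map fun i => x (i + 1)).prod)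

section Core
variable {k : Type u} [Field k] {C : ChainData k} {M : Type v} [AddCommGroup M] [Module k M]
  {x g : ℕ → Module.End k M} {f : M →ₗ[k] k}

lemma mem_core {u : M} :
    u ∈ core x f ↔ ∀ is : List ℕ, f ((is.map fun i => x (i + 1)).prod u) = 0 := by
  simp [core]

lemma apply_eq_zero_of_mem_core {u : M} (h : u ∈ core x f) : f u = 0 := mem_core.1 h []

lemma mem_core_apply {u : M} (h : u ∈ core x f) (i : ℕ) : x (i + 1) u ∈ core x f :=
  mem_core.2 fun is => by simpa using mem_core.1 h (is ++ [i])

lemma subset_core {s : Set M} (hf : ∀ u ∈ s, f u = 0)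
    (hx : ∀ i, ∀ u ∈ s, x (i + 1) u ∈ Submodule.span k s) {u : M} (hu : u ∈ s) :
    u ∈ core x f := by
  refine mem_core.2 fun is => ?_
  have h : (is.map fun i => x (i + 1)).prod u ∈ Submodule.span k s := by
    induction is with
    | nil => simpa using Submodule.subset_span hu
    | cons i is ih =>
      have : Submodule.span k s ≤ (Submodule.span k s).comap (x (i + 1)) :=
        Submodule.span_le.2 fun u hu => hx i u hu
      simpa using this ih
  have : Submodule.span k s ≤ LinearMap.ker f := Submodule.span_le.2 fun u hu => hf u hu
  exact this h

lemma core_stable (hgx : C.Bos x g) {i : ℕ} (hf : ∀ u, f (g i u) = f u) {u : M}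
    (h : u ∈ core x f) : g i u ∈ core x f := by
  refine subset_core (s := g i '' core x f) ?_ ?_ (Set.mem_image_of_mem _ h)
  · rintro _ ⟨u, hu, rfl⟩
    rw [hf, apply_eq_zero_of_mem_core hu]
  · rintro j _ ⟨u, hu, rfl⟩
    have : g i (x (j + 1) u) = C.q i (j + 1) • x (j + 1) (g i u) :=
      LinearMap.congr_fun (hgx.gx i (j + 1)) u
    rw [← inv_smul_smul₀ (C.q_ne_zero i (j + 1)) (x (j + 1) (g i u)), ← this]
    exact Submodule.smul_mem _ _ (Submodule.subset_span
      (Set.mem_image_of_mem _ (mem_core_apply hu j)))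

end Core

variable {k : Type u} [Field k] (C : ChainData k)

lemma lx_one (i : ℕ) : C.lx (i + 2) (bv 1) = (2 * C.lamS (i + 2) 0) • bv 0 := by
  have h := C.A_far (i := i + 2) (l := 0) (Or.inr (by omega))
  rw [A_zero C (by omega), map_zero, smul_zero, zero_add, defect, wt_zero, wt_zero, if_pos rfl,
    if_neg (by omega)] at h
  refine h.trans ?_
  rw [show C.lamS (i + 2) 0 * (1 - 1 * -1) = 2 * C.lamS (i + 2) 0 by ring, zero_add]
  rfl

section
variable [CharZero k]

lemma braid_one_two : C.braid (bv 1 ⊗ₜ bv 2) = C.q 0 1 • C.tx 1 (bv 1 ⊗ₜ bv 1) := by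
  have w0 : C.wt 0 0 = -1 := by simp [wt_zero]
  have w1 : C.wt 1 1 = C.q 1 0 := by simp [wt]
  have w2 : C.wt 2 0 = C.q 0 1 := by simp [wt, prod_range_succ, C.q_self]
  rw [braid_succ, lx_zero_two, TensorProduct.tmul_zero, map_zero, smul_zero, sub_zero, braid_zero,
    map_sub, tx_tmul, tx_tmul, lx_zero_two, lx_self, lg_bv, lg_bv, w0, w2, tx_bv, lx_self, w1,
    TensorProduct.zero_tmul, TensorProduct.tmul_zero]
  have := C.q_adj 0
  simp only [← TensorProduct.smul_tmul']
  linear_combination (norm := module) (-this) • (bv 1 ⊗ₜ[k] bv 2 : Letters k ⊗[k] Letters k)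

lemma one_one_mem_core : (bv 1 ⊗ₜ bv 1 : Letters k ⊗[k] Letters k) ∈ core C.tx (vac k) := by
  refine subset_core (s := insert (bv 1 ⊗ₜ bv 1) (Set.range C.braid)) ?_ ?_ (Set.mem_insert _ _)
  · rintro u (rfl | ⟨t, rfl⟩)
    · rw [vac_tmul, coord_bv_ne (by omega), zero_mul]
    · exact vac_braid t
  · have hr (t) : C.braid t ∈ Submodule.span k (insert (bv 1 ⊗ₜ bv 1) (Set.range C.braid)) :=
      Submodule.subset_span (Set.mem_insert_of_mem _ ⟨t, rfl⟩)
    rintro i u (rfl | ⟨t, rfl⟩)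
    · rcases i with _ | i
      · rw [← inv_smul_smul₀ (C.q_ne_zero 0 1) (C.tx _ _), zero_add, ← C.braid_one_two]
        exact Submodule.smul_mem _ _ (hr _)
      · have w1 : C.wt 1 (i + 2) = C.q (i + 2) 0 := by simp [wt]
        have h : C.tx (i + 2) (bv 1 ⊗ₜ bv 1) =
            (-(2 * C.lamS (i + 2) 0)) • C.braid (bv 0 ⊗ₜ bv 1) := by
          rw [braid_zero, tx_tmul, lx_one, lg_bv, w1, TensorProduct.smul_tmul_smul]
          by_cases h0 : C.lamS (i + 2) 0 = 0
          · simp [h0]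
          have := lamS_q h0 (i + 2)
          rw [C.q_self] at this
          simp only [← TensorProduct.smul_tmul']
          linear_combination (norm := module) (-2 * C.lamS (i + 2) 0 * this) •
            (bv 1 ⊗ₜ[k] bv 0 : Letters k ⊗[k] Letters k)
        exact h ▸ Submodule.smul_mem _ _ (hr _)
    · rw [braid_tx]
      exact hr _

end

/-- The coefficient of the empty word and of the powers of the letter `z_0`. -/
def vacWord : List ℕ → k
  | [] => 1
  | l :: w => coord 0 (bv l : Letters k) * vacWord w

variable (k) in
/-- The linear form that maps the words in `z_0` to `1` and all other words to `0`. -/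
def vacW : Words k →ₗ[k] k := lift vacWord

lemma vacW_nil : vacW k (bv []) = 1 := by simp [vacW, vacWord]

lemma vacW_cons (v : Letters k) (u : Words k) : vacW k (cons v u) = coord 0 v * vacW k u := by
  have := cons_ext (S := cons.compr₂ (vacW k))
    (T := (LinearMap.mul k k).compl₁₂ (coord 0) (vacW k)) fun l w => by
      simp [cons_bv, vacW, vacWord]
  exact LinearMap.congr_fun₂ this v u

variable {C}

lemma vacW_wg {i : ℕ} (hi : i ≠ 0) (u : Words k) : vacW k (C.wg i u) = vacW k u := by
  have h (v : Letters k) : coord 0 (C.lg i v) = coord 0 v :=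
    (C.G_apply i v 0).trans (by rw [wt_zero, if_neg hi, one_mul]; rfl)
  have := words_induction (T := vacW k ∘ₗ C.wg i - vacW k) (by simp [wg_nil]) fun v u hu => by
    have hu' : vacW k (C.wg i u) = vacW k u := sub_eq_zero.1 hu
    simp [wg_cons, vacW_cons, hu', h]
  exact sub_eq_zero.1 (LinearMap.congr_fun this u)

variable (C) in
/-- The words that generate no multiple of the vacuum. -/
abbrev wcore : Submodule k (Words k) := core C.wx (vacW k)

lemma cons_mem_wcore (v : Letters k) {u : Words k} (hu : u ∈ C.wcore) : cons v u ∈ C.wcore := by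
  refine subset_core (s := {t | ∃ v, ∃ u ∈ C.wcore, cons v u = t}) ?_ ?_ ⟨v, u, hu, rfl⟩
  · rintro _ ⟨v, u, hu, rfl⟩
    rw [vacW_cons, apply_eq_zero_of_mem_core hu, mul_zero]
  · rintro i _ ⟨v, u, hu, rfl⟩
    rw [wx_cons]
    exact add_mem (Submodule.subset_span ⟨_, u, hu, rfl⟩)
      (Submodule.subset_span ⟨_, _, mem_core_apply hu i, rfl⟩)

lemma wg_mem_wcore {i : ℕ} (hi : i ≠ 0) {u : Words k} (hu : u ∈ C.wcore) : C.wg i u ∈ C.wcore :=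
  core_stable C.bos_words (vacW_wg hi) hu

lemma wx_cons_zero {i : ℕ} (hi : i ≠ 0) (u : Words k) :
    C.wx i (cons (bv 0) u) = cons (bv 0) (C.wx i u) := by
  rw [wx_cons, lx_zero C hi, lg_bv, wt_zero, if_neg hi, one_smul, map_zero, LinearMap.zero_apply,
    zero_add]

lemma cons_zero_sub_mem (u : Words k) : cons (bv 0) u - u ∈ C.wcore := by
  refine subset_core (s := Set.range fun u => cons (bv 0) u - u) ?_ ?_ ⟨u, rfl⟩
  · rintro _ ⟨u, rfl⟩
    simp only [map_sub, vacW_cons, coord_bv_self, one_mul, sub_self]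
  · rintro i _ ⟨u, rfl⟩
    refine Submodule.subset_span ⟨C.wx (i + 1) u, ?_⟩
    simp only [map_sub, wx_cons_zero (Nat.succ_ne_zero i)]

/-- Multiplication by two letters. -/
def cons₂ : Letters k ⊗[k] Letters k →ₗ[k] Words k →ₗ[k] Words k :=
  TensorProduct.lift (LinearMap.mk₂ k (fun v w => cons v ∘ₗ cons w)
    (fun _ _ _ => by rw [map_add, LinearMap.add_comp])
    (fun _ _ _ => by rw [map_smul, LinearMap.smul_comp])
    (fun _ _ _ => by rw [map_add, LinearMap.comp_add])
    fun _ _ _ => by rw [map_smul, LinearMap.comp_smul])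

lemma cons₂_tmul (v w : Letters k) (u : Words k) : cons₂ (v ⊗ₜ w) u = cons v (cons w u) := rfl

lemma vacW_cons₂ (t) (u : Words k) : vacW k (cons₂ t u) = vac k t * vacW k u := by
  induction t with
  | zero => simp
  | add s t hs ht => simp only [map_add, LinearMap.add_apply, hs, ht, add_mul]
  | tmul v w => rw [cons₂_tmul, vacW_cons, vacW_cons, vac_tmul, mul_assoc]

lemma wx_cons₂ (i : ℕ) (t) (u : Words k) :
    C.wx i (cons₂ t u) = cons₂ (C.tx i t) u + cons₂ (C.tg i t) (C.wx i u) := by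
  induction t with
  | zero => simp
  | add s t hs ht => simp only [map_add, LinearMap.add_apply, hs, ht]; abel
  | tmul v w =>
    simp only [cons₂_tmul, wx_cons, tx_tmul, tg_tmul, map_add, LinearMap.add_apply, add_assoc]

lemma cons_one_one_mem [CharZero k] (u : Words k) : cons (bv 1) (cons (bv 1) u) ∈ C.wcore := by
  refine subset_core (s := {t | ∃ s ∈ core C.tx (vac k), ∃ u, cons₂ s u = t}) ?_ ?_
    ⟨_, C.one_one_mem_core, u, rfl⟩
  · rintro _ ⟨s, hs, u, rfl⟩
    rw [vacW_cons₂, apply_eq_zero_of_mem_core hs, zero_mul]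
  · rintro i _ ⟨s, hs, u, rfl⟩
    rw [wx_cons₂]
    exact add_mem (Submodule.subset_span ⟨_, mem_core_apply hs i, u, rfl⟩)
      (Submodule.subset_span ⟨_, core_stable C.rep_pairs.toBos (vac_tg _) hs, _, rfl⟩)

lemma nil_notMem : bv [] ∉ C.wcore := fun h => by
  have := apply_eq_zero_of_mem_core h
  rw [vacW_nil] at this
  exact one_ne_zero this

end ChainData
end

section
open Finset

namespace ChainData
open Free

section Quotient
variable {k : Type u} [Field k] {M M' : Type*} [AddCommGroup M] [Module k M] [AddCommGroup M']
  [Module k M']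

lemma qcomm_intertwine (π : M →ₗ[k] M') {a b : Module.End k M} {a' b' : Module.End k M'}
    (ha : ∀ u, a' (π u) = π (a u)) (hb : ∀ u, b' (π u) = π (b u)) (c : k) (u : M) :
    qcomm c a' b' (π u) = π (qcomm c a b u) := by
  simp only [qcomm, LinearMap.sub_apply, LinearMap.smul_apply, Module.End.mul_apply, ha, hb,
    map_sub, map_smul]

lemma serreComm_intertwine (π : M →ₗ[k] M') {a b c : Module.End k M} {a' b' c' : Module.End k M'}
    (ha : ∀ u, a' (π u) = π (a u)) (hb : ∀ u, b' (π u) = π (b u)) (hc : ∀ u, c' (π u) = π (c u))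
    (p r s : k) (u : M) : serreComm p r s a' b' c' (π u) = π (serreComm p r s a b c u) :=
  qcomm_intertwine π (qcomm_intertwine π ha (qcomm_intertwine π hb hc _) _) hb _ u

end Quotient

section Anticommutator
variable {k : Type u} [Field k] {B : Type*} [Ring B] [Algebra k B]

lemma serreComm_smul_left (p r s d : k) (a b c : B) :
    serreComm p r s (d • a) b c = d • serreComm p r s a b c := by
  simp only [serreComm, qcomm, smul_mul_assoc, mul_smul_comm, smul_sub, sub_mul, mul_sub]
  module

lemma serreComm_anticomm (p r s : k) {a b c z : B} (hb : z * b = b * z) (hc : z * c = c * z) :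
    serreComm p r s (a * z + z * a) b c =
      serreComm p r s a b c * z + z * serreComm p r s a b c := by
  have hb' (t : B) : z * (b * t) = b * (z * t) := by rw [← mul_assoc, hb, mul_assoc]
  have hc' (t : B) : z * (c * t) = c * (z * t) := by rw [← mul_assoc, hc, mul_assoc]
  simp only [serreComm, qcomm, add_mul, mul_add, sub_mul, mul_sub, smul_mul_assoc, mul_smul_comm,
    mul_assoc, hb, hc, hb', hc', smul_add, smul_sub]
  abel

lemma qcomm_swap {C : ChainData k} {i j : ℕ} (hij : Far i j) {a b : B}
    (h : qcomm (C.q i j) a b = C.lamS i j • 1) : qcomm (C.q j i) b a = C.lamS j i • 1 := by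
  rw [hij.lamS_symm, neg_smul, mul_smul, ← h]
  simp only [qcomm, smul_sub, smul_smul]
  rw [mul_comm (C.q j i), hij.q_mul]
  module

end Anticommutator

variable {k : Type u} [Field k] (C : ChainData k)

/-- The operators on words that induce those of the induced module. -/
def vx : ℕ → Module.End k (Words k)
  | 0 => (2⁻¹ : k) • cons (bv 1)
  | i + 1 => C.wx (i + 1)

/-- The group-like operators on words, except for the node `0`. -/
def vg : ℕ → Module.End k (Words k)
  | 0 => 0
  | i + 1 => C.wg (i + 1)

lemma vx_mem (i : ℕ) : C.wcore ≤ C.wcore.comap (C.vx i) := fun u hu => by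
  rcases i with _ | i
  · exact Submodule.smul_mem _ _ (cons_mem_wcore _ hu)
  · exact mem_core_apply hu i

lemma vg_mem (i : ℕ) : C.wcore ≤ C.wcore.comap (C.vg i) := fun u hu => by
  rcases i with _ | i
  · exact C.wcore.zero_mem
  · exact wg_mem_wcore (Nat.succ_ne_zero i) hu

/-- The module generated by a vacuum vector killed by the operators `x_1, x_2, …`. -/
def Ind : Type u := Words k ⧸ C.wcore

instance : AddCommGroup C.Ind := inferInstanceAs (AddCommGroup (Words k ⧸ C.wcore))

instance : Module k C.Ind := inferInstanceAs (Module k (Words k ⧸ C.wcore))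

/-- The quotient map. -/
def toInd : Words k →ₗ[k] C.Ind := C.wcore.mkQ

instance : Nontrivial C.Ind :=
  ⟨C.toInd (bv []), 0, fun h => nil_notMem ((Submodule.Quotient.mk_eq_zero _).1 h)⟩

/-- The operator `x_i` on the induced module; at the node `0` it satisfies the relations with
constant right hand side. -/
def ix (i : ℕ) : Module.End k C.Ind := C.wcore.mapQ C.wcore (C.vx i) (C.vx_mem i)

/-- The operator `g_i` on the induced module. -/
def ig (i : ℕ) : Module.End k C.Ind := C.wcore.mapQ C.wcore (C.vg i) (C.vg_mem i)

variable {C}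

lemma ix_toInd (i : ℕ) (u : Words k) : C.ix i (C.toInd u) = C.toInd (C.vx i u) := rfl

lemma ind_ext {f f' : Module.End k C.Ind} (h : ∀ u, f (C.toInd u) = f' (C.toInd u)) : f = f' :=
  LinearMap.ext fun t => by
    obtain ⟨u, rfl⟩ := Submodule.mkQ_surjective _ t
    exact h u

lemma toInd_eq {u w : Words k} (h : u - w ∈ C.wcore) : C.toInd u = C.toInd w :=
  (Submodule.Quotient.eq _).2 h

lemma vg_vg (i j : ℕ) : C.vg i * C.vg j = C.vg j * C.vg i := by
  rcases i with _ | i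
  · simp [vg]
  rcases j with _ | j
  · simp [vg]
  · exact C.bos_words.gg _ _

lemma vg_vx (i j : ℕ) : C.vg i * C.vx j = C.q i j • (C.vx j * C.vg i) := by
  rcases i with _ | i
  · simp [vg]
  rcases j with _ | j
  · refine LinearMap.ext fun u => ?_
    have w1 : C.wt 1 (i + 1) = C.q (i + 1) 0 := by simp [wt]
    simp only [vg, vx, Module.End.mul_apply, LinearMap.smul_apply, map_smul, wg_cons, lg_bv, w1]
    exact smul_comm _ _ _
  · exact C.bos_words.gx _ _

lemma ig_zero : C.ig 0 = 0 := ind_ext fun _ => map_zero C.toInd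

variable [CharZero k]

lemma far_vx (i : ℕ) : qcomm (C.q (i + 2) 0) (C.ix (i + 2)) (C.ix 0) = C.lamS (i + 2) 0 • 1 :=
  ind_ext fun u => by
    have h := qcomm_intertwine C.toInd (ix_toInd (C := C) (i + 2)) (ix_toInd 0) (C.q (i + 2) 0) u
    rw [h]
    have w1 : C.wt 1 (i + 2) = C.q (i + 2) 0 := by simp [wt]
    have e : qcomm (C.q (i + 2) 0) (C.vx (i + 2)) (C.vx 0) u =
        C.lamS (i + 2) 0 • cons (bv 0) u := by
      simp only [qcomm, vx, LinearMap.sub_apply, LinearMap.smul_apply, Module.End.mul_apply,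
        map_smul, wx_cons, lx_one, lg_bv, w1]
      module
    rw [e, map_smul, toInd_eq (cons_zero_sub_mem u)]
    rfl

lemma serre_vx : C.serreOf C.ix 0 = C.nu 0 • 1 := ind_ext fun u => by
  refine (serreComm_intertwine C.toInd (ix_toInd 0) (ix_toInd 1) (ix_toInd 2) _ _ _ u).trans ?_
  set Z : Module.End k (Words k) := cons (bv 0) with hZ
  have e₀ : C.vx 0 = (2⁻¹ : k) • (C.wx 0 * Z + Z * C.wx 0) := by
    refine congrArg ((2⁻¹ : k) • ·) (LinearMap.ext fun u => ?_)
    rw [LinearMap.add_apply, Module.End.mul_apply, Module.End.mul_apply, hZ, wx_cons, lx_self,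
      lg_bv, wt_zero, if_pos rfl]
    simp
  have hz (i : ℕ) (hi : i ≠ 0) : Z * C.wx i = C.wx i * Z :=
    LinearMap.ext fun u => (wx_cons_zero hi u).symm
  have hg (i : ℕ) (hi : i ≠ 0) (u) : C.wg i (Z u) = Z (C.wg i u) := by
    rw [hZ, wg_cons, lg_bv, wt_zero, if_neg hi, one_smul]
  have hg₀ (u) : C.wg 0 (Z u) = -Z (C.wg 0 u) := by
    rw [hZ, wg_cons, lg_bv, wt_zero, if_pos rfl]; simp
  have hs := C.rep_words.serre 0
  have e₁ : serreComm (C.q 0 1) (C.q 1 2) (C.q 0 2) (C.vx 0) (C.vx 1) (C.vx 2) = C.nu 0 • Z := by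
    rw [e₀, serreComm_smul_left, vx, vx, serreComm_anticomm _ _ _ (hz 1 one_ne_zero)
      (hz 2 two_ne_zero)]
    change (2⁻¹ : k) • (C.serreOf C.wx 0 * Z + Z * C.serreOf C.wx 0) = _
    rw [hs]
    refine LinearMap.ext fun u => ?_
    simp only [zero_add, LinearMap.smul_apply, LinearMap.add_apply, Module.End.mul_apply,
      LinearMap.sub_apply, Module.End.one_apply, map_smul, map_sub, hg 2 two_ne_zero,
      hg 1 one_ne_zero, hg₀]
    module
  rw [e₁, LinearMap.smul_apply, map_smul, toInd_eq (cons_zero_sub_mem u)]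
  rfl

variable (C) in
lemma rep_ind : C.Rep C.ix C.ig where
  gg i j := ind_ext fun u => congrArg C.toInd (LinearMap.congr_fun (vg_vg i j) u)
  gx i j := ind_ext fun u => congrArg C.toInd (LinearMap.congr_fun (vg_vx i j) u)
  sq i := ind_ext fun u => by
    rw [pow_two, Module.End.mul_apply, ix_toInd, ix_toInd]
    rcases i with _ | i
    · simp only [vx, LinearMap.smul_apply, map_smul]
      rw [toInd_eq ((sub_zero (cons (bv 1) (cons (bv 1) u))).symm ▸ cons_one_one_mem u), map_zero,
        smul_zero, smul_zero]
      rfl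
    · have := LinearMap.congr_fun (C.rep_words.sq (i + 1)) u
      rw [pow_two] at this
      exact (congrArg C.toInd this).trans (map_zero _)
  far i j hij := by
    rcases i with _ | i
    · obtain ⟨j, rfl⟩ : ∃ m, j = m + 2 := ⟨j - 2, by unfold Far at hij; omega⟩
      rw [qcomm_swap hij.symm (far_vx j), ig_zero]
      simp
    rcases j with _ | j
    · obtain ⟨i, rfl⟩ : ∃ m, i = m + 1 := ⟨i - 1, by unfold Far at hij; omega⟩
      rw [far_vx i, ig_zero]
      simp
    refine ind_ext fun u => ?_
    rw [qcomm_intertwine C.toInd (ix_toInd (i + 1)) (ix_toInd (j + 1)), vx, vx,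
      C.rep_words.far _ _ hij]
    simp only [LinearMap.smul_apply, LinearMap.sub_apply, map_smul, map_sub]
    rfl
  serre i := by
    rcases i with _ | i
    · rw [serre_vx, ig_zero]
      simp
    refine ind_ext fun u => ?_
    refine (serreComm_intertwine C.toInd (ix_toInd _) (ix_toInd _) (ix_toInd _) _ _ _ u).trans ?_
    have := LinearMap.congr_fun (C.rep_words.serre (i + 1)) u
    refine (congrArg C.toInd this).trans ?_
    simp only [LinearMap.smul_apply, LinearMap.sub_apply, map_smul, map_sub]
    rfl

end ChainData
end

section
open Finset

namespace ChainData
variable {k : Type u} [Field k] (C : ChainData k)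

/-- The data of the nodes `1, 2, …`. -/
def shift : ChainData k where
  q i j := C.q (i + 1) (j + 1)
  lam i j := C.lam (i + 1) (j + 1)
  nu i := C.nu (i + 1)
  q_self i := C.q_self _
  q_adj i := C.q_adj _
  q_far i j h := C.q_far _ _ (by omega)
  lam_q i j h h' a := C.lam_q _ _ (by omega) h' _
  nu_q i h a := C.nu_q _ h _
  e i j := C.e (i + 1) (j + 1)
  e_sq i j := C.e_sq _ _
  e_self i := C.e_self _
  e_symm i j h := C.e_symm _ _ (by omega)
  lam_e i j h h' a := C.lam_e _ _ (by omega) h' _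
  nu_e i h a := C.nu_e _ h _

/-- Operators that satisfy the deformed relations with constant right hand sides. -/
structure ConstRep {M : Type*} [AddCommGroup M] [Module k M] (x : ℕ → Module.End k M) : Prop where
  sq : ∀ i, x i ^ 2 = 0
  far : ∀ i j, Far i j → qcomm (C.q i j) (x i) (x j) = C.lamS i j • 1
  serre : ∀ i, C.serreOf x i = C.nu i • 1

lemma lamS_shift (i j : ℕ) : C.shift.lamS i j = C.lamS (i + 1) (j + 1) := by
  unfold lamS
  split_ifs <;> first | rfl | omega

variable {C}

lemma ConstRep.tens_ind [CharZero k] {M : Type*} [AddCommGroup M] [Module k M]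
    {x : ℕ → Module.End k M} (h : C.shift.ConstRep x) :
    C.ConstRep (tens C.ix C.ig fun i => Nat.casesOn i 0 x) := by
  set y : ℕ → Module.End k M := fun i => Nat.casesOn i 0 x with hy
  have hI := C.rep_ind
  have sq (i : ℕ) : y i ^ 2 = 0 := by
    rcases i with _ | i
    · exact zero_pow two_ne_zero
    · exact h.sq i
  have far (i j : ℕ) (hij : Far i j) : TensorProduct.map (C.ig i * C.ig j)
      (qcomm (C.q i j) (y i) (y j)) = C.lamS i j • TensorProduct.map (C.ig i * C.ig j) 1 := by
    rcases i with _ | i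
    · simp [ig_zero]
    rcases j with _ | j
    · simp [ig_zero]
    have hij' : Far i j := by unfold Far at hij ⊢; omega
    have := h.far i j hij'
    rw [lamS_shift] at this
    refine (congrArg _ this).trans ?_
    rw [TensorProduct.map_smul_right]
  refine ⟨fun i => ?_, fun i j hij => ?_, fun i => ?_⟩
  · rw [hI.sq_tens, hI.sq, sq]; simp
  · rw [hI.qcomm_tens _ hij, hI.far _ _ hij, far i j hij, TensorProduct.map_smul_left,
      map_sub_left, TensorProduct.map_one]
    module
  · rw [hI.serre_tens (hI.sq _) (sq _), hI.serre, TensorProduct.map_smul_left,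
      map_sub_left, TensorProduct.map_one]
    · rcases i with _ | i
      · simp [ig_zero]
      · have := h.serre i
        change _ + TensorProduct.map _ (C.shift.serreOf x i) = _
        rw [this, TensorProduct.map_smul_right]
        change _ + C.nu (i + 1) • _ = _
        module
    · rcases i with _ | i
      · simp [y, qcomm]
      · have := h.far i (i + 2) (Or.inl le_rfl)
        rw [lamS_shift] at this
        change qcomm _ (y (i + 1)) (y (i + 3)) = _ at this
        change qcomm (C.q (i + 1) (i + 3)) (y (i + 1)) (y (i + 3)) * _ + _ • (_ *
          qcomm (C.q (i + 1) (i + 3)) (y (i + 1)) (y (i + 3))) = 0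
        change qcomm (C.q (i + 1) (i + 3)) (y (i + 1)) (y (i + 3)) = _ at this
        rw [this]
        by_cases h0 : C.lam (i + 1) (i + 3) = 0
        · have e : C.lamS (i + 1) (i + 2 + 1) = 0 := (if_pos (by omega)).trans h0
          rw [e]; simp
        · rw [lam_adj h0]; simp

/-- The relations with constant right hand sides have a nonzero representation. -/
theorem exists_constRep [CharZero k] (n : ℕ) (C : ChainData k)
    (hlam : ∀ i j, n ≤ j → C.lam i j = 0) (hnu : ∀ i, n ≤ i + 2 → C.nu i = 0) :
    ∃ (M : Type u) (_ : AddCommGroup M) (_ : Module k M) (x : ℕ → Module.End k M),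
      Nontrivial M ∧ C.ConstRep x := by
  induction n generalizing C with
  | zero =>
    refine ⟨k, inferInstance, inferInstance, 0, inferInstance, ?_, ?_, ?_⟩
    · simp
    · intro i j _
      simp [qcomm, lamS, hlam]
    · intro i
      simp [serreOf, serreComm, qcomm, hnu]
  | succ n ih =>
    obtain ⟨M, _, _, x, _, h⟩ := ih C.shift (fun i j hj => hlam _ _ (by omega))
      fun i hi => hnu _ (by omega)
    exact ⟨C.Ind ⊗[k] M, inferInstance, inferInstance, _, inferInstance, h.tens_ind⟩

end ChainData
end

section
open Finset

section Radical
variable {X : Type*} [AddCommGroup X]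

/-- The `ℤ`-bilinear form with the given values. -/
def biform (f : ℕ → ℕ → X) : (ℕ →₀ ℤ) →ₗ[ℤ] (ℕ →₀ ℤ) →ₗ[ℤ] X :=
  Finsupp.linearCombination ℤ fun i => Finsupp.linearCombination ℤ (f i)

lemma biform_single (f : ℕ → ℕ → X) (i j : ℕ) :
    biform f (Finsupp.single i 1) (Finsupp.single j 1) = f i j := by simp [biform]

/-- `e_i + e_j` lies in the right radical of `biform f` up to an even vector. -/
def EvenRel (f : ℕ → ℕ → X) (i j : ℕ) : Prop :=
  ∃ n : ℕ →₀ ℤ, ∀ x, biform f x (Finsupp.single i 1 + Finsupp.single j 1 + (2 : ℤ) • n) = 0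

variable {f : ℕ → ℕ → X}

lemma EvenRel.refl (i : ℕ) : EvenRel f i i :=
  ⟨-Finsupp.single i 1, fun x => by
    rw [show (Finsupp.single i 1 + Finsupp.single i 1 + (2 : ℤ) • -Finsupp.single i 1 :
      ℕ →₀ ℤ) = 0 by module, map_zero]⟩

lemma EvenRel.symm {i j : ℕ} (h : EvenRel f i j) : EvenRel f j i := by
  obtain ⟨n, hn⟩ := h
  exact ⟨n, fun x => by rw [add_comm (Finsupp.single j 1)]; exact hn x⟩

lemma EvenRel.trans {i j l : ℕ} (h : EvenRel f i j) (h' : EvenRel f j l) : EvenRel f i l := by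
  obtain ⟨n, hn⟩ := h
  obtain ⟨m, hm⟩ := h'
  refine ⟨n + m + Finsupp.single j 1, fun x => ?_⟩
  have h := congrArg₂ (· + ·) (hn x) (hm x)
  simp only [add_zero, ← map_add] at h
  rw [← h]
  congr 1
  module

lemma two_smul_symm (hf : ∀ i j, (2 : ℤ) • (f i j + f j i) = 0) (x y : ℕ →₀ ℤ) :
    (2 : ℤ) • (biform f x y + biform f y x) = 0 := by
  have : (2 : ℤ) • (biform f + (biform f).flip) = 0 :=
    Finsupp.lhom_ext' fun i => LinearMap.ext_ring <| Finsupp.lhom_ext' fun j =>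
      LinearMap.ext_ring (by simpa [biform_single] using hf i j)
  exact LinearMap.congr_fun₂ this x y

lemma EvenRel.symm_mul (hf : ∀ i j, (2 : ℤ) • (f i j + f j i) = 0) {a a' b b' : ℕ}
    (ha : EvenRel f a a') (hb : EvenRel f b b') :
    (f a b + f b a) + (f a' b + f b a') + (f a b' + f b' a) + (f a' b' + f b' a') = 0 := by
  obtain ⟨n, hn⟩ := ha
  obtain ⟨m, hm⟩ := hb
  have h₁ := hm (Finsupp.single a 1 + Finsupp.single a' 1 + (2 : ℤ) • n)
  have h₂ := hn (Finsupp.single b 1 + Finsupp.single b' 1 + (2 : ℤ) • m)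
  simp only [map_add, LinearMap.add_apply, biform_single, map_smul, LinearMap.smul_apply] at h₁ h₂
  have s := two_smul_symm hf
  have s₁ := s (Finsupp.single a 1) m
  have s₂ := s (Finsupp.single a' 1) m
  have s₃ := s n (Finsupp.single b 1)
  have s₄ := s n (Finsupp.single b' 1)
  have s₅ := s n m
  linear_combination (norm := module) h₁ + h₂ - s₁ - s₂ - s₃ - s₄ - (2 : ℤ) • s₅

lemma EvenRel.symm_eq (hf : ∀ i j, (2 : ℤ) • (f i j + f j i) = 0) {a b : ℕ}
    (h : EvenRel f a b) : f a a + f b b + (f a b + f b a) = 0 := by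
  obtain ⟨n, hn⟩ := h
  have h₁ := hn (Finsupp.single a 1 + Finsupp.single b 1 + (2 : ℤ) • n)
  simp only [map_add, LinearMap.add_apply, biform_single, map_smul, LinearMap.smul_apply] at h₁
  have s := two_smul_symm hf
  have s₁ := s (Finsupp.single a 1) n
  have s₂ := s (Finsupp.single b 1) n
  have s₃ := s n n
  linear_combination (norm := module) h₁ - s₁ - s₂ - s₃

end Radical

namespace ChainData
variable {k : Type u} [Field k]

open Classical in
/-- Compatible signs exist for all braiding matrices and deformation parameters. -/
theorem exists_chainData (q lam : ℕ → ℕ → k) (nu : ℕ → k) (q_self : ∀ i, q i i = -1)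
    (q_adj : ∀ i, q i (i + 1) * q (i + 1) i = -1)
    (q_far : ∀ i j, i + 2 ≤ j → q i j * q j i = 1)
    (lam_q : ∀ i j, i + 2 ≤ j → lam i j ≠ 0 → ∀ a, q a i * q a j = 1)
    (nu_q : ∀ i, nu i ≠ 0 → ∀ a, q a i * q a (i + 1) ^ 2 * q a (i + 2) = 1) :
    ∃ C : ChainData k, C.q = q ∧ C.lam = lam ∧ C.nu = nu := by
  have sym (i j : ℕ) : (q i j * q j i) * (q i j * q j i) = 1 := by
    rcases lt_trichotomy i j with h | rfl | h
    · rcases Nat.lt_or_ge (i + 1) j with h | h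
      · rw [q_far _ _ h]; ring
      · obtain rfl : j = i + 1 := by omega
        rw [q_adj]; ring
    · rw [q_self]; ring
    · rw [mul_comm (q i j)]
      rcases Nat.lt_or_ge (j + 1) i with h | h
      · rw [q_far _ _ h]; ring
      · obtain rfl : i = j + 1 := by omega
        rw [q_adj]; ring
  have hne (i j : ℕ) : q i j ≠ 0 := fun h => by simpa [h] using sym i j
  set f : ℕ → ℕ → Additive kˣ := fun i j => Additive.ofMul (Units.mk0 (q i j) (hne i j)) with hfdef
  have hf (i j : ℕ) : (2 : ℤ) • (f i j + f j i) = 0 := by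
    rw [two_zsmul]; exact Units.ext (sym i j)
  have hrad {w : ℕ →₀ ℤ} (h : ∀ a, biform f (Finsupp.single a 1) w = 0) (x) :
      biform f x w = 0 := by
    have : (biform f).flip w = 0 := Finsupp.lhom_ext' fun a => LinearMap.ext_ring (h a)
    exact LinearMap.congr_fun this x
  have hlam {i j : ℕ} (hij : i + 2 ≤ j) (h : lam i j ≠ 0) : EvenRel f i j := by
    refine ⟨0, hrad fun a => ?_⟩
    rw [smul_zero, add_zero, map_add, biform_single, biform_single]
    exact Units.ext (lam_q i j hij h a)
  have hnu {i : ℕ} (h : nu i ≠ 0) : EvenRel f i (i + 2) := by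
    refine ⟨Finsupp.single (i + 1) 1, hrad fun a => ?_⟩
    rw [map_add, map_add, map_smul, biform_single, biform_single, biform_single, two_zsmul]
    refine Units.ext ?_
    change q a i * q a (i + 2) * (q a (i + 1) * q a (i + 1)) = 1
    rw [← nu_q i h a]; ring
  let S : Setoid ℕ := ⟨EvenRel f, EvenRel.refl, EvenRel.symm, EvenRel.trans⟩
  let r : ℕ → ℕ := fun i => (Quotient.mk S i).out
  have hr (i : ℕ) : EvenRel f (r i) i := Quotient.exact (Quotient.out_eq (Quotient.mk S i))
  have hr' {i j : ℕ} (h : EvenRel f i j) : r i = r j :=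
    congrArg Quotient.out (Quotient.sound (s := S) h)
  let s : ℕ → ℕ → k := fun i j => q i j * q j i
  have hs (i j : ℕ) : s i j * s i j = 1 := sym i j
  have hss (i j : ℕ) : s i j = s j i := mul_comm _ _
  let e : ℕ → ℕ → k := fun a b => if r a = r b then -1 else
    s a (r b) * if r b < r a then 1 else s (r b) (r a)
  have e_sq (i j : ℕ) : e i j * e i j = 1 := by
    simp only [e]
    split_ifs
    · ring
    · rw [mul_one, hs]
    · linear_combination s (r j) (r i) * s (r j) (r i) * hs i (r j) + hs (r j) (r i)
  have e_congr {i j : ℕ} (h : EvenRel f i j) (a : ℕ) : e a i = e a j := by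
    simp only [e, hr' h]
  refine ⟨⟨q, lam, nu, q_self, q_adj, q_far, lam_q, nu_q, e, e_sq, fun i => if_pos rfl, ?_,
    fun i j hij h a => ?_, fun i h a => ?_⟩, rfl, rfl, rfl⟩
  · intro i j hij
    change _ = s i j
    by_cases h : r i = r j
    · have h' : EvenRel f i j := ((hr i).symm.trans (h ▸ EvenRel.refl (r i))).trans (hr j)
      have h₁ : q i i * q j j * s i j = 1 := congrArg Units.val (h'.symm_eq hf)
      rw [q_self, q_self] at h₁
      simp only [e]
      rw [if_pos h, if_pos h.symm]
      linear_combination -h₁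
    · have h₁ : s i j * s (r i) j * s i (r j) * s (r i) (r j) = 1 :=
        congrArg Units.val ((hr i).symm.symm_mul hf (hr j).symm)
      have h₂ := hs i j
      simp only [e]
      rw [if_neg h, if_neg (Ne.symm h)]
      have h₃ : (if r j < r i then (1 : k) else s (r j) (r i)) *
          (if r i < r j then 1 else s (r i) (r j)) = s (r i) (r j) := by
        rcases lt_or_gt_of_ne h with h' | h'
        · rw [if_pos h', if_neg h'.not_gt, mul_one, hss]
        · rw [if_pos h', if_neg h'.not_gt, one_mul]
      rw [hss (r i) j] at h₁
      linear_combination s i (r j) * s j (r i) * h₃ - s i (r j) * s j (r i) * s (r i) (r j) * h₂ +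
        s i j * h₁
  · rw [e_congr (hlam hij h), e_sq]
  · rw [e_congr (hnu h), e_sq]

end ChainData
end

section
open Finset

namespace ChainData
open Free
variable {k : Type u} [Field k] (C : ChainData k)

/-- The embedding of the signs into the field. -/
def sg : ℤˣ →* k := (Int.castRingHom k).toMonoidHom.comp (Units.coeHom ℤ)

lemma sg_mul_self (t : ℤˣ) : (sg t : k) * sg t = 1 := by
  rw [← map_mul, Int.units_mul_self, map_one]

open Classical in
/-- The sign `-1` if `c = -1` and `1` otherwise. -/
def signOf (c : k) : ℤˣ := if c = -1 then -1 else 1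

lemma sg_signOf {c : k} (h : c ^ 2 = 1) : sg (signOf c) = c := by
  unfold signOf
  split_ifs with h1
  · rw [h1]; simp [sg]
  · rw [map_one]
    rw [pow_two] at h
    exact ((mul_self_eq_one_iff.1 h).resolve_right h1).symm

/-- Operators that satisfy the relations of `𝒜` with parameters `mu`, `lam`, `nu`. -/
structure FullRep (mu : ℕ → k) {M : Type*} [AddCommGroup M] [Module k M]
    (x : ℕ → Module.End k M) : Prop where
  sq : ∀ i, x i ^ 2 = mu i • 1
  far : ∀ i j, Far i j → qcomm (C.q i j) (x i) (x j) = C.lamS i j • 1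
  serre : ∀ i, C.serreOf x i = C.nu i • 1

open Classical in
/-- The translation part of the operator `x_j`. -/
def transl (mu : ℕ → k) (j : ℕ) : ℕ → ℤˣ := fun a => if mu a = 0 then 1 else signOf (C.q a j)

/-- The translation part of the `i`-th Clifford generator. -/
def clifTransl (i : ℕ) : ℕ → ℤˣ := fun a => if a < i then signOf (C.q a i) else 1

/-- Translation of the sign vectors. -/
def translOp (t : ℕ → ℤˣ) : Module.End k (Free (ℕ → ℤˣ) k) := lift fun a => bv (a * t)

/-- Clifford generators acting on the functions of sign vectors. -/
def clif (c : ℕ → k) (i : ℕ) : Module.End k (Free (ℕ → ℤˣ) k) :=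
  lift fun a => (c i * sg (a i)) • bv (a * C.clifTransl i)

lemma translOp_bv (t a : ℕ → ℤˣ) : translOp t (bv a : Free (ℕ → ℤˣ) k) = bv (a * t) := by
  simp [translOp]

lemma clif_bv (c : ℕ → k) (i : ℕ) (a : ℕ → ℤˣ) :
    C.clif c i (bv a) = (c i * sg (a i)) • bv (a * C.clifTransl i) := by simp [clif]

lemma translOp_mul (t t' : ℕ → ℤˣ) :
    (translOp t * translOp t' : Module.End k (Free (ℕ → ℤˣ) k)) = translOp (t * t') :=
  hom_ext fun a => by
    rw [Module.End.mul_apply, translOp_bv, translOp_bv, translOp_bv, mul_assoc, mul_comm t]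

lemma translOp_one : (translOp 1 : Module.End k (Free (ℕ → ℤˣ) k)) = 1 :=
  hom_ext fun a => by rw [translOp_bv, mul_one]; rfl

lemma mul_self_eq_one (t : ℕ → ℤˣ) : t * t = 1 := funext fun _ => Int.units_mul_self _

lemma qcomm_map_one {M M' : Type*} [AddCommGroup M] [Module k M] [AddCommGroup M'] [Module k M']
    (r : k) (a b : Module.End k M') :
    qcomm r (TensorProduct.map 1 a : Module.End k (M ⊗[k] M')) (TensorProduct.map 1 b) =
      TensorProduct.map 1 (qcomm r a b) := by
  simp only [qcomm, map_mul_map, one_mul, map_sub_right, TensorProduct.map_smul_right]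

variable {C} {mu c : ℕ → k}

lemma q_mul_q_sq (i j : ℕ) : (C.q i j * C.q j i) ^ 2 = 1 := by
  have : C.q i j * C.q j i = 1 ∨ C.q i j * C.q j i = -1 := by
    rcases lt_trichotomy i j with h | rfl | h
    · rcases Nat.lt_or_ge (i + 1) j with h | h
      · exact Or.inl (C.q_far _ _ h)
      · obtain rfl : j = i + 1 := by omega
        exact Or.inr (C.q_adj _)
    · rw [C.q_self]; exact Or.inl (by ring)
    · rw [mul_comm]
      rcases Nat.lt_or_ge (j + 1) i with h | h
      · exact Or.inl (C.q_far _ _ h)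
      · obtain rfl : i = j + 1 := by omega
        exact Or.inr (C.q_adj _)
  rcases this with h | h <;> rw [h] <;> ring

variable (hmu : ∀ i, mu i ≠ 0 → ∀ a, C.q a i ^ 2 = 1)
include hmu

lemma q_sq_left {i : ℕ} (h : mu i ≠ 0) (j : ℕ) : C.q i j ^ 2 = 1 := by
  have h₁ := q_mul_q_sq (C := C) i j
  rwa [mul_pow, hmu i h j, mul_one] at h₁

lemma transl_mul {i j : ℕ} (h : ∀ a, mu a ≠ 0 → C.q a i * C.q a j = 1) :
    C.transl mu i * C.transl mu j = 1 := by
  funext a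
  by_cases ha : mu a = 0
  · simp [transl, ha]
  have e : C.q a i = C.q a j := by
    have := q_sq_left hmu ha j
    have h1 := h a ha
    linear_combination (-C.q a i) * this + C.q a j * h1
  simp only [transl, Pi.mul_apply, if_neg ha, e, Int.units_mul_self, Pi.one_apply]

variable (hc : ∀ i, c i ^ 2 = mu i)
include hc

lemma ne_zero_of_sqrt {i : ℕ} (h : c i ≠ 0) : mu i ≠ 0 := by
  rw [← hc]; exact pow_ne_zero 2 h

lemma clif_sq (i : ℕ) : C.clif c i ^ 2 = mu i • 1 := hom_ext fun a => by
  rw [pow_two, Module.End.mul_apply, clif_bv, map_smul, clif_bv, smul_smul, mul_assoc a,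
    mul_self_eq_one, mul_one, Pi.mul_apply, map_mul, clifTransl, if_neg (lt_irrefl i), map_one,
    mul_one, ← hc]
  change _ = c i ^ 2 • bv a
  congr 1
  linear_combination c i ^ 2 * sg_mul_self (k := k) (a i)

lemma clif_mul {i j : ℕ} (h : i < j) :
    C.clif c i * C.clif c j = C.q i j • (C.clif c j * C.clif c i) := hom_ext fun a => by
  simp only [Module.End.mul_apply, LinearMap.smul_apply, clif_bv, map_smul, smul_smul,
    Pi.mul_apply, map_mul]
  rw [mul_assoc a, mul_comm (C.clifTransl j), ← mul_assoc a]
  congr 1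
  by_cases h0 : c i = 0
  · simp [h0]
  rw [clifTransl, if_pos h, clifTransl, if_neg (by omega), map_one,
    sg_signOf (q_sq_left hmu (ne_zero_of_sqrt hmu hc h0) j)]
  ring

lemma clif_far {i j : ℕ} (h : Far i j) : qcomm (C.q i j) (C.clif c i) (C.clif c j) = 0 := by
  rw [qcomm, sub_eq_zero]
  have hf := h
  rcases h with h' | h'
  · exact clif_mul hmu hc (by omega)
  · rw [clif_mul hmu hc (by omega : j < i), smul_smul, Far.q_mul (C := C) hf, one_smul]

lemma clif_serre (i : ℕ) : C.serreOf (C.clif c) i = 0 := by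
  have : qcomm (C.q (i + 1) (i + 2)) (C.clif c (i + 1)) (C.clif c (i + 2)) = 0 :=
    sub_eq_zero.2 (clif_mul hmu hc (Nat.lt_succ_self _))
  rw [serreOf, serreComm, this]
  simp [qcomm]

lemma clif_translOp (i j : ℕ) : C.clif c i * translOp (C.transl mu j) =
    C.q i j • (translOp (C.transl mu j) * C.clif c i) := hom_ext fun a => by
  simp only [Module.End.mul_apply, LinearMap.smul_apply, clif_bv, translOp_bv, map_smul, smul_smul,
    Pi.mul_apply, map_mul]
  rw [mul_assoc a, mul_comm (C.transl mu j), ← mul_assoc a]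
  congr 1
  by_cases h0 : c i = 0
  · simp [h0]
  have h1 := ne_zero_of_sqrt hmu hc h0
  rw [transl, if_neg h1, sg_signOf (q_sq_left hmu h1 j)]
  ring

/-- A representation for nonzero parameters `mu` from one for `mu = 0`. -/
theorem ConstRep.fullRep {M : Type*} [AddCommGroup M] [Module k M] {x : ℕ → Module.End k M}
    (h : C.ConstRep x) : C.FullRep mu fun i =>
      (TensorProduct.map (x i) (translOp (C.transl mu i)) +
        TensorProduct.map 1 (C.clif c i) : Module.End k (M ⊗[k] Free (ℕ → ℤˣ) k)) := by
  set U : ℕ → Module.End k (Free (ℕ → ℤˣ) k) := fun i => translOp (C.transl mu i) with hU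
  set X : ℕ → Module.End k (M ⊗[k] Free (ℕ → ℤˣ) k) := fun i => TensorProduct.map (x i) (U i) with hX
  set Y : ℕ → Module.End k (M ⊗[k] Free (ℕ → ℤˣ) k) := fun i => TensorProduct.map 1 (C.clif c i)
    with hY
  have hUU (i j) : U i * U j = U j * U i := by
    rw [hU]; simp only [translOp_mul, mul_comm]
  have hXY : C.Mixed X Y := fun i j => by
    simp only [hX, hY, hU, map_mul_map, one_mul, mul_one, clif_translOp hmu hc,
      TensorProduct.map_smul_right]
  have hX2 (i) : X i ^ 2 = 0 := by
    rw [pow_two, hX, map_mul_map, ← pow_two (x i), h.sq, TensorProduct.map_zero_left]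
  have hY2 (i) : Y i ^ 2 = mu i • 1 := by
    rw [pow_two, hY, map_mul_map, ← pow_two (C.clif c i), clif_sq hmu hc, one_mul,
      TensorProduct.map_smul_right, TensorProduct.map_one]
  have hYf {i j} (hij : Far i j) : qcomm (C.q i j) (Y i) (Y j) = 0 := by
    rw [hY, qcomm_map_one, clif_far hmu hc hij, TensorProduct.map_zero_right]
  have one {t : k} {i j} (ht : t ≠ 0 → ∀ a, mu a ≠ 0 → C.q a i * C.q a j = 1) :
      t • (TensorProduct.map 1 (U i * U j) : Module.End k (M ⊗[k] Free (ℕ → ℤˣ) k)) = t • 1 := by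
    by_cases h0 : t = 0
    · simp [h0]
    rw [hU]
    simp only [translOp_mul, transl_mul hmu (ht h0), translOp_one, TensorProduct.map_one]
  refine ⟨fun i => ?_, fun i j hij => ?_, fun i => ?_⟩
  · exact (hXY.sq_add i).trans (by rw [hX2, hY2, zero_add])
  · refine (hXY.qcomm_add hij).trans ?_
    rw [hYf hij, add_zero]
    have e : qcomm (C.q i j) (X i) (X j) =
        TensorProduct.map (qcomm (C.q i j) (x i) (x j)) (U i * U j) := by
      simp only [qcomm, hX, map_mul_map, map_sub_left, TensorProduct.map_smul_left, hUU j i]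
    rw [e, h.far i j hij, TensorProduct.map_smul_left]
    exact one fun h0 a _ => lamS_q h0 a
  · refine (hXY.serre_add i (hX2 _) ?_ ?_).trans ?_
    · rw [hY2, smul_mul_assoc, mul_smul_comm, one_mul, mul_one, smul_smul, smul_smul]
      by_cases h0 : mu (i + 1) = 0
      · simp [h0]
      have := q_sq_left hmu h0 (i + 2)
      congr 2
      field_simp [C.q_ne_zero]
      exact this.symm
    · rw [hYf (Or.inl le_rfl)]; simp
    · have e₁ : C.serreOf Y i = TensorProduct.map 1 (C.serreOf (C.clif c) i) := by
        simp only [serreOf, serreComm, hY, qcomm_map_one]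
      have l₁ (a b d : Module.End k (Free (ℕ → ℤˣ) k)) (hab : a * b = b * a) :
        a * (b * d) = b * (a * d) := by rw [← mul_assoc, hab, mul_assoc]
      have e₂ : C.serreOf X i = TensorProduct.map (C.serreOf x i)
          (U i * (U (i + 1) * (U (i + 1) * U (i + 2)))) := by
        have h₁ := hUU (i + 1) i
        have h₂ := hUU (i + 2) i
        have h₃ := hUU (i + 2) (i + 1)
        simp only [serreOf, serreComm, qcomm, hX, map_mul_map, map_sub_left, mul_sub, sub_mul,
          TensorProduct.map_smul_left, smul_sub, mul_smul_comm, smul_mul_assoc, mul_assoc, h₁, h₂,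
          h₃, l₁ _ _ _ h₁, l₁ _ _ _ h₂, l₁ _ _ _ h₃]
      have e₃ : U (i + 1) * (U (i + 1) * U (i + 2)) = U (i + 2) := by
        rw [← mul_assoc, hU]
        simp only [translOp_mul, mul_self_eq_one, translOp_one, one_mul]
      rw [e₁, clif_serre hmu hc, TensorProduct.map_zero_right, add_zero, e₂, h.serre,
        TensorProduct.map_smul_left, e₃]
      refine one fun h0 a ha => ?_
      have := C.nu_q i h0 a
      rwa [q_sq_left hmu ha, mul_one] at this

end ChainData
end

section
open Finset

variable {k : Type u} [Field k] {H : Type v} [Ring H] [HopfAlgebra k H] {θ : ℕ}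
  {D : PrincipalRealization k H θ}

/-- The braiding matrix extended to all natural numbers. -/
def extQ (D : PrincipalRealization k H θ) (i j : ℕ) : k :=
  if h : i < θ ∧ j < θ then D.q ⟨i, h.1⟩ ⟨j, h.2⟩ else if i = j ∨ j = i + 1 then -1 else 1

lemma extQ_fin (i j : Fin θ) : extQ D i j = D.q i j := dif_pos ⟨i.2, j.2⟩

lemma extQ_of_le {a i : ℕ} (ha : θ ≤ a) (hi : i < θ) : extQ D a i = 1 := by
  rw [extQ, dif_neg (by omega), if_neg (by omega)]

instance {ι : Type*} [Nonempty ι] : Nontrivial (Free ι k) :=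
  inferInstanceAs (Nontrivial (ι →₀ k))

theorem exists_fullRep [IsAlgClosed k] [CharZero k] (hD : IsTypeA D) (P : DeformationData D) :
    ∃ (M : Type u) (_ : AddCommGroup M) (_ : Module k M) (y : Fin θ → Module.End k M),
      Nontrivial M ∧ (∀ i j : Fin θ, (i : ℕ) + 1 < j →
        qcomm (D.q i j) (y i) (y j) = P.lam i j • 1) ∧ (∀ i, y i ^ 2 = P.mu i • 1) ∧
      ∀ i j l : Fin θ, (i : ℕ) + 1 = j → (j : ℕ) + 1 = l →
        serreComm (D.q i j) (D.q j l) (D.q i l) (y i) (y j) (y l) = P.nu j • 1 := by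
  obtain ⟨C, hq, hlam, hnu⟩ := ChainData.exists_chainData (extQ D)
    (fun i j => if h : i < θ ∧ j < θ then P.lam ⟨i, h.1⟩ ⟨j, h.2⟩ else 0)
    (fun i => if h : i + 2 < θ then P.nu ⟨i + 1, by omega⟩ else 0)
    (fun i => by
      by_cases h : i < θ
      · rw [extQ, dif_pos ⟨h, h⟩, hD.diag]
      · rw [extQ, dif_neg (by omega), if_pos (by omega)])
    (fun i => by
      by_cases h : i + 1 < θ
      · rw [extQ, dif_pos (by omega), extQ, dif_pos (by omega)]
        exact hD.adjacent ⟨i, by omega⟩ ⟨i + 1, h⟩ rfl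
      · rw [extQ, dif_neg (by omega), if_pos (by omega), extQ, dif_neg (by omega),
          if_neg (by omega), mul_one])
    (fun i j hij => by
      by_cases h : j < θ
      · rw [extQ, dif_pos (by omega), extQ, dif_pos (by omega)]
        exact hD.distant ⟨i, by omega⟩ ⟨j, h⟩ hij
      · rw [extQ, dif_neg (by omega), if_neg (by omega), extQ, dif_neg (by omega),
          if_neg (by omega), mul_one])
    (fun i j hij h a => by
      by_cases hj : j < θ
      · rw [dif_pos (by omega)] at h
        by_cases ha : a < θ
        · rw [extQ, dif_pos (by omega), extQ, dif_pos (by omega)]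
          exact P.lam_q (i := ⟨i, by omega⟩) (j := ⟨j, hj⟩) hij h ⟨a, ha⟩
        · rw [extQ_of_le (by omega) (by omega), extQ_of_le (by omega) hj, mul_one]
      · exact absurd (dif_neg (by omega)) h)
    (fun i h a => by
      by_cases hj : i + 2 < θ
      · rw [dif_pos hj] at h
        by_cases ha : a < θ
        · rw [extQ, dif_pos (by omega), extQ, dif_pos (by omega), extQ, dif_pos (by omega)]
          have := P.nu_q (i := ⟨i, by omega⟩) (m := ⟨i + 2, hj⟩) rfl rfl h ⟨a, ha⟩
          linear_combination this
        · rw [extQ_of_le (by omega) (by omega), extQ_of_le (by omega) (by omega),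
            extQ_of_le (by omega) hj]; ring
      · exact absurd (dif_neg (by omega)) h)
  obtain ⟨M, _, _, x, _, hx⟩ := ChainData.exists_constRep θ C
    (fun i j hj => by rw [hlam]; exact dif_neg (by omega))
    (fun i hi => by rw [hnu]; exact dif_neg (by omega))
  let mu : ℕ → k := fun i => if h : i < θ then P.mu ⟨i, h⟩ else 0
  choose c hc using fun i => IsAlgClosed.exists_pow_nat_eq (mu i) (n := 2) (by omega)
  have hmu (i : ℕ) (h : mu i ≠ 0) (a : ℕ) : C.q a i ^ 2 = 1 := by
    rw [hq]
    by_cases hi : i < θ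
    · simp only [mu, dif_pos hi] at h
      by_cases ha : a < θ
      · rw [extQ, dif_pos (by omega)]
        exact P.mu_q h ⟨a, ha⟩
      · rw [extQ_of_le (by omega) hi, one_pow]
    · exact absurd (dif_neg hi) h
  obtain ⟨y, hy⟩ : ∃ y : ℕ → Module.End k (M ⊗[k] Free (ℕ → ℤˣ) k), C.FullRep mu y :=
    ⟨_, hx.fullRep hmu hc⟩
  refine ⟨M ⊗[k] Free (ℕ → ℤˣ) k, inferInstance, inferInstance, fun i => y i, inferInstance, fun i j hij => ?_, fun i => ?_,
    fun i j l hij hjl => ?_⟩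
  · have := hy.far i j (Or.inl hij)
    rw [ChainData.lamS, if_pos (by omega), hq, hlam, extQ_fin] at this
    exact this.trans (congrArg (· • 1) (dif_pos ⟨i.2, j.2⟩))
  · have := hy.sq i
    simp only [mu, dif_pos i.2] at this
    exact this
  · have := hy.serre i
    obtain ⟨j, hj⟩ := j
    obtain ⟨l, hl⟩ := l
    obtain rfl : (i : ℕ) + 1 = j := hij
    obtain rfl : (i : ℕ) + 2 = l := hjl
    rw [ChainData.serreOf, hq, hnu, extQ_fin i ⟨_, hj⟩, extQ_fin ⟨_, hj⟩ ⟨_, hl⟩,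
      extQ_fin i ⟨_, hl⟩] at this
    exact this.trans (congrArg (· • 1) (dif_pos hl))
end

section
open Finset

variable {k : Type u} [Field k] {H : Type v} [Ring H] [HopfAlgebra k H] {θ : ℕ}
  {D : PrincipalRealization k H θ}

namespace PrincipalRealization
variable (D)

/-- The character `χ_i` as an element of the dual algebra of `H`. -/
def chi (i : Fin θ) : WithConv (H →ₗ[k] k) := toConv (D.χ i).toLinearMap

lemma chi_comm (i j : Fin θ) : D.chi i * D.chi j = D.chi j * D.chi i := by
  have e (c : k) : toConv (constMap k H c) = c • (1 : WithConv (H →ₗ[k] k)) := by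
    ext h; simp [constMap, mul_comm]
  have h := congr(toConv ((D.χ i).toLinearMap ∘ₗ ($(D.yd_comm j)).ofConv))
  have e₁ : toConv ((D.χ i).toLinearMap ∘ₗ (Algebra.linearMap k H ∘ₗ (D.χ j).toLinearMap)) =
      D.chi j := by
    ext h; simp [chi]
  have e₂ : toConv ((D.χ i).toLinearMap ∘ₗ constMap k H (D.g j)) = D.q j i • 1 := by
    rw [← e]; ext h; simp [constMap, q]
  have e₃ : toConv ((D.χ i).toLinearMap ∘ₗ (LinearMap.id : H →ₗ[k] H)) = D.chi i := rfl
  simp only [algHom_comp_conv, e₁, e₂, e₃, mul_smul_comm, smul_mul_assoc, mul_one] at h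
  exact smul_right_injective _ (D.q_ne_zero j i) h

end PrincipalRealization

section Crossed
variable {M : Type*} [AddCommGroup M] [Module k M]

/-- The map `h ↦ φ(h) y` in the convolution algebra. -/
def dualTens (φ : WithConv (H →ₗ[k] k)) (y : Module.End k M) : WithConv (H →ₗ[k] Module.End k M) :=
  toConv (LinearMap.toSpanSingleton k _ y ∘ₗ φ.ofConv)

variable (φ ψ : WithConv (H →ₗ[k] k)) (y z : Module.End k M)

lemma dualTens_apply (h : H) : (dualTens φ y).ofConv h = φ.ofConv h • y := rfl

lemma dualTens_mul : dualTens φ y * dualTens ψ z = dualTens (φ * ψ) (y * z) := by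
  ext1
  refine LinearMap.ext fun h => ?_
  rw [dualTens_apply, show (φ * ψ).ofConv h = _ from conv_apply φ.ofConv ψ.ofConv h (ℛ k h),
    sum_smul]
  refine (conv_apply _ _ h (ℛ k h)).trans (sum_congr rfl fun i _ => ?_)
  exact smul_mul_smul_comm (φ.ofConv _) y (ψ.ofConv _) z

lemma dualTens_mul_apply (G : WithConv (H →ₗ[k] Module.End k M)) {b : H} {ι : Type*}
    (R : Repr k b ι) : (dualTens φ y * G).ofConv b =
      ∑ j ∈ R.index, (φ.ofConv (R.left j) • y) * G.ofConv (R.right j) :=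
  conv_apply _ _ b R

lemma dualTens_sub : dualTens φ (y - z) = dualTens φ y - dualTens φ z := by
  ext1; exact LinearMap.ext fun h => smul_sub (φ.ofConv h) y z

lemma dualTens_smul (c : k) : dualTens φ (c • y) = c • dualTens φ y := by
  ext1; exact LinearMap.ext fun h => smul_comm (φ.ofConv h) c y

lemma dualTens_one : dualTens (1 : WithConv (H →ₗ[k] k)) (1 : Module.End k M) = 1 := by
  ext1; exact LinearMap.ext fun h => by
    rw [dualTens_apply]; simp [Algebra.algebraMap_eq_smul_one]

variable {φ ψ}

lemma qcomm_dualTens (c : k) (h : φ * ψ = ψ * φ) :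
    qcomm c (dualTens φ y) (dualTens ψ z) = dualTens (φ * ψ) (qcomm c y z) := by
  simp only [qcomm, dualTens_mul, dualTens_sub, dualTens_smul, h]

lemma serreComm_dualTens {ω : WithConv (H →ₗ[k] k)} (p r s : k) (a b c : Module.End k M)
    (h₁ : φ * ψ = ψ * φ) (h₂ : φ * ω = ω * φ) (h₃ : ψ * ω = ω * ψ) :
    serreComm p r s (dualTens φ a) (dualTens ψ b) (dualTens ω c) =
      dualTens (ψ * ψ * φ * ω) (serreComm p r s a b c) := by
  have e₁ : Commute φ ψ := h₁
  have e₂ : Commute φ ω := h₂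
  have e₃ : Commute ψ ω := h₃
  rw [serreComm, qcomm_dualTens _ _ _ h₃, qcomm_dualTens _ _ _ (e₁.mul_right e₂), qcomm_dualTens]
  · rw [serreComm]
    congr 1
    rw [(e₁.symm.mul_right ((Commute.refl ψ).mul_right e₃)).eq.symm, ← mul_assoc φ, h₁]
    simp only [mul_assoc]
  · exact (e₁.symm.mul_right ((Commute.refl ψ).mul_right e₃)).symm

variable (k H M) in
/-- The action of `H` on its dual by translations, extended to the convolution algebra. -/
def translate : H →ₐ[k] Module.End k (WithConv (H →ₗ[k] Module.End k M)) :=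
  AlgHom.ofLinearMap
    { toFun h :=
        { toFun F := toConv (F.ofConv ∘ₗ LinearMap.mulRight k h)
          map_add' _ _ := rfl
          map_smul' _ _ := rfl }
      map_add' a b := LinearMap.ext fun F => WithConv.ext <| LinearMap.ext fun h =>
        (congrArg F.ofConv (mul_add h a b)).trans (map_add _ _ _)
      map_smul' c a := LinearMap.ext fun F => WithConv.ext <| LinearMap.ext fun h =>
        (congrArg F.ofConv (mul_smul_comm c h a)).trans (map_smul _ _ _) }
    (LinearMap.ext fun F => WithConv.ext <| LinearMap.ext fun h => congrArg F.ofConv (mul_one h))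
    fun a b => LinearMap.ext fun F => WithConv.ext <| LinearMap.ext fun h =>
      congrArg F.ofConv (mul_assoc h a b).symm

lemma translate_apply (a : H) (F : WithConv (H →ₗ[k] Module.End k M)) (h : H) :
    (translate k H M a F).ofConv h = F.ofConv (h * a) := rfl

/-- Left multiplication by `h ↦ φ(h) y`. -/
def lmulTens (φ : WithConv (H →ₗ[k] k)) (y : Module.End k M) :
    Module.End k (WithConv (H →ₗ[k] Module.End k M)) := Algebra.lmul k _ (dualTens φ y)

lemma compat_translate (y : Fin θ → Module.End k M) :
    Bosonization.Compat D (fun i => lmulTens (D.chi i) (y i)) (translate k H M) := by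
  intro i
  ext1
  refine LinearMap.ext fun a => LinearMap.ext fun F => ?_
  ext1
  refine LinearMap.ext fun h => ?_
  rw [conv_mul_const, conv_apply _ _ a (ℛ k a)]
  have e₁ : (translate k H M a (dualTens (D.chi i) (y i) * F)).ofConv h =
    ∑ j ∈ (ℛ k a).index, D.χ i ((ℛ k a).left j) •
      (dualTens (D.chi i) (y i) * translate k H M ((ℛ k a).right j) F).ofConv h := by
    simp only [translate_apply, dualTens_mul_apply _ _ _ ((ℛ k h).mul (ℛ k a)),
      dualTens_mul_apply _ _ _ (ℛ k h), smul_sum]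
    refine (sum_product_right _ _ _).trans (sum_congr rfl fun j _ => sum_congr rfl fun l _ => ?_)
    change (D.χ i (_ * _) • y i) * _ = D.χ i _ • ((D.χ i _ • y i) * _)
    rw [map_mul, mul_comm, mul_smul, smul_mul_assoc]
    rfl
  refine e₁.trans ?_
  rw [LinearMap.sum_apply, WithConv.ofConv_sum, LinearMap.sum_apply]
  rfl

end Crossed

open Bosonization in
theorem nontrivial_quotient_biIdeal [IsAlgClosed k] [CharZero k] (hD : IsTypeA D)
    (P : DeformationData D) : Nontrivial (Bosonization D ⧸ biIdeal P 0) := by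
  obtain ⟨M, _, _, y, _, hfar, hsq, hserre⟩ := exists_fullRep hD P
  set F := lift _ _ (compat_translate (D := D) y)
  have e (φ : WithConv (H →ₗ[k] k)) (c : k) (h : c ≠ 0 → φ = 1) :
      dualTens φ (c • (1 : Module.End k M)) = c • 1 := by
    by_cases hc : c = 0
    · rw [dualTens_smul, hc, zero_smul, zero_smul]
    · rw [h hc, dualTens_smul, dualTens_one]
  have hF : AllRel (B := Module.End k (WithConv (H →ₗ[k] Module.End k M))) P 0 F := by
    refine ⟨⟨fun i j hij => ?_, fun i => ?_⟩, fun i j l hij hjl => ?_⟩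
    · simp only [F, lift_x, lmulTens, ← map_qcomm]
      rw [qcomm_dualTens _ _ _ (D.chi_comm i j), hfar i j hij, e _ _ fun h => ?_]
      · rw [map_smul, map_one, ← Algebra.algebraMap_eq_smul_one]
        simp [biPair]
      · by_contra h'
        exact h (P.lam_eq_zero i j hij fun h1 => h' congr(toConv ($h1).ofConv.toLinearMap))
    · simp only [F, lift_x, lmulTens, ← map_pow]
      rw [pow_two, dualTens_mul, ← pow_two, ← pow_two, hsq, e _ _ fun h => ?_]
      · rw [map_smul, map_one, ← Algebra.algebraMap_eq_smul_one]
        simp [biSquare]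
      · by_contra h'
        refine h (P.mu_eq_zero i fun h1 => h' ?_)
        rw [pow_two] at h1 ⊢
        exact congr(toConv ($h1).ofConv.toLinearMap)
    · simp only [F, lift_x, lmulTens, ← map_serreComm]
      rw [serreComm_dualTens _ _ _ _ _ _ (D.chi_comm i j) (D.chi_comm i l) (D.chi_comm j l),
        hserre i j l hij hjl, e _ _ fun h => ?_]
      · rw [map_smul, map_one, ← Algebra.algebraMap_eq_smul_one]
        simp [biSerre]
      · by_contra h'
        refine h (P.nu_eq_zero i j l hij hjl fun h1 => h' ?_)
        rw [pow_two] at h1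
        exact congr(toConv ($h1).ofConv.toLinearMap)
  refine Ideal.Quotient.nontrivial_iff.2 fun h => ?_
  have h1 : F 1 = 0 := AllRel.eq_zero hD hF (h ▸ Submodule.mem_top)
  rw [map_one] at h1
  have h2 := congr(($h1 1).ofConv (1 : H))
  exact one_ne_zero (α := Module.End k M) (by simpa using h2)
end

end ALift
end

theorem mainTheorem10 {k : Type*} [Field k] [IsAlgClosed k] [CharZero k]
    {H : Type*} [Ring H] [HopfAlgebra k H]
    (hS : Function.Bijective (HopfAlgebra.antipode k : H → H)) (hH : IsCosemisimple k H)
    {θ : ℕ} (D : PrincipalRealization k H θ) (hD : IsTypeA D) (P : DeformationData D) :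
    ∃ (_ : (preNicholsIdeal D).IsHopfIdeal k) (_ : (liftingIdeal P).IsHopfIdeal k)
      (ρ : (Bosonization D ⧸ cleftIdeal P) →ₐ[k]
        (Bosonization D ⧸ cleftIdeal P) ⊗[k] (Bosonization D ⧸ preNicholsIdeal D)),
      IsStandardCoaction P ρ ∧ IsCleftObject ρ ∧
      IsSchauenburgHopfAlgebra ρ (Bosonization D ⧸ liftingIdeal P) ∧
      IsCocycleDeformation (k := k) (Bosonization D ⧸ preNicholsIdeal D)
        (Bosonization D ⧸ liftingIdeal P) ∧
      GrIsomorphic (k := k) (quotFiltration (liftingIdeal P)) (quotDegree (preNicholsIdeal D)) := by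
  have := nontrivial_quotient_biIdeal hD P
  obtain ⟨i₀, iL, hρ, h⟩ := biIdeal_properties hD P preNicholsIdeal_eq (cleftIdeal_eq P)
    (liftingIdeal_eq P)
  exact ⟨i₀, iL, coact hρ, ⟨coact_mk_x hρ, coact_mk_inH hρ⟩, h⟩
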